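/- **Setting.** Let $Y=[0,1)^3$, $Y'=[-\pi,\pi)^3$. Let $Y_{\rm soft}\subset\mathbb R^3$ be a non-empty connected open set with $C^{1,1}$ boundary $\Gamma=\partial Y_{\rm soft}$ whose closure lies in the interior of $Y$, and such that $Y_{\rm stiff}:=Y\setminus Y_{\rm soft}$ is connected. Let $\mathbb A=\mathbb A_{\rm stiff}$ be a field of real fourth-order tensors on $\overline{Y_{\rm stiff}}$ with Lipschitz entries, with $\mathbb A_{ijkl}=\mathbb A_{jikl}=\mathbb A_{klij}$ and, for some $\nu>0$, $\nu|\xi|^2\le\mathbb A(y)\xi:\xi\le\nu^{-1}|\xi|^2$ for all symmetric $\xi\in\mathbb R^{3\times3}$ and all $y\in Y_{\rm stiff}$. Let $H^1_\#$ be the closure of the smooth $Y$-periodic fields $\mathbb R^3\to\mathbb C^3$ (restricted to $Y_{\rm stiff}$) in the norm of $H^1(Y_{\rm stiff};\mathbb C^3)$, and for $\chi\in\mathbb R^3$ put $X_\chi u=\operatorname{sym}(u\otimes\chi)$ and $$a_\chi(u,v)=\int_{Y_{\rm stiff}}\mathbb A(\operatorname{sym}\nabla+{\rm i}X_\chi)u:\overline{(\operatorname{sym}\nabla+{\rm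 i}X_\chi)v}.$$ *Lift and Dirichlet-to-Neumann map.* For $g\in H^{1/2}(\Gamma;\mathbb C^3)$ let $\Pi_\chi g\in H^1_\#$ be the function $u$ with $u|_\Gamma=g$ and $a_\chi(u,v)=0$ for all $v\in H^1_\#$ with $v|_\Gamma=0$. The operator $\Lambda_\chi^{\rm stiff}$ on $L^2(\Gamma;\mathbb C^3)$ is $g\mapsto-\partial_\nu\Pi_\chi g$, where $\partial_\nu u=(\mathbb A(\operatorname{sym}\nabla+{\rm i}X_\chi)u)\,n|_\Gamma$ and $n$ is the normal on $\Gamma$ exterior to $Y_{\rm stiff}$; precisely, $g\in\mathcal D(\Lambda_\chi^{\rm stiff})$ and $\Lambda_\chi^{\rm stiff}g=f$ if and only if $a_\chi(\Pi_\chi g,v)=-\int_\Gamma f\cdot\overline v$ for all $v\in H^1_\#$. *Homogenised matrix.* For $c\in\mathbb C^3$ (a constant field on $\Gamma$) let $\widetilde\Pi_{\chi,1}c\in H^1_\#$ be the solution $w$, $w|_\Gamma=0$, of $$\int_{Y_{\rm stiff}}\mathbb A\operatorname{sym}\nabla w:\overline{\operatorname{sym}\nabla v}=-\int_{Y_{\rm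 stiff}}\mathbb A\,{\rm i}X_\chi\Pi_0c:\overline{\operatorname{sym}\nabla v}-\int_{Y_{\rm stiff}}\mathbb A\operatorname{sym}\nabla\Pi_0c:\overline{{\rm i}X_\chi v}$$ for all $v\in H^1_\#$ with $v|_\Gamma=0$, put $\Psi_\chi c={\rm i}X_\chi\Pi_0c+\operatorname{sym}\nabla\widetilde\Pi_{\chi,1}c$, and let $c_{\rm corr}$ be the field on $\Gamma$, normalised by $\int_{Y_{\rm stiff}}\Pi_0c_{\rm corr}=0$, with $$\int_{Y_{\rm stiff}}\mathbb A[\operatorname{sym}\nabla\Pi_0c_{\rm corr}+\Psi_\chi c]:\overline{\operatorname{sym}\nabla\Pi_0v}=0\qquad\forall v\in H^{1/2}(\Gamma;\mathbb C^3).$$ Then $\Lambda_\chi^{\rm hom}\in\mathbb C^{3\times3}$ is the matrix with $$\langle-\Lambda_\chi^{\rm hom}c,d\rangle_{\mathbb C^3}=\frac1{|\Gamma|}\int_{Y_{\rm stiff}}\mathbb A[\operatorname{sym}\nabla\Pi_0c_{\rm corr}+\Psi_\chi c]:\overline{\Psi_\chi d}\qquad\forall c,d\in\mathbb C^3.$$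 Finally let $Sh=|\Gamma|^{-1}\int_\Gamma h$. **Theorem.** There is a constant $C>0$, independent of $\chi$, such that for every $\chi\in Y'\setminus\{0\}$ the operator $\Lambda_\chi^{\rm stiff}$ and the matrix $\Lambda_\chi^{\rm hom}$ are well defined, $|\chi|^{-2}\Lambda_\chi^{\rm stiff}-I$ has a bounded everywhere defined inverse on $L^2(\Gamma;\mathbb C^3)$, the matrix $|\chi|^{-2}\Lambda_\chi^{\rm hom}-I$ is invertible, and $$\left\|\left(|\chi|^{-2}\Lambda_\chi^{\rm stiff}-I\right)^{-1}-\left(|\chi|^{-2}\Lambda_\chi^{\rm hom}-I\right)^{-1}S\right\|_{L^2(\Gamma;\mathbb C^3)\to H^{1/2}(\Gamma;\mathbb C^3)}\le C|\chi|.$$ -/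

import Mathlib

open MeasureTheory Set
open scoped ENNReal NNReal Topology Matrix ContDiff

noncomputable section

namespace StiffDtN

/-- Points of `ℝ³`, with the Euclidean norm. -/
abbrev R3 : Type := EuclideanSpace ℝ (Fin 3)

/-- Values of displacement fields. -/
abbrev C3 : Type := EuclideanSpace ℂ (Fin 3)

/-- Values of displacement gradients, with the Frobenius norm. -/
abbrev C33 : Type := EuclideanSpace ℂ (Fin 3 × Fin 3)

/-- A field of real fourth-order tensors `A y i j k l`. -/
abbrev TensorField : Type := R3 → Fin 3 → Fin 3 → Fin 3 → Fin 3 → ℝ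

/-! ### Geometry -/

/-- The reference cell `Y = [0,1)³`. -/
def cell : Set R3 := {y | ∀ i, y i ∈ Ico (0 : ℝ) 1}

/-- The set of quasimomenta `Y' = [-π,π)³`. -/
def dualCell : Set R3 := {χ | ∀ i, χ i ∈ Ico (-Real.pi) Real.pi}

/-- The stiff component `Y_stiff = Y \ Y_soft`. -/
def stiff (S : Set R3) : Set R3 := cell \ S

/-- The set `Ω` has a boundary of class `C^{1,1}`: near each boundary point and after a rigid change
of coordinates, `Ω` is the region strictly above the graph of a `C^1` function of two variables with
Lipschitz derivative. -/
def HasC11Boundary (Ω : Set R3) : Prop :=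
  ∀ x₀ ∈ frontier Ω, ∃ (Φ : R3 ≃ᵃⁱ[ℝ] R3) (γ : EuclideanSpace ℝ (Fin 2) → ℝ) (K : ℝ≥0),
    ContDiff ℝ 1 γ ∧ LipschitzWith K (fderiv ℝ γ) ∧
      ∃ U ∈ 𝓝 x₀, ∀ x ∈ U, (x ∈ Ω ↔ γ !₂[Φ x 0, Φ x 1] < Φ x 2)

/-- The standing assumptions on the soft inclusion `S = Y_soft`. -/
structure IsInclusion (S : Set R3) : Prop where
  isOpen : IsOpen S
  isConnected : IsConnected S
  boundary : HasC11Boundary S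
  closure_subset : closure S ⊆ interior cell
  isConnected_stiff : IsConnected (stiff S)

/-- The standing assumptions on the tensor `𝔸_stiff`. -/
structure IsElasticityTensor (S : Set R3) (A : TensorField) : Prop where
  elliptic : ∃ ν : ℝ, 0 < ν ∧ ∀ y ∈ stiff S, ∀ ξ : Matrix (Fin 3) (Fin 3) ℝ, ξ.IsSymm →
    ν * ∑ i, ∑ j, ξ i j ^ 2 ≤ ∑ i, ∑ j, ∑ k, ∑ l, A y i j k l * ξ k l * ξ i j ∧
    ∑ i, ∑ j, ∑ k, ∑ l, A y i j k l * ξ k l * ξ i j ≤ ν⁻¹ * ∑ i, ∑ j, ξ i j ^ 2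
  minor_symm : ∀ y ∈ stiff S, ∀ i j k l, A y i j k l = A y j i k l
  major_symm : ∀ y ∈ stiff S, ∀ i j k l, A y i j k l = A y k l i j
  lipschitz : ∃ K : ℝ≥0, ∀ i j k l, LipschitzOnWith K (fun y => A y i j k l) (closure (stiff S))

/-- Surface measure on the interface `Γ = ∂Y_soft`. -/
def surf (S : Set R3) : Measure R3 := (μHE[2] : Measure R3).restrict (frontier S)

/-! ### Function spaces -/

/-- `L²(Y_stiff; ℂ³)`. -/
abbrev L2Stiff (S : Set R3) : Type := Lp C3 2 (volume.restrict (stiff S))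

/-- `L²(Y_stiff; ℂ^{3×3})`. -/
abbrev L2Grad (S : Set R3) : Type := Lp C33 2 (volume.restrict (stiff S))

/-- `L²(Γ; ℂ³)`. -/
abbrev L2Bdry (S : Set R3) : Type := Lp C3 2 (surf S)

/-- The Jacobian matrix `(∇φ)_{ij} = ∂_j φ_i`. -/
def grad (φ : R3 → C3) (y : R3) : C33 :=
  WithLp.toLp 2 fun ij => fderiv ℝ φ y (EuclideanSpace.single ij.2 1) ij.1

/-- Smooth `Y`-periodic vector fields on `ℝ³`. -/
def IsSmoothPeriodic (φ : R3 → C3) : Prop :=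
  ContDiff ℝ ∞ φ ∧ ∀ (y : R3) (i : Fin 3), φ (y + EuclideanSpace.single i 1) = φ y

/-- The space `H¹_#(Y_stiff; ℂ³)`: the closure of the smooth periodic fields in the `H¹` norm.
An element `u` is recorded together with its gradient and its trace on `Γ`, as the triple
`(u, ∇u, u|_Γ)`; since the trace is bounded in the `H¹` norm, the closure of the set of triples
of smooth fields consists exactly of these triples. -/
def H1per (S : Set R3) : Set (L2Stiff S × L2Grad S × L2Bdry S) :=
  closure {p | ∃ φ : R3 → C3, IsSmoothPeriodic φ ∧
    p.1 =ᵐ[volume.restrict (stiff S)] φ ∧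
    p.2.1 =ᵐ[volume.restrict (stiff S)] grad φ ∧
    p.2.2 =ᵐ[surf S] φ}

/-- The `H^{1/2}(Γ)` norm of a field on `Γ` (a two-dimensional surface), with the
Gagliardo-Slobodeckij double integral; it is `∞` if the field is not in `H^{1/2}(Γ)`. -/
def h12Norm (S : Set R3) (g : R3 → C3) : ℝ≥0∞ :=
  (∫⁻ x, ‖g x‖ₑ ^ 2 ∂(surf S) +
    ∫⁻ x, ∫⁻ y, ‖g x - g y‖ₑ ^ 2 / edist x y ^ 3 ∂(surf S) ∂(surf S)) ^ (1 / 2 : ℝ)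

/-! ### Strains and the elastic form -/

/-- `sym ∇u`, for `u` given as the triple `p`. -/
def symGrad {S : Set R3} (p : L2Stiff S × L2Grad S × L2Bdry S) (y : R3) :
    Matrix (Fin 3) (Fin 3) ℂ :=
  Matrix.of fun i j => ((p.2.1 y) (i, j) + (p.2.1 y) (j, i)) / 2

/-- `X_χ u = sym (u ⊗ χ)`, for `u` given as the triple `p`. -/
def symShift {S : Set R3} (χ : R3) (p : L2Stiff S × L2Grad S × L2Bdry S) (y : R3) :
    Matrix (Fin 3) (Fin 3) ℂ :=
  Matrix.of fun i j => ((p.1 y) i * (χ j : ℂ) + (p.1 y) j * (χ i : ℂ)) / 2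

/-- `(sym ∇ + i X_χ) u`. -/
def strain {S : Set R3} (χ : R3) (p : L2Stiff S × L2Grad S × L2Bdry S) (y : R3) :
    Matrix (Fin 3) (Fin 3) ℂ :=
  symGrad p y + Complex.I • symShift χ p y

/-- `∫_{Y_stiff} 𝔸_stiff E : conj F`. -/
def energy (S : Set R3) (A : TensorField) (E F : R3 → Matrix (Fin 3) (Fin 3) ℂ) : ℂ :=
  ∫ y in stiff S, ∑ i, ∑ j, ∑ k, ∑ l, (A y i j k l : ℂ) * E y k l * star (F y i j)

/-! ### Lift operator and Dirichlet-to-Neumann map -/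

/-- `u ∈ H¹_#(Y_stiff)` is the lift `Π_χ^stiff g` of its trace `g = u|_Γ`, that is, `u` is a weak
solution of `(sym ∇ + i X_χ)^* 𝔸_stiff (sym ∇ + i X_χ) u = 0` in `Y_stiff`. -/
def IsLift (S : Set R3) (A : TensorField) (χ : R3) (u : L2Stiff S × L2Grad S × L2Bdry S) : Prop :=
  u ∈ H1per S ∧ ∀ v ∈ H1per S, v.2.2 = 0 → energy S A (strain χ u) (strain χ v) = 0

/-- The graph of `Λ_χ^stiff` as an operator on `L²(Γ; ℂ³)`: `g` is in the domain and
`Λ_χ^stiff g = f`. Here `f = -∂_ν u` for `u = Π_χ^stiff g`, where `∂_ν u` is the co-normal derivative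
`𝔸_stiff (sym ∇ + i X_χ) u · n`, understood weakly (through Green's formula). -/
def IsDtN (S : Set R3) (A : TensorField) (χ : R3) (g f : L2Bdry S) : Prop :=
  ∃ u, IsLift S A χ u ∧ u.2.2 = g ∧
    ∀ v ∈ H1per S, energy S A (strain χ u) (strain χ v) = -(inner ℂ v.2.2 f)

/-- `R = (t Λ_χ^stiff - I)⁻¹`, a bounded everywhere defined operator on `L²(Γ; ℂ³)`. -/
def IsDtNResolvent (S : Set R3) (A : TensorField) (χ : R3) (t : ℝ)
    (R : L2Bdry S →L[ℂ] L2Bdry S) : Prop :=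
  (∀ h, ∃ f, IsDtN S A χ (R h) f ∧ (t : ℂ) • f - R h = h) ∧
    ∀ g f, IsDtN S A χ g f → R ((t : ℂ) • f - g) = g

/-! ### The homogenised matrix -/

/-- `w = Π̃_{χ,1} g`, the part of `Π_χ^stiff g` that is linear in `χ`, where `u = Π_0^stiff g`. -/
def IsFirstCorrector (S : Set R3) (A : TensorField) (χ : R3)
    (u w : L2Stiff S × L2Grad S × L2Bdry S) : Prop :=
  w ∈ H1per S ∧ w.2.2 = 0 ∧ ∀ v ∈ H1per S, v.2.2 = 0 →
    energy S A (symGrad w) (symGrad v) =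
      -energy S A (fun y => Complex.I • symShift χ u y) (symGrad v)
        - energy S A (symGrad u) (fun y => Complex.I • symShift χ v y)

/-- `ψ = Ψ_χ c`, with `Ψ_χ = i X_χ Π_0^stiff + sym ∇ Π̃_{χ,1}`, for the constant boundary field `c`. -/
def IsPsi (S : Set R3) (A : TensorField) (χ : R3) (c : C3)
    (ψ : R3 → Matrix (Fin 3) (Fin 3) ℂ) : Prop :=
  ∃ u w, IsLift S A 0 u ∧ (∀ᵐ y ∂(surf S), u.2.2 y = c) ∧ IsFirstCorrector S A χ u w ∧
    ψ = fun y => Complex.I • symShift χ u y + symGrad w y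

/-- `κ = Π_0^stiff c_corr`, normalised by `∫_{Y_stiff} κ = 0`, solves the cell problem with
datum `ψ = Ψ_χ c`. -/
def IsCellCorrector (S : Set R3) (A : TensorField) (ψ : R3 → Matrix (Fin 3) (Fin 3) ℂ)
    (κ : L2Stiff S × L2Grad S × L2Bdry S) : Prop :=
  IsLift S A 0 κ ∧ (∫ y in stiff S, κ.1 y) = 0 ∧
    ∀ v, IsLift S A 0 v → energy S A (fun y => symGrad κ y + ψ y) (symGrad v) = 0

/-- `M = Λ_χ^hom`:
`⟨-M c, d⟩ = |Γ|⁻¹ ∫_{Y_stiff} 𝔸_stiff [sym ∇ Π_0 c_corr + Ψ_χ c] : conj (Ψ_χ d)` for all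
`c, d ∈ ℂ³`. -/
def IsHomMatrix (S : Set R3) (A : TensorField) (χ : R3) (M : Matrix (Fin 3) (Fin 3) ℂ) : Prop :=
  ∀ c d : C3, ∃ ψc ψd κ, IsPsi S A χ c ψc ∧ IsPsi S A χ d ψd ∧ IsCellCorrector S A ψc κ ∧
    ∑ i, -(M *ᵥ c.ofLp) i * star (d i) =
      (((surf S).real univ)⁻¹ : ℂ) * energy S A (fun y => symGrad κ y + ψc y) ψd

/-- The averaging operator `S h = |Γ|⁻¹ ∫_Γ h`. -/
def bdryAverage (S : Set R3) (h : L2Bdry S) : C3 :=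
  ((surf S).real univ)⁻¹ • ∫ y, h y ∂(surf S)

end StiffDtN

end

/-! Write s = |χ|, t = s⁻², D = sym ∇ and X = iX_χ. The equation (tΛ_χ - I)g = h says that g is the
trace of the field u in H¹_# with t a_χ(u, v) + ⟨u, v⟩_Γ = -⟨h, v⟩_Γ for all v. The analytic core is
a Korn inequality with a constant independent of χ: the squared H¹ norm of u is at most C times the
sum of the squares of the L² norm of (D + X)u and of the mean of u over Γ
(`IsInclusion.exists_coercive`). It makes the problem for u uniquely solvable, and since t is of
order s⁻² it forces the strain to be of order s and u to be nearly constant.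

The comparison takes place in an abstract Hilbert space setting (`CellData`). For a constant c let
Nc be the field with mean zero over Γ for which E = D(Nc) + Xc satisfies ⟨Dv, AE⟩ = 0 for all v; it
is of order s. Let c solve (tΛ_hom - I)c = mean of h, and put r = u - c - Nc. Inserted into the
equation for u, the approximation c + Nc leaves a residual functional of the test field which
vanishes on constants: this is exactly the equation for c. By Korn the residual at v is then bounded
by the norm of Dv instead of that of v. For v = r one has Dr = (D + X)r - Xr, where both terms carry
a factor s, and coercivity gives r = O(s) in H¹ (`CellData.IsShift.norm_sub_cst_le`). The trace
inequality from H¹ to H^{1/2}(Γ) (`IsInclusion.exists_trace_H1per`) finishes the estimate. The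
matrix defined through lifts is the abstract one, because the zero-trace corrector plus Π_0 c_corr
has the same strain as Nc (`CellData.inner_eq_of_corrector`, `Describes.isHomMatrix_iff`).

The uniform Korn inequality is proved by compactness. Korn's inequality in the whole space comes
from integrating by parts. Fields are extended across Γ by a combination of covariant reflections,
which keeps the symmetrised gradient under control and uses the C^{1,1} regularity. A Poincaré
inequality on small cubes then gives Korn's inequality modulo finitely many bounded functionals
(`IsInclusion.exists_korn`). A normalised sequence violating the claim therefore has a Cauchy
subsequence in H¹. Its limit times exp(iχ·y) has zero strain, so it is affine on the connected
periodic stiff component, and quasi-periodicity leaves only constants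
(`IsInclusion.exists_const_of_fstrain_tendsto`), which the vanishing mean over Γ excludes. -/

noncomputable section

namespace StiffDtN

open Filter

set_option linter.unusedSectionVars false

/-! ### Difference quotients and translations of Lipschitz functions in the whole space -/

section WholeSpace

variable {E : Type*} [NormedAddCommGroup E] [NormedSpace ℝ E] [FiniteDimensional ℝ E]
  [MeasurableSpace E] [BorelSpace E] {μ : Measure E} [μ.IsAddHaarMeasure]
  {F : Type*} [NormedAddCommGroup F] [NormedSpace ℝ F]

/-- Difference quotients of a compactly supported Lipschitz function are bounded by a multiple of
the indicator of a compact set. -/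
theorem norm_slope_le_indicator {f : E → F} {K : ℝ≥0} (hf : LipschitzWith K f) (v : E) {t : ℝ}
    (ht : t ∈ Ioc (0 : ℝ) 1) (x : E) :
    ‖t⁻¹ • (f (x + t • v) - f x)‖ ≤
      (Metric.cthickening ‖v‖ (tsupport f)).indicator (fun _ => (K * ‖v‖ : ℝ)) x := by
  have t_pos : 0 < t := ht.1
  by_cases hx : x ∈ Metric.cthickening ‖v‖ (tsupport f)
  · rw [indicator_of_mem hx, norm_smul]
    calc ‖t⁻¹‖ * ‖f (x + t • v) - f x‖ ≤ ‖t⁻¹‖ * (K * ‖(x + t • v) - x‖) := by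
          gcongr; exact LipschitzWith.norm_sub_le hf (x + t • v) x
      _ = K * ‖v‖ := by simp [field, norm_smul, abs_of_nonneg t_pos.le]
  · have A : f x = 0 := by
      rw [← Function.notMem_support]
      contrapose hx
      exact Metric.self_subset_cthickening _ (subset_tsupport _ hx)
    have B : f (x + t • v) = 0 := by
      rw [← Function.notMem_support]
      contrapose hx
      apply Metric.mem_cthickening_of_dist_le _ _ (‖v‖) (tsupport f) (subset_tsupport _ hx)
      simp only [dist_eq_norm, sub_add_cancel_left, norm_neg, norm_smul, Real.norm_eq_abs,
        abs_of_nonneg t_pos.le]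
      exact mul_le_of_le_one_left (norm_nonneg v) ht.2
    simp [A, B, hx]

theorem ae_tendsto_slope [FiniteDimensional ℝ F] {f : E → F} {K : ℝ≥0} (hf : LipschitzWith K f)
    (v : E) :
    ∀ᵐ x ∂μ, Tendsto (fun t : ℝ => t⁻¹ • (f (x + t • v) - f x)) (𝓝[>] 0) (𝓝 (fderiv ℝ f x v)) := by
  filter_upwards [hf.ae_differentiableAt (μ := μ)] with x hx
  have := (hx.hasFDerivAt.hasLineDerivAt v).tendsto_slope_zero_right
  exact this

/-- Rademacher's theorem gives the pointwise limit. The quotients of `g` are merely bounded, so the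
compact support of `f` alone provides the integrable majorant. -/
theorem tendsto_integral_slope_mul {f g : E → ℂ} {K K' : ℝ≥0} (hf : LipschitzWith K f)
    (hg : LipschitzWith K' g) (cf : HasCompactSupport f) (v w : E) :
    Tendsto (fun t : ℝ => ∫ x, (t⁻¹ • (f (x + t • v) - f x)) * (t⁻¹ • (g (x + t • w) - g x)) ∂μ)
      (𝓝[>] 0) (𝓝 (∫ x, fderiv ℝ f x v * fderiv ℝ g x w ∂μ)) := by
  apply tendsto_integral_filter_of_dominated_convergence
    ((Metric.cthickening ‖v‖ (tsupport f)).indicator (fun _ => (K * ‖v‖) * (K' * ‖w‖) : E → ℝ))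
  · filter_upwards with t
    have := hf.continuous; have := hg.continuous
    exact Continuous.aestronglyMeasurable (by fun_prop)
  · filter_upwards [Ioc_mem_nhdsGT zero_lt_one] with t ht
    filter_upwards with x
    rw [norm_mul]
    have h1 := norm_slope_le_indicator hf v ht x
    have h2 := norm_slope_le_indicator hg w ht x
    have h3 : ‖t⁻¹ • (g (x + t • w) - g x)‖ ≤ K' * ‖w‖ :=
      h2.trans (indicator_le_self' (fun _ _ => by positivity) x)
    by_cases hx : x ∈ Metric.cthickening ‖v‖ (tsupport f)
    · rw [indicator_of_mem hx] at h1 ⊢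
      gcongr
    · rw [indicator_of_notMem hx] at h1 ⊢
      have := le_antisymm h1 (norm_nonneg _)
      rw [this, zero_mul]
  · rw [integrable_indicator_iff (IsCompact.cthickening cf).measurableSet]
    exact integrableOn_const (IsCompact.cthickening cf).measure_lt_top.ne
  · filter_upwards [ae_tendsto_slope (μ := μ) hf v, ae_tendsto_slope (μ := μ) hg w] with x h1 h2
    exact h1.mul h2

/-- The symmetry of second derivatives, in weak form, for Lipschitz functions. -/
theorem integral_fderiv_mul_fderiv_comm {f g : E → ℂ} {K K' : ℝ≥0} (hf : LipschitzWith K f)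
    (hg : LipschitzWith K' g) (cf : HasCompactSupport f) (v w : E) :
    ∫ x, fderiv ℝ f x v * fderiv ℝ g x w ∂μ = ∫ x, fderiv ℝ f x w * fderiv ℝ g x v ∂μ := by
  have A := tendsto_integral_slope_mul (μ := μ) hf hg cf v w
  -- For every t the quotients for (v, w) and for (-w, -v) have the same integral. By `key` the
  -- integral for shifts a, b involves the correlation of `f` and `g` only at a - b, a, -b and 0,
  -- and replacing (a, b) by (-b, -a) just exchanges the two middle terms.
  have B := tendsto_integral_slope_mul (μ := μ) hf hg cf (-w) (-v)
  simp only [map_neg, neg_mul_neg] at B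
  refine tendsto_nhds_unique A (B.congr fun t => ?_)
  have hfc := hf.continuous
  have hgc := hg.continuous
  have key : ∀ a b : E, ∫ x, (f (x + a) - f x) * (g (x + b) - g x) ∂μ =
      (∫ x, f (x + (a - b)) * g x ∂μ) - (∫ x, f (x + a) * g x ∂μ)
        - (∫ x, f (x + -b) * g x ∂μ) + ∫ x, f x * g x ∂μ := by
    intro a b
    have hc : ∀ a b : E, Integrable (fun x => f (x + a) * g (x + b)) μ := fun a b => by
      apply Continuous.integrable_of_hasCompactSupport (by fun_prop)
      exact (cf.comp_homeomorph (Homeomorph.addRight a)).mul_right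
    have s1 : ∀ a : E, ∫ x, f (x + (a - b)) * g x ∂μ = ∫ x, f (x + a) * g (x + b) ∂μ := fun a => by
      rw [← integral_add_right_eq_self (μ := μ) (fun x => f (x + (a - b)) * g x) b]
      simp [add_assoc]
    have s2 := s1 0
    simp only [zero_sub, add_zero] at s2
    rw [s1, s2]
    have i1 := hc a b
    have i2 := hc a 0
    have i3 := hc 0 b
    have i4 := hc 0 0
    simp only [add_zero] at i2 i3 i4
    have e : (fun x => (f (x + a) - f x) * (g (x + b) - g x)) =
        ((fun x => f (x + a) * g (x + b)) - (fun x => f (x + a) * g x) - (fun x => f x * g (x + b)))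
          + fun x => f x * g x := by
      ext x; simp only [Pi.sub_apply, Pi.add_apply]; ring
    rw [e, integral_add' ((i1.sub i2).sub i3) i4, integral_sub' (i1.sub i2) i3, integral_sub' i1 i2]
  have e1 : ∀ v w : E, ∫ x, (t⁻¹ • (f (x + t • v) - f x)) * (t⁻¹ • (g (x + t • w) - g x)) ∂μ =
      (t⁻¹ * t⁻¹) • ∫ x, (f (x + t • v) - f x) * (g (x + t • w) - g x) ∂μ := fun v w => by
    rw [← integral_smul]
    congr 1; ext x; rw [smul_mul_smul_comm]
  rw [e1, e1, key, key]
  congr 1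
  have : t • -w - t • -v = t • v - t • w := by module
  rw [this]
  simp only [smul_neg, neg_neg]
  ring

/-- The `L²` modulus of continuity of a compactly supported Lipschitz function is controlled by
its derivative. -/
theorem eLpNorm_translate_sub_le [FiniteDimensional ℝ F] {f : E → F} {K : ℝ≥0}
    (hf : LipschitzWith K f) (cf : HasCompactSupport f) (z : E) :
    eLpNorm (fun x => f (x + z) - f x) 2 μ ≤ eLpNorm (fun x => fderiv ℝ f x z) 2 μ := by
  have hfc := hf.continuous
  -- A translation by z is split into n + 1 equal small ones, whose L² differences agree by
  -- translation invariance. As n tends to infinity the rescaled small difference tends to the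
  -- derivative, so no constant is lost.
  have step : ∀ (n : ℕ) (w : E), eLpNorm (fun x => f (x + n • w) - f x) 2 μ ≤
      n * eLpNorm (fun x => f (x + w) - f x) 2 μ := by
    intro n w
    induction n with
    | zero => simp
    | succ n ih =>
      have : (fun x => f (x + (n + 1) • w) - f x) =
          (fun x => f (x + n • w) - f x) + fun x => f (x + w + n • w) - f (x + n • w) := by
        ext x; simp only [Pi.add_apply]; rw [add_smul, one_smul, add_comm (n • w), ← add_assoc]
        abel
      rw [this]
      refine (eLpNorm_add_le (Continuous.aestronglyMeasurable (by fun_prop))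
        (Continuous.aestronglyMeasurable (by fun_prop)) (by norm_num)).trans ?_
      push_cast
      rw [add_mul, one_mul]
      refine add_le_add ih (le_of_eq ?_)
      have hmp := measurePreserving_add_right μ (n • w)
      have := eLpNorm_comp_measurePreserving (p := 2) (g := fun x => f (x + w) - f x)
        (Continuous.aestronglyMeasurable (by fun_prop)) hmp
      rw [← this]
      congr 1; ext x; simp only [Function.comp]
      rw [add_right_comm]
  have lim : Tendsto (fun t : ℝ => ∫⁻ x, ‖t⁻¹ • (f (x + t • z) - f x)‖ₑ ^ (2 : ℝ) ∂μ) (𝓝[>] 0)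
      (𝓝 (∫⁻ x, ‖fderiv ℝ f x z‖ₑ ^ (2 : ℝ) ∂μ)) := by
    apply tendsto_lintegral_filter_of_dominated_convergence
      ((Metric.cthickening ‖z‖ (tsupport f)).indicator
        (fun _ => ENNReal.ofReal (K * ‖z‖) ^ (2 : ℝ)))
    · filter_upwards with t
      exact (Continuous.measurable (by fun_prop) : Measurable fun x => ‖t⁻¹ • (f (x + t • z) - f x)‖ₑ).pow_const _
    · filter_upwards [Ioc_mem_nhdsGT zero_lt_one] with t ht
      filter_upwards with x
      have h1 := norm_slope_le_indicator hf z ht x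
      by_cases hx : x ∈ Metric.cthickening ‖z‖ (tsupport f)
      · rw [indicator_of_mem hx] at h1 ⊢
        rw [← ofReal_norm]
        gcongr
      · rw [indicator_of_notMem hx] at h1 ⊢
        have := norm_le_zero_iff.1 h1
        rw [this]; simp
    · rw [lintegral_indicator (IsCompact.cthickening cf).measurableSet, lintegral_const]
      refine ENNReal.mul_ne_top (ENNReal.rpow_ne_top_of_nonneg (by norm_num) ENNReal.ofReal_ne_top) ?_
      simpa using (IsCompact.cthickening cf).measure_lt_top.ne
    · filter_upwards [ae_tendsto_slope (μ := μ) hf z] with x h1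
      exact ((ENNReal.continuous_rpow_const.tendsto _).comp (continuous_enorm.tendsto _)).comp h1
  have lim2 : Tendsto (fun t : ℝ => eLpNorm (fun x => t⁻¹ • (f (x + t • z) - f x)) 2 μ) (𝓝[>] 0)
      (𝓝 (eLpNorm (fun x => fderiv ℝ f x z) 2 μ)) := by
    simp only [eLpNorm_eq_lintegral_rpow_enorm_toReal (by norm_num : (2 : ℝ≥0∞) ≠ 0)
      (by norm_num : (2 : ℝ≥0∞) ≠ ⊤), ENNReal.toReal_ofNat]
    exact (ENNReal.continuous_rpow_const.tendsto _).comp lim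
  have lim3 : Tendsto (fun n : ℕ => ((n : ℝ) + 1)⁻¹) atTop (𝓝[>] 0) := by
    refine tendsto_nhdsWithin_iff.2 ⟨?_, Eventually.of_forall fun n => by
      simp only [mem_Ioi]; positivity⟩
    simpa [one_div] using tendsto_one_div_add_atTop_nhds_zero_nat (𝕜 := ℝ)
  refine ge_of_tendsto' (lim2.comp lim3) fun n => ?_
  have := step (n + 1) (((n : ℝ) + 1)⁻¹ • z)
  have e : (n + 1) • (((n : ℝ) + 1)⁻¹ • z) = z := by
    rw [← Nat.cast_smul_eq_nsmul ℝ, smul_smul]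
    push_cast
    rw [mul_inv_cancel₀ (by positivity), one_smul]
  rw [e] at this
  refine this.trans (le_of_eq ?_)
  simp only [Function.comp, inv_inv]
  have h2 := eLpNorm_const_smul ((n : ℝ) + 1) (fun x => f (x + ((n : ℝ) + 1)⁻¹ • z) - f x) 2 μ
  have h3 : ‖((n : ℝ) + 1)‖ₑ = ((n + 1 : ℕ) : ℝ≥0∞) := by
    rw [← ofReal_norm, Real.norm_of_nonneg (by positivity)]
    rw [show (n : ℝ) + 1 = ((n + 1 : ℕ) : ℝ) by push_cast; ring, ENNReal.ofReal_natCast]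
  rw [h3] at h2
  exact h2.symm

/-! ### Elementary inequalities for lower integrals -/

theorem eLpNorm_two_sq {α G : Type*} [MeasurableSpace α] [NormedAddCommGroup G] (ν : Measure α)
    (f : α → G) : eLpNorm f 2 ν ^ 2 = ∫⁻ x, ‖f x‖ₑ ^ 2 ∂ν := by
  have := eLpNorm_nnreal_pow_eq_lintegral (f := f) (μ := ν) (p := 2) (by norm_num)
  simp only [NNReal.coe_ofNat, ENNReal.rpow_ofNat] at this
  exact_mod_cast this

theorem lintegral_translate_sub_sq_le [FiniteDimensional ℝ F] {f : E → F} {K : ℝ≥0}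
    (hf : LipschitzWith K f) (cf : HasCompactSupport f) (z : E) :
    ∫⁻ x, ‖f (x + z) - f x‖ₑ ^ 2 ∂μ ≤ ∫⁻ x, ‖fderiv ℝ f x z‖ₑ ^ 2 ∂μ := by
  rw [← eLpNorm_two_sq, ← eLpNorm_two_sq]
  gcongr
  exact eLpNorm_translate_sub_le hf cf z

/-- The Cauchy-Schwarz inequality for lower Lebesgue integrals. -/
theorem sq_lintegral_mul_le {α : Type*} [MeasurableSpace α] {ν : Measure α} {f g : α → ℝ≥0∞}
    (hf : AEMeasurable f ν) (hg : AEMeasurable g ν) :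
    (∫⁻ x, f x * g x ∂ν) ^ 2 ≤ (∫⁻ x, f x ^ 2 ∂ν) * ∫⁻ x, g x ^ 2 ∂ν := by
  have := ENNReal.lintegral_mul_le_Lp_mul_Lq ν Real.HolderConjugate.two_two hf hg
  simp only [ENNReal.rpow_ofNat, Pi.mul_apply] at this
  calc _ ≤ _ := pow_le_pow_left' this 2
    _ = _ := by
      rw [mul_pow, ← ENNReal.rpow_natCast, ← ENNReal.rpow_natCast, ← ENNReal.rpow_mul,
        ← ENNReal.rpow_mul]
      norm_num

theorem sq_lintegral_le {α : Type*} [MeasurableSpace α] {ν : Measure α} {f : α → ℝ≥0∞}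
    (hf : AEMeasurable f ν) :
    (∫⁻ x, f x ∂ν) ^ 2 ≤ ν univ * ∫⁻ x, f x ^ 2 ∂ν := by
  have := sq_lintegral_mul_le (aemeasurable_const (b := (1 : ℝ≥0∞))) hf
  simpa using this

theorem enorm_add_sq_le {G : Type*} [NormedAddCommGroup G] (a b : G) :
    ‖a + b‖ₑ ^ 2 ≤ 2 * ‖a‖ₑ ^ 2 + 2 * ‖b‖ₑ ^ 2 := by
  calc ‖a + b‖ₑ ^ 2 ≤ (‖a‖ₑ + ‖b‖ₑ) ^ 2 := by gcongr; exact enorm_add_le a b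
    _ ≤ 2 ^ (2 - 1) * (‖a‖ₑ ^ 2 + ‖b‖ₑ ^ 2) := by
      have := ENNReal.rpow_add_le_mul_rpow_add_rpow ‖a‖ₑ ‖b‖ₑ (p := 2) (by norm_num)
      norm_num at this ⊢
      exact this
    _ = _ := by norm_num; ring

end WholeSpace

/-! ### Gradients as matrices -/

/-- The matrix of a real linear map `ℝ³ → ℂ³`. -/
def gradL : (R3 →L[ℝ] C3) →ₗ[ℝ] C33 where
  toFun T := WithLp.toLp 2 fun ij => T (EuclideanSpace.single ij.2 1) ij.1
  map_add' _ _ := by ext; simp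
  map_smul' _ _ := by ext; simp

theorem grad_eq_gradL (φ : R3 → C3) (y : R3) : grad φ y = gradL (fderiv ℝ φ y) := rfl

theorem gradL_apply (T : R3 →L[ℝ] C3) (i j : Fin 3) :
    gradL T (i, j) = T (EuclideanSpace.single j 1) i := rfl

/-- The symmetric part of a matrix. -/
def symL : C33 →L[ℂ] C33 :=
  LinearMap.toContinuousLinearMap
    { toFun := fun ξ => WithLp.toLp 2 fun ij => (ξ (ij.1, ij.2) + ξ (ij.2, ij.1)) / 2
      map_add' := fun _ _ => by ext; simp; ring
      map_smul' := fun _ _ => by ext; simp; ring }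

theorem symL_apply (ξ : C33) (i j : Fin 3) : symL ξ (i, j) = (ξ (i, j) + ξ (j, i)) / 2 := rfl

/-- `u ⊗ χ`. -/
def outerL (χ : R3) : C3 →L[ℂ] C33 :=
  LinearMap.toContinuousLinearMap
    { toFun := fun u => WithLp.toLp 2 fun ij => u ij.1 * (χ ij.2 : ℂ)
      map_add' := fun _ _ => by ext; simp; ring
      map_smul' := fun _ _ => by ext; simp; ring }

theorem outerL_apply (χ : R3) (u : C3) (i j : Fin 3) : outerL χ u (i, j) = u i * (χ j : ℂ) := rfl

theorem norm_sq_C33 (ξ : C33) : ‖ξ‖ ^ 2 = ∑ i, ∑ j, ‖ξ (i, j)‖ ^ 2 := by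
  rw [EuclideanSpace.norm_sq_eq, Fintype.sum_prod_type]

theorem norm_outerL (χ : R3) (u : C3) : ‖outerL χ u‖ = ‖u‖ * ‖χ‖ := by
  rw [← sq_eq_sq₀ (norm_nonneg _) (by positivity), mul_pow, norm_sq_C33,
    EuclideanSpace.norm_sq_eq, EuclideanSpace.norm_sq_eq, Finset.sum_mul_sum]
  simp [outerL_apply, mul_pow]

theorem norm_symL_le (ξ : C33) : ‖symL ξ‖ ≤ ‖ξ‖ := by
  have h : ‖(WithLp.toLp 2 fun ij : Fin 3 × Fin 3 => ξ (ij.2, ij.1) : C33)‖ = ‖ξ‖ := by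
    rw [← sq_eq_sq₀ (norm_nonneg _) (norm_nonneg _), norm_sq_C33, norm_sq_C33, Finset.sum_comm]
  have e : symL ξ = (1 / 2 : ℂ) • ξ +
      (1 / 2 : ℂ) • (WithLp.toLp 2 fun ij : Fin 3 × Fin 3 => ξ (ij.2, ij.1) : C33) := by
    ext ⟨i, j⟩; simp [symL_apply]; ring
  rw [e]
  refine (norm_add_le _ _).trans ?_
  rw [norm_smul, norm_smul, h]
  norm_num
  linarith

theorem norm_apply_le_gradL (T : R3 →L[ℝ] C3) (z : R3) : ‖T z‖ ≤ ‖gradL T‖ * ‖z‖ := by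
  have hz : z = ∑ j, z j • (EuclideanSpace.single j 1 : R3) := by
    ext i; simp [Finset.sum_apply, Pi.single_apply]
  rw [← sq_le_sq₀ (norm_nonneg _) (by positivity), mul_pow, norm_sq_C33,
    EuclideanSpace.norm_sq_eq (T z), Finset.sum_mul]
  refine Finset.sum_le_sum fun i _ => ?_
  have : T z i = ∑ j, (z j : ℂ) * gradL T (i, j) := by
    conv_lhs => rw [hz]
    simp [gradL_apply]
  rw [this]
  calc ‖∑ j, (z j : ℂ) * gradL T (i, j)‖ ^ 2 ≤ (∑ j, ‖z j‖ * ‖gradL T (i, j)‖) ^ 2 := by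
        gcongr
        refine (norm_sum_le _ _).trans (le_of_eq ?_)
        simp
    _ ≤ _ := by
      rw [EuclideanSpace.norm_sq_eq z, mul_comm]
      exact Finset.sum_mul_sq_le_sq_mul_sq _ _ _

theorem norm_gradL_le (T : R3 →L[ℝ] C3) : ‖gradL T‖ ≤ 3 * ‖T‖ := by
  have : ‖gradL T‖ ^ 2 ≤ 3 * ‖T‖ ^ 2 := by
    rw [norm_sq_C33, Finset.sum_comm]
    calc ∑ j, ∑ i, ‖gradL T (i, j)‖ ^ 2 = ∑ j, ‖T (EuclideanSpace.single j 1)‖ ^ 2 := by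
          simp only [EuclideanSpace.norm_sq_eq]; rfl
      _ ≤ ∑ _j : Fin 3, ‖T‖ ^ 2 := by
          refine Finset.sum_le_sum fun j _ => ?_
          gcongr
          simpa using T.le_opNorm (EuclideanSpace.single j 1)
      _ = _ := by simp
  nlinarith [norm_nonneg (gradL T), norm_nonneg T, sq_nonneg ‖T‖]

theorem measurable_grad (φ : R3 → C3) : Measurable (grad φ) := by
  refine (WithLp.measurable_toLp 2 _).comp (measurable_pi_lambda _ fun ij => ?_)
  have h := measurable_fderiv_apply_const ℝ φ (EuclideanSpace.single ij.2 1)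
  exact (measurable_pi_apply ij.1).comp ((WithLp.measurable_ofLp 2 _).comp h)

theorem norm_grad_le_of_lipschitz {V : R3 → C3} {K : ℝ≥0} (hV : LipschitzWith K V) (x : R3) :
    ‖grad V x‖ ≤ 3 * K := by
  rw [grad_eq_gradL]
  exact (norm_gradL_le _).trans (by gcongr; exact norm_fderiv_le_of_lipschitz ℝ hV)

theorem grad_eq_zero_of_notMem_tsupport {V : R3 → C3} {x : R3} (hx : x ∉ tsupport V) :
    grad V x = 0 := by
  have : fderiv ℝ V x = 0 := by
    by_contra h
    exact hx (support_fderiv_subset ℝ (Function.mem_support.2 h))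
  rw [grad_eq_gradL, this, map_zero]

/-- The algebraic half of Korn's inequality: it remains to see that the last sum has a non-negative
integral when G is the gradient of a compactly supported field. -/
theorem norm_sq_symL_add (G : C33) : 2 * ‖symL G‖ ^ 2 =
    ‖G‖ ^ 2 + ∑ i, ∑ j, (G (i, j) * star (G (j, i))).re := by
  simp only [norm_sq_C33, symL_apply, Fin.sum_univ_three, ← Complex.normSq_eq_norm_sq,
    Complex.normSq_apply]
  simp
  ring

/-- Korn's inequality in the whole space. -/
theorem integral_norm_grad_sq_le {V : R3 → C3} {K : ℝ≥0} (hV : LipschitzWith K V)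
    (cV : HasCompactSupport V) :
    ∫ x, ‖grad V x‖ ^ 2 ≤ 2 * ∫ x, ‖symL (grad V x)‖ ^ 2 := by
  have hb := norm_grad_le_of_lipschitz hV
  have hint : ∀ f : R3 → ℂ, AEStronglyMeasurable f → (∃ C, ∀ x, ‖f x‖ ≤ C) →
      (∀ x ∉ tsupport V, f x = 0) → Integrable f := by
    rintro f hm ⟨C, hC⟩ h0
    have : IntegrableOn f (tsupport V) := by
      refine Measure.integrableOn_of_bounded (M := C) cV.measure_lt_top.ne hm ?_
      exact Eventually.of_forall hC
    rwa [integrableOn_iff_integrable_of_support_subset] at this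
    intro x hx
    by_contra h
    exact hx (h0 x h)
  have hintR : ∀ f : R3 → ℝ, AEStronglyMeasurable f → (∃ C, ∀ x, ‖f x‖ ≤ C) →
      (∀ x ∉ tsupport V, f x = 0) → Integrable f := by
    rintro f hm ⟨C, hC⟩ h0
    have := hint (fun x => (f x : ℂ)) (Complex.continuous_ofReal.comp_aestronglyMeasurable hm)
      ⟨C, fun x => by simpa using hC x⟩ (fun x hx => by simp [h0 x hx])
    simpa using this.re
  have hm := measurable_grad V
  have hcomp : ∀ ij, @Measurable R3 ℂ _ _ fun x => grad V x ij := fun ij =>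
    (measurable_pi_apply ij).comp ((WithLp.measurable_ofLp 2 _).comp hm)
  have hprod : ∀ i j k l, Integrable fun x => grad V x (i, j) * star (grad V x (k, l)) := by
    intro i j k l
    refine hint _ ((hcomp _).mul (continuous_star.measurable.comp (hcomp _))).aestronglyMeasurable
      ⟨(3 * K) * (3 * K), fun x => ?_⟩ fun x hx => by
        simp [grad_eq_zero_of_notMem_tsupport hx]
    rw [norm_mul, norm_star]
    gcongr
    · exact (PiLp.norm_apply_le _ _).trans (hb x)
    · exact (PiLp.norm_apply_le _ _).trans (hb x)
  have Vi : ∀ i, LipschitzWith K fun x => V x i := fun i =>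
    LipschitzWith.of_dist_le_mul fun x y => by
      refine le_trans ?_ (hV.dist_le_mul x y)
      rw [dist_eq_norm, dist_eq_norm]
      exact PiLp.norm_apply_le (V x - V y) i
  have cVi : ∀ i, HasCompactSupport fun x => V x i := fun i =>
    cV.comp_left (g := fun v : C3 => v i) rfl
  have hder : ∀ᵐ x, ∀ i j, grad V x (i, j) =
      fderiv ℝ (fun x => V x i) x (EuclideanSpace.single j 1) := by
    filter_upwards [hV.ae_differentiableAt (μ := volume)] with x hx i j
    have := ((EuclideanSpace.proj (𝕜 := ℂ) i : C3 →L[ℂ] ℂ).restrictScalars ℝ).hasFDerivAt.comp x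
      hx.hasFDerivAt
    have h2 : fderiv ℝ (fun x => V x i) x = _ := this.fderiv
    rw [h2]; rfl
  have hderc : ∀ᵐ x, ∀ i j, star (grad V x (i, j)) =
      fderiv ℝ (fun x => star (V x i)) x (EuclideanSpace.single j 1) := by
    filter_upwards [hder, hV.ae_differentiableAt (μ := volume)] with x h hx i j
    have := ((EuclideanSpace.proj (𝕜 := ℂ) i : C3 →L[ℂ] ℂ).restrictScalars ℝ).hasFDerivAt.comp x
      hx.hasFDerivAt
    have h3 := (starL' ℝ (A := ℂ)).toContinuousLinearMap.hasFDerivAt.comp x this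
    have h2 : fderiv ℝ (fun x => star (V x i)) x = _ := h3.fderiv
    rw [h2]; rfl
  have Vci : ∀ i, LipschitzWith K fun x => star (V x i) := fun i =>
    LipschitzWith.of_dist_le_mul fun x y => by
      simpa [dist_star_star] using (Vi i).dist_le_mul x y
  -- Exchanging the two derivatives turns the mixed terms of `norm_sq_symL_add` into those of the
  -- square of the divergence, whose integral is non-negative.
  have hswap : ∀ i j, ∫ x, grad V x (i, j) * star (grad V x (j, i)) =
      ∫ x, grad V x (i, i) * star (grad V x (j, j)) := by
    intro i j
    have h := integral_fderiv_mul_fderiv_comm (μ := (volume : Measure R3)) (Vi i) (Vci j) (cVi i)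
      (EuclideanSpace.single j 1) (EuclideanSpace.single i 1)
    refine Eq.trans (integral_congr_ae ?_) (h.trans (integral_congr_ae ?_))
    · filter_upwards [hder, hderc] with x h1 h2
      simp only [h2]
      simp only [h1]
    · filter_upwards [hder, hderc] with x h1 h2
      simp only [h2]
      simp only [h1]
  have hre : ∀ i j k l, ∫ x, (grad V x (i, j) * star (grad V x (k, l))).re =
      (∫ x, grad V x (i, j) * star (grad V x (k, l))).re := fun i j k l => by
    simpa using integral_re (hprod i j k l)
  have hrei : ∀ i j k l, Integrable fun x => (grad V x (i, j) * star (grad V x (k, l))).re :=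
    fun i j k l => by simpa using (hprod i j k l).re
  have hpos : 0 ≤ ∫ x, ∑ i, ∑ j, (grad V x (i, j) * star (grad V x (j, i))).re := by
    have hsum : ∀ F : Fin 3 → Fin 3 → R3 → ℝ, (∀ i j, Integrable (F i j)) →
        ∫ x, ∑ i, ∑ j, F i j x = ∑ i, ∑ j, ∫ x, F i j x := fun F hF => by
      rw [integral_finsetSum _ fun i _ => integrable_finsetSum _ fun j _ => hF i j]
      exact Finset.sum_congr rfl fun i _ => integral_finsetSum _ fun j _ => hF i j
    rw [hsum _ fun i j => hrei i j j i]
    have hsw : ∑ i, ∑ j, ∫ x, (grad V x (i, j) * star (grad V x (j, i))).re =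
        ∑ i, ∑ j, ∫ x, (grad V x (i, i) * star (grad V x (j, j))).re :=
      Finset.sum_congr rfl fun i _ => Finset.sum_congr rfl fun j _ => by
        rw [hre i j j i, hre i i j j]
        exact congrArg Complex.re (hswap i j)
    rw [hsw, ← hsum _ fun i j => hrei i i j j]
    refine integral_nonneg fun x => ?_
    have : ∑ i, ∑ j, (grad V x (i, i) * star (grad V x (j, j))).re =
        ((∑ i, grad V x (i, i)) * star (∑ j, grad V x (j, j))).re := by
      rw [star_sum, Finset.sum_mul_sum, Complex.re_sum]
      simp_rw [Complex.re_sum]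
    simp only [Pi.zero_apply]
    rw [this, Complex.star_def, Complex.mul_conj]
    simpa using Complex.normSq_nonneg _
  have hsq : Integrable fun x => ‖grad V x‖ ^ 2 := by
    refine hintR _ (hm.norm.pow_const 2).aestronglyMeasurable ⟨(3 * K) ^ 2, fun x => ?_⟩
      fun x hx => by simp [grad_eq_zero_of_notMem_tsupport hx]
    rw [Real.norm_of_nonneg (by positivity)]
    gcongr; exact hb x
  rw [← integral_const_mul]
  simp_rw [norm_sq_symL_add]
  rw [integral_add hsq (integrable_finsetSum _ fun i _ => integrable_finsetSum _ fun j _ =>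
    hrei _ _ _ _)]
  linarith

theorem lintegral_grad_sq_le {V : R3 → C3} {K : ℝ≥0} (hV : LipschitzWith K V)
    (cV : HasCompactSupport V) :
    ∫⁻ x, ‖grad V x‖ₑ ^ 2 ≤ 2 * ∫⁻ x, ‖symL (grad V x)‖ₑ ^ 2 := by
  have hm := measurable_grad V
  have hb := norm_grad_le_of_lipschitz hV
  have conv : ∀ f : R3 → C33, Measurable f → (∀ x, ‖f x‖ ≤ ‖grad V x‖) →
      ∫⁻ x, ‖f x‖ₑ ^ 2 = ENNReal.ofReal (∫ x, ‖f x‖ ^ 2) := by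
    intro f hf hle
    rw [ofReal_integral_eq_lintegral_ofReal]
    · refine lintegral_congr fun x => ?_
      rw [ENNReal.ofReal_pow (norm_nonneg _), ofReal_norm]
    · have : IntegrableOn (fun x => ‖f x‖ ^ 2) (tsupport V) := by
        refine Measure.integrableOn_of_bounded (M := (3 * K) ^ 2) cV.measure_lt_top.ne
          (hf.norm.pow_const 2).aestronglyMeasurable (Eventually.of_forall fun x => ?_)
        rw [Real.norm_of_nonneg (by positivity)]
        gcongr; exact (hle x).trans (hb x)
      rwa [integrableOn_iff_integrable_of_support_subset] at this
      intro x hx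
      by_contra h
      have := hle x
      rw [grad_eq_zero_of_notMem_tsupport h, norm_zero] at this
      exact hx (by simp [le_antisymm this (norm_nonneg _)])
    · exact Eventually.of_forall fun x => by positivity
  rw [conv _ hm fun x => le_rfl,
    conv (fun x => symL (grad V x)) (symL.continuous.measurable.comp hm) fun x => norm_symL_le _]
  refine (ENNReal.ofReal_le_ofReal (integral_norm_grad_sq_le hV cV)).trans (le_of_eq ?_)
  rw [ENNReal.ofReal_mul (by norm_num)]
  simp

/-! ### A Poincaré inequality on a grid of small cubes, replacing compact embeddings -/

set_option maxHeartbeats 1000000 in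
/-- For compactly supported Lipschitz functions the `L²` norm is controlled by finitely many
averages, up to a small multiple of the norm of the gradient. -/
theorem exists_finite_averages (R : ℝ) {ε : ℝ≥0∞} (hε : ε ≠ 0) :
    ∃ (ι : Type) (_ : Fintype ι) (Q : ι → Set R3), (∀ k, MeasurableSet (Q k) ∧ volume (Q k) < ⊤) ∧
      ∃ C : ℝ≥0∞, C ≠ ⊤ ∧ ∀ V : R3 → C3, (∃ K, LipschitzWith K V) →
        tsupport V ⊆ Metric.closedBall 0 R →
          ∫⁻ x, ‖V x‖ₑ ^ 2 ≤ C * ∑ k, ‖∫ x in Q k, V x‖ₑ ^ 2 + ε * ∫⁻ x, ‖grad V x‖ₑ ^ 2 := by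
  -- the constant from the Poincaré inequality on cubes of side `h`
  set c : ℝ≥0∞ := 2 * (ENNReal.ofReal (2 ^ 5) * volume (Metric.ball (0 : R3) 1)) with hc
  have hctop : c ≠ ⊤ := ENNReal.mul_ne_top (by norm_num)
    (ENNReal.mul_ne_top ENNReal.ofReal_ne_top measure_ball_lt_top.ne)
  obtain ⟨h, hpos, hh⟩ : ∃ h : ℝ, 0 < h ∧ c * ENNReal.ofReal (h ^ 2) ≤ ε := by
    have : Tendsto (fun h : ℝ => c * ENNReal.ofReal (h ^ 2)) (𝓝[>] 0) (𝓝 (c * ENNReal.ofReal (0 ^ 2))) := by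
      refine Tendsto.mono_left ?_ nhdsWithin_le_nhds
      refine ENNReal.Tendsto.const_mul ?_ (Or.inr hctop)
      exact (ENNReal.continuous_ofReal.comp (continuous_pow 2)).tendsto 0
    simp only [ne_eq, OfNat.ofNat_ne_zero, not_false_eq_true, zero_pow, ENNReal.ofReal_zero,
      mul_zero] at this
    have h2 := (this.eventually (gt_mem_nhds (pos_iff_ne_zero.2 hε))).and self_mem_nhdsWithin
    obtain ⟨h, h3, h4⟩ := h2.exists
    exact ⟨h, h4, h3.le⟩
  -- The grid of half-open cubes of side h: `q x` is the index of the cube containing x. The bound B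
  -- is large enough for the cubes with indices in [-B, B] to cover the ball of radius R.
  let q : R3 → Fin 3 → ℤ := fun x i => ⌊x i / h⌋
  have hqm : Measurable q := measurable_pi_lambda _ fun i => by
    have : Measurable fun x : R3 => x i / h := Continuous.measurable (by fun_prop)
    exact Int.measurable_floor.comp this
  let B : ℤ := ⌈R / h⌉ + 1
  let ι := Fin 3 → Finset.Icc (-B) B
  let Q : ι → Set R3 := fun k => {x | ∀ i, q x i = k i}
  have hQeq : ∀ k, Q k = WithLp.ofLp ⁻¹' (Set.pi univ fun i => Ico ((k i : ℤ) * h) ((k i : ℤ) * h + h)) := by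
    intro k
    ext x
    simp only [Q, q, mem_ofPred_eq, mem_preimage, Set.mem_pi, mem_univ, true_imp_iff, mem_Ico]
    refine forall_congr' fun i => ?_
    rw [Int.floor_eq_iff, le_div_iff₀ hpos, div_lt_iff₀ hpos]
    constructor <;> rintro ⟨h1, h2⟩ <;> refine ⟨h1, ?_⟩ <;> linarith
  have hQm : ∀ k, MeasurableSet (Q k) := fun k => by
    rw [hQeq]
    exact (MeasurableSet.univ_pi fun i => measurableSet_Ico).preimage (WithLp.measurable_ofLp 2 _)
  have hQv : ∀ k, volume (Q k) = ENNReal.ofReal (h ^ 3) := fun k => by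
    rw [hQeq, (PiLp.volume_preserving_ofLp (Fin 3)).measure_preimage
      (MeasurableSet.univ_pi fun i => measurableSet_Ico).nullMeasurableSet, Real.volume_pi_Ico]
    simp [Finset.prod_const, ENNReal.ofReal_pow hpos.le]
  have hQd : Pairwise (Function.onFun Disjoint Q) := fun k l hkl => by
    refine Set.disjoint_left.2 fun x hx hy => hkl ?_
    ext i
    rw [← hx i, ← hy i]
  have hv0 : ENNReal.ofReal (h ^ 3) ≠ 0 := by simp; positivity
  have hvt : ENNReal.ofReal (h ^ 3) ≠ ⊤ := ENNReal.ofReal_ne_top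
  refine ⟨ι, inferInstance, Q, fun k => ⟨hQm k, by rw [hQv]; exact ENNReal.ofReal_lt_top⟩,
    2 * (ENNReal.ofReal (h ^ 3))⁻¹, ENNReal.mul_ne_top (by norm_num) (ENNReal.inv_ne_top.2 hv0), ?_⟩
  rintro V ⟨K, hV⟩ hR
  have cV : HasCompactSupport V := (isCompact_closedBall 0 R).of_isClosed_subset
    (isClosed_tsupport _) hR
  have hVc := hV.continuous
  have hcover : ∀ x, V x ≠ 0 → x ∈ ⋃ k, Q k := by
    intro x hx
    have hx1 : ‖x‖ ≤ R := by simpa using hR (subset_tsupport _ hx)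
    have : ∀ i, q x i ∈ Finset.Icc (-B) B := by
      intro i
      have h1 : |x i| ≤ R := (PiLp.norm_apply_le x i).trans hx1
      obtain ⟨h2, h3⟩ := abs_le.1 h1
      have h5 : x i / h ≤ R / h := by gcongr
      have h6 : -(R / h) ≤ x i / h := by rw [← neg_div]; gcongr
      have h7 := Int.le_ceil (R / h)
      rw [Finset.mem_Icc]
      constructor
      · rw [Int.le_floor]; push_cast [B]; linarith
      · rw [← Int.lt_add_one_iff, Int.floor_lt]; push_cast [B]; linarith
    exact mem_iUnion.2 ⟨fun i => ⟨q x i, this i⟩, fun i => rfl⟩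
  have hsum : ∀ f : R3 → ℝ≥0∞, ∑ k, ∫⁻ x in Q k, f x = ∫⁻ x in ⋃ k, Q k, f x := fun f => by
    rw [lintegral_iUnion hQm hQd, tsum_fintype]
  have hpoinc : ∀ k, ∫⁻ x in Q k, ‖V x - (h ^ 3)⁻¹ • ∫ y in Q k, V y‖ₑ ^ 2 ≤
      (ENNReal.ofReal (h ^ 3))⁻¹ * ∫⁻ x in Q k, ∫⁻ y in Q k, ‖V x - V y‖ₑ ^ 2 := by
    intro k
    rw [← lintegral_const_mul' _ _ (ENNReal.inv_ne_top.2 hv0)]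
    refine lintegral_mono fun x => ?_
    have hint : IntegrableOn V (Q k) := (hVc.integrable_of_hasCompactSupport cV).integrableOn
    have e : V x - (h ^ 3)⁻¹ • ∫ y in Q k, V y = (h ^ 3)⁻¹ • ∫ y in Q k, (V x - V y) := by
      rw [integral_sub _ hint, smul_sub, setIntegral_const, Measure.real, hQv,
        ENNReal.toReal_ofReal (by positivity), smul_smul, inv_mul_cancel₀ (by positivity), one_smul]
      exact integrableOn_const (by rw [hQv]; exact hvt)
    have e2 : ‖(h ^ 3)⁻¹‖ₑ = (ENNReal.ofReal (h ^ 3))⁻¹ := by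
      rw [← ofReal_norm, Real.norm_of_nonneg (by positivity), ENNReal.ofReal_inv_of_pos (by positivity)]
    rw [e, enorm_smul, mul_pow, e2]
    calc (ENNReal.ofReal (h ^ 3))⁻¹ ^ 2 * ‖∫ y in Q k, (V x - V y)‖ₑ ^ 2
        ≤ (ENNReal.ofReal (h ^ 3))⁻¹ ^ 2 * (∫⁻ y in Q k, ‖V x - V y‖ₑ) ^ 2 := by
          gcongr; exact enorm_integral_le_lintegral_enorm _
      _ ≤ (ENNReal.ofReal (h ^ 3))⁻¹ ^ 2 *
          (volume.restrict (Q k) univ * ∫⁻ y in Q k, ‖V x - V y‖ₑ ^ 2) := by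
          gcongr; exact sq_lintegral_le (by fun_prop)
      _ = _ := by
        rw [Measure.restrict_apply_univ, hQv, ← mul_assoc, sq, mul_assoc (_)⁻¹ (_)⁻¹,
          ENNReal.inv_mul_cancel hv0 hvt, mul_one]
  -- Two points of the same cube differ by at most √3 h < 2h. The sum of the double integrals over
  -- the disjoint cubes is thus at most the integral of |V(x + z) - V(x)|² over all x and all |z| <
  -- 2h, to which the translation estimate applies for each z.
  have hdouble : ∑ k, ∫⁻ x in Q k, ∫⁻ y in Q k, ‖V x - V y‖ₑ ^ 2 ≤
      ENNReal.ofReal ((2 * h) ^ 3) * volume (Metric.ball (0 : R3) 1) *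
        (ENNReal.ofReal ((2 * h) ^ 2) * ∫⁻ x, ‖grad V x‖ₑ ^ 2) := by
    calc ∑ k, ∫⁻ x in Q k, ∫⁻ y in Q k, ‖V x - V y‖ₑ ^ 2
        ≤ ∑ k, ∫⁻ x in Q k, ∫⁻ z in Metric.ball (0 : R3) (2 * h), ‖V (x + z) - V x‖ₑ ^ 2 := by
          refine Finset.sum_le_sum fun k _ => setLIntegral_mono' (hQm k) fun x hx => ?_
          have : ∫⁻ z in Metric.ball (0 : R3) (2 * h), ‖V (x + z) - V x‖ₑ ^ 2 =
              ∫⁻ y in Metric.ball x (2 * h), ‖V x - V y‖ₑ ^ 2 := by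
            have hmp := (measurePreserving_add_left (volume : Measure R3) x)
            have hpre : (fun z => x + z) ⁻¹' Metric.ball x (2 * h) = Metric.ball 0 (2 * h) := by
              ext z; simp
            have hcm : Measurable fun y => ‖V x - V y‖ₑ ^ 2 := Continuous.measurable (by fun_prop)
            rw [← hmp.setLIntegral_comp_preimage measurableSet_ball hcm, hpre]
            simp_rw [enorm_sub_rev (V x)]
          rw [this]
          refine lintegral_mono_set fun y hy => ?_
          rw [Metric.mem_ball, dist_eq_norm]
          refine lt_of_pow_lt_pow_left₀ 2 (by positivity) ?_
          rw [EuclideanSpace.norm_sq_eq]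
          have : ∀ i, ‖(y - x) i‖ ^ 2 ≤ h ^ 2 := by
            intro i
            have hx' := hx; have hy' := hy
            rw [hQeq] at hx' hy'
            have h1 := hx' i trivial
            have h2 := hy' i trivial
            simp only [mem_Ico] at h1 h2
            rw [Real.norm_eq_abs, sq_abs, PiLp.sub_apply]
            exact sq_le_sq' (by linarith) (by linarith)
          calc ∑ i, ‖(y - x) i‖ ^ 2 ≤ ∑ _i : Fin 3, h ^ 2 := Finset.sum_le_sum fun i _ => this i
            _ < _ := by simp; nlinarith [sq_pos_of_pos hpos]
      _ ≤ ∫⁻ x, ∫⁻ z in Metric.ball (0 : R3) (2 * h), ‖V (x + z) - V x‖ₑ ^ 2 := by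
          rw [hsum]; exact setLIntegral_le_lintegral _ _
      _ = ∫⁻ z in Metric.ball (0 : R3) (2 * h), ∫⁻ x, ‖V (x + z) - V x‖ₑ ^ 2 := by
          rw [lintegral_lintegral_swap]
          exact Measurable.aemeasurable (by fun_prop)
      _ ≤ ∫⁻ z in Metric.ball (0 : R3) (2 * h),
            ENNReal.ofReal ((2 * h) ^ 2) * ∫⁻ x, ‖grad V x‖ₑ ^ 2 := by
          refine setLIntegral_mono' measurableSet_ball fun z hz => ?_
          refine (lintegral_translate_sub_sq_le hV cV z).trans ?_
          rw [← lintegral_const_mul' _ _ ENNReal.ofReal_ne_top]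
          refine lintegral_mono fun x => ?_
          rw [← ofReal_norm, ← ofReal_norm, ← ENNReal.ofReal_pow (norm_nonneg _),
            ← ENNReal.ofReal_pow (norm_nonneg _), ← ENNReal.ofReal_mul (by positivity)]
          refine ENNReal.ofReal_le_ofReal ?_
          rw [mul_comm, ← mul_pow]
          gcongr
          refine (norm_apply_le_gradL _ z).trans ?_
          rw [← grad_eq_gradL]
          gcongr
          exact (mem_ball_zero_iff.1 hz).le
      _ = _ := by
        rw [lintegral_const, Measure.restrict_apply_univ,
          Measure.addHaar_ball (volume : Measure R3) 0 (by positivity : 0 ≤ 2 * h), mul_comm]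
        simp
  calc ∫⁻ x, ‖V x‖ₑ ^ 2 = ∑ k, ∫⁻ x in Q k, ‖V x‖ₑ ^ 2 := by
        rw [hsum, setLIntegral_eq_of_support_subset]
        intro x hx
        refine hcover x fun h0 => hx ?_
        simp [h0]
    _ ≤ ∑ k, ((2 * ∫⁻ x in Q k, ‖V x - (h ^ 3)⁻¹ • ∫ y in Q k, V y‖ₑ ^ 2) +
          2 * (ENNReal.ofReal (h ^ 3))⁻¹ * ‖∫ y in Q k, V y‖ₑ ^ 2) := by
        refine Finset.sum_le_sum fun k _ => ?_
        calc ∫⁻ x in Q k, ‖V x‖ₑ ^ 2 ≤ ∫⁻ x in Q k, (2 * ‖V x - (h ^ 3)⁻¹ • ∫ y in Q k, V y‖ₑ ^ 2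
              + 2 * ‖(h ^ 3)⁻¹ • ∫ y in Q k, V y‖ₑ ^ 2) := by
              refine lintegral_mono fun x => ?_
              have := enorm_add_sq_le (V x - (h ^ 3)⁻¹ • ∫ y in Q k, V y)
                ((h ^ 3)⁻¹ • ∫ y in Q k, V y)
              rwa [sub_add_cancel] at this
          _ = _ := by
            have e2 : ‖(h ^ 3)⁻¹‖ₑ = (ENNReal.ofReal (h ^ 3))⁻¹ := by
              rw [← ofReal_norm, Real.norm_of_nonneg (by positivity),
                ENNReal.ofReal_inv_of_pos (by positivity)]
            rw [lintegral_add_right _ measurable_const, lintegral_const_mul' _ _ (by norm_num),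
              lintegral_const, Measure.restrict_apply_univ, hQv, enorm_smul, mul_pow, e2]
            congr 1
            rw [sq (ENNReal.ofReal (h ^ 3))⁻¹]
            calc _ = 2 * ((ENNReal.ofReal (h ^ 3))⁻¹ * ‖∫ y in Q k, V y‖ₑ ^ 2) *
                  ((ENNReal.ofReal (h ^ 3))⁻¹ * ENNReal.ofReal (h ^ 3)) := by ring
              _ = _ := by rw [ENNReal.inv_mul_cancel hv0 hvt]; ring
    _ = 2 * (ENNReal.ofReal (h ^ 3))⁻¹ * ∑ k, ‖∫ y in Q k, V y‖ₑ ^ 2 +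
          2 * ∑ k, ∫⁻ x in Q k, ‖V x - (h ^ 3)⁻¹ • ∫ y in Q k, V y‖ₑ ^ 2 := by
        rw [Finset.sum_add_distrib, ← Finset.mul_sum, ← Finset.mul_sum, add_comm]
    _ ≤ _ := by
      refine add_le_add le_rfl ?_
      calc _ ≤ 2 * ∑ k, (ENNReal.ofReal (h ^ 3))⁻¹ *
            ∫⁻ x in Q k, ∫⁻ y in Q k, ‖V x - V y‖ₑ ^ 2 := by
            gcongr with k; exact hpoinc k
        _ ≤ 2 * ((ENNReal.ofReal (h ^ 3))⁻¹ *
            (ENNReal.ofReal ((2 * h) ^ 3) * volume (Metric.ball (0 : R3) 1) *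
            (ENNReal.ofReal ((2 * h) ^ 2) * ∫⁻ x, ‖grad V x‖ₑ ^ 2))) := by
            rw [← Finset.mul_sum]; gcongr
        _ = (c * ENNReal.ofReal (h ^ 2)) * ∫⁻ x, ‖grad V x‖ₑ ^ 2 := by
            -- The volume h³ of a cube cancels and leaves h² times 2⁵ = 2³ · 2², the constant built
            -- into c.
            have : ENNReal.ofReal ((2 * h) ^ 3) * ENNReal.ofReal ((2 * h) ^ 2) =
                ENNReal.ofReal (h ^ 3) * (ENNReal.ofReal (2 ^ 5) * ENNReal.ofReal (h ^ 2)) := by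
              rw [← ENNReal.ofReal_mul (by positivity), ← ENNReal.ofReal_mul (by positivity),
                ← ENNReal.ofReal_mul (by positivity)]
              congr 1; ring
            calc _ = 2 * ((ENNReal.ofReal (h ^ 3))⁻¹ * (volume (Metric.ball (0 : R3) 1) *
                  (ENNReal.ofReal ((2 * h) ^ 3) * ENNReal.ofReal ((2 * h) ^ 2)) *
                  ∫⁻ x, ‖grad V x‖ₑ ^ 2)) := by ring
              _ = ((ENNReal.ofReal (h ^ 3))⁻¹ * ENNReal.ofReal (h ^ 3)) *
                  ((c * ENNReal.ofReal (h ^ 2)) * ∫⁻ x, ‖grad V x‖ₑ ^ 2) := by rw [this, hc]; ring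
              _ = _ := by rw [ENNReal.inv_mul_cancel hv0 hvt, one_mul]
        _ ≤ _ := by gcongr

/-! ### Reflection across a graph -/

/-- On a compact neighbourhood of the support the local Lipschitz constants are uniform. A point of
the support and a point outside the 1-thickening are at distance at least 1, where the bound of |f|
serves as a Lipschitz constant. -/
theorem exists_lipschitzWith_of_hasCompactSupport {E F : Type*} [NormedAddCommGroup E]
    [NormedSpace ℝ E] [FiniteDimensional ℝ E] [NormedAddCommGroup F] {f : E → F}
    (hf : LocallyLipschitz f) (cf : HasCompactSupport f) : ∃ K, LipschitzWith K f := by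
  have : ProperSpace E := FiniteDimensional.proper ℝ E
  have hc : IsCompact (Metric.cthickening 1 (tsupport f)) := IsCompact.cthickening cf
  obtain ⟨K, hK⟩ := (hf.locallyLipschitzOn (s := Metric.cthickening 1 (tsupport f))
    ).exists_lipschitzOnWith_of_compact hc
  obtain ⟨M, hM⟩ := cf.exists_bound_of_continuous hf.continuous
  have hM0 : 0 ≤ M := (norm_nonneg _).trans (hM 0)
  have key : ∀ x y, x ∈ Metric.cthickening 1 (tsupport f) →
      dist (f x) (f y) ≤ max K M.toNNReal * dist x y := by
    intro x y hx
    by_cases hy : y ∈ Metric.cthickening 1 (tsupport f)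
    · exact (hK.dist_le_mul x hx y hy).trans (by gcongr; exact le_max_left _ _)
    have hy0 : f y = 0 := by
      by_contra h
      exact hy (Metric.self_subset_cthickening _ (subset_tsupport _ h))
    by_cases hx' : x ∈ tsupport f
    · have h1 : 1 ≤ dist x y := by
        by_contra! h
        exact hy (Metric.mem_cthickening_of_dist_le y x 1 _ hx' (by rw [dist_comm]; exact h.le))
      rw [hy0, dist_zero_right]
      calc ‖f x‖ ≤ M * 1 := by simpa using hM x
        _ ≤ max K M.toNNReal * dist x y := by
          gcongr
          rw [NNReal.coe_max, Real.coe_toNNReal _ hM0]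
          exact le_max_right _ _
    · rw [hy0, image_eq_zero_of_notMem_tsupport hx', dist_self]
      positivity
  refine ⟨max K M.toNNReal, LipschitzWith.of_dist_le_mul fun x y => ?_⟩
  by_cases hx : x ∈ Metric.cthickening 1 (tsupport f)
  · exact key x y hx
  by_cases hy : y ∈ Metric.cthickening 1 (tsupport f)
  · rw [dist_comm, dist_comm x]; exact key y x hy
  have hz : ∀ z, z ∉ Metric.cthickening 1 (tsupport f) → f z = 0 := fun z hz => by
    by_contra h
    exact hz (Metric.self_subset_cthickening _ (subset_tsupport _ h))
  rw [hz x hx, hz y hy, dist_self]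
  positivity

theorem LocallyLipschitz.contDiff_comp₂ {E F G H : Type*} [NormedAddCommGroup E]
    [NormedAddCommGroup F] [NormedSpace ℝ F] [NormedAddCommGroup G] [NormedSpace ℝ G]
    [NormedAddCommGroup H] [NormedSpace ℝ H] {B : F × G → H} (hB : ContDiff ℝ 1 B) {f : E → F}
    {g : E → G} (hf : LocallyLipschitz f) (hg : LocallyLipschitz g) :
    LocallyLipschitz fun x => B (f x, g x) :=
  (ContDiff.locallyLipschitz (𝕂 := ℝ) hB).comp (hf.prodMk hg)

/-- The defining function of a graph in the direction `e`, with Lipschitz derivative. -/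
structure IsGraphFunction (δ : R3 → ℝ) (e : R3) (K : ℝ≥0) : Prop where
  contDiff : ContDiff ℝ 1 δ
  lipschitz : LipschitzWith K (fderiv ℝ δ)
  add_smul : ∀ x s, δ (x + s • e) = δ x + s

namespace IsGraphFunction

variable {δ : R3 → ℝ} {e : R3} {K : ℝ≥0}

theorem fderiv_apply (h : IsGraphFunction δ e K) (x : R3) : fderiv ℝ δ x e = 1 := by
  have h1 := ((h.contDiff.differentiable (by simp) x).hasFDerivAt.hasLineDerivAt e)
  have h2 : HasDerivAt (fun s : ℝ => δ (x + s • e)) 1 0 := by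
    simp_rw [h.add_smul]
    simpa using (hasDerivAt_id (0 : ℝ)).const_add (δ x)
  exact h1.unique h2

/-- The graph is a null set. -/
theorem ae_ne_zero (h : IsGraphFunction δ e K) : ∀ᵐ x, δ x ≠ 0 := by
  let L : ℝ →L[ℝ] R3 := ContinuousLinearMap.smulRight (1 : ℝ →L[ℝ] ℝ) e
  have hm : MeasurableSet {x | δ x ≠ 0} :=
    (isOpen_ne_fun h.contDiff.continuous continuous_const).measurableSet
  -- Fubini along the lines in the direction e: each of them meets the graph in exactly one point.
  refine ae_mem_of_ae_add_linearMap_mem L.toLinearMap volume volume hm fun p => ?_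
  have : ∀ t : ℝ, t ≠ -δ p → p + L.toLinearMap t ∈ {x | δ x ≠ 0} := by
    intro t ht
    have : L.toLinearMap t = t • e := by simp [L]
    rw [this]
    change δ (p + t • e) ≠ 0
    rw [h.add_smul]
    contrapose! ht
    linarith
  filter_upwards [Measure.ae_ne volume (-δ p)] with t ht using this t ht

end IsGraphFunction

/-- The map reflecting the region `δ > 0` into the region `δ < 0`, which is the identity in the
latter. -/
def reflect (δ : R3 → ℝ) (e : R3) (m : ℝ) (x : R3) : R3 := x - (m * max (δ x) 0) • e

/-- The (complex bilinear) product with a real vector. -/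
def dotL (e : R3) : C3 →L[ℂ] ℂ :=
  LinearMap.toContinuousLinearMap
    { toFun := fun u => ∑ i, (e i : ℂ) * u i
      map_add' := fun _ _ => by simp [mul_add, Finset.sum_add_distrib]
      map_smul' := fun _ _ => by simp [Finset.mul_sum]; congr 1; ext; ring }

theorem dotL_apply (e : R3) (u : C3) : dotL e u = ∑ i, (e i : ℂ) * u i := rfl

/-- The vector of a linear form. -/
def vecL : (R3 →L[ℝ] ℝ) →L[ℝ] C3 :=
  LinearMap.toContinuousLinearMap
    { toFun := fun T => WithLp.toLp 2 fun j => ((T (EuclideanSpace.single j 1) : ℝ) : ℂ)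
      map_add' := fun _ _ => by ext; simp
      map_smul' := fun _ _ => by ext; simp }

theorem vecL_apply (T : R3 →L[ℝ] ℝ) (j : Fin 3) :
    vecL T j = ((T (EuclideanSpace.single j 1) : ℝ) : ℂ) := rfl

/-- The covariant pull-back of a field under a reflection. -/
def pullback (δ : R3 → ℝ) (e : R3) (m : ℝ) (V : R3 → C3) (x : R3) : C3 :=
  -- Where δ > 0 this is Jᵀ V at the reflected point, with J = 1 - m e ⊗ ∇δ the Jacobian of the
  -- reflection. The same formula is kept where the reflection is the identity, which makes the
  -- pull-back continuous across the graph.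
  V (reflect δ e m x) - ((m : ℂ) * dotL e (V (reflect δ e m x))) • vecL (fderiv ℝ δ x)

/-- The extension of a field across the graph `δ = 0`, which preserves the integrability of the
symmetrised gradient. -/
def extend (δ : R3 → ℝ) (e : R3) : (R3 → C3) →ₗ[ℂ] (R3 → C3) where
  -- The weights 3, -2 for the factors m = 2, 3 satisfy 3 - 2 = 1 and 3 · 2 - 2 · 3 = 0. Hence the
  -- terms with ∇δ cancel where δ ≤ 0, and the combination equals V there.
  toFun V x := (3 : ℂ) • pullback δ e 2 V x - (2 : ℂ) • pullback δ e 3 V x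
  map_add' V W := by
    ext1 x; simp only [pullback, Pi.add_apply, map_add]; module
  map_smul' c V := by
    ext1 x; simp only [pullback, Pi.smul_apply, map_smul, RingHom.id_apply, smul_eq_mul]; module

theorem extend_apply (δ : R3 → ℝ) (e : R3) (V : R3 → C3) (x : R3) :
    extend δ e V x = (3 : ℂ) • pullback δ e 2 V x - (2 : ℂ) • pullback δ e 3 V x := rfl

theorem norm_C33_le {ξ : C33} {M : ℝ} (hM : 0 ≤ M) (h : ∀ i j, ‖ξ (i, j)‖ ≤ M) : ‖ξ‖ ≤ 3 * M := by
  rw [← sq_le_sq₀ (norm_nonneg _) (by positivity), norm_sq_C33]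
  calc ∑ i, ∑ j, ‖ξ (i, j)‖ ^ 2 ≤ ∑ _i : Fin 3, ∑ _j : Fin 3, M ^ 2 := by
        gcongr with i _ j _; exact h i j
    _ = _ := by simp; ring

theorem norm_C3_le {ξ : C3} {M : ℝ} (hM : 0 ≤ M) (h : ∀ i, ‖ξ i‖ ≤ M) : ‖ξ‖ ≤ 3 * M := by
  rw [← sq_le_sq₀ (norm_nonneg _) (by positivity), EuclideanSpace.norm_sq_eq]
  calc ∑ i, ‖ξ i‖ ^ 2 ≤ ∑ _i : Fin 3, M ^ 2 := by
        gcongr with i _; exact h i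
    _ ≤ _ := by simp; nlinarith [sq_nonneg M]

theorem norm_dotL_le (e : R3) (u : C3) : ‖dotL e u‖ ≤ 3 * ‖e‖ * ‖u‖ := by
  rw [dotL_apply]
  calc ‖∑ i, (e i : ℂ) * u i‖ ≤ ∑ i, ‖(e i : ℂ) * u i‖ := norm_sum_le _ _
    _ ≤ ∑ _i : Fin 3, ‖e‖ * ‖u‖ := by
      gcongr with i _
      rw [norm_mul]
      gcongr
      · rw [Complex.norm_real]; exact PiLp.norm_apply_le e i
      · exact PiLp.norm_apply_le u i
    _ = _ := by simp; ring

theorem norm_vecL_le (T : R3 →L[ℝ] ℝ) : ‖vecL T‖ ≤ 3 * ‖T‖ := by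
  refine norm_C3_le (norm_nonneg _) fun i => ?_
  rw [vecL_apply, Complex.norm_real]
  simpa using T.le_opNorm (EuclideanSpace.single i 1)

namespace IsGraphFunction

variable {δ : R3 → ℝ} {e : R3} {K : ℝ≥0}

theorem reflect_of_nonpos {m : ℝ} {x : R3} (hx : δ x ≤ 0) : reflect δ e m x = x := by
  simp [reflect, max_eq_right hx]

theorem reflect_of_nonneg {m : ℝ} {x : R3} (hx : 0 ≤ δ x) :
    reflect δ e m x = x - (m * δ x) • e := by
  simp [reflect, max_eq_left hx]

theorem apply_sub_smul (h : IsGraphFunction δ e K) (x : R3) (s : ℝ) : δ (x - s • e) = δ x - s := by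
  rw [sub_eq_add_neg, ← neg_smul, h.add_smul, sub_eq_add_neg]

theorem extend_of_nonpos {V : R3 → C3} {x : R3} (hx : δ x ≤ 0) : extend δ e V x = V x := by
  rw [extend_apply]
  simp only [pullback, reflect_of_nonpos hx]
  push_cast
  module

/-- The C^{1,1} regularity of the boundary enters here: the pull-back contains the factor ∇δ, so it
is Lipschitz because ∇δ is. -/
theorem locallyLipschitz_pullback (h : IsGraphFunction δ e K) (m : ℝ) {V : R3 → C3}
    (hV : ContDiff ℝ 1 V) : LocallyLipschitz (pullback δ e m V) := by
  have hT : LocallyLipschitz (reflect δ e m) := by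
    have h1 : ContDiff ℝ 1 fun p : R3 × ℝ => p.1 - (m * p.2) • e := by fun_prop
    have h2 : LocallyLipschitz δ := h.contDiff.locallyLipschitz
    have h3 : LocallyLipschitz fun x => max (δ x) 0 := h2.max_const 0
    exact LocallyLipschitz.contDiff_comp₂ h1 LocallyLipschitz.id h3
  have hV' : LocallyLipschitz V := ContDiff.locallyLipschitz (𝕂 := ℝ) hV
  have hVT : LocallyLipschitz fun x => V (reflect δ e m x) := hV'.comp hT
  have hg : LocallyLipschitz fun x => vecL (fderiv ℝ δ x) :=
    vecL.lipschitz.locallyLipschitz.comp h.lipschitz.locallyLipschitz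
  have h1 : ContDiff ℝ 1 fun p : C3 × C3 => p.1 - ((m : ℂ) * dotL e p.1) • p.2 := by
    have : ContDiff ℝ 1 fun p : C3 × C3 => dotL e p.1 :=
      ((dotL e).restrictScalars ℝ).contDiff.comp contDiff_fst
    exact contDiff_fst.sub ((contDiff_const.mul this).smul contDiff_snd)
  exact LocallyLipschitz.contDiff_comp₂ h1 hVT hg

/-- The derivative of the pull-back on the side where the reflection acts. -/
theorem hasFDerivAt_pullback (h : IsGraphFunction δ e K) (m : ℝ) {V : R3 → C3}
    (hV : ContDiff ℝ 1 V) {x : R3} (hx : 0 < δ x) (hd : DifferentiableAt ℝ (fderiv ℝ δ) x) :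
    ∃ F' : R3 →L[ℝ] C3, HasFDerivAt (pullback δ e m V) F' x ∧ ∀ z,
      F' z = fderiv ℝ V (reflect δ e m x) (z - (m * fderiv ℝ δ x z) • e)
        - ((m : ℂ) * dotL e (fderiv ℝ V (reflect δ e m x) (z - (m * fderiv ℝ δ x z) • e))) •
            vecL (fderiv ℝ δ x)
        - ((m : ℂ) * dotL e (V (reflect δ e m x))) • vecL (fderiv ℝ (fderiv ℝ δ) x z) := by
  have hδ := (h.contDiff.differentiable (by simp) x).hasFDerivAt
  have hT : HasFDerivAt (reflect δ e m)
      (ContinuousLinearMap.id ℝ R3 - (m • fderiv ℝ δ x).smulRight e) x := by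
    have h1 : HasFDerivAt (fun y => y - (m * δ y) • e)
      (ContinuousLinearMap.id ℝ R3 - (m • fderiv ℝ δ x).smulRight e) x :=
      (hasFDerivAt_id x).sub ((hδ.const_mul m).smul_const e)
    refine h1.congr_of_eventuallyEq ?_
    filter_upwards [h.contDiff.continuous.continuousAt.eventually (lt_mem_nhds hx)] with y hy
    exact reflect_of_nonneg hy.le
  set P : R3 →L[ℝ] C3 := (fderiv ℝ V (reflect δ e m x)).comp
    (ContinuousLinearMap.id ℝ R3 - (m • fderiv ℝ δ x).smulRight e) with hP
  have hVT : HasFDerivAt (fun y => V (reflect δ e m y)) P x :=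
    ((hV.differentiable (by simp) (reflect δ e m x)).hasFDerivAt).comp x hT
  set D : C3 →L[ℝ] ℂ := ((m : ℂ) • dotL e).restrictScalars ℝ with hD
  have hdot : HasFDerivAt (fun y => D (V (reflect δ e m y))) (D.comp P) x :=
    D.hasFDerivAt.comp x hVT
  have hg : HasFDerivAt (fun y => vecL (fderiv ℝ δ y)) (vecL.comp (fderiv ℝ (fderiv ℝ δ) x)) x :=
    vecL.hasFDerivAt.comp x hd.hasFDerivAt
  have hsm : HasFDerivAt (fun y => D (V (reflect δ e m y)) • vecL (fderiv ℝ δ y)) _ x :=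
    hdot.smul hg
  refine ⟨_, hVT.sub hsm, fun z => ?_⟩
  have hPz : P z = fderiv ℝ V (reflect δ e m x) (z - (m * fderiv ℝ δ x z) • e) := rfl
  have hDz : ∀ u, D u = (m : ℂ) * dotL e u := fun u => rfl
  rw [← hPz, ← hDz, ← hDz, sub_sub, add_comm]
  rfl

/-- The reason for pulling back covariantly: the symmetrised gradient becomes Jᵀ (sym ∇V) J at the
reflected point, plus a term of order zero in V with the second derivatives of δ. Plain composition
would also bring in the antisymmetric part of ∇V, which the strain does not control. -/
theorem symL_gradL_pullback (h : IsGraphFunction δ e K) (m : ℝ) {V : R3 → C3}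
    (hV : ContDiff ℝ 1 V) {x : R3} (hx : 0 < δ x) (hd : DifferentiableAt ℝ (fderiv ℝ δ) x)
    (j k : Fin 3) :
    symL (grad (pullback δ e m V) x) (j, k) =
      ∑ i, ∑ l, (((if i = j then 1 else 0) - m * e i * fderiv ℝ δ x (EuclideanSpace.single j 1) : ℝ) : ℂ)
        * (((if l = k then 1 else 0) - m * e l * fderiv ℝ δ x (EuclideanSpace.single k 1) : ℝ) : ℂ)
        * symL (grad V (reflect δ e m x)) (i, l)
      - ((m : ℂ) * dotL e (V (reflect δ e m x))) *
        (vecL (fderiv ℝ (fderiv ℝ δ) x (EuclideanSpace.single k 1)) j +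
          vecL (fderiv ℝ (fderiv ℝ δ) x (EuclideanSpace.single j 1)) k) / 2 := by
  obtain ⟨F', hF, hF'⟩ := h.hasFDerivAt_pullback m hV hx hd
  rw [symL_apply, grad_eq_gradL, gradL_apply, gradL_apply, hF.fderiv, hF', hF']
  have hexp : ∀ (T : R3 →L[ℝ] C3) (k : Fin 3) (s : ℝ) (i : Fin 3),
      T (EuclideanSpace.single k 1 - s • e) i =
        gradL T (i, k) - s * ∑ l, (e l : ℂ) * gradL T (i, l) := by
    intro T k s i
    have he : e = ∑ j, e j • (EuclideanSpace.single j 1 : R3) := by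
      ext i; simp [Finset.sum_apply, Pi.single_apply]
    rw [map_sub, map_smul]
    conv_lhs => rw [he]
    simp [gradL_apply]
  simp only [PiLp.sub_apply, PiLp.smul_apply, smul_eq_mul, dotL_apply, hexp, ← grad_eq_gradL,
    symL_apply, vecL_apply]
  generalize grad V (reflect δ e m x) = G
  generalize V (reflect δ e m x) = v
  fin_cases j <;> fin_cases k <;> simp [Fin.sum_univ_three] <;> ring

/-- Change of variables under the reflection. -/
theorem lintegral_reflect_le (h : IsGraphFunction δ e K) {m : ℝ} (hm : 2 ≤ m) (g : R3 → ℝ≥0∞) :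
    ∫⁻ x in {x | 0 < δ x}, g (reflect δ e m x) ≤ ∫⁻ x in {x | δ x < 0}, g x := by
  have hs : MeasurableSet {x | 0 < δ x} :=
    (isOpen_lt continuous_const h.contDiff.continuous).measurableSet
  let T : R3 → R3 := fun x => x - (m * δ x) • e
  let T' : R3 → (R3 →L[ℝ] R3) := fun x =>
    ContinuousLinearMap.id ℝ R3 - (m • fderiv ℝ δ x).smulRight e
  have hT : ∀ x ∈ {x | 0 < δ x}, HasFDerivWithinAt T (T' x) {x | 0 < δ x} x := fun x _ =>
    ((hasFDerivAt_id x).sub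
      (((h.contDiff.differentiable (by simp) x).hasFDerivAt.const_mul m).smul_const e)
      ).hasFDerivWithinAt
  have hδT : ∀ x, δ (T x) = (1 - m) * δ x := fun x => by
    simp only [T, h.apply_sub_smul]; ring
  have hinj : InjOn T {x | 0 < δ x} := by
    intro x _ y _ hxy
    have h1 : δ x = δ y := by
      have := congrArg δ hxy
      rw [hδT, hδT] at this
      exact mul_left_cancel₀ (by linarith : (1 - m) ≠ 0) this
    simp only [T, h1] at hxy
    exact sub_left_injective hxy
  -- The derivative is a rank-one perturbation 1 - m e ⊗ ∇δ of the identity, with ∇δ(e) = 1. For m ≥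
  -- 2 its determinant has modulus m - 1 ≥ 1, so the change of variables costs no constant.
  have hdet : ∀ x, (T' x).det = 1 - m := by
    intro x
    have : (T' x : R3 →ₗ[ℝ] R3) = LinearMap.transvection (-(m • fderiv ℝ δ x : R3 →L[ℝ] ℝ) : R3 →ₗ[ℝ] ℝ) e := by
      ext1 z
      simp [T', LinearMap.transvection.apply, sub_eq_add_neg]
    rw [ContinuousLinearMap.det, this, LinearMap.transvection.det]
    simp [h.fderiv_apply]
    ring
  have := lintegral_image_eq_lintegral_abs_det_fderiv_mul volume hs hT hinj g
  calc ∫⁻ x in {x | 0 < δ x}, g (reflect δ e m x)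
      ≤ ∫⁻ x in {x | 0 < δ x}, ENNReal.ofReal |(T' x).det| * g (T x) := by
        refine setLIntegral_mono' hs fun x hx => ?_
        rw [reflect_of_nonneg (le_of_lt hx), hdet]
        have : 1 ≤ ENNReal.ofReal |1 - m| := by
          rw [ENNReal.one_le_ofReal, abs_sub_comm]
          exact (by linarith : 1 ≤ m - 1).trans (le_abs_self _)
        calc g (T x) = 1 * g (T x) := (one_mul _).symm
          _ ≤ _ := by gcongr
    _ = ∫⁻ x in T '' {x | 0 < δ x}, g x := this.symm
    _ ≤ _ := by
      refine lintegral_mono_set ?_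
      rintro _ ⟨x, hx, rfl⟩
      change δ (T x) < 0
      rw [hδT]
      have : 0 < δ x := hx
      nlinarith

end IsGraphFunction

theorem enorm_sq_eq {G : Type*} [NormedAddCommGroup G] (a : G) :
    ‖a‖ₑ ^ 2 = ENNReal.ofReal (‖a‖ ^ 2) := by
  rw [ENNReal.ofReal_pow (norm_nonneg _), ofReal_norm]

theorem enorm_sq_le_of_norm_le {G H : Type*} [NormedAddCommGroup G] [NormedAddCommGroup H]
    {a : G} {b : H} {c : ℝ} (h : ‖a‖ ≤ c * ‖b‖) :
    ‖a‖ₑ ^ 2 ≤ ENNReal.ofReal (c ^ 2) * ‖b‖ₑ ^ 2 := by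
  rw [enorm_sq_eq, enorm_sq_eq, ← ENNReal.ofReal_mul (by positivity), ← mul_pow]
  exact ENNReal.ofReal_le_ofReal (by gcongr)

theorem enorm_sq_le_of_norm_le_add {G H I : Type*} [NormedAddCommGroup G] [NormedAddCommGroup H]
    [NormedAddCommGroup I] {a : G} {b : H} {d : I} {c : ℝ} (h : ‖a‖ ≤ c * (‖b‖ + ‖d‖)) :
    ‖a‖ₑ ^ 2 ≤ ENNReal.ofReal (2 * c ^ 2) * (‖b‖ₑ ^ 2 + ‖d‖ₑ ^ 2) := by
  rw [enorm_sq_eq, enorm_sq_eq, enorm_sq_eq, ← ENNReal.ofReal_add (by positivity) (by positivity),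
    ← ENNReal.ofReal_mul (by positivity)]
  refine ENNReal.ofReal_le_ofReal ?_
  calc ‖a‖ ^ 2 ≤ (c * (‖b‖ + ‖d‖)) ^ 2 := by gcongr
    _ = c ^ 2 * (‖b‖ + ‖d‖) ^ 2 := by ring
    _ ≤ c ^ 2 * (2 * (‖b‖ ^ 2 + ‖d‖ ^ 2)) := by gcongr; nlinarith [sq_nonneg (‖b‖ - ‖d‖)]
    _ = _ := by ring

namespace IsGraphFunction

variable {δ : R3 → ℝ} {e : R3} {K : ℝ≥0}

theorem norm_pullback_le (m : ℝ) (V : R3 → C3) (x : R3) :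
    ‖pullback δ e m V x‖ ≤
      (1 + |m| * (3 * ‖e‖) * (3 * ‖fderiv ℝ δ x‖)) * ‖V (reflect δ e m x)‖ := by
  rw [pullback]
  refine (norm_sub_le _ _).trans ?_
  rw [norm_smul, norm_mul, Complex.norm_real, Real.norm_eq_abs]
  have h1 := norm_dotL_le e (V (reflect δ e m x))
  have h2 := norm_vecL_le (fderiv ℝ δ x)
  calc ‖V (reflect δ e m x)‖ + |m| * ‖dotL e (V (reflect δ e m x))‖ * ‖vecL (fderiv ℝ δ x)‖
      ≤ ‖V (reflect δ e m x)‖ + |m| * (3 * ‖e‖ * ‖V (reflect δ e m x)‖) *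
        (3 * ‖fderiv ℝ δ x‖) := by gcongr
    _ = _ := by ring

theorem norm_symL_grad_pullback_le (h : IsGraphFunction δ e K) (m : ℝ) {V : R3 → C3}
    (hV : ContDiff ℝ 1 V) {x : R3} (hx : 0 < δ x) (hd : DifferentiableAt ℝ (fderiv ℝ δ) x) :
    ‖symL (grad (pullback δ e m V) x)‖ ≤
      3 * (9 * (1 + |m| * ‖e‖ * ‖fderiv ℝ δ x‖) ^ 2 * ‖symL (grad V (reflect δ e m x))‖ +
        |m| * (3 * ‖e‖) * (3 * K) * ‖V (reflect δ e m x)‖) := by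
  refine norm_C33_le (by positivity) fun j k => ?_
  rw [h.symL_gradL_pullback m hV hx hd]
  refine (norm_sub_le _ _).trans (add_le_add ?_ ?_)
  · have hB : ∀ i j : Fin 3, ‖(((if i = j then 1 else 0) - m * e i *
        fderiv ℝ δ x (EuclideanSpace.single j 1) : ℝ) : ℂ)‖ ≤
          1 + |m| * ‖e‖ * ‖fderiv ℝ δ x‖ := by
      intro i j
      rw [Complex.norm_real]
      refine (norm_sub_le _ _).trans (add_le_add ?_ ?_)
      · split_ifs <;> simp
      · rw [norm_mul, norm_mul, Real.norm_eq_abs m]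
        gcongr
        · exact PiLp.norm_apply_le e i
        · simpa using (fderiv ℝ δ x).le_opNorm (EuclideanSpace.single j 1)
    calc _ ≤ ∑ _i : Fin 3, ∑ _l : Fin 3, (1 + |m| * ‖e‖ * ‖fderiv ℝ δ x‖) *
          (1 + |m| * ‖e‖ * ‖fderiv ℝ δ x‖) * ‖symL (grad V (reflect δ e m x))‖ := by
          refine (norm_sum_le _ _).trans (Finset.sum_le_sum fun i _ => ?_)
          refine (norm_sum_le _ _).trans (Finset.sum_le_sum fun l _ => ?_)
          rw [norm_mul, norm_mul]
          gcongr
          · exact hB i j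
          · exact hB l k
          · exact PiLp.norm_apply_le (symL (grad V (reflect δ e m x))) (i, l)
      _ = _ := by simp; ring
  · have hH : ∀ j k : Fin 3, ‖vecL (fderiv ℝ (fderiv ℝ δ) x (EuclideanSpace.single k 1)) j‖ ≤ 3 * K := by
      intro j k
      refine (PiLp.norm_apply_le _ j).trans ((norm_vecL_le _).trans ?_)
      gcongr
      have h1 := (fderiv ℝ (fderiv ℝ δ) x).le_opNorm (EuclideanSpace.single k 1)
      have h2 : ‖fderiv ℝ (fderiv ℝ δ) x‖ ≤ K := norm_fderiv_le_of_lipschitz ℝ h.lipschitz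
      simp only [PiLp.norm_single, norm_one, mul_one] at h1
      exact h1.trans h2
    rw [norm_div, norm_mul, norm_mul, Complex.norm_real, Real.norm_eq_abs]
    have h1 := norm_dotL_le e (V (reflect δ e m x))
    have h3 := (norm_add_le _ _).trans (add_le_add (hH j k) (hH k j))
    calc _ ≤ |m| * (3 * ‖e‖ * ‖V (reflect δ e m x)‖) * (3 * K + 3 * K) / ‖(2 : ℂ)‖ := by gcongr
      _ = _ := by norm_num; ring

/-- Bounds for the extension across the graph of fields supported in a fixed ball. -/
theorem exists_extend_bounds (h : IsGraphFunction δ e K) (x₀ : R3) (ρ : ℝ) :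
    ∃ (R : ℝ) (C : ℝ≥0∞), C ≠ ⊤ ∧ ∀ V : R3 → C3, ContDiff ℝ 1 V →
      tsupport V ⊆ Metric.closedBall x₀ ρ →
        (∃ K', LipschitzWith K' (extend δ e V)) ∧
        tsupport (extend δ e V) ⊆ Metric.closedBall x₀ R ∧
        ∫⁻ x, ‖extend δ e V x‖ₑ ^ 2 ≤ C * ∫⁻ x in {x | δ x < 0}, ‖V x‖ₑ ^ 2 ∧
        ∫⁻ x, ‖symL (grad (extend δ e V) x)‖ₑ ^ 2 ≤
          C * ((∫⁻ x in {x | δ x < 0}, ‖symL (grad V x)‖ₑ ^ 2) +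
            ∫⁻ x in {x | δ x < 0}, ‖V x‖ₑ ^ 2) := by
  obtain ⟨D, hD⟩ := (isCompact_closedBall x₀ ρ).exists_bound_of_continuousOn
    h.contDiff.continuous.continuousOn
  set R := ρ + 2 * ‖e‖ * |D| with hR
  have hρR : ρ ≤ R := by rw [hR]; have := abs_nonneg D; have := norm_nonneg e; nlinarith
  obtain ⟨L, hL⟩ := (isCompact_closedBall x₀ R).exists_bound_of_continuousOn
    (h.contDiff.continuous_fderiv (by simp)).continuousOn
  -- Since δ changes its value from δ(x) to (1 - m)δ(x) under the reflection, the bound |δ| ≤ |D|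
  -- near the support gives (m - 1)δ(x) ≤ |D|, hence a displacement m δ(x) ≤ 2|D| because m ≤ 2(m -
  -- 1).
  have hreg : ∀ m : ℝ, 2 ≤ m → ∀ x, reflect δ e m x ∈ Metric.closedBall x₀ ρ →
      x ∈ Metric.closedBall x₀ R := by
    intro m hm x hx
    rcases le_or_gt (δ x) 0 with hx0 | hx0
    · rw [reflect_of_nonpos hx0] at hx
      exact Metric.closedBall_subset_closedBall hρR hx
    · have hb := hD _ hx
      rw [reflect_of_nonneg hx0.le, h.apply_sub_smul, Real.norm_eq_abs] at hb
      have h1 : (m - 1) * δ x ≤ |D| := by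
        have := (le_abs_self _).trans ((abs_sub_comm _ _).le.trans (hb.trans (le_abs_self D)))
        linarith
      have h2 : m * δ x ≤ 2 * |D| := by nlinarith
      rw [reflect_of_nonneg hx0.le, Metric.mem_closedBall, dist_eq_norm] at hx
      rw [Metric.mem_closedBall, dist_eq_norm, hR]
      calc ‖x - x₀‖ = ‖(x - (m * δ x) • e - x₀) + (m * δ x) • e‖ := by congr 1; abel
        _ ≤ ‖x - (m * δ x) • e - x₀‖ + ‖(m * δ x) • e‖ := norm_add_le _ _
        _ ≤ ρ + (2 * |D|) * ‖e‖ := by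
          rw [norm_smul, Real.norm_of_nonneg (by positivity)]
          gcongr
        _ = _ := by ring
  -- a common constant for the pointwise bounds
  set M : ℝ := 1 + 3 * (3 * ‖e‖) * (3 * |L|) + 27 * (1 + 3 * ‖e‖ * |L|) ^ 2 +
    3 * (3 * (3 * ‖e‖) * (3 * K)) with hM
  have hM0 : 0 ≤ M := by positivity
  have hLx : ∀ {m : ℝ} (_ : 2 ≤ m) {V : R3 → C3} (_ : tsupport V ⊆ Metric.closedBall x₀ ρ) {x},
      ‖fderiv ℝ δ x‖ ≤ |L| ∨ reflect δ e m x ∉ tsupport V := by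
    intro m hm V hV x
    by_cases hx : reflect δ e m x ∈ tsupport V
    · exact Or.inl ((hL x (hreg m hm x (hV hx))).trans (le_abs_self L))
    · exact Or.inr hx
  have p1 : ∀ m : ℝ, 2 ≤ m → m ≤ 3 → ∀ V : R3 → C3, tsupport V ⊆ Metric.closedBall x₀ ρ →
      ∀ x, ‖pullback δ e m V x‖ ≤ M * ‖V (reflect δ e m x)‖ := by
    intro m hm hm3 V hV x
    refine (norm_pullback_le m V x).trans ?_
    rcases hLx hm hV (x := x) with h1 | h1
    · rw [abs_of_nonneg (by linarith : 0 ≤ m)]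
      gcongr
      calc _ ≤ 1 + 3 * (3 * ‖e‖) * (3 * |L|) := by gcongr
        _ ≤ M := by
          rw [hM, add_assoc (1 + 3 * (3 * ‖e‖) * (3 * |L|))]
          exact le_add_of_nonneg_right (by positivity)
    · rw [image_eq_zero_of_notMem_tsupport h1]; simp
  have p2 : ∀ m : ℝ, 2 ≤ m → m ≤ 3 → ∀ V : R3 → C3, ContDiff ℝ 1 V →
      tsupport V ⊆ Metric.closedBall x₀ ρ → ∀ x, 0 < δ x → DifferentiableAt ℝ (fderiv ℝ δ) x →
        ‖symL (grad (pullback δ e m V) x)‖ ≤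
          M * (‖symL (grad V (reflect δ e m x))‖ + ‖V (reflect δ e m x)‖) := by
    intro m hm hm3 V hV hsV x hx hd
    refine (h.norm_symL_grad_pullback_le m hV hx hd).trans ?_
    rcases hLx hm hsV (x := x) with h1 | h1
    · rw [abs_of_nonneg (by linarith : 0 ≤ m), mul_add, mul_add]
      refine add_le_add ?_ ?_
      · rw [← mul_assoc]
        gcongr
        calc 3 * (9 * (1 + m * ‖e‖ * ‖fderiv ℝ δ x‖) ^ 2)
            ≤ 3 * (9 * (1 + 3 * ‖e‖ * |L|) ^ 2) := by gcongr
          _ = 27 * (1 + 3 * ‖e‖ * |L|) ^ 2 := by ring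
          _ ≤ M := by
            rw [hM, add_right_comm]
            exact le_add_of_nonneg_left (by positivity)
      · rw [← mul_assoc]
        gcongr
        calc 3 * (m * (3 * ‖e‖) * (3 * K)) ≤ 3 * (3 * (3 * ‖e‖) * (3 * K)) := by gcongr
          _ ≤ M := le_add_of_nonneg_left (by positivity)
    · rw [image_eq_zero_of_notMem_tsupport h1, grad_eq_zero_of_notMem_tsupport h1]; simp
  have hsplit : ∀ f : R3 → ℝ≥0∞,
      ∫⁻ x, f x ≤ (∫⁻ x in {x | δ x < 0}, f x) + ∫⁻ x in {x | 0 < δ x}, f x := by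
    intro f
    have : (volume : Measure R3) = volume.restrict ({x | δ x < 0} ∪ {x | 0 < δ x}) := by
      symm
      refine Measure.restrict_eq_self_of_ae_mem ?_
      filter_upwards [h.ae_ne_zero] with x hx using lt_or_gt_of_ne hx
    conv_lhs => rw [this]
    exact lintegral_union_le f _ _
  have hms : MeasurableSet {x | δ x < 0} :=
    (isOpen_lt h.contDiff.continuous continuous_const).measurableSet
  have hms' : MeasurableSet {x | 0 < δ x} :=
    (isOpen_lt continuous_const h.contDiff.continuous).measurableSet
  -- The summand 1 is the contribution of the side δ < 0, where the extension is V itself. The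
  -- factor 5 = 3 + 2 is the sum of the moduli of the weights.
  refine ⟨R, 1 + ENNReal.ofReal (2 * (5 * M) ^ 2) * (ENNReal.ofReal (2 * (1 : ℝ) ^ 2) + 
    ENNReal.ofReal (2 * (1 : ℝ) ^ 2)), by finiteness, fun V hV hsV => ?_⟩
  have hll : LocallyLipschitz (extend δ e V) := by
    have hc : ContDiff ℝ 1 fun p : C3 × C3 => (3 : ℂ) • p.1 - (2 : ℂ) • p.2 := by fun_prop
    exact LocallyLipschitz.contDiff_comp₂ hc (h.locallyLipschitz_pullback 2 hV)
      (h.locallyLipschitz_pullback 3 hV)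
  have hsupp : tsupport (extend δ e V) ⊆ Metric.closedBall x₀ R := by
    refine closure_minimal (fun x hx => ?_) Metric.isClosed_closedBall
    by_contra hxR
    have h0 : ∀ m : ℝ, 2 ≤ m → m ≤ 3 → pullback δ e m V x = 0 := fun m hm hm3 => by
      have h1 := p1 m hm hm3 V hsV x
      have h2 : reflect δ e m x ∉ tsupport V := fun h3 => hxR (hreg m hm x (hsV h3))
      rw [image_eq_zero_of_notMem_tsupport h2, norm_zero, mul_zero] at h1
      exact norm_le_zero_iff.1 h1
    exact hx (by rw [extend_apply, h0 2 le_rfl (by norm_num), h0 3 (by norm_num) le_rfl]; simp)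
  have hcomb : ∀ a b : ℝ, 0 ≤ a → 0 ≤ b → 3 * (M * a) + 2 * (M * b) ≤ (5 * M) * (a + b) := by
    intro a b ha hb
    nlinarith [mul_nonneg hM0 ha, mul_nonneg hM0 hb]
  have hcr : ∀ m, Measurable (reflect δ e m) := fun m => by
    have := h.contDiff.continuous
    exact Continuous.measurable (by unfold reflect; fun_prop)
  have hmV : ∀ m, Measurable fun x => ‖V (reflect δ e m x)‖ₑ ^ 2 := fun m =>
    (hV.continuous.measurable.comp (hcr m)).enorm.pow_const 2
  refine ⟨exists_lipschitzWith_of_hasCompactSupport hll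
    ((isCompact_closedBall x₀ R).of_isClosed_subset (isClosed_tsupport _) hsupp), hsupp, ?_, ?_⟩
  · refine (hsplit _).trans ?_
    have a1 : ∫⁻ x in {x | δ x < 0}, ‖extend δ e V x‖ₑ ^ 2 = ∫⁻ x in {x | δ x < 0}, ‖V x‖ₑ ^ 2 :=
      setLIntegral_congr_fun hms fun x hx => by
        rw [extend_of_nonpos (le_of_lt hx)]
    have a2 : ∫⁻ x in {x | 0 < δ x}, ‖extend δ e V x‖ₑ ^ 2 ≤
        ENNReal.ofReal (2 * (5 * M) ^ 2) * ((∫⁻ x in {x | δ x < 0}, ‖V x‖ₑ ^ 2) +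
          ∫⁻ x in {x | δ x < 0}, ‖V x‖ₑ ^ 2) := by
      calc _ ≤ ∫⁻ x in {x | 0 < δ x}, ENNReal.ofReal (2 * (5 * M) ^ 2) *
            (‖V (reflect δ e 2 x)‖ₑ ^ 2 + ‖V (reflect δ e 3 x)‖ₑ ^ 2) := by
            refine lintegral_mono fun x => enorm_sq_le_of_norm_le_add ?_
            rw [extend_apply]
            refine (norm_sub_le _ _).trans ?_
            rw [norm_smul, norm_smul]
            refine le_trans ?_ (hcomb _ _ (norm_nonneg _) (norm_nonneg _))
            have q1 := p1 2 le_rfl (by norm_num) V hsV x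
            have q2 := p1 3 (by norm_num) le_rfl V hsV x
            norm_num
            gcongr
        _ ≤ _ := by
            rw [lintegral_const_mul' _ _ ENNReal.ofReal_ne_top]
            gcongr
            rw [lintegral_add_left (hmV 2)]
            exact add_le_add (h.lintegral_reflect_le (m := 2) le_rfl fun x => ‖V x‖ₑ ^ 2)
              (h.lintegral_reflect_le (m := 3) (by norm_num) fun x => ‖V x‖ₑ ^ 2)
    rw [a1, add_mul, one_mul]
    refine add_le_add le_rfl (a2.trans ?_)
    rw [mul_assoc, add_mul]
    have : (1 : ℝ≥0∞) ≤ ENNReal.ofReal (2 * (1 : ℝ) ^ 2) := by norm_num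
    gcongr <;> exact le_mul_of_one_le_left' this
  · refine (hsplit _).trans ?_
    have a1 : ∫⁻ x in {x | δ x < 0}, ‖symL (grad (extend δ e V) x)‖ₑ ^ 2 =
        ∫⁻ x in {x | δ x < 0}, ‖symL (grad V x)‖ₑ ^ 2 :=
      setLIntegral_congr_fun hms fun x hx => by
        have : extend δ e V =ᶠ[𝓝 x] V := by
          filter_upwards [h.contDiff.continuous.continuousAt.eventually (gt_mem_nhds hx)] with y hy
          exact extend_of_nonpos (le_of_lt hy)
        rw [grad_eq_gradL, this.fderiv_eq, ← grad_eq_gradL]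
    set I := (∫⁻ x in {x | δ x < 0}, ‖symL (grad V x)‖ₑ ^ 2) +
      ∫⁻ x in {x | δ x < 0}, ‖V x‖ₑ ^ 2 with hI
    have hmS : Measurable fun x => ‖symL (grad V x)‖ₑ ^ 2 :=
      (symL.continuous.measurable.comp (measurable_grad V)).enorm.pow_const 2
    have hR : ∀ m, 2 ≤ m → ∫⁻ x in {x | 0 < δ x}, ENNReal.ofReal (2 * (1 : ℝ) ^ 2) *
        (‖symL (grad V (reflect δ e m x))‖ₑ ^ 2 + ‖V (reflect δ e m x)‖ₑ ^ 2) ≤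
          ENNReal.ofReal (2 * (1 : ℝ) ^ 2) * I := by
      intro m hm
      rw [lintegral_const_mul' _ _ ENNReal.ofReal_ne_top, hI, ← lintegral_add_left hmS]
      exact mul_le_mul' le_rfl
        (h.lintegral_reflect_le hm fun x => ‖symL (grad V x)‖ₑ ^ 2 + ‖V x‖ₑ ^ 2)
    have a2 : ∫⁻ x in {x | 0 < δ x}, ‖symL (grad (extend δ e V) x)‖ₑ ^ 2 ≤
        ENNReal.ofReal (2 * (5 * M) ^ 2) * (ENNReal.ofReal (2 * (1 : ℝ) ^ 2) * I +
          ENNReal.ofReal (2 * (1 : ℝ) ^ 2) * I) := by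
      calc _ ≤ ∫⁻ x in {x | 0 < δ x}, ENNReal.ofReal (2 * (5 * M) ^ 2) *
            (ENNReal.ofReal (2 * (1 : ℝ) ^ 2) * (‖symL (grad V (reflect δ e 2 x))‖ₑ ^ 2 +
              ‖V (reflect δ e 2 x)‖ₑ ^ 2) + ENNReal.ofReal (2 * (1 : ℝ) ^ 2) *
              (‖symL (grad V (reflect δ e 3 x))‖ₑ ^ 2 + ‖V (reflect δ e 3 x)‖ₑ ^ 2)) := by
            refine lintegral_mono_ae ?_
            filter_upwards [ae_restrict_mem hms',
              ae_restrict_of_ae (h.lipschitz.ae_differentiableAt (μ := volume))] with x hx hd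
            obtain ⟨F, hF, -⟩ := h.hasFDerivAt_pullback 2 hV hx hd
            obtain ⟨G, hG, -⟩ := h.hasFDerivAt_pullback 3 hV hx hd
            have q1 := p2 2 le_rfl (by norm_num) V hV hsV x hx hd
            have q2 := p2 3 (by norm_num) le_rfl V hV hsV x hx hd
            have hE : HasFDerivAt (extend δ e V) ((3 : ℝ) • F - (2 : ℝ) • G) x := by
              have := (hF.const_smul (3 : ℝ)).sub (hG.const_smul (2 : ℝ))
              refine this.congr_of_eventuallyEq (Eventually.of_forall fun y => ?_)
              rw [extend_apply]
              simp only [Pi.sub_apply, Pi.smul_apply, ← Complex.coe_smul]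
              norm_num
            have hg : grad (extend δ e V) x =
                (3 : ℂ) • grad (pullback δ e 2 V) x - (2 : ℂ) • grad (pullback δ e 3 V) x := by
              rw [grad_eq_gradL, grad_eq_gradL, grad_eq_gradL, hE.fderiv, hF.fderiv, hG.fderiv,
                map_sub, map_smul, map_smul, ← Complex.coe_smul, ← Complex.coe_smul]
              norm_num
            set s1 := ‖symL (grad V (reflect δ e 2 x))‖ + ‖V (reflect δ e 2 x)‖ with hs1
            set s2 := ‖symL (grad V (reflect δ e 3 x))‖ + ‖V (reflect δ e 3 x)‖ with hs2
            have n1 : 0 ≤ s1 := by positivity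
            have n2 : 0 ≤ s2 := by positivity
            have hle : ‖symL (grad (extend δ e V) x)‖ ≤ (5 * M) * (‖s1‖ + ‖s2‖) := by
              rw [hg, map_sub, map_smul, map_smul]
              refine (norm_sub_le _ _).trans ?_
              rw [norm_smul, norm_smul, Real.norm_of_nonneg n1, Real.norm_of_nonneg n2]
              refine le_trans ?_ (hcomb _ _ n1 n2)
              norm_num
              gcongr
            refine (enorm_sq_le_of_norm_le_add hle).trans ?_
            gcongr
            · exact enorm_sq_le_of_norm_le_add (by rw [Real.norm_of_nonneg n1, one_mul])
            · exact enorm_sq_le_of_norm_le_add (by rw [Real.norm_of_nonneg n2, one_mul])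
        _ ≤ _ := by
            rw [lintegral_const_mul' _ _ ENNReal.ofReal_ne_top, lintegral_add_left]
            · gcongr
              · exact hR 2 le_rfl
              · exact hR 3 (by norm_num)
            · exact ((hmS.comp (hcr 2)).add (hmV 2)).const_mul _
    rw [a1, add_mul, one_mul]
    refine add_le_add le_self_add (a2.trans (le_of_eq ?_))
    ring

end IsGraphFunction

/-! ### The periodicity cell -/

/-- The lattice of periods. -/
def lattice : Set R3 := {k | ∀ i, ∃ n : ℤ, k i = n}

/-- The periodic continuation of the stiff component. -/
def perStiff (S : Set R3) : Set R3 := {x | ∀ k ∈ lattice, x + k ∉ S}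

theorem zero_mem_lattice : (0 : R3) ∈ lattice := fun _ => ⟨0, by simp⟩

theorem neg_mem_lattice {k : R3} (hk : k ∈ lattice) : -k ∈ lattice := fun i => by
  obtain ⟨n, hn⟩ := hk i
  exact ⟨-n, by simp [hn]⟩

theorem add_mem_lattice {k l : R3} (hk : k ∈ lattice) (hl : l ∈ lattice) : k + l ∈ lattice :=
  fun i => by
    obtain ⟨n, hn⟩ := hk i
    obtain ⟨m, hm⟩ := hl i
    exact ⟨n + m, by simp [hn, hm]⟩

theorem isClosed_perStiff {S : Set R3} (hS : IsOpen S) : IsClosed (perStiff S) := by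
  have : perStiff S = ⋂ k ∈ lattice, (fun x => x + k) ⁻¹' Sᶜ := by
    ext x; simp [perStiff]
  rw [this]
  exact isClosed_biInter fun k _ => hS.isClosed_compl.preimage (by fun_prop)

theorem add_mem_perStiff {S : Set R3} {x k : R3} (hx : x ∈ perStiff S) (hk : k ∈ lattice) :
    x + k ∈ perStiff S := fun l hl => by
  rw [add_assoc]; exact hx _ (add_mem_lattice hk hl)

theorem eq_zero_of_mem_cell {x k : R3} (hx : x ∈ cell) (hk : k ∈ lattice) (hxk : x + k ∈ cell) :
    k = 0 := by
  ext i
  obtain ⟨n, hn⟩ := hk i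
  have h1 := hx i
  have h2 := hxk i
  simp only [mem_Ico, PiLp.add_apply, hn] at h1 h2
  have h3 : n < 1 := by exact_mod_cast (by linarith : (n : ℝ) < 1)
  have h4 : -1 < n := by exact_mod_cast (by linarith : (-1 : ℝ) < n)
  have : n = 0 := by omega
  simp [hn, this]

theorem measurableSet_cell : MeasurableSet cell := by
  have : cell = ⋂ i, (fun x : R3 => x i) ⁻¹' Ico 0 1 := by ext x; simp [cell]
  rw [this]
  exact MeasurableSet.iInter fun i => measurableSet_Ico.preimage
    (Continuous.measurable (by fun_prop))

theorem norm_le_of_mem_Icc {x : R3} (hx : ∀ i, x i ∈ Icc (0 : ℝ) 1) : ‖x‖ ≤ 2 := by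
  rw [← sq_le_sq₀ (norm_nonneg _) (by norm_num), EuclideanSpace.norm_sq_eq]
  calc ∑ i, ‖x i‖ ^ 2 ≤ ∑ _i : Fin 3, (1 : ℝ) := by
        refine Finset.sum_le_sum fun i _ => ?_
        obtain ⟨h1, h2⟩ := hx i
        rw [Real.norm_of_nonneg h1]
        nlinarith
    _ ≤ _ := by norm_num

theorem closure_cell_subset : closure cell ⊆ {x | ∀ i, x i ∈ Icc (0 : ℝ) 1} := by
  refine closure_minimal (fun x hx i => Ico_subset_Icc_self (hx i)) ?_
  have : {x : R3 | ∀ i, x i ∈ Icc (0 : ℝ) 1} = ⋂ i, (fun x : R3 => x i) ⁻¹' Icc 0 1 := by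
    ext x; simp
  rw [this]
  exact isClosed_iInter fun i => isClosed_Icc.preimage (by fun_prop)

theorem isCompact_closure_cell : IsCompact (closure cell) :=
  (isCompact_closedBall (0 : R3) 2).of_isClosed_subset isClosed_closure fun _ hx => by
    simpa using norm_le_of_mem_Icc (closure_cell_subset hx)

theorem exists_add_lattice_mem_cell (x : R3) : ∃ k ∈ lattice, x + k ∈ cell := by
  refine ⟨WithLp.toLp 2 fun i => -(⌊x i⌋ : ℝ), fun i => ⟨-⌊x i⌋, by simp⟩, fun i => ?_⟩
  simp only [PiLp.add_apply, mem_Ico, ← sub_eq_add_neg]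
  exact ⟨Int.fract_nonneg _, Int.fract_lt_one _⟩

namespace IsInclusion

variable {S : Set R3}

theorem subset_cell (hS : IsInclusion S) : S ⊆ cell :=
  subset_closure.trans (hS.closure_subset.trans interior_subset)

theorem stiff_eq (hS : IsInclusion S) : stiff S = cell ∩ perStiff S := by
  ext x
  constructor
  · rintro ⟨h1, h2⟩
    refine ⟨h1, fun k hk h3 => ?_⟩
    rw [eq_zero_of_mem_cell h1 hk (hS.subset_cell h3), add_zero] at h3
    exact h2 h3
  · rintro ⟨h1, h2⟩
    refine ⟨h1, fun h3 => h2 0 zero_mem_lattice (by simpa using h3)⟩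

theorem measurableSet_stiff (hS : IsInclusion S) : MeasurableSet (stiff S) :=
  measurableSet_cell.diff hS.isOpen.measurableSet

theorem measurableSet_perStiff (hS : IsInclusion S) : MeasurableSet (perStiff S) :=
  (isClosed_perStiff hS.isOpen).measurableSet

theorem volume_stiff_lt_top (_hS : IsInclusion S) : volume (stiff S) < ⊤ :=
  (measure_mono (fun x hx => by
    simpa using norm_le_of_mem_Icc fun i => Ico_subset_Icc_self (hx.1 i)
    : stiff S ⊆ Metric.closedBall (0 : R3) 2)).trans_lt measure_closedBall_lt_top

/-- The inclusion keeps a positive distance from the boundary of the cell. -/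
theorem exists_margin (hS : IsInclusion S) : ∃ ε > 0, ∀ x ∈ closure S, ∀ i, x i ∈ Ico ε (1 - ε) := by
  have hc : IsCompact (closure S) := isCompact_closure_cell.of_isClosed_subset isClosed_closure
    (hS.closure_subset.trans (interior_subset.trans subset_closure))
  obtain ⟨ε, hε, h⟩ := hc.exists_cthickening_subset_open isOpen_interior hS.closure_subset
  refine ⟨ε, hε, fun x hx i => ?_⟩
  have h1 : ∀ s : ℝ, |s| ≤ ε → x + EuclideanSpace.single i s ∈ cell := fun s hs =>
    interior_subset (h (Metric.mem_cthickening_of_dist_le _ x ε _ hx (by simpa using hs)))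
  have h2 := h1 (-ε) (by simp [abs_of_pos hε]) i
  have h3 := h1 ε (by simp [abs_of_pos hε]) i
  simp at h2 h3
  constructor <;> linarith

/-- Points of the cell away from the closure of the inclusion are interior to the periodic stiff
component. -/
theorem exists_ball_subset_perStiff (hS : IsInclusion S) {x : R3} (hx : x ∈ closure cell)
    (hxS : x ∉ closure S) : ∃ ρ > 0, Metric.ball x ρ ⊆ perStiff S := by
  obtain ⟨ε, hε, hm⟩ := hS.exists_margin
  obtain ⟨ρ, hρ, hb⟩ := Metric.isOpen_iff.1 isClosed_closure.isOpen_compl x hxS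
  refine ⟨min ρ ε, lt_min hρ hε, fun y hy k hk hyk => ?_⟩
  have hk0 : k ≠ 0 := by
    rintro rfl
    rw [add_zero] at hyk
    exact hb (Metric.ball_subset_ball (min_le_left _ _) hy) (subset_closure hyk)
  -- A translate by k ≠ 0 cannot come close either: the inclusion keeps the distance ε from the
  -- faces of the cell, so every coordinate of k would lie strictly between -1 and 1.
  refine hk0 ?_
  ext i
  obtain ⟨n, hn⟩ := hk i
  have h1 := closure_cell_subset hx i
  have h2 := hm _ (subset_closure hyk) i
  have h3 : |y i - x i| < ε := by
    refine lt_of_le_of_lt ?_ (hy.trans_le (min_le_right _ _))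
    rw [dist_eq_norm]
    exact PiLp.norm_apply_le (y - x) i
  obtain ⟨h4, h5⟩ := abs_lt.1 h3
  simp only [mem_Icc, mem_Ico, PiLp.add_apply, hn] at h1 h2
  have h6 : n < 1 := by exact_mod_cast (by linarith : (n : ℝ) < 1)
  have h7 : -1 < n := by exact_mod_cast (by linarith : (-1 : ℝ) < n)
  have : n = 0 := by omega
  simp [hn, this]

theorem mem_perStiff_of_mem_cell (hS : IsInclusion S) {x : R3} (hx : x ∈ cell) :
    x ∈ perStiff S ↔ x ∉ S := by
  constructor
  · intro h h2; exact h 0 zero_mem_lattice (by simpa using h2)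
  · intro h
    have : x ∈ stiff S := ⟨hx, h⟩
    rw [hS.stiff_eq] at this
    exact this.2

/-- Integrals of periodic functions over bounded sets are controlled by the integral over the
cell. -/
theorem exists_lintegral_le (hS : IsInclusion S) (R : ℝ) : ∃ C : ℝ≥0∞, C ≠ ⊤ ∧
    ∀ f : R3 → ℝ≥0∞, Measurable f → (∀ x, ∀ k ∈ lattice, f (x + k) = f x) →
      ∫⁻ x in perStiff S ∩ Metric.closedBall 0 R, f x ≤ C * ∫⁻ x in stiff S, f x := by
  let B : ℤ := ⌈R⌉ + 1
  let ι := Fin 3 → Finset.Icc (-B) B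
  let κ : ι → R3 := fun k => WithLp.toLp 2 fun i => ((k i : ℤ) : ℝ)
  have hκ : ∀ k, κ k ∈ lattice := fun k i => ⟨k i, rfl⟩
  refine ⟨Fintype.card ι, by simp, fun f hf hper => ?_⟩
  -- A bounded part of the periodic stiff component is covered by finitely many lattice translates
  -- of `stiff S`, and a periodic function has the same integral over each of them.
  have hcov : perStiff S ∩ Metric.closedBall 0 R ⊆ ⋃ k, (fun x => x + -κ k) ⁻¹' stiff S := by
    rintro x ⟨hx, hxR⟩
    have hxR : ‖x‖ ≤ R := by simpa using hxR
    have hB : ∀ i, ⌊x i⌋ ∈ Finset.Icc (-B) B := by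
      intro i
      have h1 : |x i| ≤ R := (PiLp.norm_apply_le x i).trans hxR
      obtain ⟨h2, h3⟩ := abs_le.1 h1
      have h7 := Int.le_ceil R
      rw [Finset.mem_Icc]
      constructor
      · rw [Int.le_floor]; push_cast [B]; linarith
      · rw [← Int.lt_add_one_iff, Int.floor_lt]; push_cast [B]; linarith
    refine mem_iUnion.2 ⟨fun i => ⟨⌊x i⌋, hB i⟩, ?_⟩
    rw [mem_preimage, hS.stiff_eq]
    refine ⟨fun i => ?_, add_mem_perStiff hx (neg_mem_lattice (hκ _))⟩
    exact ⟨Int.fract_nonneg (x i), Int.fract_lt_one (x i)⟩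
  calc _ ≤ ∫⁻ x in ⋃ k, (fun x => x + -κ k) ⁻¹' stiff S, f x := lintegral_mono_set hcov
    _ ≤ ∑' k, ∫⁻ x in (fun x => x + -κ k) ⁻¹' stiff S, f x := lintegral_iUnion_le _ _
    _ = ∑' _k : ι, ∫⁻ x in stiff S, f x := by
      congr 1; ext k
      rw [← (measurePreserving_add_right (volume : Measure R3) (-κ k)).setLIntegral_comp_preimage
        hS.measurableSet_stiff hf]
      exact lintegral_congr fun x => (hper x _ (neg_mem_lattice (hκ k))).symm
    _ = _ := by simp [tsum_fintype]

end IsInclusion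

/-! ### Charts at the interface -/

/-- The projection onto the first two coordinates. -/
def projL : R3 →L[ℝ] EuclideanSpace ℝ (Fin 2) :=
  LinearMap.toContinuousLinearMap
    { toFun := fun x => !₂[x 0, x 1]
      map_add' := fun _ _ => by ext i; fin_cases i <;> simp
      map_smul' := fun _ _ => by ext i; fin_cases i <;> simp }

theorem projL_apply (x : R3) : projL x = !₂[x 0, x 1] := rfl

/-- The function whose zero set is the graph of `γ` in the coordinates given by `Φ`. -/
def graphFun (Φ : R3 ≃ᵃⁱ[ℝ] R3) (γ : EuclideanSpace ℝ (Fin 2) → ℝ) (x : R3) : ℝ :=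
  Φ x 2 - γ (projL (Φ x))

/-- The vertical direction in the coordinates given by `Φ`. -/
def vertical (Φ : R3 ≃ᵃⁱ[ℝ] R3) : R3 := Φ.linearIsometryEquiv.symm (EuclideanSpace.single 2 1)

theorem apply_add_smul_vertical (Φ : R3 ≃ᵃⁱ[ℝ] R3) (x : R3) (s : ℝ) :
    Φ (x + s • vertical Φ) = Φ x + EuclideanSpace.single 2 s := by
  have := Φ.map_vadd x (s • vertical Φ)
  rw [vadd_eq_add, vadd_eq_add, add_comm] at this
  rw [this, add_comm, map_smul, vertical, LinearIsometryEquiv.apply_symm_apply]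
  congr 1
  ext i; simp

/-- The derivative of `graphFun Φ γ` depends affinely on that of γ, evaluated after a Lipschitz map,
so it is again Lipschitz. A vertical shift changes only the third coordinate in the chart. -/
theorem isGraphFunction_graphFun (Φ : R3 ≃ᵃⁱ[ℝ] R3) {γ : EuclideanSpace ℝ (Fin 2) → ℝ} {K : ℝ≥0}
    (hγ : ContDiff ℝ 1 γ) (hK : LipschitzWith K (fderiv ℝ γ)) :
    ∃ K', IsGraphFunction (graphFun Φ γ) (vertical Φ) K' := by
  let Q : R3 →L[ℝ] R3 := Φ.linearIsometryEquiv.toContinuousLinearEquiv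
  have hΦ : ∀ x, Φ x = Q x + Φ 0 := fun x => by
    have := Φ.map_vadd 0 x
    have h2 : Φ x = Φ.linearIsometryEquiv x + Φ 0 := by simpa [vadd_eq_add] using this
    exact h2
  have hd : ∀ x, HasFDerivAt Φ Q x := fun x =>
    ((Q.hasFDerivAt (x := x)).add_const (Φ 0)).congr_of_eventuallyEq
      (Eventually.of_forall hΦ)
  have hΦc : ContDiff ℝ 1 Φ := by
    have : ContDiff ℝ 1 fun x => Q x + Φ 0 := by fun_prop
    rwa [show (Φ : R3 → R3) = fun x => Q x + Φ 0 from funext hΦ]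
  let c : R3 →L[ℝ] ℝ := EuclideanSpace.proj 2
  have hδ : ∀ x, HasFDerivAt (graphFun Φ γ)
      (c.comp Q - (fderiv ℝ γ (projL (Φ x))).comp (projL.comp Q)) x := fun x =>
    (c.hasFDerivAt.comp x (hd x)).sub
      (((hγ.differentiable (by simp) _).hasFDerivAt).comp x (projL.hasFDerivAt.comp x (hd x)))
  have hpre : ∀ x, fderiv ℝ (graphFun Φ γ) x = c.comp Q -
      (ContinuousLinearMap.precomp ℝ (projL.comp Q)) (fderiv ℝ γ (projL (Φ x))) := fun x =>
    (hδ x).fderiv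
  have h1 : LipschitzWith _ fun x => fderiv ℝ γ (projL (Φ x)) :=
    hK.comp (projL.lipschitz.comp Φ.isometry.lipschitz)
  have h2 := (LipschitzWith.const (c.comp Q)).sub
    ((ContinuousLinearMap.precomp ℝ (projL.comp Q)).lipschitz.comp h1)
  have h3 : ContDiff ℝ 1 fun x => γ (projL (Φ x)) := hγ.comp (projL.contDiff.comp hΦc)
  have h4 : ContDiff ℝ 1 fun x => Φ x 2 := c.contDiff.comp hΦc
  obtain ⟨K', h5⟩ : ∃ K', LipschitzWith K' (fderiv ℝ (graphFun Φ γ)) := by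
    rw [show fderiv ℝ (graphFun Φ γ) = _ from funext hpre]
    exact ⟨_, h2⟩
  refine ⟨K', ⟨h4.sub h3, h5, ?_⟩⟩
  · intro x s
    rw [graphFun, graphFun, apply_add_smul_vertical]
    have : projL (Φ x + EuclideanSpace.single 2 s) = projL (Φ x) := by
      ext i; fin_cases i <;> simp [projL_apply]
    rw [this]
    simp
    ring

/-- The boundary of the inclusion is locally a graph, with both sides described. -/
theorem IsInclusion.exists_chart {S : Set R3} (hS : IsInclusion S) {x₀ : R3}
    (hx₀ : x₀ ∈ frontier S) :
    ∃ (Φ : R3 ≃ᵃⁱ[ℝ] R3) (γ : EuclideanSpace ℝ (Fin 2) → ℝ) (K : ℝ≥0) (ρ : ℝ), ContDiff ℝ 1 γ ∧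
      IsGraphFunction (graphFun Φ γ) (vertical Φ) K ∧ 0 < ρ ∧
      Metric.closedBall x₀ ρ ⊆ interior cell ∧
      ∀ x ∈ Metric.closedBall x₀ ρ, (x ∈ S ↔ 0 < graphFun Φ γ x) := by
  obtain ⟨Φ, γ, K, hγ, hK, U, hU, hUS⟩ := hS.boundary x₀ hx₀
  obtain ⟨K', hK'⟩ := isGraphFunction_graphFun Φ hγ hK
  have hc : interior cell ∈ 𝓝 x₀ :=
    isOpen_interior.mem_nhds (hS.closure_subset (frontier_subset_closure hx₀))
  obtain ⟨ρ, hρ, hb⟩ := Metric.nhds_basis_closedBall.mem_iff.1 (inter_mem hU hc)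
  refine ⟨Φ, γ, K', ρ, hγ, hK', hρ, fun x hx => (hb hx).2, fun x hx => ?_⟩
  rw [hUS x (hb hx).1, graphFun, sub_pos, projL_apply]

/-! ### Localised extension operators -/

/-- The strain of a function. -/
def fstrain (χ : R3) (φ : R3 → C3) (x : R3) : C33 :=
  symL (grad φ x + Complex.I • outerL χ (φ x))

theorem grad_smul_apply {θ : R3 → ℝ} {φ : R3 → C3} {x : R3} (hθ : DifferentiableAt ℝ θ x)
    (hφ : DifferentiableAt ℝ φ x) : grad (fun y => θ y • φ y) x =
      (θ x) • grad φ x + gradL ((fderiv ℝ θ x).smulRight (φ x)) := by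
  have h : HasFDerivAt (fun y => θ y • φ y) (θ x • fderiv ℝ φ x + (fderiv ℝ θ x).smulRight (φ x)) x :=
    hθ.hasFDerivAt.smul hφ.hasFDerivAt
  rw [grad_eq_gradL, h.fderiv, map_add, map_smul, ← grad_eq_gradL]

theorem norm_symL_grad_smul_le {θ : R3 → ℝ} {φ : R3 → C3} {x : R3} (hθ : DifferentiableAt ℝ θ x)
    (hφ : DifferentiableAt ℝ φ x) {L : ℝ} (h1 : |θ x| ≤ 1) (h2 : ‖fderiv ℝ θ x‖ ≤ L) :
    ‖symL (grad (fun y => θ y • φ y) x)‖ ≤ (1 + 3 * L) * (‖symL (grad φ x)‖ + ‖φ x‖) := by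
  have hL : 0 ≤ L := (norm_nonneg _).trans h2
  rw [grad_smul_apply hθ hφ, map_add]
  have e1 : ‖symL (θ x • grad φ x)‖ ≤ ‖symL (grad φ x)‖ := by
    rw [← Complex.coe_smul, map_smul, norm_smul, Complex.norm_real, Real.norm_eq_abs]
    exact mul_le_of_le_one_left (norm_nonneg _) h1
  have e2 : ‖symL (gradL ((fderiv ℝ θ x).smulRight (φ x)))‖ ≤ 3 * (L * ‖φ x‖) := by
    refine (norm_symL_le _).trans ((norm_gradL_le _).trans ?_)
    rw [ContinuousLinearMap.norm_smulRight_apply]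
    gcongr
  refine (norm_add_le _ _).trans ((add_le_add e1 e2).trans ?_)
  nlinarith [norm_nonneg (symL (grad φ x)), norm_nonneg (φ x),
    mul_nonneg hL (norm_nonneg (symL (grad φ x)))]

/-- A local extension operator: it maps (restrictions to the stiff component of) smooth fields to
compactly supported Lipschitz fields on the whole space, coinciding with them near `x₀`. -/
theorem IsInclusion.exists_local_extension {S : Set R3} (hS : IsInclusion S) {x₀ : R3}
    (hx₀ : x₀ ∈ closure cell) (hx₀S : x₀ ∉ S) :
    ∃ (r R : ℝ) (C : ℝ≥0∞) (E : (R3 → C3) →ₗ[ℂ] (R3 → C3)), 0 < r ∧ C ≠ ⊤ ∧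
      ∀ φ : R3 → C3, ContDiff ℝ 1 φ →
        (∃ K, LipschitzWith K (E φ)) ∧ tsupport (E φ) ⊆ Metric.closedBall 0 R ∧
        (∀ᵐ x, x ∈ Metric.ball x₀ r ∩ perStiff S → E φ =ᶠ[𝓝 x] φ) ∧
        ∫⁻ x, ‖E φ x‖ₑ ^ 2 ≤ C * ∫⁻ x in perStiff S ∩ Metric.closedBall 0 R, ‖φ x‖ₑ ^ 2 ∧
        ∫⁻ x, ‖symL (grad (E φ) x)‖ₑ ^ 2 ≤
          C * ((∫⁻ x in perStiff S ∩ Metric.closedBall 0 R, ‖symL (grad φ x)‖ₑ ^ 2) +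
            ∫⁻ x in perStiff S ∩ Metric.closedBall 0 R, ‖φ x‖ₑ ^ 2) := by
  -- the data common to both cases: a cut-off function
  have hcut : ∀ ρ > 0, ∃ (θ : ContDiffBump x₀) (L : ℝ), 0 ≤ L ∧ θ.rOut = ρ ∧ 0 < θ.rIn ∧
      (∀ x, ‖fderiv ℝ θ x‖ ≤ L) ∧ ∀ φ : R3 → C3, ContDiff ℝ 1 φ →
        ContDiff ℝ 1 (fun x => θ x • φ x) ∧
        tsupport (fun x => θ x • φ x) ⊆ Metric.closedBall x₀ ρ ∧
        (∀ x, ‖θ x • φ x‖ ≤ ‖φ x‖) ∧ (∀ x, ‖symL (grad (fun y => θ y • φ y) x)‖ ≤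
          (1 + 3 * L) * (‖symL (grad φ x)‖ + ‖φ x‖)) := by
    intro ρ hρ
    let θ : ContDiffBump x₀ := ⟨ρ / 2, ρ, by positivity, by linarith⟩
    have hθ : ContDiff ℝ 1 θ := θ.contDiff
    obtain ⟨L, hL⟩ := (θ.hasCompactSupport.fderiv ℝ).exists_bound_of_continuous
      (hθ.continuous_fderiv (by simp))
    refine ⟨θ, L, (norm_nonneg _).trans (hL x₀), rfl, θ.rIn_pos, hL, fun φ hφ =>
      ⟨hθ.smul hφ, ?_, fun x => ?_, fun x => ?_⟩⟩
    · refine (tsupport_smul_subset_left _ _).trans (le_of_eq ?_)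
      exact θ.tsupport_eq
    · rw [norm_smul, Real.norm_of_nonneg θ.nonneg]
      exact mul_le_of_le_one_left (norm_nonneg _) θ.le_one
    · exact norm_symL_grad_smul_le (hθ.differentiable (by simp) x) (hφ.differentiable (by simp) x)
        (by rw [abs_of_nonneg θ.nonneg]; exact θ.le_one) (hL x)
  have hsmul : ∀ θ : R3 → ℝ, ∃ F : (R3 → C3) →ₗ[ℂ] (R3 → C3), ∀ φ, F φ = fun x => θ x • φ x :=
    fun θ => ⟨{ toFun := fun φ x => θ x • φ x
                map_add' := fun φ ψ => by ext1 x; simp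
                map_smul' := fun c φ => by ext1 x; exact smul_comm (θ x) c (φ x) }, fun φ => rfl⟩
  have hnear : ∀ (θ : ContDiffBump x₀) (φ : R3 → C3), ∀ x ∈ Metric.ball x₀ θ.rIn,
      (fun x => θ x • φ x) =ᶠ[𝓝 x] φ := by
    intro θ φ x hx
    filter_upwards [Metric.isOpen_ball.mem_nhds hx] with y hy
    rw [θ.one_of_mem_closedBall (Metric.ball_subset_closedBall hy), one_smul]
  have hset : ∀ {G : Type} [NormedAddCommGroup G] (f : R3 → G) (D : Set R3) (R : ℝ),
      MeasurableSet D → (∀ x ∈ D, f x ≠ 0 → x ∈ perStiff S ∩ Metric.closedBall 0 R) →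
      ∀ g : R3 → ℝ≥0∞, (∀ x, ‖f x‖ₑ ^ 2 ≤ g x) →
        ∫⁻ x in D, ‖f x‖ₑ ^ 2 ≤ ∫⁻ x in perStiff S ∩ Metric.closedBall 0 R, g x := by
    intro G _ f D R hD h g hg
    calc ∫⁻ x in D, ‖f x‖ₑ ^ 2
        ≤ ∫⁻ x in D, (perStiff S ∩ Metric.closedBall 0 R).indicator g x := by
          refine setLIntegral_mono' hD fun x hx => ?_
          by_cases h0 : f x = 0
          · simp [h0]
          · rw [indicator_of_mem (h x hx h0)]; exact hg x
      _ ≤ ∫⁻ x, (perStiff S ∩ Metric.closedBall 0 R).indicator g x := setLIntegral_le_lintegral _ _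
      _ = _ := lintegral_indicator
          (hS.measurableSet_perStiff.inter Metric.isClosed_closedBall.measurableSet) _
  have hsymm : ∀ φ : R3 → C3, Measurable fun x => ‖symL (grad φ x)‖ₑ ^ 2 := fun φ =>
    (symL.continuous.measurable.comp (measurable_grad φ)).enorm.pow_const 2
  have hball : ∀ ρ, Metric.closedBall x₀ ρ ⊆ Metric.closedBall 0 (ρ + ‖x₀‖) := fun ρ =>
    Metric.closedBall_subset_closedBall' (by rw [dist_zero_right])
  -- At a point of the interface the field is cut off and then extended by reflection. At any other
  -- point a whole ball lies in the periodic stiff component, and the cut-off alone is an extension.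
  by_cases hcl : x₀ ∈ closure S
  · have hfr : x₀ ∈ frontier S := ⟨hcl, by rwa [hS.isOpen.interior_eq]⟩
    obtain ⟨Φ, γ, K, ρ, -, hδ, hρ, hcell, hSδ⟩ := hS.exists_chart hfr
    set δ := graphFun Φ γ with hδdef
    obtain ⟨R, C, hC, hext⟩ := hδ.exists_extend_bounds x₀ ρ
    obtain ⟨θ, L, hL0, hθρ, hin, hL, hθ⟩ := hcut ρ hρ
    obtain ⟨F, hF⟩ := hsmul θ
    have hD : MeasurableSet {x | δ x < 0} :=
      (isOpen_lt hδ.contDiff.continuous continuous_const).measurableSet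
    set R' := max R ρ + ‖x₀‖ with hR'
    have hmem : ∀ x ∈ {x | δ x < 0}, x ∈ Metric.closedBall x₀ ρ →
        x ∈ perStiff S ∩ Metric.closedBall 0 R' := fun x hx hxρ =>
      ⟨(hS.mem_perStiff_of_mem_cell (interior_subset (hcell hxρ))).2 fun h =>
        lt_asymm ((hSδ x hxρ).1 h) hx,
        hball _ (Metric.closedBall_subset_closedBall (le_max_right _ _) hxρ)⟩
    refine ⟨θ.rIn, R', C * (1 + ENNReal.ofReal (2 * (1 + 3 * L) ^ 2)),
      (extend δ (vertical Φ)).comp F, hin, by finiteness, fun φ hφ => ?_⟩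
    obtain ⟨h1, h2, h3, h4⟩ := hθ φ hφ
    obtain ⟨k1, k2, k3, k4⟩ := hext _ h1 h2
    simp only [LinearMap.comp_apply, hF]
    have i1 := hset (fun x => θ x • φ x) {x | δ x < 0} R' hD
      (fun x hx h0 => hmem x hx (h2 (subset_tsupport _ h0))) (fun x => ‖φ x‖ₑ ^ 2)
      (fun x => by simpa using enorm_sq_le_of_norm_le (c := 1) (by simpa using h3 x))
    have i2 := hset (fun x => symL (grad (fun y => θ y • φ y) x)) {x | δ x < 0} R' hD
      (fun x hx h0 => hmem x hx (h2 (by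
        by_contra hn
        exact h0 (by rw [grad_eq_zero_of_notMem_tsupport hn, map_zero]))))
      (fun x => ENNReal.ofReal (2 * (1 + 3 * L) ^ 2) * (‖symL (grad φ x)‖ₑ ^ 2 + ‖φ x‖ₑ ^ 2))
      (fun x => enorm_sq_le_of_norm_le_add (h4 x))
    rw [lintegral_const_mul' _ _ ENNReal.ofReal_ne_top, lintegral_add_left (hsymm φ)] at i2
    refine ⟨k1, k2.trans ((hball _).trans (Metric.closedBall_subset_closedBall (by
      rw [hR']; gcongr; exact le_max_left _ _))), ?_, ?_, ?_⟩
    -- On the graph itself the extension need not coincide with φ in a full neighbourhood. The graph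
    -- is a null set, so equality of gradients almost everywhere is not affected.
    · filter_upwards [hδ.ae_ne_zero] with x hx0 hx
      have hxρ : x ∈ Metric.closedBall x₀ ρ := by
        rw [← hθρ]
        exact Metric.ball_subset_closedBall (Metric.ball_subset_ball θ.rIn_lt_rOut.le hx.1)
      have hneg : δ x < 0 := by
        refine lt_of_le_of_ne (not_lt.1 fun hpos => ?_) hx0
        exact (hS.mem_perStiff_of_mem_cell (interior_subset (hcell hxρ))).1 hx.2
          ((hSδ x hxρ).2 hpos)
      filter_upwards [hδ.contDiff.continuous.continuousAt.eventually (gt_mem_nhds hneg),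
        hnear θ φ x hx.1] with y hy1 hy2
      rw [IsGraphFunction.extend_of_nonpos (le_of_lt hy1)]
      exact hy2
    · refine k3.trans ((mul_le_mul' le_rfl i1).trans ?_)
      gcongr
      exact le_mul_of_one_le_right' le_self_add
    · refine k4.trans ((mul_le_mul' le_rfl (add_le_add i2 i1)).trans ?_)
      rw [mul_assoc, add_mul, one_mul, add_comm]
      gcongr
      exact le_add_self
  · obtain ⟨ρ', hρ', hsub⟩ := hS.exists_ball_subset_perStiff hx₀ hcl
    obtain ⟨θ, L, hL0, hθρ, hin, hL, hθ⟩ := hcut (ρ' / 2) (by positivity)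
    obtain ⟨F, hF⟩ := hsmul θ
    have hmem : ∀ x ∈ Metric.closedBall x₀ (ρ' / 2),
        x ∈ perStiff S ∩ Metric.closedBall 0 (ρ' / 2 + ‖x₀‖) := fun x hx =>
      ⟨hsub (Metric.closedBall_subset_ball (by linarith) hx), hball _ hx⟩
    refine ⟨θ.rIn, ρ' / 2 + ‖x₀‖, 1 + ENNReal.ofReal (2 * (1 + 3 * L) ^ 2), F, hin, by finiteness,
      fun φ hφ => ?_⟩
    obtain ⟨h1, h2, h3, h4⟩ := hθ φ hφ
    simp only [hF]
    have i1 := hset (fun x => θ x • φ x) univ (ρ' / 2 + ‖x₀‖) MeasurableSet.univ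
      (fun x _ h0 => hmem x (h2 (subset_tsupport _ h0))) (fun x => ‖φ x‖ₑ ^ 2)
      (fun x => by simpa using enorm_sq_le_of_norm_le (c := 1) (by simpa using h3 x))
    have i2 := hset (fun x => symL (grad (fun y => θ y • φ y) x)) univ (ρ' / 2 + ‖x₀‖)
      MeasurableSet.univ
      (fun x _ h0 => hmem x (h2 (by
        by_contra hn
        exact h0 (by rw [grad_eq_zero_of_notMem_tsupport hn, map_zero]))))
      (fun x => ENNReal.ofReal (2 * (1 + 3 * L) ^ 2) * (‖symL (grad φ x)‖ₑ ^ 2 + ‖φ x‖ₑ ^ 2))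
      (fun x => enorm_sq_le_of_norm_le_add (h4 x))
    rw [lintegral_const_mul' _ _ ENNReal.ofReal_ne_top, lintegral_add_left (hsymm φ)] at i2
    rw [Measure.restrict_univ] at i1 i2
    refine ⟨exists_lipschitzWith_of_hasCompactSupport
      (ContDiff.locallyLipschitz (𝕂 := ℝ) h1)
      ((isCompact_closedBall _ _).of_isClosed_subset (isClosed_tsupport _) h2),
      h2.trans (hball _), Eventually.of_forall fun x hx => hnear θ φ x hx.1, ?_, ?_⟩
    · exact i1.trans (le_mul_of_one_le_left' le_self_add)
    · exact i2.trans (mul_le_mul' le_add_self le_rfl)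

/-! ### Smooth periodic fields -/

/-- The lattice is generated by the standard basis. -/
theorem mem_of_mem_lattice (G : AddSubgroup R3) (hG : ∀ i, EuclideanSpace.single i (1 : ℝ) ∈ G)
    {k : R3} (hk : k ∈ lattice) : k ∈ G := by
  choose n hn using hk
  have h : k = ∑ i, n i • EuclideanSpace.single i (1 : ℝ) := by
    ext j
    simp [hn, Fin.sum_univ_three, PiLp.single_apply]
    fin_cases j <;> simp
  rw [h]
  exact sum_mem fun i _ => zsmul_mem (hG i) _

namespace IsSmoothPeriodic

variable {φ ψ : R3 → C3}

theorem apply_add_lattice (hφ : IsSmoothPeriodic φ) {k : R3} (hk : k ∈ lattice) (x : R3) :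
    φ (x + k) = φ x :=
  mem_of_mem_lattice
    { carrier := {k | ∀ x, φ (x + k) = φ x}
      zero_mem' := fun x => by simp
      add_mem' := fun {a b} ha hb x => by rw [← add_assoc, hb, ha]
      neg_mem' := fun {a} ha x => by rw [← ha (x + -a)]; simp } (fun i x => hφ.2 x i) hk x

theorem grad_add_lattice (hφ : IsSmoothPeriodic φ) {k : R3} (hk : k ∈ lattice) (x : R3) :
    grad φ (x + k) = grad φ x := by
  rw [grad_eq_gradL, grad_eq_gradL, ← fderiv_comp_add_right k]
  congr 2
  ext1 y
  exact hφ.apply_add_lattice hk y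

theorem contDiff_one (hφ : IsSmoothPeriodic φ) : ContDiff ℝ 1 φ := hφ.1.of_le (by simp)

theorem differentiable (hφ : IsSmoothPeriodic φ) : Differentiable ℝ φ :=
  hφ.1.differentiable (by simp)

theorem continuous_grad (hφ : IsSmoothPeriodic φ) : Continuous (grad φ) := by
  have h : Continuous (fderiv ℝ φ) := hφ.1.continuous_fderiv (by simp)
  exact (gradL.toContinuousLinearMap.continuous).comp h

theorem add (hφ : IsSmoothPeriodic φ) (hψ : IsSmoothPeriodic ψ) :
    IsSmoothPeriodic fun x => φ x + ψ x :=
  ⟨hφ.1.add hψ.1, fun y i => by simp only [hφ.2, hψ.2]⟩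

theorem sub (hφ : IsSmoothPeriodic φ) (hψ : IsSmoothPeriodic ψ) :
    IsSmoothPeriodic fun x => φ x - ψ x :=
  ⟨hφ.1.sub hψ.1, fun y i => by simp only [hφ.2, hψ.2]⟩

theorem const_smul (hφ : IsSmoothPeriodic φ) (c : ℂ) : IsSmoothPeriodic fun x => c • φ x :=
  ⟨hφ.1.const_smul c, fun y i => by simp only [hφ.2]⟩

theorem grad_add (hφ : IsSmoothPeriodic φ) (hψ : IsSmoothPeriodic ψ) (x : R3) :
    grad (fun y => φ y + ψ y) x = grad φ x + grad ψ x := by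
  simp only [grad_eq_gradL]
  rw [fderiv_fun_add (hφ.differentiable x) (hψ.differentiable x), map_add]

theorem grad_sub (hφ : IsSmoothPeriodic φ) (hψ : IsSmoothPeriodic ψ) (x : R3) :
    grad (fun y => φ y - ψ y) x = grad φ x - grad ψ x := by
  simp only [grad_eq_gradL]
  rw [fderiv_fun_sub (hφ.differentiable x) (hψ.differentiable x), map_sub]

theorem grad_const_smul (hφ : IsSmoothPeriodic φ) (c : ℂ) (x : R3) :
    grad (fun y => c • φ y) x = c • grad φ x := by
  ext ij
  simp only [grad_eq_gradL]
  rw [fderiv_fun_const_smul (hφ.differentiable x)]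
  rfl

end IsSmoothPeriodic

theorem isSmoothPeriodic_const (c : C3) : IsSmoothPeriodic fun _ => c :=
  ⟨contDiff_const, fun _ _ => rfl⟩

theorem grad_const (c : C3) (x : R3) : grad (fun _ => c) x = 0 := by
  rw [grad_eq_gradL, fderiv_fun_const]; exact map_zero _

theorem norm_fstrain_le (χ : R3) (φ : R3 → C3) (x : R3) :
    ‖symL (grad φ x)‖ ≤ ‖fstrain χ φ x‖ + ‖χ‖ * ‖φ x‖ := by
  have h : symL (grad φ x) = fstrain χ φ x - symL (Complex.I • outerL χ (φ x)) := by
    rw [fstrain, map_add]; abel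
  rw [h]
  refine (norm_sub_le _ _).trans (add_le_add le_rfl ((norm_symL_le _).trans ?_))
  rw [norm_smul, Complex.norm_I, one_mul, norm_outerL, mul_comm]

/-! ### A Korn inequality with finitely many linear functionals -/

namespace IsInclusion

variable {S : Set R3}

theorem lintegral_enorm_sq_lt_top (hS : IsInclusion S) {G : Type*} [NormedAddCommGroup G]
    {f : R3 → G} (hf : Continuous f) : ∫⁻ x in stiff S, ‖f x‖ₑ ^ 2 < ⊤ := by
  obtain ⟨M, hM⟩ := isCompact_closure_cell.exists_bound_of_continuousOn hf.continuousOn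
  calc ∫⁻ x in stiff S, ‖f x‖ₑ ^ 2 ≤ ∫⁻ _x in stiff S, ENNReal.ofReal M ^ 2 := by
        refine setLIntegral_mono' hS.measurableSet_stiff fun x hx => ?_
        gcongr
        rw [← ofReal_norm]
        exact ENNReal.ofReal_le_ofReal (hM x (subset_closure hx.1))
    _ < ⊤ := by
        rw [setLIntegral_const]
        exact ENNReal.mul_lt_top (by finiteness) hS.volume_stiff_lt_top

/-- Finitely many balls with local extension operators cover the compact set `closure cell \ S`. The
fields `E m φ` live in the whole space, where Korn's inequality and the averages are available. They
coincide with φ on the stiff part of their balls, so together they control its norms, and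
periodicity reduces the integrals over bounded sets to the cell. -/
theorem exists_extensions (hS : IsInclusion S) :
    ∃ (ι : Type) (_ : Fintype ι) (R : ℝ) (C : ℝ≥0∞) (E : ι → (R3 → C3) →ₗ[ℂ] (R3 → C3)),
      C ≠ ⊤ ∧ ∀ φ, IsSmoothPeriodic φ →
        (∀ m, (∃ K, LipschitzWith K (E m φ)) ∧ tsupport (E m φ) ⊆ Metric.closedBall 0 R ∧
          ∫⁻ x, ‖E m φ x‖ₑ ^ 2 ≤ C * ∫⁻ x in stiff S, ‖φ x‖ₑ ^ 2 ∧
          ∫⁻ x, ‖symL (grad (E m φ) x)‖ₑ ^ 2 ≤ C * ((∫⁻ x in stiff S, ‖symL (grad φ x)‖ₑ ^ 2) +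
            ∫⁻ x in stiff S, ‖φ x‖ₑ ^ 2)) ∧
        ∫⁻ x in stiff S, ‖φ x‖ₑ ^ 2 ≤ ∑ m, ∫⁻ x, ‖E m φ x‖ₑ ^ 2 ∧
        ∫⁻ x in stiff S, ‖grad φ x‖ₑ ^ 2 ≤ ∑ m, ∫⁻ x, ‖grad (E m φ) x‖ₑ ^ 2 := by
  have hK : IsCompact (closure cell \ S) := isCompact_closure_cell.diff hS.isOpen
  choose r R C E hr hC hE using fun x : ↥(closure cell \ S) =>
    hS.exists_local_extension x.2.1 x.2.2
  choose D hD hDle using hS.exists_lintegral_le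
  obtain ⟨t, ht⟩ := hK.elim_nhds_subcover' (fun x hx => Metric.ball x (r ⟨x, hx⟩))
    fun x hx => Metric.ball_mem_nhds _ (hr _)
  have hcov : ∀ (g : R3 → ℝ≥0∞) (f : t → R3 → ℝ≥0∞),
      (∀ m : t, ∀ᵐ x, x ∈ Metric.ball (m : R3) (r m) ∩ perStiff S → g x = f m x) →
      ∫⁻ x in stiff S, g x ≤ ∑ m, ∫⁻ x, f m x := by
    intro g f h
    calc ∫⁻ x in stiff S, g x
        ≤ ∫⁻ x in ⋃ m : t, Metric.ball (m : R3) (r m) ∩ perStiff S, g x := by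
          refine lintegral_mono_set fun x hx => ?_
          obtain ⟨m, hm, hxm⟩ := mem_iUnion₂.1 (ht ⟨subset_closure hx.1, hx.2⟩)
          exact mem_iUnion.2 ⟨⟨m, hm⟩, hxm, (hS.mem_perStiff_of_mem_cell hx.1).2 hx.2⟩
      _ ≤ ∑' m : t, ∫⁻ x in Metric.ball (m : R3) (r m) ∩ perStiff S, g x := lintegral_iUnion_le _ _
      _ ≤ ∑' m : t, ∫⁻ x, f m x := by
          refine ENNReal.tsum_le_tsum fun m => ?_
          rw [setLIntegral_congr_fun_ae
            (Metric.isOpen_ball.measurableSet.inter hS.measurableSet_perStiff) (h m)]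
          exact setLIntegral_le_lintegral _ _
      _ = _ := tsum_fintype _
  refine ⟨t, inferInstance, ∑ m : t, |R m|, ∑ m : t, C m * D (R m), fun m => E m,
    ENNReal.sum_ne_top.2 fun m _ => ENNReal.mul_ne_top (hC _) (hD _), fun φ hφ =>
    ⟨fun m => ?_, ?_, ?_⟩⟩
  · obtain ⟨h1, h2, -, h4, h5⟩ := hE m φ hφ.contDiff_one
    have hle : C m * D (R m) ≤ ∑ m : t, C m * D (R m) :=
      Finset.single_le_sum (f := fun m : t => C m * D (R m)) (fun _ _ => zero_le) (Finset.mem_univ m)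
    have i1 := hDle (R m) (fun x => ‖φ x‖ₑ ^ 2) (hφ.1.continuous.measurable.enorm.pow_const 2)
      fun x k hk => by rw [hφ.apply_add_lattice hk]
    have i2 := hDle (R m) (fun x => ‖symL (grad φ x)‖ₑ ^ 2)
      ((symL.continuous.comp hφ.continuous_grad).measurable.enorm.pow_const 2)
      fun x k hk => by rw [hφ.grad_add_lattice hk]
    refine ⟨h1, h2.trans (Metric.closedBall_subset_closedBall ?_), ?_, ?_⟩
    · exact (le_abs_self _).trans (Finset.single_le_sum (f := fun m : t => |R m|)
        (fun _ _ => abs_nonneg _) (Finset.mem_univ m))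
    · refine h4.trans ((mul_le_mul' le_rfl i1).trans ?_)
      rw [← mul_assoc]
      exact mul_le_mul' hle le_rfl
    · refine h5.trans ((mul_le_mul' le_rfl (add_le_add i2 i1)).trans ?_)
      rw [← mul_add, ← mul_assoc]
      exact mul_le_mul' hle le_rfl
  · refine hcov (fun x => ‖φ x‖ₑ ^ 2) (fun m x => ‖E m φ x‖ₑ ^ 2) fun m => ?_
    filter_upwards [(hE m φ hφ.contDiff_one).2.2.1] with x hx h
    rw [(hx h).eq_of_nhds]
  · refine hcov (fun x => ‖grad φ x‖ₑ ^ 2) (fun m x => ‖grad (E m φ) x‖ₑ ^ 2) fun m => ?_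
    filter_upwards [(hE m φ hφ.contDiff_one).2.2.1] with x hx h
    rw [grad_eq_gradL, grad_eq_gradL, (hx h).fderiv_eq]

/-- Korn's inequality on the stiff component, modulo finitely many bounded linear functionals,
uniformly in bounded quasimomenta. -/
theorem exists_korn (hS : IsInclusion S) (B : ℝ) :
    ∃ (ι : Type) (_ : Fintype ι) (P : ι → (R3 → C3) → C3) (C : ℝ≥0∞), C ≠ ⊤ ∧
      (∀ i φ ψ, IsSmoothPeriodic φ → IsSmoothPeriodic ψ →
        P i (fun x => φ x - ψ x) = P i φ - P i ψ) ∧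
      (∀ i φ, IsSmoothPeriodic φ → ‖P i φ‖ₑ ^ 2 ≤ C * ∫⁻ x in stiff S, ‖φ x‖ₑ ^ 2) ∧
      ∀ χ : R3, ‖χ‖ ≤ B → ∀ φ, IsSmoothPeriodic φ →
        (∫⁻ x in stiff S, ‖φ x‖ₑ ^ 2) + ∫⁻ x in stiff S, ‖grad φ x‖ₑ ^ 2 ≤
          C * ((∫⁻ x in stiff S, ‖fstrain χ φ x‖ₑ ^ 2) + ∑ i, ‖P i φ‖ₑ ^ 2) := by
  obtain ⟨ι, _, R, C, E, hC, hE⟩ := hS.exists_extensions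
  -- the constant in the bound of the gradients
  set D : ℝ≥0∞ := Fintype.card ι * (2 * C) with hDdef
  have hD : D ≠ ⊤ := by rw [hDdef]; finiteness
  set b : ℝ≥0∞ := ENNReal.ofReal (2 * (|B| + 1) ^ 2) with hb
  -- This value gives ε D (b + 1) ≤ 1/2, which allows the L² norm of φ on the right-hand side to be
  -- absorbed in `hA2`.
  set ε : ℝ≥0∞ := (2 * (D * (b + 1) + 1))⁻¹ with hε
  have hε0 : ε ≠ 0 := by rw [hε]; exact ENNReal.inv_ne_zero.2 (by finiteness)
  have hεt : ε ≠ ⊤ := by rw [hε]; exact ENNReal.inv_ne_top.2 (by simp)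
  have hεD : ε * (D * (b + 1)) ≤ 2⁻¹ := by
    rw [hε, ENNReal.mul_inv (by simp) (by simp), mul_assoc]
    refine mul_le_of_le_one_right' ?_
    rw [mul_comm, ← div_eq_mul_inv]
    exact ENNReal.div_le_of_le_mul (by rw [one_mul]; exact le_self_add)
  obtain ⟨κ, _, Q, hQ, C', hC', hav⟩ := exists_finite_averages R hε0
  set V : ℝ≥0∞ := ∑ k, volume (Q k) with hV
  have hVt : V ≠ ⊤ := ENNReal.sum_ne_top.2 fun k _ => (hQ k).2.ne
  have hint : ∀ m k φ, IsSmoothPeriodic φ → IntegrableOn (E m φ) (Q k) := by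
    intro m k φ hφ
    obtain ⟨⟨K, hK⟩, h2, -⟩ := (hE φ hφ).1 m
    exact (hK.continuous.integrable_of_hasCompactSupport
      ((isCompact_closedBall _ _).of_isClosed_subset (isClosed_tsupport _) h2)).integrableOn
  -- The functionals are the integrals of the extended fields `E m φ` over the cubes `Q k`. They are
  -- linear in φ and bounded by its L² norm on the stiff component.
  refine ⟨ι × κ, inferInstance, fun mk φ => ∫ x in Q mk.2, E mk.1 φ x,
    V * C + (2 * C' + 4) * (1 + D * b + D), by finiteness, ?_, ?_, ?_⟩
  · rintro ⟨m, k⟩ φ ψ hφ hψ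
    have : E m (fun x => φ x - ψ x) = E m φ - E m ψ := (E m).map_sub φ ψ
    simp only [this, Pi.sub_apply]
    exact integral_sub (hint m k φ hφ) (hint m k ψ hψ)
  · rintro ⟨m, k⟩ φ hφ
    have hmeas : AEMeasurable (fun x => ‖E m φ x‖ₑ) (volume.restrict (Q k)) :=
      (hint m k φ hφ).aestronglyMeasurable.enorm
    calc ‖∫ x in Q k, E m φ x‖ₑ ^ 2 ≤ (∫⁻ x in Q k, ‖E m φ x‖ₑ) ^ 2 := by
          gcongr; exact enorm_integral_le_lintegral_enorm _
      _ ≤ volume (Q k) * ∫⁻ x in Q k, ‖E m φ x‖ₑ ^ 2 := by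
          simpa using sq_lintegral_le hmeas
      _ ≤ V * (C * ∫⁻ x in stiff S, ‖φ x‖ₑ ^ 2) := by
          refine mul_le_mul' ?_ ((setLIntegral_le_lintegral _ _).trans ((hE φ hφ).1 m).2.2.1)
          exact Finset.single_le_sum (f := fun k => volume (Q k)) (fun _ _ => zero_le)
            (Finset.mem_univ k)
      _ ≤ _ := by
          rw [← mul_assoc]
          exact mul_le_mul' le_self_add le_rfl
  · intro χ hχ φ hφ
    obtain ⟨h1, h2, h3⟩ := hE φ hφ
    set a := ∫⁻ x in stiff S, ‖φ x‖ₑ ^ 2 with ha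
    set g := ∫⁻ x in stiff S, ‖grad φ x‖ₑ ^ 2
    set s₀ := ∫⁻ x in stiff S, ‖symL (grad φ x)‖ₑ ^ 2
    set s := ∫⁻ x in stiff S, ‖fstrain χ φ x‖ₑ ^ 2
    set p := ∑ i : ι × κ, ‖∫ x in Q i.2, E i.1 φ x‖ₑ ^ 2 with hp
    have hat : a < ⊤ := hS.lintegral_enorm_sq_lt_top hφ.1.continuous
    have hs₀ : s₀ ≤ b * (s + a) := by
      rw [ha, ← lintegral_add_right _ (hφ.1.continuous.measurable.enorm.pow_const 2),
        ← lintegral_const_mul' _ _ (by finiteness)]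
      refine lintegral_mono fun x => enorm_sq_le_of_norm_le_add
        ((norm_fstrain_le χ φ x).trans ?_)
      have h4 : ‖χ‖ ≤ |B| := hχ.trans (le_abs_self B)
      nlinarith [norm_nonneg (φ x), norm_nonneg (fstrain χ φ x), abs_nonneg B,
        mul_nonneg (abs_nonneg B) (norm_nonneg (fstrain χ φ x))]
    have hG : ∑ m, ∫⁻ x, ‖grad (E m φ) x‖ₑ ^ 2 ≤ D * (s₀ + a) := by
      calc _ ≤ ∑ _m : ι, 2 * (C * (s₀ + a)) := by
            refine Finset.sum_le_sum fun m _ => ?_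
            obtain ⟨⟨K, hK⟩, k2, -, k4⟩ := h1 m
            exact (lintegral_grad_sq_le hK ((isCompact_closedBall _ _).of_isClosed_subset
              (isClosed_tsupport _) k2)).trans (mul_le_mul' le_rfl k4)
        _ = _ := by simp [hDdef]; ring
    have hsa : s₀ + a ≤ b * s + (b + 1) * a := by
      calc s₀ + a ≤ b * (s + a) + a := by gcongr
        _ = _ := by ring
    have hA : a ≤ C' * p + ε * (D * (s₀ + a)) := by
      calc a ≤ ∑ m, ∫⁻ x, ‖E m φ x‖ₑ ^ 2 := h2
        _ ≤ ∑ m, (C' * ∑ k, ‖∫ x in Q k, E m φ x‖ₑ ^ 2 + ε * ∫⁻ x, ‖grad (E m φ) x‖ₑ ^ 2) :=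
            Finset.sum_le_sum fun m _ => hav _ (h1 m).1 (h1 m).2.1
        _ = C' * p + ε * ∑ m, ∫⁻ x, ‖grad (E m φ) x‖ₑ ^ 2 := by
            rw [Finset.sum_add_distrib, ← Finset.mul_sum, ← Finset.mul_sum, hp,
              Fintype.sum_prod_type]
        _ ≤ _ := by gcongr
    have hA2 : a ≤ 2 * (C' * p + s) := by
      have h5 : ε * (D * (s₀ + a)) ≤ s + 2⁻¹ * a := by
        calc ε * (D * (s₀ + a)) ≤ ε * (D * (b * s + (b + 1) * a)) := by gcongr
          _ = ε * (D * b) * s + ε * (D * (b + 1)) * a := by ring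
          _ ≤ 1 * s + 2⁻¹ * a := by
            refine add_le_add (mul_le_mul' ?_ le_rfl) (mul_le_mul' hεD le_rfl)
            calc ε * (D * b) ≤ ε * (D * (b + 1)) := by gcongr; exact le_self_add
              _ ≤ 2⁻¹ := hεD
              _ ≤ 1 := by simp
          _ = _ := by rw [one_mul]
      have h6 : 2⁻¹ * a + 2⁻¹ * a ≤ C' * p + s + 2⁻¹ * a := by
        rw [← add_mul, ENNReal.inv_two_add_inv_two, one_mul, add_assoc]
        exact hA.trans (by gcongr)
      -- Half of a can be cancelled because a is finite.
      have h7 : 2⁻¹ * a ≤ C' * p + s :=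
        (ENNReal.add_le_add_iff_right (ENNReal.mul_ne_top (by simp) hat.ne)).1 h6
      calc a = 2 * (2⁻¹ * a) := by
            rw [← mul_assoc, ENNReal.mul_inv_cancel (by simp) (by simp), one_mul]
        _ ≤ _ := by gcongr
    calc a + g ≤ a + D * (b * s + (b + 1) * a) := by
          gcongr; exact h3.trans (hG.trans (by gcongr))
      _ = D * b * s + (1 + D * b + D) * a := by ring
      _ ≤ D * b * s + (1 + D * b + D) * (2 * (C' * p + s)) := by gcongr
      _ ≤ (1 + D * b + D) * (2 * s) + (1 + D * b + D) * (2 * (C' * p + s)) := by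
          gcongr
          · calc D * b ≤ 1 + D * b := le_add_self
              _ ≤ _ := le_self_add
          · rw [two_mul]; exact le_self_add
      _ = (1 + D * b + D) * (2 * C' * p + 4 * s) := by ring
      _ ≤ (1 + D * b + D) * ((2 * C' + 4) * (s + p)) := by
          gcongr
          rw [mul_add, add_comm]
          gcongr
          · exact le_add_self
          · exact le_self_add
      _ = (2 * C' + 4) * (1 + D * b + D) * (s + p) := by ring
      _ ≤ _ := by gcongr; exact le_add_self

end IsInclusion

section

open scoped Convolution

/-! ### Functions with vanishing weak gradient -/

section WeakGradient

variable {F : Type*} [NormedAddCommGroup F] [NormedSpace ℝ F] [CompleteSpace F]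

/-- A function with vanishing weak gradient on a ball is constant on a smaller ball. -/
theorem exists_ae_eq_const_on_ball {f : R3 → F} {x : R3} {r : ℝ}
    (hf : IntegrableOn f (Metric.ball x r))
    (h : ∀ η : R3 → ℝ, ContDiff ℝ ∞ η → tsupport η ⊆ Metric.ball x r → ∀ v,
      ∫ y, fderiv ℝ η y v • f y = 0) :
    ∃ c, ∀ᵐ y, y ∈ Metric.ball x (r / 2) → f y = c := by
  rcases le_or_gt r 0 with hr | hr
  · exact ⟨0, Eventually.of_forall fun y hy => by
      rw [Metric.ball_eq_empty.2 (by linarith)] at hy; exact hy.elim⟩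
  set g := (Metric.ball x r).indicator f with hg
  have hgi : Integrable g := hf.integrable_indicator measurableSet_ball
  -- Outer radii at most r/4 keep the mollifier centred at a point of the ball of radius r/2
  -- supported in the ball of radius r. The fixed ratio 2 of the radii is required for convergence
  -- almost everywhere.
  let b : ℕ → ContDiffBump (0 : R3) := fun n =>
    ⟨r / (8 * (n + 1)), 2 * (r / (8 * (n + 1))), by positivity, by
      have : 0 < r / (8 * ((n : ℝ) + 1)) := by positivity
      linarith⟩
  have hb0 : Tendsto (fun n => (b n).rOut) atTop (𝓝 0) := by
    have h1 := (tendsto_one_div_add_atTop_nhds_zero_nat (𝕜 := ℝ)).const_mul (r / 4)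
    rw [mul_zero] at h1
    refine h1.congr fun n => ?_
    simp only [b]
    field_simp
    norm_num
  have hbr : ∀ n, (b n).rOut ≤ r / 4 := by
    intro n
    simp only [b]
    have h1 : r / (8 * ((n : ℝ) + 1)) ≤ r / 8 := by
      apply div_le_div_of_nonneg_left hr.le (by norm_num)
      nlinarith [(Nat.cast_nonneg n : (0 : ℝ) ≤ n)]
    linarith
  have hlim := ContDiffBump.ae_convolution_tendsto_right_of_locallyIntegrable (μ := volume)
    (φ := b) (K := 2) hb0 (Eventually.of_forall fun n => le_rfl) hgi.locallyIntegrable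
  -- the mollified functions are constant on the smaller ball
  have hconst : ∀ n, ∀ y ∈ Metric.ball x (r / 2), ∀ z ∈ Metric.ball x (r / 2),
      ((b n).normed volume ⋆[ContinuousLinearMap.lsmul ℝ ℝ, volume] g) y =
      ((b n).normed volume ⋆[ContinuousLinearMap.lsmul ℝ ℝ, volume] g) z := by
    intro n y hy z hz
    set ψ := (b n).normed volume with hψ
    have hψs : ContDiff ℝ ∞ ψ := (b n).contDiff_normed
    have hψc : HasCompactSupport ψ := (b n).hasCompactSupport_normed
    have hder : ∀ w, HasFDerivAt (ψ ⋆[ContinuousLinearMap.lsmul ℝ ℝ, volume] g) _ w := fun w =>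
      hψc.hasFDerivAt_convolution_left (ContinuousLinearMap.lsmul ℝ ℝ) (hψs.of_le (by simp))
        hgi.locallyIntegrable w
    refine IsOpen.is_const_of_fderiv_eq_zero (𝕜 := ℝ) Metric.isOpen_ball
      (convex_ball x (r / 2)).isPreconnected
      (fun w _ => (hder w).differentiableAt.differentiableWithinAt) (fun w hw => ?_) hy hz
    rw [(hder w).fderiv]
    ext v
    have hex := (hψc.fderiv ℝ).convolutionExists_left
      (ContinuousLinearMap.precompL R3 (ContinuousLinearMap.lsmul ℝ ℝ : ℝ →L[ℝ] F →L[ℝ] F))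
      (hψs.continuous_fderiv (by simp)) hgi.locallyIntegrable w
    rw [convolution_def, ContinuousLinearMap.integral_apply hex]
    set η : R3 → ℝ := fun s => ψ (w - s) with hη
    have hηd : ∀ s, fderiv ℝ η s v = -fderiv ℝ ψ (w - s) v := by
      intro s
      have : HasFDerivAt η ((fderiv ℝ ψ (w - s)).comp (-ContinuousLinearMap.id ℝ R3)) s :=
        (hψs.differentiable (by simp) (w - s)).hasFDerivAt.comp s
          ((hasFDerivAt_id s).const_sub w)
      rw [this.fderiv]
      simp
    have hηs : tsupport η ⊆ Metric.ball x r := by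
      refine (closure_minimal (fun s hs => ?_) Metric.isClosed_closedBall).trans
        (Metric.closedBall_subset_ball' (x := w) (ε₁ := r / 4) ?_)
      · have h1 : w - s ∈ Function.support ψ := hs
        rw [hψ, ContDiffBump.support_normed_eq] at h1
        have h2 : ‖w - s‖ < (b n).rOut := by simpa using h1
        rw [Metric.mem_closedBall, dist_comm, dist_eq_norm]
        linarith [hbr n]
      · have : dist w x < r / 2 := hw
        linarith
    have h0 := h η (hψs.comp (contDiff_const.sub contDiff_id)) hηs v
    have h1 : ∀ t, (ContinuousLinearMap.precompL R3
        (ContinuousLinearMap.lsmul ℝ ℝ : ℝ →L[ℝ] F →L[ℝ] F)) (fderiv ℝ ψ t) (g (w - t)) v =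
        fderiv ℝ ψ t v • g (w - t) := fun t => by
      simp [ContinuousLinearMap.precompL_apply]
    simp_rw [h1]
    have h2 := integral_sub_left_eq_self (fun s => fderiv ℝ ψ (w - s) v • g s) volume w
    simp only [sub_sub_cancel] at h2
    rw [h2]
    have h3 : ∀ s, fderiv ℝ ψ (w - s) v • g s = -(fderiv ℝ η s v • f s) := by
      intro s
      by_cases hs : s ∈ Metric.ball x r
      · rw [hg, indicator_of_mem hs, hηd, neg_smul, neg_neg]
      · have : fderiv ℝ η s = 0 := by
          by_contra hne
          exact hs (hηs (support_fderiv_subset ℝ hne))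
        rw [hg, indicator_of_notMem hs, this]
        simp
    simp_rw [h3]
    rw [integral_neg, h0]
    simp
  have hpos : volume (Metric.ball x (r / 2)) ≠ 0 := (Metric.measure_ball_pos _ _ (by linarith)).ne'
  obtain ⟨z, hz, hzlim⟩ : ∃ z ∈ Metric.ball x (r / 2), Tendsto (fun n => ((b n).normed volume
      ⋆[ContinuousLinearMap.lsmul ℝ ℝ, volume] g) z) atTop (𝓝 (g z)) := by
    by_contra! hcon
    refine hpos (measure_mono_null (fun y hy => ?_) hlim)
    exact hcon y hy
  refine ⟨g z, ?_⟩
  filter_upwards [hlim] with y hy hyb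
  have h1 : g y = f y :=
    indicator_of_mem (Metric.ball_subset_ball (by linarith) hyb) f
  rw [← h1]
  exact tendsto_nhds_unique hy (hzlim.congr fun n => hconst n z hz y hyb)

end WeakGradient

/-- A locally a.e. constant function on a preconnected set is a.e. constant. -/
theorem exists_ae_eq_const_of_isPreconnected {F : Type*} [NormedAddCommGroup F] {T : Set R3} (hT : IsPreconnected T) {f : R3 → F}
    (hpos : ∀ x ∈ T, ∀ V ∈ 𝓝 x, volume (V ∩ T) ≠ 0)
    (hloc : ∀ x ∈ T, ∃ V ∈ 𝓝 x, ∃ c, ∀ᵐ y, y ∈ V → y ∈ T → f y = c) :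
    ∃ c, ∀ᵐ y, y ∈ T → f y = c := by
  rcases T.eq_empty_or_nonempty with rfl | ⟨x₀, hx₀⟩
  · exact ⟨0, by simp⟩
  choose! V hV c hc using hloc
  -- Near a point of T the neighbourhoods overlap in a subset of T of positive measure, on which f
  -- has both constants as its value. The local constant is therefore a locally constant function on
  -- T.
  have hVo : ∀ x ∈ T, ∀ y ∈ interior (V x) ∩ T, c y = c x := by
    rintro x hx y ⟨hyV, hyT⟩
    by_contra hne
    refine hpos y hyT (V x ∩ V y) (inter_mem (mem_interior_iff_mem_nhds.1 hyV) (hV y hyT)) ?_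
    refine measure_mono_null (t := {z | ¬((z ∈ V x → z ∈ T → f z = c x) ∧
      (z ∈ V y → z ∈ T → f z = c y))}) (fun z hz h => ?_) ((hc x hx).and (hc y hyT))
    exact hne ((h.2 hz.1.2 hz.2).symm.trans (h.1 hz.1.1 hz.2))
  have hcc : ∀ x ∈ T, c x = c x₀ := by
    intro x hx
    have : PreconnectedSpace T := Subtype.preconnectedSpace hT
    have hl : IsLocallyConstant fun y : T => c y := by
      rw [IsLocallyConstant.iff_eventually_eq]
      intro y
      have h1 : interior (V y) ∈ 𝓝 (y : R3) := interior_mem_nhds.2 (hV y y.2)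
      filter_upwards [continuous_subtype_val.continuousAt.preimage_mem_nhds h1] with z hz
      exact hVo y y.2 z ⟨hz, z.2⟩
    exact hl.apply_eq_of_isPreconnected isPreconnected_univ (x := ⟨x, hx⟩) (y := ⟨x₀, hx₀⟩)
      trivial trivial
  -- By the Lindelöf property countably many of the neighbourhoods suffice, so the exceptional sets
  -- still add up to a null set.
  obtain ⟨t, htT, htc, hcov⟩ := TopologicalSpace.countable_cover_nhdsWithin (f := V) (s := T)
    fun x hx => mem_nhdsWithin_of_mem_nhds (hV x hx)
  refine ⟨c x₀, ?_⟩
  have := (ae_ball_iff htc (p := fun y x _ => y ∈ V x → y ∈ T → f y = c x)).2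
    fun x hx => hc x (htT hx)
  filter_upwards [this] with y hy hyT
  obtain ⟨x, hx, hyx⟩ := mem_iUnion₂.1 (hcov hyT)
  rw [hy x hx hyx hyT, hcc x (htT hx)]

end

/-! ### Connectedness of the periodic stiff component -/

theorem norm_vertical (Φ : R3 ≃ᵃⁱ[ℝ] R3) : ‖vertical Φ‖ = 1 := by
  rw [vertical, LinearIsometryEquiv.norm_map]; simp

theorem single_mem_lattice (i : Fin 3) : EuclideanSpace.single i (1 : ℝ) ∈ lattice := fun j => by
  by_cases h : j = i
  · exact ⟨1, by simp [h]⟩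
  · exact ⟨0, by simp [h]⟩

/-- The open set swept by translating a ball along the graph is preconnected. -/
theorem IsGraphFunction.exists_collar {δ : R3 → ℝ} {e : R3} {K : ℝ≥0} (h : IsGraphFunction δ e K)
    (he : ‖e‖ = 1) {x₀ : R3} (hx₀ : δ x₀ = 0) {ρ : ℝ} (hρ : 0 < ρ) :
    ∃ r > 0, r ≤ ρ ∧ ∃ D, IsOpen D ∧ IsPreconnected D ∧ x₀ ∈ closure D ∧
      D ⊆ Metric.ball x₀ ρ ∩ {x | δ x < 0} ∧ ∀ y ∈ Metric.ball x₀ r, δ y < 0 → y ∈ D := by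
  have hc : Continuous δ := h.contDiff.continuous
  obtain ⟨r', hr', hb⟩ := Metric.continuousAt_iff.1 (hc.continuousAt (x := x₀)) (ρ / 4)
    (by positivity)
  set r := min r' (ρ / 4) with hr
  have hr0 : 0 < r := lt_min hr' (by positivity)
  have hδ : ∀ y ∈ Metric.ball x₀ r, |δ y| < ρ / 4 := fun y hy => by
    have := hb (Metric.ball_subset_ball (min_le_left _ _) hy)
    rwa [hx₀, Real.dist_eq, sub_zero] at this
  -- The point at depth t below the graph on the line through y: δ(m(y, t)) = -t. The collar D is
  -- the image of a product of convex sets, so it is preconnected; its openness follows from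
  -- describing it by δ and by translates of the ball.
  let m : R3 × ℝ → R3 := fun p => p.1 - (δ p.1 + p.2) • e
  have hm : Continuous m := by fun_prop
  have hsub : ∀ y s, δ (y - s • e) = δ y - s := fun y s => by
    rw [sub_eq_add_neg, ← neg_smul, h.add_smul]; ring
  refine ⟨r, hr0, (min_le_right _ _).trans (by linarith), m '' (Metric.ball x₀ r ×ˢ Ioo 0 (ρ / 4)),
    ?_, ?_, ?_, ?_, ?_⟩
  · have : m '' (Metric.ball x₀ r ×ˢ Ioo 0 (ρ / 4)) = {z | -(ρ / 4) < δ z ∧ δ z < 0} ∩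
        ⋃ τ : ℝ, (fun z => z + τ • e) ⁻¹' Metric.ball x₀ r := by
      ext z
      simp only [mem_image, mem_prod, mem_inter_iff, mem_iUnion, mem_preimage, Prod.exists]
      constructor
      · rintro ⟨y, t, ⟨hy, ht⟩, rfl⟩
        refine ⟨?_, δ y + t, by simpa [m] using hy⟩
        simp only [m, Set.mem_ofPred_eq, hsub]
        constructor <;> linarith [ht.1, ht.2]
      · rintro ⟨⟨h1, h2⟩, τ, hτ⟩
        refine ⟨z + τ • e, -δ z, ⟨hτ, by linarith, by linarith⟩, ?_⟩
        simp [m, h.add_smul]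
    rw [this]
    refine IsOpen.inter ?_ (isOpen_iUnion fun τ => Metric.isOpen_ball.preimage (by fun_prop))
    exact (isOpen_lt continuous_const hc).inter (isOpen_lt hc continuous_const)
  · exact ((convex_ball x₀ r).isPreconnected.prod isPreconnected_Ioo).image _ hm.continuousOn
  · have h1 : Tendsto (fun t : ℝ => m (x₀, t)) (𝓝[>] 0) (𝓝 x₀) := by
      have : Tendsto (fun t : ℝ => m (x₀, t)) (𝓝 0) (𝓝 (m (x₀, 0))) :=
        (hm.comp (by fun_prop : Continuous fun t : ℝ => (x₀, t))).continuousAt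
      simp only [m, hx₀, add_zero, zero_smul, sub_zero] at this
      simpa [m, hx₀] using this.mono_left nhdsWithin_le_nhds
    refine mem_closure_of_tendsto h1 ?_
    filter_upwards [Ioo_mem_nhdsGT (by positivity : (0 : ℝ) < ρ / 4)] with t ht
    exact ⟨(x₀, t), ⟨Metric.mem_ball_self hr0, ht⟩, rfl⟩
  · rintro _ ⟨⟨y, t⟩, ⟨hy, ht⟩, rfl⟩
    have hy : y ∈ Metric.ball x₀ r := hy
    have ht : t ∈ Ioo 0 (ρ / 4) := ht
    refine ⟨?_, ?_⟩
    · have h2 : dist y x₀ < ρ / 4 := lt_of_lt_of_le hy (min_le_right _ _)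
      rw [dist_eq_norm] at h2
      have h3 : ‖(δ y + t) • e‖ < ρ / 2 := by
        rw [norm_smul, he, mul_one, Real.norm_eq_abs]
        have := abs_add_le (δ y) t
        rw [abs_of_pos ht.1] at this
        linarith [hδ y hy, ht.2]
      rw [Metric.mem_ball, dist_eq_norm]
      have h4 : m (y, t) - x₀ = (y - x₀) - (δ y + t) • e := by simp only [m]; abel
      rw [h4]
      linarith [norm_sub_le (y - x₀) ((δ y + t) • e)]
    · simp only [m, Set.mem_ofPred_eq, hsub]
      linarith [ht.1]
  · intro y hy hlt
    refine ⟨(y, -δ y), ⟨hy, by linarith, ?_⟩, ?_⟩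
    · linarith [(abs_lt.1 (hδ y hy)).1]
    · simp [m]

namespace IsInclusion

variable {S : Set R3}

theorem graphFun_eq_zero {x₀ : R3} (hx₀ : x₀ ∈ frontier S)
    (hSo : IsOpen S) {δ : R3 → ℝ} (hδ : Continuous δ) {ρ : ℝ} (hρ : 0 < ρ)
    (hSδ : ∀ x ∈ Metric.closedBall x₀ ρ, (x ∈ S ↔ 0 < δ x)) : δ x₀ = 0 := by
  refine le_antisymm (not_lt.1 fun hpos => ?_) (not_lt.1 fun hneg => ?_)
  · have := (hSδ x₀ (Metric.mem_closedBall_self hρ.le)).2 hpos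
    exact (hSo.frontier_eq ▸ hx₀).2 this
  · have h1 : {x | δ x < 0} ∩ Metric.ball x₀ ρ ∈ 𝓝 x₀ :=
      inter_mem ((isOpen_lt hδ continuous_const).mem_nhds hneg) (Metric.ball_mem_nhds _ hρ)
    obtain ⟨y, ⟨hy1, hy2⟩, hyS⟩ := mem_closure_iff_nhds.1 (frontier_subset_closure hx₀) _ h1
    exact lt_asymm hy1 ((hSδ y (Metric.ball_subset_closedBall hy2)).1 hyS)

theorem zero_notMem_closure (hS : IsInclusion S) : (0 : R3) ∉ closure S := fun h => by
  obtain ⟨ε, hε, hm⟩ := hS.exists_margin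
  have := (hm 0 h 0).1
  simp at this
  linarith

theorem zero_mem_cell : (0 : R3) ∈ cell := fun i => by simp

/-- Each point of the periodic stiff component has a neighbourhood in which this component is
connected up to a null set. -/
theorem exists_local_domain (hS : IsInclusion S) {x₀ : R3} (hx₀ : x₀ ∈ perStiff S) :
    ∃ r > 0, ∃ D, IsOpen D ∧ IsPreconnected D ∧ D ⊆ perStiff S ∧ x₀ ∈ closure D ∧
      ∀ᵐ y, y ∈ Metric.ball x₀ r → y ∈ perStiff S → y ∈ D := by
  have hcell : ∀ x ∈ cell, x ∉ S → ∃ r > 0, ∃ D, IsOpen D ∧ IsPreconnected D ∧ D ⊆ perStiff S ∧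
      x ∈ closure D ∧ ∀ᵐ y, y ∈ Metric.ball x r → y ∈ perStiff S → y ∈ D := by
    intro x hx hxS
    by_cases hcl : x ∈ closure S
    · have hfr : x ∈ frontier S := ⟨hcl, by rwa [hS.isOpen.interior_eq]⟩
      obtain ⟨Φ, γ, K, ρ, -, hδ, hρ, hcell, hSδ⟩ := hS.exists_chart hfr
      have h0 := graphFun_eq_zero hfr hS.isOpen hδ.contDiff.continuous hρ hSδ
      obtain ⟨r, hr, hrρ, D, hDo, hDc, hxD, hDsub, hD⟩ :=
        hδ.exists_collar (norm_vertical Φ) h0 hρ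
      refine ⟨r, hr, D, hDo, hDc, fun y hy => ?_, hxD, ?_⟩
      · have hyρ := Metric.ball_subset_closedBall (hDsub hy).1
        exact (hS.mem_perStiff_of_mem_cell (interior_subset (hcell hyρ))).2 fun h =>
          lt_asymm ((hSδ y hyρ).1 h) (hDsub hy).2
      · filter_upwards [hδ.ae_ne_zero] with y hy0 hyr hyS
        have hyρ : y ∈ Metric.closedBall x ρ :=
          Metric.ball_subset_closedBall (Metric.ball_subset_ball hrρ hyr)
        refine hD y hyr (lt_of_le_of_ne (not_lt.1 fun hpos => ?_) hy0)
        exact (hS.mem_perStiff_of_mem_cell (interior_subset (hcell hyρ))).1 hyS ((hSδ y hyρ).2 hpos)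
    · obtain ⟨ρ, hρ, hb⟩ := hS.exists_ball_subset_perStiff (subset_closure hx) hcl
      exact ⟨ρ, hρ, Metric.ball x ρ, Metric.isOpen_ball, (convex_ball x ρ).isPreconnected, hb,
        subset_closure (Metric.mem_ball_self hρ), Eventually.of_forall fun y hy _ => hy⟩
  obtain ⟨k, hk, hkc⟩ := exists_add_lattice_mem_cell x₀
  obtain ⟨r, hr, D, hDo, hDc, hDS, hxD, hD⟩ := hcell _ hkc (hx₀ k hk)
  have hpre : (fun y => y + k) ⁻¹' D = (fun y => y + -k) '' D := by
    rw [image_add_right, neg_neg]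
  refine ⟨r, hr, (fun y => y + k) ⁻¹' D, hDo.preimage (by fun_prop), ?_, fun y hy => ?_, ?_, ?_⟩
  · rw [hpre]
    exact hDc.image _ (by fun_prop)
  · have := add_mem_perStiff (hDS hy) (neg_mem_lattice hk)
    simpa using this
  · rw [hpre]
    have := image_closure_subset_closure_image (f := fun y : R3 => y + -k) (s := D) (by fun_prop)
      ⟨_, hxD, rfl⟩
    simpa using this
  · filter_upwards [(quasiMeasurePreserving_add_right volume k).ae hD] with y hy hyb hyS
    refine hy ?_ (add_mem_perStiff hyS hk)
    simpa [Metric.mem_ball] using hyb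

/-- The lattice vectors that are joined to 0 inside the periodic stiff component form a subgroup. It
contains each basis vector, which is the limit of the points (1 - t)e_i on an edge of the cell, away
from the inclusion. Every point lies in a lattice translate of the connected set `stiff S`, and that
translate contains a lattice point. -/
theorem isPreconnected_perStiff (hS : IsInclusion S) : IsPreconnected (perStiff S) := by
  obtain ⟨ε, hε, hm⟩ := hS.exists_margin
  have htrans : ∀ {P : Set R3}, IsPreconnected P → P ⊆ perStiff S → ∀ k ∈ lattice,
      IsPreconnected ((fun x => x + k) '' P) ∧ (fun x => x + k) '' P ⊆ perStiff S := by
    intro P hP hPS k hk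
    refine ⟨hP.image _ (by fun_prop), ?_⟩
    rintro _ ⟨x, hx, rfl⟩
    exact add_mem_perStiff (hPS hx) hk
  have hst : stiff S ⊆ perStiff S := by rw [hS.stiff_eq]; exact inter_subset_right
  have h0 : (0 : R3) ∈ stiff S := ⟨zero_mem_cell, fun h => hS.zero_notMem_closure (subset_closure h)⟩
  let G : AddSubgroup R3 :=
    { carrier := {k | k ∈ lattice ∧ ∃ P ⊆ perStiff S, IsPreconnected P ∧ 0 ∈ P ∧ k ∈ P}
      zero_mem' := ⟨zero_mem_lattice, stiff S, hst, hS.isConnected_stiff.isPreconnected, h0, h0⟩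
      add_mem' := by
        rintro a b ⟨ha, P, hPS, hP, hP0, hPa⟩ ⟨hb, Q, hQS, hQ, hQ0, hQb⟩
        obtain ⟨h1, h2⟩ := htrans hQ hQS a ha
        refine ⟨add_mem_lattice ha hb, P ∪ (fun x => x + a) '' Q, union_subset hPS h2,
          hP.union a hPa ⟨0, hQ0, by simp⟩ h1, Or.inl hP0, Or.inr ⟨b, hQb, add_comm _ _⟩⟩
      neg_mem' := by
        rintro a ⟨ha, P, hPS, hP, hP0, hPa⟩
        obtain ⟨h1, h2⟩ := htrans hP hPS (-a) (neg_mem_lattice ha)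
        exact ⟨neg_mem_lattice ha, _, h2, h1, ⟨a, hPa, by simp⟩, ⟨0, hP0, by simp⟩⟩ }
  have hG : ∀ k ∈ lattice, k ∈ G := by
    intro k hk
    refine mem_of_mem_lattice G (fun i => ⟨single_mem_lattice i,
      insert (EuclideanSpace.single i 1) (stiff S), ?_, ?_, Or.inr h0, Or.inl rfl⟩) hk
    · refine insert_subset ?_ hst
      have := add_mem_perStiff (hst h0) (single_mem_lattice i)
      rwa [zero_add] at this
    · refine hS.isConnected_stiff.isPreconnected.subset_closure (subset_insert _ _)
        (insert_subset ?_ subset_closure)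
      have h1 : Tendsto (fun t : ℝ => EuclideanSpace.single i (1 - t)) (𝓝[>] 0)
          (𝓝 (EuclideanSpace.single i (1 : ℝ))) := by
        have : Continuous fun t : ℝ => (1 - t) • EuclideanSpace.single i (1 : ℝ) := by fun_prop
        have h2 := this.tendsto 0
        simp only [sub_zero, one_smul] at h2
        refine (h2.mono_left nhdsWithin_le_nhds).congr fun t => ?_
        ext j; by_cases hj : j = i <;> simp [hj]
      refine mem_closure_of_tendsto h1 ?_
      filter_upwards [Ioo_mem_nhdsGT (zero_lt_one : (0 : ℝ) < 1)] with t ht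
      refine ⟨fun j => ?_, fun h => ?_⟩
      · by_cases hj : j = i
        · simp only [hj, PiLp.single_apply, if_true, mem_Ico]
          constructor <;> linarith [ht.1, ht.2]
        · simp [hj]
      · have := (hm _ (subset_closure h) (i + 1)).1
        have hne : i + 1 ≠ i := by fin_cases i <;> decide
        simp [hne] at this
        linarith
  refine isPreconnected_of_forall 0 fun y hy => ?_
  obtain ⟨k, hk, hkc⟩ := exists_add_lattice_mem_cell y
  obtain ⟨-, P, hPS, hP, hP0, hPk⟩ := hG _ (neg_mem_lattice hk)
  obtain ⟨h1, h2⟩ := htrans hS.isConnected_stiff.isPreconnected hst (-k) (neg_mem_lattice hk)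
  exact ⟨P ∪ (fun x => x + -k) '' stiff S, union_subset hPS h2, Or.inl hP0,
    Or.inr ⟨y + k, ⟨hkc, hy k hk⟩, by simp⟩, hP.union (-k) hPk ⟨0, h0, by simp⟩ h1⟩

/-- A locally integrable function with vanishing weak gradient in the periodic stiff component is
constant there. -/
theorem exists_ae_eq_const (hS : IsInclusion S) {F : Type*} [NormedAddCommGroup F]
    [NormedSpace ℝ F] [CompleteSpace F] {f : R3 → F}
    (hf : ∀ R, IntegrableOn f (perStiff S ∩ Metric.closedBall 0 R))
    (h : ∀ η : R3 → ℝ, ContDiff ℝ ∞ η → HasCompactSupport η → tsupport η ⊆ perStiff S →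
      ∀ v, ∫ y, fderiv ℝ η y v • f y = 0) :
    ∃ c, ∀ᵐ y, y ∈ perStiff S → f y = c := by
  refine exists_ae_eq_const_of_isPreconnected hS.isPreconnected_perStiff ?_ ?_
  · intro x hx V hV
    obtain ⟨r, hr, D, hDo, hDc, hDS, hxD, hD⟩ := hS.exists_local_domain hx
    have hne : (interior V ∩ D).Nonempty :=
      mem_closure_iff_nhds.1 hxD _ (interior_mem_nhds.2 hV)
    refine ((isOpen_interior.inter hDo).measure_pos volume hne).ne' ∘ fun h0 => ?_
    exact measure_mono_null (inter_subset_inter interior_subset hDS) h0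
  · intro x hx
    obtain ⟨r, hr, D, hDo, hDc, hDS, hxD, hD⟩ := hS.exists_local_domain hx
    -- Test functions see only interior points, so constancy is first obtained on the open
    -- preconnected set D. Up to a null set D fills a neighbourhood of x in the periodic stiff
    -- component, also when x lies on the interface.
    obtain ⟨c, hc⟩ : ∃ c, ∀ᵐ y, y ∈ D → f y = c := by
      refine exists_ae_eq_const_of_isPreconnected hDc ?_ ?_
      · intro z hz V hV
        refine (MeasureTheory.Measure.measure_pos_of_mem_nhds volume (x := z) (inter_mem hV (hDo.mem_nhds hz))).ne'
      · intro z hz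
        obtain ⟨ρ, hρ, hb⟩ := Metric.isOpen_iff.1 hDo z hz
        obtain ⟨c, hc⟩ := exists_ae_eq_const_on_ball (f := f) (x := z) (r := ρ)
          ((hf (ρ + ‖z‖)).mono_set fun y hy => ⟨hDS (hb hy), by
            have h1 := norm_le_norm_add_norm_sub' y z
            have h2 : ‖y - z‖ < ρ := by rw [← dist_eq_norm]; exact hy
            rw [mem_closedBall_zero_iff]; linarith⟩)
          fun η hη hηs v => h η hη ((isCompact_closedBall z ρ).of_isClosed_subset
            (isClosed_tsupport _) (hηs.trans Metric.ball_subset_closedBall))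
            (hηs.trans (hb.trans hDS)) v
        exact ⟨_, Metric.ball_mem_nhds z (half_pos hρ), c, hc.mono fun y hy h1 _ => hy h1⟩
    exact ⟨_, Metric.ball_mem_nhds x hr, c, by
      filter_upwards [hc, hD] with y h1 h2 h3 h4 using h1 (h2 h3 h4)⟩

end IsInclusion

/-! ### Local square-integrable convergence in the periodic stiff component -/

theorem tendsto_zero_of_sq {ι : Type*} {l : Filter ι} {f : ι → ℝ≥0∞}
    (h : Tendsto (fun i => f i ^ 2) l (𝓝 0)) : Tendsto f l (𝓝 0) := by
  rw [ENNReal.tendsto_nhds_zero] at h ⊢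
  intro ε hε
  filter_upwards [h (ε ^ 2) (by positivity)] with i hi
  exact (ENNReal.pow_le_pow_left_iff two_ne_zero).1 hi

theorem tendsto_zero_const_mul {ι : Type*} {l : Filter ι} {f : ι → ℝ≥0∞} {c : ℝ≥0∞} (hc : c ≠ ⊤)
    (h : Tendsto f l (𝓝 0)) : Tendsto (fun i => c * f i) l (𝓝 0) := by
  have := ENNReal.Tendsto.const_mul h (Or.inr hc)
  rwa [mul_zero] at this

/-- Convergence in `L²` on bounded parts of the periodic stiff component. -/
structure TendstoL2loc {F : Type*} [NormedAddCommGroup F] (S : Set R3) (h : ℕ → R3 → F)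
    (l : R3 → F) : Prop where
  continuous : ∀ n, Continuous (h n)
  stronglyMeasurable : StronglyMeasurable l
  tendsto : ∀ R, Tendsto (fun n => ∫⁻ x in perStiff S ∩ Metric.closedBall 0 R, ‖h n x - l x‖ₑ ^ 2)
    atTop (𝓝 0)

namespace TendstoL2loc

variable {F : Type*} [NormedAddCommGroup F] {S : Set R3} {h k : ℕ → R3 → F} {l m : R3 → F}

theorem volume_lt_top (S : Set R3) (R : ℝ) : volume (perStiff S ∩ Metric.closedBall 0 R) < ⊤ :=
  (measure_mono inter_subset_right).trans_lt measure_closedBall_lt_top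

theorem measurable_enorm_sub (H : TendstoL2loc S h l) (n : ℕ) :
    Measurable fun x => ‖h n x - l x‖ₑ :=
  ((H.continuous n).stronglyMeasurable.sub H.stronglyMeasurable).enorm

theorem tendsto_lintegral (H : TendstoL2loc S h l) (R : ℝ) :
    Tendsto (fun n => ∫⁻ x in perStiff S ∩ Metric.closedBall 0 R, ‖h n x - l x‖ₑ) atTop (𝓝 0) := by
  refine tendsto_zero_of_sq (tendsto_of_tendsto_of_tendsto_of_le_of_le tendsto_const_nhds
    (tendsto_zero_const_mul (volume_lt_top S R).ne (H.tendsto R)) (fun n => zero_le) fun n => ?_)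
  simpa using sq_lintegral_le (ν := volume.restrict (perStiff S ∩ Metric.closedBall 0 R))
    (H.measurable_enorm_sub n).aemeasurable

theorem integrableOn (H : TendstoL2loc S h l) (R : ℝ) :
    IntegrableOn l (perStiff S ∩ Metric.closedBall 0 R) := by
  obtain ⟨n, hn⟩ := ((ENNReal.tendsto_nhds_zero.1 (H.tendsto_lintegral R)) 1 one_pos).exists
  have h1 : IntegrableOn (h n) (perStiff S ∩ Metric.closedBall 0 R) :=
    ((H.continuous n).continuousOn.integrableOn_compact (isCompact_closedBall 0 R)).mono_set
      inter_subset_right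
  have h2 : IntegrableOn (fun x => h n x - l x) (perStiff S ∩ Metric.closedBall 0 R) :=
    ⟨((H.continuous n).stronglyMeasurable.sub H.stronglyMeasurable).aestronglyMeasurable,
      hn.trans_lt ENNReal.one_lt_top⟩
  have := h1.sub h2
  simpa [Pi.sub_def] using this

/-- The tool for passing to the limit in integrations by parts: strong local convergence implies
convergence against test functions supported in the periodic stiff component. -/
theorem tendsto_integral_smul [NormedSpace ℝ F] (H : TendstoL2loc S h l) {ζ : R3 → ℝ}
    (hζ : Continuous ζ) (cζ : HasCompactSupport ζ) (hs : Function.support ζ ⊆ perStiff S) :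
    Tendsto (fun n => ∫ x, ζ x • h n x) atTop (𝓝 (∫ x, ζ x • l x)) := by
  obtain ⟨M, hM⟩ := cζ.exists_bound_of_continuous hζ
  obtain ⟨R, hR⟩ := cζ.isCompact.isBounded.subset_closedBall 0
  refine tendsto_integral_of_L1 (fun x => ζ x • l x) (hζ.stronglyMeasurable.smul
    H.stronglyMeasurable).aestronglyMeasurable
    (Eventually.of_forall fun n => (hζ.smul (H.continuous n)).integrable_of_hasCompactSupport
      (cζ.smul_right)) ?_
  refine tendsto_of_tendsto_of_tendsto_of_le_of_le tendsto_const_nhds (tendsto_zero_const_mul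
    (c := ENNReal.ofReal M) ENNReal.ofReal_ne_top (H.tendsto_lintegral R)) (fun n => zero_le)
    fun n => ?_
  have hsub : Function.support (fun x => ‖ζ x • h n x - ζ x • l x‖ₑ) ⊆
      perStiff S ∩ Metric.closedBall 0 R := by
    intro x hx
    have : ζ x ≠ 0 := fun h0 => hx (by simp [h0])
    exact ⟨hs this, hR (subset_tsupport _ this)⟩
  rw [← setLIntegral_eq_of_support_subset hsub, ← lintegral_const_mul' _ _ ENNReal.ofReal_ne_top]
  refine lintegral_mono fun x => ?_
  rw [← smul_sub, enorm_smul]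
  gcongr
  rw [← ofReal_norm]
  exact ENNReal.ofReal_le_ofReal (hM x)

theorem of_norm_le {F' : Type*} [NormedAddCommGroup F'] (H : TendstoL2loc S h l)
    {h' : ℕ → R3 → F'} {l' : R3 → F'} (hc : ∀ n, Continuous (h' n)) (hl : StronglyMeasurable l')
    {c : ℝ} (hle : ∀ n x, ‖h' n x - l' x‖ ≤ c * ‖h n x - l x‖) : TendstoL2loc S h' l' := by
  refine ⟨hc, hl, fun R => tendsto_of_tendsto_of_tendsto_of_le_of_le tendsto_const_nhds
    (tendsto_zero_const_mul (c := ENNReal.ofReal (c ^ 2)) ENNReal.ofReal_ne_top (H.tendsto R))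
    (fun n => zero_le) fun n => ?_⟩
  rw [← lintegral_const_mul' _ _ ENNReal.ofReal_ne_top]
  exact lintegral_mono fun x => enorm_sq_le_of_norm_le (hle n x)

theorem clm_comp {F' : Type*} [NormedAddCommGroup F'] [NormedSpace ℂ F] [NormedSpace ℂ F']
    (H : TendstoL2loc S h l) (L : F →L[ℂ] F') :
    TendstoL2loc S (fun n x => L (h n x)) fun x => L (l x) :=
  H.of_norm_le (fun n => L.continuous.comp (H.continuous n))
    (L.continuous.comp_stronglyMeasurable H.stronglyMeasurable)
    fun n x => by rw [← map_sub]; exact L.le_opNorm _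

theorem phase_smul [NormedSpace ℂ F] (H : TendstoL2loc S h l) {e : R3 → ℂ} (he : Continuous e)
    (h1 : ∀ x, ‖e x‖ = 1) : TendstoL2loc S (fun n x => e x • h n x) fun x => e x • l x :=
  H.of_norm_le (c := 1) (fun n => he.smul (H.continuous n))
    (he.stronglyMeasurable.smul H.stronglyMeasurable)
    fun n x => by rw [← smul_sub, norm_smul, h1]

theorem sub_const (H : TendstoL2loc S h l) {g : R3 → F} (hg : Continuous g) :
    TendstoL2loc S (fun n x => h n x - g x) fun x => l x - g x :=
  H.of_norm_le (c := 1) (fun n => (H.continuous n).sub hg)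
    (H.stronglyMeasurable.sub hg.stronglyMeasurable)
    fun n x => by rw [sub_sub_sub_cancel_right, one_mul]

theorem add (H : TendstoL2loc S h l) (K : TendstoL2loc S k m) :
    TendstoL2loc S (fun n x => h n x + k n x) fun x => l x + m x := by
  refine ⟨fun n => (H.continuous n).add (K.continuous n),
    H.stronglyMeasurable.add K.stronglyMeasurable, fun R => ?_⟩
  have h0 := (tendsto_zero_const_mul (c := 2) (by simp) (H.tendsto R)).add
    (tendsto_zero_const_mul (c := 2) (by simp) (K.tendsto R))
  rw [add_zero] at h0
  refine tendsto_of_tendsto_of_tendsto_of_le_of_le tendsto_const_nhds h0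
    (fun n => zero_le) fun n => ?_
  simp only
  rw [← lintegral_const_mul' _ _ (by simp), ← lintegral_const_mul' _ _ (by simp),
    ← lintegral_add_left (((H.measurable_enorm_sub n).pow_const 2).const_mul 2)]
  refine lintegral_mono fun x => ?_
  rw [add_sub_add_comm]
  exact enorm_add_sq_le _ _

end TendstoL2loc

/-! ### Periodic continuation -/

/-- The periodic continuation of the restriction of a function to the cell. -/
def periodize {F : Type*} (w : R3 → F) (y : R3) : F := w (WithLp.toLp 2 fun i => Int.fract (y i))

theorem periodize_of_mem_cell {F : Type*} (w : R3 → F) {y : R3} (hy : y ∈ cell) :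
    periodize w y = w y := by
  rw [periodize]
  congr 1
  ext i
  exact Int.fract_eq_self.2 (hy i)

theorem periodize_add {F : Type*} (w : R3 → F) {k : R3} (hk : k ∈ lattice) (y : R3) :
    periodize w (y + k) = periodize w y := by
  rw [periodize, periodize]
  congr 2
  ext i
  obtain ⟨n, hn⟩ := hk i
  simp [hn]

theorem measurable_fract_coords : Measurable fun y : R3 =>
    (WithLp.toLp 2 fun i => Int.fract (y i) : R3) := by
  refine (WithLp.measurable_toLp 2 _).comp (measurable_pi_lambda _ fun i => ?_)
  exact measurable_fract.comp (Continuous.measurable (by fun_prop))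

theorem IsInclusion.tendstoL2loc_periodize {S : Set R3} (hS : IsInclusion S) {F : Type*}
    [NormedAddCommGroup F] {h : ℕ → R3 → F} {l : R3 → F} (hc : ∀ n, Continuous (h n))
    (hper : ∀ n, ∀ k ∈ lattice, ∀ x, h n (x + k) = h n x) (hl : StronglyMeasurable l)
    (hlim : Tendsto (fun n => ∫⁻ x in stiff S, ‖h n x - l x‖ₑ ^ 2) atTop (𝓝 0)) :
    TendstoL2loc S h (periodize l) := by
  have hm : StronglyMeasurable (periodize l) := hl.comp_measurable measurable_fract_coords
  refine ⟨hc, hm, fun R => ?_⟩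
  obtain ⟨C, hC, hle⟩ := hS.exists_lintegral_le R
  refine tendsto_of_tendsto_of_tendsto_of_le_of_le tendsto_const_nhds
    (tendsto_zero_const_mul hC hlim) (fun n => zero_le) fun n => ?_
  refine (hle (fun x => ‖h n x - periodize l x‖ₑ ^ 2)
    (((hc n).stronglyMeasurable.sub hm).enorm.pow_const 2)
    fun x k hk => by rw [hper n k hk, periodize_add l hk]).trans (mul_le_mul' le_rfl (le_of_eq ?_))
  exact setLIntegral_congr_fun hS.measurableSet_stiff fun x hx => by
    rw [periodize_of_mem_cell _ hx.1]

/-! ### Fields with vanishing strain -/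

/-- The matrix-vector product with a real vector. -/
def contr (v : R3) : C33 →L[ℂ] C3 :=
  LinearMap.toContinuousLinearMap
    { toFun := fun ξ => WithLp.toLp 2 fun i => ∑ j, ξ (i, j) * (v j : ℂ)
      map_add' := fun ξ ζ => by ext i; simp [add_mul, Finset.sum_add_distrib]
      map_smul' := fun c ξ => by ext i; simp [Finset.mul_sum, mul_assoc] }

theorem contr_apply (v : R3) (ξ : C33) (i : Fin 3) : contr v ξ i = ∑ j, ξ (i, j) * (v j : ℂ) := rfl

theorem contr_gradL (v : R3) (T : R3 →L[ℝ] C3) : contr v (gradL T) = T v := by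
  have hv : v = ∑ j, v j • EuclideanSpace.single j (1 : ℝ) := by
    ext i; fin_cases i <;> simp [Fin.sum_univ_three]
  ext i
  conv_rhs => rw [hv]
  rw [contr_apply, map_sum]
  simp only [gradL_apply, map_smul, WithLp.ofLp_sum, Finset.sum_apply]
  refine Finset.sum_congr rfl fun j _ => ?_
  rw [mul_comm, PiLp.smul_apply, Complex.real_smul]

/-- The linear map with a given matrix. -/
def mulVecL (B : C33) : R3 →L[ℝ] C3 :=
  LinearMap.toContinuousLinearMap
    { toFun := fun v => contr v B
      map_add' := fun v w => by ext i; simp [contr_apply, mul_add, Finset.sum_add_distrib]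
      map_smul' := fun c v => by
        ext i
        simp only [contr_apply, PiLp.smul_apply, Finset.smul_sum, Complex.real_smul,
          RingHom.id_apply, smul_eq_mul, Complex.ofReal_mul]
        exact Finset.sum_congr rfl fun j _ => by ring }

theorem mulVecL_apply (B : C33) (v : R3) : mulVecL B v = contr v B := rfl

theorem eq_zero_of_mulVecL {B : C33} (h : ∀ j, mulVecL B (EuclideanSpace.single j 1) = 0) :
    B = 0 := by
  ext ⟨i, j⟩
  have := congrArg (fun z : C3 => z i) (h j)
  simp only [mulVecL_apply, contr_apply, PiLp.single_apply] at this
  rw [Finset.sum_eq_single j (fun k _ hk => by simp [hk]) (by simp)] at this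
  simpa using this

/-- The Bloch phase factor. -/
def phase (χ y : R3) : ℂ := Complex.exp (Complex.I * (inner ℝ χ y : ℝ))

theorem norm_phase (χ y : R3) : ‖phase χ y‖ = 1 := by
  rw [phase, mul_comm, Complex.norm_exp_ofReal_mul_I]

theorem phase_ne_zero (χ y : R3) : phase χ y ≠ 0 := Complex.exp_ne_zero _

theorem phase_add (χ y z : R3) : phase χ (y + z) = phase χ z * phase χ y := by
  rw [phase, phase, phase, ← Complex.exp_add, inner_add_right]
  push_cast
  ring_nf

theorem contDiff_phase (χ : R3) : ContDiff ℝ ∞ (phase χ) := by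
  have h : ContDiff ℝ ∞ fun y : R3 => (inner ℝ χ y : ℝ) := (innerSL ℝ χ).contDiff
  exact (contDiff_const.mul (Complex.ofRealCLM.contDiff.comp h)).cexp

theorem phase_zero_left (y : R3) : phase 0 y = 1 := by simp [phase]

theorem hasFDerivAt_phase (χ y : R3) : HasFDerivAt (phase χ)
    ((innerSL ℝ χ).smulRight (phase χ y * Complex.I)) y := by
  have h : HasFDerivAt (fun y : R3 => (inner ℝ χ y : ℝ)) (innerSL ℝ χ) y :=
    (innerSL ℝ χ).hasFDerivAt
  have h2 := ((Complex.ofRealCLM.hasFDerivAt.comp y h).const_mul Complex.I).cexp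
  refine h2.congr_fderiv ?_
  ext v
  simp [phase]
  ring_nf

theorem grad_phase_smul {χ : R3} {φ : R3 → C3} {y : R3} (hφ : DifferentiableAt ℝ φ y) :
    grad (fun y => phase χ y • φ y) y =
      phase χ y • (grad φ y + Complex.I • outerL χ (φ y)) := by
  have h : HasFDerivAt (fun y => phase χ y • φ y) (phase χ y • fderiv ℝ φ y +
      ((innerSL ℝ χ).smulRight (phase χ y * Complex.I)).smulRight (φ y)) y :=
    (hasFDerivAt_phase χ y).smul hφ.hasFDerivAt
  rw [grad_eq_gradL, h.fderiv]
  ext ⟨i, j⟩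
  rw [gradL_apply, grad_eq_gradL]
  simp only [PiLp.smul_apply, PiLp.add_apply, gradL_apply, outerL_apply]
  simp [mul_add, EuclideanSpace.inner_single_right]
  ring

/-- The Bloch phase turns the shifted strain into an ordinary strain; the price is that periodicity
becomes quasi-periodicity. -/
theorem symL_grad_phase_smul {χ : R3} {φ : R3 → C3} {y : R3} (hφ : DifferentiableAt ℝ φ y) :
    symL (grad (fun y => phase χ y • φ y) y) = phase χ y • fstrain χ φ y := by
  rw [grad_phase_smul hφ, map_smul, fstrain]

/-- The weak gradient of the limit of gradients with vanishing symmetric part vanishes. -/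
theorem integral_smul_eq_zero_of_symL_tendsto {S : Set R3} {U : ℕ → R3 → C3} {G : R3 → C33}
    (hU : ∀ n, ∃ K, LipschitzWith K (U n)) (hG : TendstoL2loc S (fun n => grad (U n)) G)
    (hsym : TendstoL2loc S (fun n x => symL (grad (U n) x)) fun _ => 0) {η : R3 → ℝ}
    (hη : ContDiff ℝ ∞ η) (cη : HasCompactSupport η) (hs : tsupport η ⊆ perStiff S) (v : R3)
    (hdiff : ∀ n, Differentiable ℝ (U n)) :
    ∫ y, fderiv ℝ η y v • G y = 0 := by
  have hcont : ∀ v, Continuous fun y => fderiv ℝ η y v := fun v =>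
    (hη.continuous_fderiv (by simp)).clm_apply continuous_const
  have hcs : ∀ v, HasCompactSupport fun y => fderiv ℝ η y v := fun v => cη.fderiv_apply ℝ v
  have hsup : ∀ v, Function.support (fun y => fderiv ℝ η y v) ⊆ perStiff S := fun v y hy =>
    hs (support_fderiv_subset ℝ fun h0 => hy (by simp [h0]))
  let pr : Fin 3 × Fin 3 → C33 →L[ℂ] ℂ := fun ij => EuclideanSpace.proj ij
  let e : Fin 3 → R3 := fun k => EuclideanSpace.single k 1
  set I : Fin 3 → Fin 3 → Fin 3 → ℂ := fun i j k => ∫ y, fderiv ℝ η y (e k) • G y (i, j) with hI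
  have hlim : ∀ i j k, Tendsto (fun n => ∫ y, fderiv ℝ η y (e k) • grad (U n) y (i, j)) atTop
      (𝓝 (I i j k)) := fun i j k =>
    (hG.clm_comp (pr (i, j))).tendsto_integral_smul (hcont _) (hcs _) (hsup _)
  have hint : ∀ n i j k, Integrable fun y => fderiv ℝ η y (e k) • grad (U n) y (i, j) :=
    fun n i j k => ((hcont (e k)).smul ((pr (i, j)).continuous.comp
      (hG.continuous n))).integrable_of_hasCompactSupport ((hcs _).smul_right)
  -- `I i j k` is, up to sign, the k-th weak derivative of the entry (i, j) of the limit gradient,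
  -- tested with η. Weak second derivatives commute for each n, and this passes to the limit.
  have hsym1 : ∀ i j k, I i j k = I i k j := by
    intro i j k
    refine tendsto_nhds_unique (hlim i j k) ((hlim i k j).congr fun n => ?_)
    obtain ⟨K, hK⟩ := hU n
    obtain ⟨K', hK'⟩ := hη.lipschitzWith_of_hasCompactSupport cη (by simp)
    let pi : C3 →L[ℂ] ℂ := EuclideanSpace.proj i
    have h1 : LipschitzWith _ fun y => pi (U n y) := pi.lipschitz.comp hK
    have h2 : LipschitzWith _ fun y => (η y : ℂ) := Complex.ofRealCLM.lipschitz.comp hK'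
    have h3 := integral_fderiv_mul_fderiv_comm (μ := volume) h2 h1
      (cη.comp_left (g := Complex.ofReal) rfl) (e j) (e k)
    have d1 : ∀ y w, fderiv ℝ (fun y => (η y : ℂ)) y w = (fderiv ℝ η y w : ℂ) := fun y w => by
      have := (Complex.ofRealCLM.hasFDerivAt.comp y
        (hη.differentiable (by simp) y).hasFDerivAt)
      have h4 : HasFDerivAt (fun y => (η y : ℂ)) _ y := this
      rw [h4.fderiv]; rfl
    have d2 : ∀ y l, fderiv ℝ (fun y => pi (U n y)) y (e l) = grad (U n) y (i, l) := fun y l => by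
      have h4 : HasFDerivAt (fun y => pi (U n y)) _ y :=
        (pi.restrictScalars ℝ).hasFDerivAt.comp y (hdiff n y).hasFDerivAt
      rw [h4.fderiv]; rfl
    simp only [d1, d2] at h3
    simpa only [Complex.real_smul] using h3
  have hanti : ∀ i j k, I i j k = -I j i k := by
    intro i j k
    have h1 := ((hsym.clm_comp (pr (i, j))).tendsto_integral_smul (hcont (e k)) (hcs _)
      (hsup _)).const_mul 2
    have h2 := (hlim i j k).add (hlim j i k)
    rw [eq_neg_iff_add_eq_zero]
    refine tendsto_nhds_unique h2 ?_
    simp only [map_zero, smul_zero, integral_zero, mul_zero] at h1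
    refine h1.congr fun n => ?_
    rw [← integral_add (hint n i j k) (hint n j i k), ← integral_const_mul]
    refine integral_congr_ae (Eventually.of_forall fun y => ?_)
    have : pr (i, j) (symL (grad (U n) y)) = (grad (U n) y (i, j) + grad (U n) y (j, i)) / 2 :=
      symL_apply _ _ _
    simp only [this, Complex.real_smul]
    ring
  -- An array that is symmetric in its last two indices and antisymmetric in its first two vanishes.
  -- This is the usual argument that a displacement without strain has no second derivatives.
  have hzero : ∀ i j k, I i j k = 0 := by
    intro i j k
    have : I i j k = -I i j k := by
      calc I i j k = -I j i k := hanti _ _ _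
        _ = -I j k i := by rw [hsym1 j i k]
        _ = I k j i := by rw [hanti j k i, neg_neg]
        _ = I k i j := hsym1 _ _ _
        _ = -I i k j := hanti _ _ _
        _ = -I i j k := by rw [hsym1 i k j]
    exact self_eq_neg.1 this
  have hintG : ∀ w, Integrable fun y => fderiv ℝ η y w • G y := by
    intro w
    obtain ⟨R, hR⟩ := cη.isCompact.isBounded.subset_closedBall 0
    obtain ⟨M, hM⟩ := (hcs w).exists_bound_of_continuous (hcont w)
    have h1 : IntegrableOn (fun y => fderiv ℝ η y w • G y) (perStiff S ∩ Metric.closedBall 0 R) := by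
      exact Integrable.bdd_smul (hG.integrableOn R) M
        (hcont w).aestronglyMeasurable (Eventually.of_forall hM)
    refine (integrableOn_iff_integrable_of_support_subset fun y hy => ?_).1 h1
    have h0 : fderiv ℝ η y w ≠ 0 := fun h0 => hy (by simp [h0])
    exact ⟨hsup w h0, hR (support_fderiv_subset ℝ fun h => h0 (by simp [h]))⟩
  have hv : v = ∑ k, v k • e k := by
    ext i; fin_cases i <;> simp [e, Fin.sum_univ_three]
  have hbasis : ∀ k, ∫ y, fderiv ℝ η y (e k) • G y = 0 := by
    intro k
    ext ⟨i, j⟩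
    have := ((pr (i, j)).integral_comp_comm (hintG (e k)))
    have h2 : (∫ y, fderiv ℝ η y (e k) • G y) (i, j) = I i j k := by
      rw [hI]; exact this.symm
    rw [h2, hzero]; rfl
  calc ∫ y, fderiv ℝ η y v • G y = ∫ y, ∑ k, v k • (fderiv ℝ η y (e k) • G y) := by
        congr 1
        ext1 y
        conv_lhs => rw [hv]
        rw [map_sum, Finset.sum_smul]
        exact Finset.sum_congr rfl fun k _ => by rw [map_smul, smul_assoc]
    _ = 0 := by
        rw [integral_finsetSum (f := fun k y => v k • (fderiv ℝ η y (e k) • G y)) _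
          fun k _ => (hintG (e k)).smul (v k)]
        refine Finset.sum_eq_zero fun k _ => ?_
        rw [integral_smul, hbasis, smul_zero]

/-- A phase equal to 1 at e_i means that χ_i is a multiple of 2π, and |χ_i| ≤ π leaves only 0.
Taking the closed dual cell costs nothing here and provides compactness in χ later. -/
theorem exists_phase_single_ne_one {χ : R3} (hχ : ∀ i, |χ i| ≤ Real.pi) (h0 : χ ≠ 0) :
    ∃ i, phase χ (EuclideanSpace.single i 1) ≠ 1 := by
  by_contra! h
  refine h0 ?_
  ext i
  have h1 := h i
  rw [phase, Complex.exp_eq_one_iff] at h1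
  obtain ⟨n, hn⟩ := h1
  have h2 : (inner ℝ χ (EuclideanSpace.single i (1 : ℝ)) : ℝ) = χ i := by
    rw [EuclideanSpace.inner_single_right]; simp
  rw [h2] at hn
  have h3 : χ i = n * (2 * Real.pi) := by
    have h4 : (Complex.I * (χ i : ℂ)) = Complex.I * ((n * (2 * Real.pi) : ℝ) : ℂ) := by
      rw [hn]; push_cast; ring
    exact_mod_cast mul_left_cancel₀ Complex.I_ne_zero h4
  have h4 : |(n : ℝ)| * (2 * Real.pi) ≤ Real.pi := by
    have := hχ i
    rwa [h3, abs_mul, abs_of_pos (by positivity : 0 < 2 * Real.pi)] at this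
  have h5 : |(n : ℝ)| < 1 := by
    by_contra! hc
    nlinarith [Real.pi_pos]
  have h6 : n = 0 := Int.abs_lt_one_iff.1 (by exact_mod_cast h5)
  rw [h3, h6]; simp

namespace IsInclusion

variable {S : Set R3}

/-- The kernel of the shifted symmetric gradient on periodic fields consists of the constants for
`χ = 0` and is trivial for the other quasimomenta. -/
theorem exists_const_of_fstrain_tendsto (hS : IsInclusion S) {χ : R3}
    (hχ : ∀ i, |χ i| ≤ Real.pi) {φ : ℕ → R3 → C3} (hφ : ∀ n, IsSmoothPeriodic (φ n)) {u : R3 → C3}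
    {g : R3 → C33} (hu : StronglyMeasurable u) (hg : StronglyMeasurable g)
    (h1 : Tendsto (fun n => ∫⁻ x in stiff S, ‖φ n x - u x‖ₑ ^ 2) atTop (𝓝 0))
    (h2 : Tendsto (fun n => ∫⁻ x in stiff S, ‖grad (φ n) x - g x‖ₑ ^ 2) atTop (𝓝 0))
    (h3 : Tendsto (fun n => ∫⁻ x in stiff S, ‖fstrain χ (φ n) x‖ₑ ^ 2) atTop (𝓝 0)) :
    ∃ a : C3, (χ ≠ 0 → a = 0) ∧ ∀ᵐ y ∂(volume.restrict (stiff S)), u y = a ∧ g y = 0 := by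
  have hphc : Continuous (phase χ) := (contDiff_phase χ).continuous
  have H1 := hS.tendstoL2loc_periodize (fun n => (hφ n).1.continuous)
    (fun n k hk x => (hφ n).apply_add_lattice hk x) hu h1
  have H2 := hS.tendstoL2loc_periodize (fun n => (hφ n).continuous_grad)
    (fun n k hk x => (hφ n).grad_add_lattice hk x) hg h2
  have H3 : TendstoL2loc S (fun n => fstrain χ (φ n)) fun _ => 0 := by
    refine hS.tendstoL2loc_periodize (l := fun _ => (0 : C33)) (fun n => ?_) (fun n k hk x => ?_)
      stronglyMeasurable_const (by simpa using h3)
    · exact symL.continuous.comp ((hφ n).continuous_grad.add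
        (((outerL χ).continuous.comp (hφ n).1.continuous).const_smul Complex.I))
    · rw [fstrain, fstrain, (hφ n).grad_add_lattice hk, (hφ n).apply_add_lattice hk]
  set U : ℕ → R3 → C3 := fun n y => phase χ y • φ n y with hU
  set U' : R3 → C3 := fun y => phase χ y • periodize u y with hU'
  set G' : R3 → C33 := fun y => phase χ y • (periodize g y +
    Complex.I • outerL χ (periodize u y)) with hG'
  have HU : TendstoL2loc S U U' := H1.phase_smul hphc (norm_phase χ)
  have hgrad : ∀ n y, grad (U n) y = phase χ y • (grad (φ n) y + Complex.I • outerL χ (φ n y)) :=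
    fun n y => grad_phase_smul ((hφ n).differentiable y)
  have HG : TendstoL2loc S (fun n => grad (U n)) G' := by
    have := (H2.add ((H1.clm_comp (Complex.I • outerL χ)))).phase_smul hphc (norm_phase χ)
    rw [show (fun n => grad (U n)) = _ from funext fun n => funext (hgrad n)]
    exact this
  have Hsym : TendstoL2loc S (fun n x => symL (grad (U n) x)) fun _ => 0 := by
    have := H3.phase_smul hphc (norm_phase χ)
    simp only [smul_zero] at this
    rw [show (fun n x => symL (grad (U n) x)) = fun n x => phase χ x • fstrain χ (φ n) x from
      funext fun n => funext fun y => symL_grad_phase_smul ((hφ n).differentiable y)]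
    exact this
  have hUs : ∀ n, ContDiff ℝ ∞ (U n) := fun n => (contDiff_phase χ).smul (hφ n).1
  have hUd : ∀ n, Differentiable ℝ (U n) := fun n => (hUs n).differentiable (by simp)
  -- The phase has modulus 1, so the norm of the gradient of `U n` is periodic and hence bounded.
  have hUlip : ∀ n, ∃ K, LipschitzWith K (U n) := by
    intro n
    obtain ⟨M, hM⟩ := isCompact_closure_cell.exists_bound_of_continuousOn
      (HG.continuous n).continuousOn
    have hM' : ∀ y, ‖grad (U n) y‖ ≤ M := by
      intro y
      obtain ⟨k, hk, hkc⟩ := exists_add_lattice_mem_cell y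
      refine le_trans (le_of_eq ?_) (hM _ (subset_closure hkc))
      rw [hgrad, hgrad, norm_smul, norm_smul, norm_phase, norm_phase, (hφ n).grad_add_lattice hk,
        (hφ n).apply_add_lattice hk]
    refine ⟨M.toNNReal, lipschitzWith_of_nnnorm_fderiv_le (hUd n) fun y => ?_⟩
    rw [← NNReal.coe_le_coe, Real.coe_toNNReal _ ((norm_nonneg _).trans (hM' 0))]
    refine ContinuousLinearMap.opNorm_le_bound _ ((norm_nonneg _).trans (hM' 0)) fun z => ?_
    refine (norm_apply_le_gradL _ z).trans ?_
    gcongr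
    exact hM' y
  -- the gradient is constant
  obtain ⟨B, hB⟩ := hS.exists_ae_eq_const HG.integrableOn fun η hη cη hs v =>
    integral_smul_eq_zero_of_symL_tendsto hUlip HG Hsym hη cη hs v hUd
  -- the field is affine
  obtain ⟨a, ha⟩ : ∃ a, ∀ᵐ y, y ∈ perStiff S → U' y - mulVecL B y = a := by
    refine hS.exists_ae_eq_const (HU.sub_const (mulVecL B).continuous).integrableOn ?_
    intro η hη cη hs v
    have l1 := (HU.sub_const (mulVecL B).continuous).tendsto_integral_smul
      (ζ := fun y => fderiv ℝ η y v)
      ((hη.continuous_fderiv (by simp)).clm_apply continuous_const) (cη.fderiv_apply ℝ v)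
      fun y hy => hs (support_fderiv_subset ℝ fun h0 => hy (by simp [h0]))
    have l2 := (((HG.clm_comp (contr v)).sub_const (g := fun _ => contr v B)
      continuous_const)).tendsto_integral_smul hη.continuous cη ((subset_tsupport _).trans hs)
    have l3 : ∫ y, η y • (contr v (G' y) - contr v B) = 0 := by
      refine integral_eq_zero_of_ae ?_
      filter_upwards [hB] with y hy
      by_cases hyS : y ∈ perStiff S
      · rw [hy hyS, sub_self, smul_zero]; rfl
      · rw [image_eq_zero_of_notMem_tsupport fun h => hyS (hs h), zero_smul]; rfl
    rw [l3] at l2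
    have l4 := l2.neg
    rw [neg_zero] at l4
    refine tendsto_nhds_unique l1 (l4.congr fun n => ?_)
    have hd : Differentiable ℝ fun y => U n y - mulVecL B y :=
      (hUd n).sub (mulVecL B).differentiable
    have hdc : Continuous fun y => fderiv ℝ (fun y => U n y - mulVecL B y) y v :=
      (((hUs n).sub (mulVecL B).contDiff).continuous_fderiv (by simp)).clm_apply continuous_const
    have hp := integral_smul_fderiv_eq_neg_fderiv_smul_of_integrable (μ := volume) (𝕜 := ℝ)
      (f := η) (g := fun y => U n y - mulVecL B y) (v := v)
      ((((hη.continuous_fderiv (by simp)).clm_apply continuous_const).smul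
        hd.continuous).integrable_of_hasCompactSupport ((cη.fderiv_apply ℝ v).smul_right))
      ((hη.continuous.smul hdc).integrable_of_hasCompactSupport cη.smul_right)
      ((hη.continuous.smul hd.continuous).integrable_of_hasCompactSupport cη.smul_right)
      (fun y _ => hη.differentiable (by simp) y) (fun y _ => hd y)
    rw [← neg_eq_iff_eq_neg] at hp
    rw [← hp]
    congr 1
    refine integral_congr_ae (Eventually.of_forall fun y => ?_)
    simp only
    rw [fderiv_fun_sub (hUd n y) (mulVecL B).differentiableAt, (mulVecL B).fderiv,
      sub_apply, mulVecL_apply, grad_eq_gradL, contr_gradL]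
  -- comparison of the values near opposite faces
  obtain ⟨r, hr, hball⟩ := hS.exists_ball_subset_perStiff (subset_closure zero_mem_cell)
    hS.zero_notMem_closure
  have hper : ∀ i, ∀ y ∈ Metric.ball (0 : R3) r, a + mulVecL B (y + EuclideanSpace.single i 1) =
      phase χ (EuclideanSpace.single i 1) • (a + mulVecL B y) := by
    intro i
    refine Measure.eqOn_open_of_ae_eq (μ := volume) ?_ Metric.isOpen_ball
      (by fun_prop) (by fun_prop)
    rw [Filter.EventuallyEq, ae_restrict_iff' Metric.isOpen_ball.measurableSet]
    filter_upwards [ha, (quasiMeasurePreserving_add_right volume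
      (EuclideanSpace.single i (1 : ℝ))).ae ha] with y hy1 hy2 hyb
    have k1 := hy1 (hball hyb)
    have k2 := hy2 (add_mem_perStiff (hball hyb) (single_mem_lattice i))
    rw [← k1, sub_add_cancel, k1, ← k2, sub_add_cancel, hU']
    simp only
    rw [periodize_add _ (single_mem_lattice i), phase_add, mul_smul]
  -- The quasi-periodicity of the affine field y ↦ a + By at y = 0.
  have hzero : ∀ i, mulVecL B (EuclideanSpace.single i 1) =
      (phase χ (EuclideanSpace.single i 1) - 1) • a := by
    intro i
    have := hper i 0 (Metric.mem_ball_self hr)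
    rw [zero_add, map_zero, add_zero] at this
    rw [sub_smul, one_smul, ← this]; abel
  have hlin : ∀ i y, (phase χ (EuclideanSpace.single i 1) - 1) • mulVecL B y = 0 := by
    intro i y
    obtain ⟨t, ht, hty⟩ : ∃ t : ℝ, t ≠ 0 ∧ t • y ∈ Metric.ball (0 : R3) r := by
      refine ⟨r / (2 * (‖y‖ + 1)), by positivity, ?_⟩
      rw [mem_ball_zero_iff, norm_smul, Real.norm_of_nonneg (by positivity), div_mul_eq_mul_div,
        div_lt_iff₀ (by positivity)]
      nlinarith [norm_nonneg y]
    have h4 := hper i _ hty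
    rw [map_add, hzero i, smul_add, sub_smul, one_smul] at h4
    have h5 : (phase χ (EuclideanSpace.single i 1) - 1) • mulVecL B (t • y) = 0 := by
      rw [sub_smul, one_smul, sub_eq_zero]
      have h6 : a + (mulVecL B (t • y) + (phase χ (EuclideanSpace.single i 1) • a - a)) =
        phase χ (EuclideanSpace.single i 1) • a + mulVecL B (t • y) := by abel
      rw [h6] at h4
      exact (add_left_cancel h4).symm
    rw [map_smul, smul_comm] at h5
    exact (smul_eq_zero.1 h5).resolve_left ht
  -- For χ = 0 all phases are 1 and `hzero` annihilates every column of B. For χ ≠ 0 some phase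
  -- differs from 1, and `hlin`, the linear part of the quasi-periodicity relation, applies.
  have hB0 : B = 0 := by
    by_cases hχ0 : χ = 0
    · refine eq_zero_of_mulVecL fun j => ?_
      rw [hzero j, hχ0, phase_zero_left, sub_self, zero_smul]
    · obtain ⟨i, hi⟩ := exists_phase_single_ne_one hχ hχ0
      exact eq_zero_of_mulVecL fun j =>
        (smul_eq_zero.1 (hlin i (EuclideanSpace.single j 1))).resolve_left (sub_ne_zero.2 hi)
  have ha0 : χ ≠ 0 → a = 0 := by
    intro hχ0
    obtain ⟨i, hi⟩ := exists_phase_single_ne_one hχ hχ0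
    have h4 := hzero i
    rw [hB0, mulVecL_apply, map_zero] at h4
    exact (smul_eq_zero.1 h4.symm).resolve_left (sub_ne_zero.2 hi)
  refine ⟨a, ha0, ?_⟩
  rw [ae_restrict_iff' hS.measurableSet_stiff]
  filter_upwards [ha, hB] with y hy1 hy2 hys
  have hyS : y ∈ perStiff S := (hS.mem_perStiff_of_mem_cell hys.1).2 hys.2
  have k1 := hy1 hyS
  have k2 := hy2 hyS
  rw [hB0, mulVecL_apply, map_zero, sub_zero] at k1
  simp only [hU'] at k1
  rw [hB0] at k2
  simp only [hG'] at k2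
  rw [periodize_of_mem_cell _ hys.1] at k1
  rw [periodize_of_mem_cell _ hys.1, periodize_of_mem_cell _ hys.1] at k2
  have k3 := (smul_eq_zero.1 k2).resolve_left (phase_ne_zero χ y)
  by_cases hχ0 : χ = 0
  · subst hχ0
    rw [phase_zero_left, one_smul] at k1
    refine ⟨k1, ?_⟩
    have : outerL 0 (u y) = 0 := by ext ij; rw [outerL_apply]; simp
    simpa [this] using k3
  · rw [ha0 hχ0] at k1 ⊢
    have k4 := (smul_eq_zero.1 k1).resolve_left (phase_ne_zero χ y)
    refine ⟨k4, ?_⟩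
    rw [k4, map_zero, smul_zero, add_zero] at k3
    exact k3

end IsInclusion

/-! ### The trace inequality in the half-space -/

/-- The plane. -/
abbrev R2 : Type := EuclideanSpace ℝ (Fin 2)

/-- Integration of radial functions in the plane. -/
theorem lintegral_fun_norm {f : ℝ → ℝ≥0∞} (hf : Measurable f) :
    ∫⁻ x : R2, f ‖x‖ =
      (volume : Measure R2).toSphere univ * ∫⁻ ρ in Ioi (0 : ℝ), ENNReal.ofReal ρ * f ρ := by
  have hm : MeasurableSet ({0}ᶜ : Set R2) := (measurableSet_singleton _).compl
  have hm1 : Measurable fun y : Ioi (0 : ℝ) => f y := hf.comp measurable_subtype_coe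
  have hm2 : Measurable fun p : Metric.sphere (0 : R2) 1 × Ioi (0 : ℝ) => f p.2 :=
    hm1.comp measurable_snd
  calc ∫⁻ x : R2, f ‖x‖ = ∫⁻ x in ({0}ᶜ : Set R2), f ‖x‖ := by rw [restrict_compl_singleton]
    _ = ∫⁻ x : ({0}ᶜ : Set R2), f ‖x.1‖ ∂((volume : Measure R2).comap Subtype.val) :=
        (lintegral_subtype_comap hm fun x => f ‖x‖).symm
    _ = ∫⁻ p, f p.2 ∂((volume : Measure R2).toSphere.prod (.volumeIoiPow (Module.finrank ℝ R2 - 1))) := by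
        rw [← (volume : Measure R2).measurePreserving_homeomorphUnitSphereProd.lintegral_comp hm2]
        simp
    _ = (volume : Measure R2).toSphere univ *
          ∫⁻ y : Ioi (0 : ℝ), f y ∂(.volumeIoiPow (Module.finrank ℝ R2 - 1)) := by
        rw [lintegral_prod _ hm2.aemeasurable]
        simp [mul_comm]
    _ = _ := by
        congr 1
        rw [Measure.volumeIoiPow, lintegral_withDensity_eq_lintegral_mul _ (by fun_prop) hm1]
        rw [← lintegral_subtype_comap measurableSet_Ioi]
        simp

theorem lintegral_Ioc_rpow_neg_half {ρ : ℝ} (hρ : 0 < ρ) :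
    ∫⁻ t in Ioc 0 ρ, ENNReal.ofReal (t ^ (-(1 / 2) : ℝ)) = ENNReal.ofReal (2 * ρ ^ (1 / 2 : ℝ)) := by
  have hi : IntegrableOn (fun t : ℝ => t ^ (-(1 / 2) : ℝ)) (Ioc 0 ρ) :=
    (intervalIntegrable_iff_integrableOn_Ioc_of_le hρ.le).1
      (intervalIntegral.intervalIntegrable_rpow' (by norm_num))
  rw [← ofReal_integral_eq_lintegral_ofReal hi, ← intervalIntegral.integral_of_le hρ.le,
    integral_rpow (Or.inl (by norm_num))]
  · congr 1
    norm_num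
    ring
  · filter_upwards [ae_restrict_mem measurableSet_Ioc] with t ht
    exact Real.rpow_nonneg ht.1.le _

theorem lintegral_Ioi_rpow {t : ℝ} (ht : 0 < t) :
    ∫⁻ ρ in Ioi t, ENNReal.ofReal (2 * ρ ^ (-(3 / 2) : ℝ)) =
      ENNReal.ofReal (4 * t ^ (-(1 / 2) : ℝ)) := by
  have hi : IntegrableOn (fun ρ : ℝ => 2 * ρ ^ (-(3 / 2) : ℝ)) (Ioi t) :=
    (integrableOn_Ioi_rpow_of_lt (by norm_num) ht).const_mul 2
  rw [← ofReal_integral_eq_lintegral_ofReal hi, integral_const_mul,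
    integral_Ioi_rpow_of_lt (by norm_num) ht]
  · congr 1
    norm_num
    ring
  · filter_upwards [ae_restrict_mem measurableSet_Ioi] with ρ hρ
    have : 0 < ρ := ht.trans hρ
    positivity

/-- Cauchy-Schwarz with the weights t^{1/4} and t^{-1/4}. Without weights the integral over ρ that
follows in the trace estimate would diverge logarithmically. -/
theorem sq_lintegral_Ioc_le {N : ℝ → ℝ≥0∞} (hN : Measurable N) {ρ : ℝ} (hρ : 0 < ρ) :
    (∫⁻ t in Ioc 0 ρ, N t) ^ 2 ≤ ENNReal.ofReal (2 * ρ ^ (1 / 2 : ℝ)) *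
      ∫⁻ t in Ioc 0 ρ, ENNReal.ofReal (t ^ (1 / 2 : ℝ)) * N t ^ 2 := by
  have e1 : ∫⁻ t in Ioc 0 ρ, N t = ∫⁻ t in Ioc 0 ρ, ENNReal.ofReal (t ^ (-(1 / 4) : ℝ)) *
      (ENNReal.ofReal (t ^ (1 / 4 : ℝ)) * N t) := by
    refine setLIntegral_congr_fun measurableSet_Ioc fun t ht => ?_
    have h0 : 0 ≤ t ^ (-(1 / 4) : ℝ) := Real.rpow_nonneg ht.1.le _
    rw [← mul_assoc, ← ENNReal.ofReal_mul h0, ← Real.rpow_add ht.1]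
    norm_num
  rw [e1]
  refine (sq_lintegral_mul_le (by fun_prop) (by fun_prop)).trans (le_of_eq ?_)
  congr 1
  · rw [← lintegral_Ioc_rpow_neg_half hρ]
    refine setLIntegral_congr_fun measurableSet_Ioc fun t ht => ?_
    have h0 : 0 ≤ t ^ (-(1 / 4) : ℝ) := Real.rpow_nonneg ht.1.le _
    rw [← ENNReal.ofReal_pow h0, ← Real.rpow_natCast, ← Real.rpow_mul ht.1.le]
    norm_num
  · refine setLIntegral_congr_fun measurableSet_Ioc fun t ht => ?_
    have h0 : 0 ≤ t ^ (1 / 4 : ℝ) := Real.rpow_nonneg ht.1.le _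
    rw [mul_pow, ← ENNReal.ofReal_pow h0, ← Real.rpow_natCast, ← Real.rpow_mul ht.1.le]
    norm_num

/-- A weighted Hardy inequality. -/
theorem lintegral_hardy_le {g : ℝ → ℝ≥0∞} (hg : Measurable g) :
    ∫⁻ ρ in Ioi (0 : ℝ), ENNReal.ofReal (2 * ρ ^ (-(3 / 2) : ℝ)) *
      ∫⁻ t in Ioc 0 ρ, ENNReal.ofReal (t ^ (1 / 2 : ℝ)) * g t ≤ 4 * ∫⁻ t in Ioi (0 : ℝ), g t := by
  set c : ℝ → ℝ≥0∞ := fun ρ => ENNReal.ofReal (2 * ρ ^ (-(3 / 2) : ℝ)) with hc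
  set F : ℝ → ℝ≥0∞ := fun t => ENNReal.ofReal (t ^ (1 / 2 : ℝ)) * g t with hF
  have hcm : Measurable c := by fun_prop
  have hFm : Measurable F := by fun_prop
  have e1 : ∀ ρ, c ρ * ∫⁻ t in Ioc 0 ρ, F t =
      ∫⁻ t in Ioi (0 : ℝ), {p : ℝ × ℝ | p.2 ≤ p.1}.indicator (fun p => c p.1 * F p.2) (ρ, t) := by
    intro ρ
    have : ∀ t, {p : ℝ × ℝ | p.2 ≤ p.1}.indicator (fun p => c p.1 * F p.2) (ρ, t) =
        (Iic ρ).indicator (fun t => c ρ * F t) t := fun t => rfl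
    simp_rw [this]
    rw [setLIntegral_indicator measurableSet_Iic, inter_comm, Ioi_inter_Iic,
      lintegral_const_mul _ hFm]
  have hm : Measurable ({p : ℝ × ℝ | p.2 ≤ p.1}.indicator fun p => c p.1 * F p.2) :=
    ((hcm.comp measurable_fst).mul (hFm.comp measurable_snd)).indicator
      (measurableSet_le measurable_snd measurable_fst)
  -- After the exchange of integrals, integrating the weight over ρ > t gives 4 t^{-1/2}, which
  -- cancels the factor t^{1/2}.
  calc _ = ∫⁻ ρ in Ioi (0 : ℝ), ∫⁻ t in Ioi (0 : ℝ),
        {p : ℝ × ℝ | p.2 ≤ p.1}.indicator (fun p => c p.1 * F p.2) (ρ, t) :=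
        lintegral_congr fun ρ => e1 ρ
    _ = ∫⁻ t in Ioi (0 : ℝ), ∫⁻ ρ in Ioi (0 : ℝ),
        {p : ℝ × ℝ | p.2 ≤ p.1}.indicator (fun p => c p.1 * F p.2) (ρ, t) :=
        lintegral_lintegral_swap hm.aemeasurable
    _ = ∫⁻ t in Ioi (0 : ℝ), 4 * g t := by
        refine setLIntegral_congr_fun measurableSet_Ioi fun t ht => ?_
        have ht : 0 < t := ht
        have : ∀ ρ, {p : ℝ × ℝ | p.2 ≤ p.1}.indicator (fun p => c p.1 * F p.2) (ρ, t) =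
          (Ici t).indicator (fun ρ => c ρ * F t) ρ := fun ρ => rfl
        simp_rw [this]
        rw [setLIntegral_indicator measurableSet_Ici, inter_eq_left.2 (Ici_subset_Ioi.2 ht),
          setLIntegral_congr Ioi_ae_eq_Ici.symm, lintegral_mul_const _ hcm, hc,
          lintegral_Ioi_rpow ht, hF]
        simp only
        rw [← mul_assoc, ← ENNReal.ofReal_mul (by positivity), mul_assoc, ← Real.rpow_add ht]
        norm_num
    _ ≤ _ := (lintegral_const_mul _ hg).le

section Trace

variable {F : Type*} [NormedAddCommGroup F] [NormedSpace ℝ F]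

theorem enorm_sub_le_lintegral_fderiv {w : R2 × ℝ → F} (hw : ContDiff ℝ 1 w) (p q : R2 × ℝ) {ρ : ℝ}
    (hρ : 0 ≤ ρ) :
    ‖w (p + ρ • q) - w p‖ₑ ≤ ∫⁻ t in Ioc 0 ρ, ‖fderiv ℝ w (p + t • q)‖ₑ * ‖q‖ₑ := by
  have h1 : ContDiff ℝ 1 fun t : ℝ => w (p + t • q) := hw.comp (by fun_prop)
  have h2 := enorm_sub_le_lintegral_deriv_of_contDiffOn_Icc h1.contDiffOn hρ
  simp only [zero_smul, add_zero] at h2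
  rw [restrict_Ioc_eq_restrict_Icc]
  refine h2.trans (lintegral_mono fun t => ?_)
  have h3 : HasDerivAt (fun t : ℝ => w (p + t • q)) (fderiv ℝ w (p + t • q) q) t := by
    have h4 : HasDerivAt (fun t : ℝ => p + t • q) q t := by
      simpa using ((hasDerivAt_id t).smul_const q).const_add p
    exact (hw.differentiable (by simp) _).hasFDerivAt.comp_hasDerivAt t h4
  rw [h3.deriv]
  exact ContinuousLinearMap.le_opENorm _ _

variable {w : R2 × ℝ → F}

theorem measurable_enorm_fderiv (hw : ContDiff ℝ 1 w) :
    Measurable fun p : R2 × ℝ => ‖fderiv ℝ w p‖ₑ :=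
  (hw.continuous_fderiv (by simp)).enorm.measurable

theorem measurable_slice (hw : ContDiff ℝ 1 w) :
    Measurable fun t : ℝ => ∫⁻ z : R2, ‖fderiv ℝ w (z, t)‖ₑ ^ 2 :=
  Measurable.lintegral_prod_left ((measurable_enorm_fderiv hw).pow_const 2)

/-- Vertical differences. -/
theorem lintegral_vertical_sub_le (hw : ContDiff ℝ 1 w) {ρ : ℝ} (hρ : 0 < ρ) :
    ∫⁻ z, ‖w (z, ρ) - w (z, 0)‖ₑ ^ 2 ≤ ENNReal.ofReal (2 * ρ ^ (1 / 2 : ℝ)) *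
      ∫⁻ t in Ioc 0 ρ, ENNReal.ofReal (t ^ (1 / 2 : ℝ)) * ∫⁻ z, ‖fderiv ℝ w (z, t)‖ₑ ^ 2 := by
  have hN := measurable_enorm_fderiv hw
  have hm : ∀ z, Measurable fun t : ℝ => ‖fderiv ℝ w (z, t)‖ₑ := fun z =>
    hN.comp measurable_prodMk_left
  calc ∫⁻ z, ‖w (z, ρ) - w (z, 0)‖ₑ ^ 2
      ≤ ∫⁻ z, ENNReal.ofReal (2 * ρ ^ (1 / 2 : ℝ)) * ∫⁻ t in Ioc 0 ρ,
          ENNReal.ofReal (t ^ (1 / 2 : ℝ)) * ‖fderiv ℝ w (z, t)‖ₑ ^ 2 := by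
        refine lintegral_mono fun z => le_trans ?_ (sq_lintegral_Ioc_le (hm z) hρ)
        have h1 := enorm_sub_le_lintegral_fderiv hw (z, 0) (0, 1) hρ.le
        have h2 : ‖((0, 1) : R2 × ℝ)‖ₑ = 1 := by
          rw [← ofReal_norm, Prod.norm_mk]; simp
        simp only [Prod.smul_mk, Prod.mk_add_mk, smul_zero, smul_eq_mul, mul_one, add_zero,
          zero_add, h2] at h1
        gcongr
    _ = ENNReal.ofReal (2 * ρ ^ (1 / 2 : ℝ)) * ∫⁻ z, ∫⁻ t in Ioc 0 ρ,
          ENNReal.ofReal (t ^ (1 / 2 : ℝ)) * ‖fderiv ℝ w (z, t)‖ₑ ^ 2 :=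
        lintegral_const_mul' _ _ ENNReal.ofReal_ne_top
    _ = _ := by
        congr 1
        rw [lintegral_lintegral_swap]
        · exact lintegral_congr fun t => lintegral_const_mul' _ _ ENNReal.ofReal_ne_top
        · exact Measurable.aemeasurable (by
            refine Measurable.mul ?_ (hN.pow_const 2)
            fun_prop)

/-- Horizontal differences. -/
theorem lintegral_horizontal_sub_le (hw : ContDiff ℝ 1 w) (h : R2) (t : ℝ) :
    ∫⁻ z, ‖w (z + h, t) - w (z, t)‖ₑ ^ 2 ≤ ‖h‖ₑ ^ 2 * ∫⁻ z, ‖fderiv ℝ w (z, t)‖ₑ ^ 2 := by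
  have hN := measurable_enorm_fderiv hw
  have hslice : Measurable fun z : R2 => ‖fderiv ℝ w (z, t)‖ₑ := hN.comp measurable_prodMk_right
  have hjoint : Measurable fun p : R2 × ℝ => ‖fderiv ℝ w (p.1 + p.2 • h, t)‖ₑ :=
    hslice.comp (by fun_prop)
  calc ∫⁻ z, ‖w (z + h, t) - w (z, t)‖ₑ ^ 2
      ≤ ∫⁻ z, ‖h‖ₑ ^ 2 * ∫⁻ s in Ioc (0 : ℝ) 1, ‖fderiv ℝ w (z + s • h, t)‖ₑ ^ 2 := by
        refine lintegral_mono fun z => ?_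
        have h1 := enorm_sub_le_lintegral_fderiv hw (z, t) (h, 0) zero_le_one
        have h2 : ‖((h, 0) : R2 × ℝ)‖ₑ = ‖h‖ₑ := by
          rw [← ofReal_norm, Prod.norm_mk]; simp
        simp only [Prod.smul_mk, Prod.mk_add_mk, smul_zero, add_zero, one_smul, h2] at h1
        have hmz : Measurable fun s : ℝ => ‖fderiv ℝ w (z + s • h, t)‖ₑ :=
          hslice.comp (by fun_prop)
        rw [lintegral_mul_const _ hmz] at h1
        calc _ ≤ ((∫⁻ s in Ioc (0 : ℝ) 1, ‖fderiv ℝ w (z + s • h, t)‖ₑ) * ‖h‖ₑ) ^ 2 := by gcongr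
          _ = ‖h‖ₑ ^ 2 * (∫⁻ s in Ioc (0 : ℝ) 1, ‖fderiv ℝ w (z + s • h, t)‖ₑ) ^ 2 := by ring
          _ ≤ _ := by
            gcongr
            simpa using sq_lintegral_le (ν := volume.restrict (Ioc (0 : ℝ) 1)) hmz.aemeasurable
    _ = ‖h‖ₑ ^ 2 * ∫⁻ z, ∫⁻ s in Ioc (0 : ℝ) 1, ‖fderiv ℝ w (z + s • h, t)‖ₑ ^ 2 :=
        lintegral_const_mul' _ _ (by finiteness)
    _ = ‖h‖ₑ ^ 2 * ∫⁻ s in Ioc (0 : ℝ) 1, ∫⁻ z, ‖fderiv ℝ w (z + s • h, t)‖ₑ ^ 2 := by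
        rw [lintegral_lintegral_swap (hjoint.pow_const 2).aemeasurable]
    _ = _ := by
        congr 1
        have : ∀ s : ℝ, ∫⁻ z, ‖fderiv ℝ w (z + s • h, t)‖ₑ ^ 2 =
            ∫⁻ z, ‖fderiv ℝ w (z, t)‖ₑ ^ 2 := fun s =>
          lintegral_add_right_eq_self (fun z => ‖fderiv ℝ w (z, t)‖ₑ ^ 2) (s • h)
        simp_rw [this]
        simp

/-- The trace of a function on the boundary of the half-space lies in `H^{1/2}`. -/
theorem exists_halfSpace_trace : ∃ C : ℝ≥0∞, C ≠ ⊤ ∧ ∀ w : R2 × ℝ → F, ContDiff ℝ 1 w →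
    (∫⁻ z, ‖w (z, 0)‖ₑ ^ 2) + ∫⁻ z, ∫⁻ z', ‖w (z, 0) - w (z', 0)‖ₑ ^ 2 / edist z z' ^ 3 ≤
      C * ((∫⁻ t in Ioi (0 : ℝ), ∫⁻ z, ‖w (z, t)‖ₑ ^ 2) +
        ∫⁻ t in Ioi (0 : ℝ), ∫⁻ z, ‖fderiv ℝ w (z, t)‖ₑ ^ 2) := by
  set c := (volume : Measure R2).toSphere univ with hc
  have hct : c ≠ ⊤ := measure_ne_top _ _
  refine ⟨4 + c * 28, by finiteness, fun w hw => ?_⟩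
  set g : ℝ → ℝ≥0∞ := fun t => ∫⁻ z, ‖fderiv ℝ w (z, t)‖ₑ ^ 2 with hg
  set a : ℝ → ℝ≥0∞ := fun t => ∫⁻ z, ‖w (z, t)‖ₑ ^ 2 with ha
  have hgm : Measurable g := measurable_slice hw
  have hwc : Continuous w := hw.continuous
  have hw0 : ∀ t : ℝ, Continuous fun z : R2 => w (z, t) := fun t => hwc.comp (by fun_prop)
  set A : ℝ → ℝ≥0∞ := fun ρ => ENNReal.ofReal (2 * ρ ^ (1 / 2 : ℝ)) *
    ∫⁻ t in Ioc 0 ρ, ENNReal.ofReal (t ^ (1 / 2 : ℝ)) * g t with hA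
  have hvert : ∀ ρ, 0 < ρ → ∫⁻ z, ‖w (z, ρ) - w (z, 0)‖ₑ ^ 2 ≤ A ρ := fun ρ hρ =>
    lintegral_vertical_sub_le hw hρ
  have hAm : Measurable A := by
    have h1 : Measurable fun ρ : ℝ => ∫⁻ t, {p : ℝ × ℝ | p.2 ∈ Ioc 0 p.1}.indicator
        (fun p => ENNReal.ofReal (p.2 ^ (1 / 2 : ℝ)) * g p.2) (ρ, t) := by
      refine Measurable.lintegral_prod_right' (f := {p : ℝ × ℝ | p.2 ∈ Ioc 0 p.1}.indicator
        (fun p => ENNReal.ofReal (p.2 ^ (1 / 2 : ℝ)) * g p.2)) ?_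
      refine Measurable.indicator (by fun_prop) ?_
      exact (measurableSet_lt measurable_const measurable_snd).inter
        (measurableSet_le measurable_snd measurable_fst)
    have h2 : ∀ ρ, ∫⁻ t in Ioc 0 ρ, ENNReal.ofReal (t ^ (1 / 2 : ℝ)) * g t =
        ∫⁻ t, {p : ℝ × ℝ | p.2 ∈ Ioc 0 p.1}.indicator
        (fun p => ENNReal.ofReal (p.2 ^ (1 / 2 : ℝ)) * g p.2) (ρ, t) := fun ρ => by
      rw [← lintegral_indicator measurableSet_Ioc]; rfl
    simp only [hA, h2]
    exact Measurable.mul (by fun_prop) h1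
  -- the trace in `L²`
  have hL2 : ∫⁻ z, ‖w (z, 0)‖ₑ ^ 2 ≤ 4 * ((∫⁻ t in Ioi (0 : ℝ), a t) + ∫⁻ t in Ioi (0 : ℝ), g t) := by
    set I := ∫⁻ t in Ioi (0 : ℝ), g t
    -- The boundary values are compared with the values at an arbitrary height t ≤ 1; averaging over
    -- t then gives the bound.
    have h1 : ∀ t ∈ Ioc (0 : ℝ) 1, ∫⁻ z, ‖w (z, 0)‖ₑ ^ 2 ≤ 2 * a t + 4 * I := by
      intro t ht
      calc ∫⁻ z, ‖w (z, 0)‖ₑ ^ 2 ≤ ∫⁻ z, (2 * ‖w (z, t)‖ₑ ^ 2 + 2 * ‖w (z, t) - w (z, 0)‖ₑ ^ 2) := by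
            refine lintegral_mono fun z => ?_
            have := enorm_add_sq_le (w (z, t)) (-(w (z, t) - w (z, 0)))
            rwa [enorm_neg, neg_sub, add_sub_cancel] at this
        _ = 2 * a t + 2 * ∫⁻ z, ‖w (z, t) - w (z, 0)‖ₑ ^ 2 := by
            rw [lintegral_add_left (((hw0 t).enorm.measurable.pow_const 2).const_mul 2),
              lintegral_const_mul' _ _ (by simp), lintegral_const_mul' _ _ (by simp)]
        _ ≤ 2 * a t + 2 * (2 * I) := by
            gcongr
            refine (hvert t ht.1).trans (mul_le_mul' ?_ ?_)
            · rw [show (2 : ℝ≥0∞) = ENNReal.ofReal 2 by simp]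
              refine ENNReal.ofReal_le_ofReal ?_
              have := Real.rpow_le_one ht.1.le ht.2 (by norm_num : (0 : ℝ) ≤ 1 / 2)
              linarith
            · calc _ ≤ ∫⁻ s in Ioc 0 t, g s := by
                    refine setLIntegral_mono' measurableSet_Ioc fun s hs => ?_
                    refine mul_le_of_le_one_left' ?_
                    rw [ENNReal.ofReal_le_one]
                    exact Real.rpow_le_one hs.1.le (hs.2.trans ht.2) (by norm_num)
                _ ≤ I := lintegral_mono_set Ioc_subset_Ioi_self
        _ = _ := by ring
    calc ∫⁻ z, ‖w (z, 0)‖ₑ ^ 2 = ∫⁻ _t in Ioc (0 : ℝ) 1, ∫⁻ z, ‖w (z, 0)‖ₑ ^ 2 := by simp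
      _ ≤ ∫⁻ t in Ioc (0 : ℝ) 1, (2 * a t + 4 * I) := setLIntegral_mono' measurableSet_Ioc h1
      _ = 2 * (∫⁻ t in Ioc (0 : ℝ) 1, a t) + 4 * I := by
          rw [lintegral_add_right _ measurable_const, lintegral_const_mul' _ _ (by simp)]
          simp
      _ ≤ 4 * (∫⁻ t in Ioi (0 : ℝ), a t) + 4 * I := by
          gcongr
          · norm_num
          · exact Ioc_subset_Ioi_self
      _ = _ := by ring
  -- the double integral
  set f : ℝ → ℝ≥0∞ := fun ρ => ENNReal.ofReal ((ρ ^ 3)⁻¹) * (6 * A ρ + 4 * (ENNReal.ofReal ρ ^ 2 * g ρ))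
    with hf
  have hfm : Measurable f := by fun_prop
  have hdiff : ∀ h : R2, ∫⁻ z, ‖w (z, 0) - w (z + h, 0)‖ₑ ^ 2 / edist z (z + h) ^ 3 ≤ f ‖h‖ := by
    intro h
    rcases eq_or_ne h 0 with rfl | h0
    · simp
    have hρ : 0 < ‖h‖ := norm_pos_iff.2 h0
    have hed : ∀ z, edist z (z + h) = ‖h‖ₑ := fun z => by
      rw [edist_comm, edist_eq_enorm_sub, add_sub_cancel_left]
    have hinv : (‖h‖ₑ ^ 3)⁻¹ = ENNReal.ofReal ((‖h‖ ^ 3)⁻¹) := by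
      rw [ENNReal.ofReal_inv_of_pos (by positivity), ENNReal.ofReal_pow (norm_nonneg _), ofReal_norm]
    simp_rw [hed, div_eq_mul_inv, hinv]
    rw [lintegral_mul_const' _ _ ENNReal.ofReal_ne_top, mul_comm, hf]
    refine mul_le_mul' le_rfl ?_
    have m1 : ∀ s t : ℝ, Measurable fun z => ‖w (z, s) - w (z, t)‖ₑ ^ 2 := fun s t =>
      ((hw0 s).sub (hw0 t)).enorm.measurable.pow_const 2
    have m2 : Measurable fun z => ‖w (z + h, ‖h‖) - w (z, ‖h‖)‖ₑ ^ 2 :=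
      (((hw0 _).comp (by fun_prop : Continuous fun z : R2 => z + h)).sub
        (hw0 _)).enorm.measurable.pow_const 2
    -- The points (z, 0) and (z + h, 0) are joined by going up to the height |h|, across and down
    -- again. The two vertical parts have the same integral by translation invariance, which
    -- explains 6 = 4 + 2.
    calc ∫⁻ z, ‖w (z, 0) - w (z + h, 0)‖ₑ ^ 2
        ≤ ∫⁻ z, (4 * ‖w (z, ‖h‖) - w (z, 0)‖ₑ ^ 2 + 4 * ‖w (z + h, ‖h‖) - w (z, ‖h‖)‖ₑ ^ 2 +
            2 * ‖w (z + h, ‖h‖) - w (z + h, 0)‖ₑ ^ 2) := by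
          refine lintegral_mono fun z => ?_
          have i1 := enorm_add_sq_le ((w (z, ‖h‖) - w (z, 0)) + (w (z + h, ‖h‖) - w (z, ‖h‖)))
            (-(w (z + h, ‖h‖) - w (z + h, 0)))
          have i2 := enorm_add_sq_le (w (z, ‖h‖) - w (z, 0)) (w (z + h, ‖h‖) - w (z, ‖h‖))
          have i3 : (w (z, ‖h‖) - w (z, 0)) + (w (z + h, ‖h‖) - w (z, ‖h‖)) +
            (-(w (z + h, ‖h‖) - w (z + h, 0))) = -(w (z, 0) - w (z + h, 0)) := by abel
          rw [i3, enorm_neg, enorm_neg] at i1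
          refine i1.trans ?_
          gcongr
          refine (mul_le_mul' le_rfl i2).trans (le_of_eq ?_)
          ring
      _ = 4 * (∫⁻ z, ‖w (z, ‖h‖) - w (z, 0)‖ₑ ^ 2) + 4 * (∫⁻ z, ‖w (z + h, ‖h‖) - w (z, ‖h‖)‖ₑ ^ 2)
            + 2 * ∫⁻ z, ‖w (z + h, ‖h‖) - w (z + h, 0)‖ₑ ^ 2 := by
          have m3 : Measurable fun z => 4 * ‖w (z, ‖h‖) - w (z, 0)‖ₑ ^ 2 +
              4 * ‖w (z + h, ‖h‖) - w (z, ‖h‖)‖ₑ ^ 2 := ((m1 _ _).const_mul 4).add (m2.const_mul 4)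
          rw [lintegral_add_left m3, lintegral_add_left ((m1 _ _).const_mul 4), lintegral_const_mul' _ _ (by simp),
            lintegral_const_mul' _ _ (by simp), lintegral_const_mul' _ _ (by simp)]
      _ ≤ 4 * A ‖h‖ + 4 * (‖h‖ₑ ^ 2 * g ‖h‖) + 2 * A ‖h‖ := by
          have k1 := hvert ‖h‖ hρ
          have k2 : ∫⁻ z, ‖w (z + h, ‖h‖) - w (z + h, 0)‖ₑ ^ 2 =
              ∫⁻ z, ‖w (z, ‖h‖) - w (z, 0)‖ₑ ^ 2 :=
            lintegral_add_right_eq_self (fun z => ‖w (z, ‖h‖) - w (z, 0)‖ₑ ^ 2) h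
          have k3 := lintegral_horizontal_sub_le hw h ‖h‖
          rw [k2]
          exact add_le_add (add_le_add (mul_le_mul' le_rfl k1) (mul_le_mul' le_rfl k3))
            (mul_le_mul' le_rfl k1)
      _ = _ := by rw [ofReal_norm]; ring
  have hJ : ∫⁻ z, ∫⁻ z', ‖w (z, 0) - w (z', 0)‖ₑ ^ 2 / edist z z' ^ 3 ≤
      c * (28 * ∫⁻ t in Ioi (0 : ℝ), g t) := by
    have hmeas : Measurable fun p : R2 × R2 =>
        ‖w (p.1, 0) - w (p.1 + p.2, 0)‖ₑ ^ 2 / edist p.1 (p.1 + p.2) ^ 3 := by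
      refine Measurable.div (Measurable.pow_const ?_ 2) (Measurable.pow_const ?_ 3)
      · exact (((hw0 0).comp continuous_fst).sub
          ((hw0 0).comp (continuous_fst.add continuous_snd))).enorm.measurable
      · exact (continuous_fst.edist (continuous_fst.add continuous_snd)).measurable
    calc _ = ∫⁻ z, ∫⁻ h, ‖w (z, 0) - w (z + h, 0)‖ₑ ^ 2 / edist z (z + h) ^ 3 :=
          lintegral_congr fun z => (lintegral_add_left_eq_self
            (fun z' => ‖w (z, 0) - w (z', 0)‖ₑ ^ 2 / edist z z' ^ 3) z).symm
      _ = ∫⁻ h, ∫⁻ z, ‖w (z, 0) - w (z + h, 0)‖ₑ ^ 2 / edist z (z + h) ^ 3 :=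
          lintegral_lintegral_swap hmeas.aemeasurable
      _ ≤ ∫⁻ h, f ‖h‖ := lintegral_mono hdiff
      _ = c * ∫⁻ ρ in Ioi (0 : ℝ), ENNReal.ofReal ρ * f ρ := lintegral_fun_norm hfm
      _ = c * ∫⁻ ρ in Ioi (0 : ℝ), (6 * (ENNReal.ofReal (2 * ρ ^ (-(3 / 2) : ℝ)) *
            ∫⁻ t in Ioc 0 ρ, ENNReal.ofReal (t ^ (1 / 2 : ℝ)) * g t) + 4 * g ρ) := by
          congr 1
          refine setLIntegral_congr_fun measurableSet_Ioi fun ρ hρ => ?_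
          have hρ : 0 < ρ := hρ
          simp only [hf, hA]
          have e1 : ENNReal.ofReal ρ * ENNReal.ofReal ((ρ ^ 3)⁻¹) *
              ENNReal.ofReal (2 * ρ ^ (1 / 2 : ℝ)) = ENNReal.ofReal (2 * ρ ^ (-(3 / 2) : ℝ)) := by
            rw [← ENNReal.ofReal_mul hρ.le, ← ENNReal.ofReal_mul (by positivity)]
            congr 1
            have : ρ ^ (1 / 2 : ℝ) = ρ ^ (-(3 / 2) : ℝ) * ρ ^ 2 := by
              rw [← Real.rpow_natCast, ← Real.rpow_add hρ]; norm_num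
            rw [this]
            field_simp
          have e2 : ENNReal.ofReal ρ * ENNReal.ofReal ((ρ ^ 3)⁻¹) * ENNReal.ofReal ρ ^ 2 = 1 := by
            rw [← ENNReal.ofReal_pow hρ.le, ← ENNReal.ofReal_mul hρ.le,
              ← ENNReal.ofReal_mul (by positivity), ← ENNReal.ofReal_one]
            congr 1
            field_simp
          rw [← e1]
          calc _ = 6 * (ENNReal.ofReal ρ * ENNReal.ofReal ((ρ ^ 3)⁻¹) *
                ENNReal.ofReal (2 * ρ ^ (1 / 2 : ℝ)) *
                ∫⁻ t in Ioc 0 ρ, ENNReal.ofReal (t ^ (1 / 2 : ℝ)) * g t) +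
                4 * ((ENNReal.ofReal ρ * ENNReal.ofReal ((ρ ^ 3)⁻¹) * ENNReal.ofReal ρ ^ 2) * g ρ) := by
                  ring
            _ = _ := by rw [e2, one_mul]
      _ ≤ c * (6 * (4 * ∫⁻ t in Ioi (0 : ℝ), g t) + 4 * ∫⁻ t in Ioi (0 : ℝ), g t) := by
          refine mul_le_mul' le_rfl ?_
          rw [lintegral_add_right _ (hgm.const_mul 4), lintegral_const_mul' _ _ (by simp),
            lintegral_const_mul' _ _ (by simp)]
          exact add_le_add (mul_le_mul' le_rfl (lintegral_hardy_le hgm)) le_rfl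
      _ = _ := by ring
  calc _ ≤ 4 * ((∫⁻ t in Ioi (0 : ℝ), a t) + ∫⁻ t in Ioi (0 : ℝ), g t) +
        c * (28 * ∫⁻ t in Ioi (0 : ℝ), g t) := add_le_add hL2 hJ
    _ ≤ 4 * ((∫⁻ t in Ioi (0 : ℝ), a t) + ∫⁻ t in Ioi (0 : ℝ), g t) +
        c * (28 * ((∫⁻ t in Ioi (0 : ℝ), a t) + ∫⁻ t in Ioi (0 : ℝ), g t)) := by
        gcongr; exact le_add_self
    _ = _ := by ring

end Trace

/-! ### Flattening the interface -/

/-- The identification of `ℝ² × ℝ` with `ℝ³`. -/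
def packL : R2 × ℝ →L[ℝ] R3 :=
  LinearMap.toContinuousLinearMap
    { toFun := fun p => !₂[p.1 0, p.1 1, p.2]
      map_add' := fun _ _ => by ext i; fin_cases i <;> simp
      map_smul' := fun _ _ => by ext i; fin_cases i <;> simp }

theorem packL_apply (p : R2 × ℝ) : packL p = !₂[p.1 0, p.1 1, p.2] := rfl

theorem projL_packL (p : R2 × ℝ) : projL (packL p) = p.1 := by
  ext i; fin_cases i <;> simp [projL_apply, packL_apply]

theorem packL_projL (x : R3) : packL (projL x, x 2) = x := by
  ext i; fin_cases i <;> simp [projL_apply, packL_apply]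

theorem norm_projL_le (x : R3) : ‖projL x‖ ≤ ‖x‖ := by
  rw [← sq_le_sq₀ (norm_nonneg _) (norm_nonneg _), EuclideanSpace.norm_sq_eq,
    EuclideanSpace.norm_sq_eq, Fin.sum_univ_two, Fin.sum_univ_three]
  have h0 : projL x 0 = x 0 := rfl
  have h1 : projL x 1 = x 1 := rfl
  rw [h0, h1]
  linarith [sq_nonneg ‖x 2‖]

theorem measurePreserving_packL : MeasurePreserving packL (volume : Measure (R2 × ℝ)) volume := by
  have h1 : MeasurePreserving (Prod.map (WithLp.ofLp : R2 → Fin 2 → ℝ) (id : ℝ → ℝ)) volume volume :=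
    (PiLp.volume_preserving_ofLp (Fin 2)).prod (MeasurePreserving.id volume)
  have h2 : MeasurePreserving (Prod.swap : (Fin 2 → ℝ) × ℝ → ℝ × (Fin 2 → ℝ)) volume volume :=
    Measure.measurePreserving_swap
  have h3 := (volume_preserving_piFinSuccAbove (fun _ : Fin 3 => ℝ) 2).symm
  have h4 : MeasurePreserving (WithLp.toLp 2 : (Fin 3 → ℝ) → R3) volume volume :=
    PiLp.volume_preserving_toLp (Fin 3)
  have h5 := h4.comp (h3.comp (h2.comp h1))
  have h6 : (packL : R2 × ℝ → R3) = (WithLp.toLp 2 : (Fin 3 → ℝ) → R3) ∘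
      ((MeasurableEquiv.piFinSuccAbove (fun _ : Fin 3 => ℝ) 2).symm ∘ (Prod.swap ∘
        Prod.map (WithLp.ofLp : R2 → Fin 2 → ℝ) (id : ℝ → ℝ))) := by
    funext p
    ext i
    fin_cases i <;> rfl
  rw [h6]
  exact h5

/-- The map flattening the interface: `(z, t)` is sent to the point at depth `t` below the graph
of `γ` over `z`. -/
def flatMap (Φ : R3 ≃ᵃⁱ[ℝ] R3) (γ : R2 → ℝ) (p : R2 × ℝ) : R3 :=
  Φ.symm (packL (p.1, γ p.1 - p.2))

variable (Φ : R3 ≃ᵃⁱ[ℝ] R3) {γ : R2 → ℝ}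

theorem projL_flatMap (p : R2 × ℝ) : projL (Φ (flatMap Φ γ p)) = p.1 := by
  rw [flatMap, AffineIsometryEquiv.apply_symm_apply, projL_packL]

theorem graphFun_flatMap (p : R2 × ℝ) : graphFun Φ γ (flatMap Φ γ p) = -p.2 := by
  rw [graphFun, projL_flatMap, flatMap, AffineIsometryEquiv.apply_symm_apply]
  simp [packL_apply]

theorem flatMap_inverse (x : R3) : flatMap Φ γ (projL (Φ x), -graphFun Φ γ x) = x := by
  rw [flatMap, graphFun]
  simp only [sub_neg_eq_add, add_sub_cancel]
  rw [packL_projL, AffineIsometryEquiv.symm_apply_apply]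

theorem affineIsometryEquiv_apply (x : R3) : Φ x = Φ.linearIsometryEquiv x + Φ 0 := by
  have := Φ.map_vadd 0 x
  simpa [vadd_eq_add] using this

theorem measurePreserving_affineIsometryEquiv : MeasurePreserving Φ volume volume := by
  have h := (measurePreserving_add_right (volume : Measure R3) (Φ 0)).comp
    Φ.linearIsometryEquiv.measurePreserving
  rwa [show (Φ : R3 → R3) = (fun x => x + Φ 0) ∘ Φ.linearIsometryEquiv from
    funext (affineIsometryEquiv_apply Φ)]

theorem contDiff_affineIsometryEquiv : ContDiff ℝ 1 Φ := by
  rw [show (Φ : R3 → R3) = fun x => Φ.linearIsometryEquiv x + Φ 0 from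
    funext (affineIsometryEquiv_apply Φ)]
  exact (Φ.linearIsometryEquiv.contDiff).add contDiff_const

theorem contDiff_flatMap (hγ : ContDiff ℝ 1 γ) : ContDiff ℝ 1 (flatMap Φ γ) :=
  (contDiff_affineIsometryEquiv Φ.symm).comp (packL.contDiff.comp
    (contDiff_fst.prodMk ((hγ.comp contDiff_fst).sub contDiff_snd)))

/-- On each vertical line the map is t ↦ γ(z) - t, and an isometry follows; so it preserves volume
for any continuous γ, and no Jacobians appear in the trace estimate. -/
theorem measurePreserving_flatMap (hγ : Continuous γ) :
    MeasurePreserving (flatMap Φ γ) volume volume := by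
  have h1 : MeasurePreserving (fun p : R2 × ℝ => (p.1, γ p.1 - p.2)) volume volume :=
    (MeasurePreserving.id (volume : Measure R2)).skew_product (g := fun z t => γ z - t)
      (by
        have : Continuous fun p : R2 × ℝ => γ p.1 - p.2 := by fun_prop
        exact this.measurable)
      (Eventually.of_forall fun z => (Measure.measurePreserving_sub_left volume (γ z)).map_eq)
  exact (measurePreserving_affineIsometryEquiv Φ.symm).comp (measurePreserving_packL.comp h1)

/-- The surface measure is controlled by the plane measure in a chart. -/
theorem exists_surf_le {S : Set R3} (hγ : ContDiff ℝ 1 γ) {x₀ : R3} {ρ : ℝ}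
    (h0 : ∀ x ∈ frontier S ∩ Metric.closedBall x₀ ρ, graphFun Φ γ x = 0) :
    ∃ C : ℝ≥0∞, C ≠ ⊤ ∧ ∀ f : R3 → ℝ≥0∞, Measurable f →
      ∫⁻ x in Metric.closedBall x₀ ρ, f x ∂(surf S) ≤
        C * ∫⁻ z in Metric.closedBall (projL (Φ x₀)) ρ, f (flatMap Φ γ (z, 0)) := by
  set D := Metric.closedBall (projL (Φ x₀)) ρ
  set G : R2 → R3 := fun z => flatMap Φ γ (z, 0) with hG
  have hGc : ContDiff ℝ 1 G := (contDiff_flatMap Φ hγ).comp (by fun_prop)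
  obtain ⟨M, hM⟩ := (isCompact_closedBall (projL (Φ x₀)) ρ).exists_bound_of_continuousOn
    (hGc.continuous_fderiv (by simp)).continuousOn
  have hL : LipschitzOnWith M.toNNReal G D := by
    refine Convex.lipschitzOnWith_of_nnnorm_fderiv_le (𝕜 := ℝ)
      (fun z _ => hGc.differentiable (by simp) z) (fun z hz => ?_) (convex_closedBall _ _)
    rw [← NNReal.coe_le_coe, coe_nnnorm]
    exact (hM z hz).trans (Real.le_coe_toNNReal M)
  refine ⟨(M.toNNReal : ℝ≥0∞) ^ (2 : ℝ), by finiteness, fun f hf => ?_⟩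
  -- The part of the frontier in the ball lies on the graph, which is the image of a disc under a
  -- Lipschitz map. Such a map multiplies two-dimensional Hausdorff measure by at most the square of
  -- its constant, and in the plane that measure, as normalised, is Lebesgue measure.
  have hle : (surf S).restrict (Metric.closedBall x₀ ρ) ≤
      ((M.toNNReal : ℝ≥0∞) ^ (2 : ℝ)) • (volume.restrict D).map G := by
    refine Measure.le_iff.2 fun A hA => ?_
    rw [Measure.restrict_apply hA, surf, Measure.restrict_apply (hA.inter measurableSet_closedBall),
      Measure.smul_apply, Measure.map_apply hGc.continuous.measurable hA,
      Measure.restrict_apply (hGc.continuous.measurable hA)]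
    have hsub : A ∩ Metric.closedBall x₀ ρ ∩ frontier S ⊆ G '' (G ⁻¹' A ∩ D) := by
      rintro x ⟨⟨hxA, hxB⟩, hxS⟩
      have hx : G (projL (Φ x)) = x := by
        have := flatMap_inverse Φ (γ := γ) x
        rwa [h0 x ⟨hxS, hxB⟩, neg_zero] at this
      refine ⟨projL (Φ x), ⟨?_, ?_⟩, hx⟩
      · rwa [mem_preimage, hx]
      · rw [Metric.mem_closedBall, dist_eq_norm, ← map_sub]
        refine (norm_projL_le _).trans ?_
        rw [← dist_eq_norm, Φ.dist_map]
        exact hxB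
    refine (measure_mono hsub).trans ?_
    rw [← EuclideanSpace.euclideanHausdorffMeasure_eq_volume 2,
      Measure.euclideanHausdorffMeasure_def, Measure.euclideanHausdorffMeasure_def,
      Measure.smul_apply, Measure.smul_apply]
    have := (hL.mono inter_subset_right).hausdorffMeasure_image_le (s := G ⁻¹' A ∩ D)
      (d := (2 : ℕ)) (by norm_num)
    simp only [ENNReal.smul_def, smul_eq_mul] at this ⊢
    calc _ ≤ _ := mul_le_mul' le_rfl this
      _ = _ := by push_cast; ring
  calc ∫⁻ x in Metric.closedBall x₀ ρ, f x ∂(surf S)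
      ≤ ∫⁻ x, f x ∂(((M.toNNReal : ℝ≥0∞) ^ (2 : ℝ)) • (volume.restrict D).map G) :=
        lintegral_mono' hle le_rfl
    _ = _ := by
        rw [lintegral_smul_measure, lintegral_map hf hGc.continuous.measurable]
        rfl

/-! ### The trace inequality -/

theorem norm_fderiv_le_norm_grad (φ : R3 → C3) (x : R3) : ‖fderiv ℝ φ x‖ ≤ ‖grad φ x‖ :=
  ContinuousLinearMap.opNorm_le_bound _ (norm_nonneg _) fun z => norm_apply_le_gradL _ z

/-- Measurability of the integrand of the Gagliardo seminorm. -/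
theorem measurable_kernel {α : Type*} [MeasurableSpace α] {f : R3 → C3} (hf : Continuous f)
    {a b : α → R3} (ha : Measurable a) (hb : Measurable b) :
    Measurable fun p => ‖f (a p) - f (b p)‖ₑ ^ 2 / edist (a p) (b p) ^ 3 :=
  (((hf.measurable.comp ha).sub (hf.measurable.comp hb)).enorm.pow_const 2).div
    ((ha.edist hb).pow_const 3)

namespace IsInclusion

variable {S : Set R3}

set_option maxHeartbeats 400000 in
/-- The trace inequality near a point of the interface. -/
theorem exists_local_trace (hS : IsInclusion S) {x₀ : R3} (hx₀ : x₀ ∈ frontier S) :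
    ∃ r > 0, surf S (Metric.ball x₀ r) < ⊤ ∧ ∃ C : ℝ≥0∞, C ≠ ⊤ ∧ ∀ φ : R3 → C3, ContDiff ℝ 1 φ →
      (∫⁻ x in Metric.ball x₀ r, ‖φ x‖ₑ ^ 2 ∂(surf S)) +
        ∫⁻ x in Metric.ball x₀ r, ∫⁻ y in Metric.ball x₀ r,
          ‖φ x - φ y‖ₑ ^ 2 / edist x y ^ 3 ∂(surf S) ∂(surf S) ≤
        C * ((∫⁻ x in stiff S, ‖φ x‖ₑ ^ 2) + ∫⁻ x in stiff S, ‖grad φ x‖ₑ ^ 2) := by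
  obtain ⟨Φ, γ, K, ρ, hγ, hδ, hρ, hcell, hSδ⟩ := hS.exists_chart hx₀
  set δ := graphFun Φ γ with hδdef
  set Ψ := flatMap Φ γ with hΨdef
  have hδc : Continuous δ := hδ.contDiff.continuous
  have hΨ : ContDiff ℝ 1 Ψ := contDiff_flatMap Φ hγ
  have hΨm := measurePreserving_flatMap Φ hγ.continuous
  have h0 : ∀ x ∈ frontier S ∩ Metric.closedBall x₀ (ρ / 2), δ x = 0 := by
    rintro x ⟨hx, hxB⟩
    refine graphFun_eq_zero hx hS.isOpen hδc (half_pos hρ) fun y hy => hSδ y ?_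
    refine Metric.closedBall_subset_closedBall' ?_ hy
    have : dist x x₀ ≤ ρ / 2 := hxB
    linarith
  obtain ⟨C₁, hC₁, hsurf⟩ := exists_surf_le Φ hγ h0
  set D := Metric.closedBall (projL (Φ x₀)) (ρ / 2)
  have hball : Metric.ball x₀ (ρ / 2) ⊆ Metric.closedBall x₀ (ρ / 2) := Metric.ball_subset_closedBall
  let θ : ContDiffBump x₀ := ⟨ρ / 2, ρ, by positivity, by linarith⟩
  have hθ : ContDiff ℝ 1 θ := θ.contDiff
  obtain ⟨L, hL⟩ := (θ.hasCompactSupport.fderiv ℝ).exists_bound_of_continuous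
    (hθ.continuous_fderiv (by simp))
  have hL0 : 0 ≤ L := (norm_nonneg _).trans (hL x₀)
  -- a bound for the derivative of the flattening map
  obtain ⟨M, hM⟩ : ∃ M : ℝ, ∀ p, Ψ p ∈ Metric.closedBall x₀ ρ → ‖fderiv ℝ Ψ p‖ ≤ M := by
    have hinv : Continuous fun x => (projL (Φ x), -δ x) :=
      (projL.continuous.comp Φ.continuous).prodMk hδc.neg
    obtain ⟨M, hM⟩ := ((isCompact_closedBall x₀ ρ).image hinv).exists_bound_of_continuousOn
      (hΨ.continuous_fderiv (by simp)).continuousOn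
    refine ⟨M, fun p hp => hM p ⟨Ψ p, hp, ?_⟩⟩
    simp only
    rw [hδdef, hΨdef, projL_flatMap, graphFun_flatMap, neg_neg]
  have hM0 : 0 ≤ M := by
    have h1 : Ψ (projL (Φ x₀), -δ x₀) = x₀ := flatMap_inverse Φ x₀
    exact (norm_nonneg _).trans (hM _ (by rw [h1]; exact Metric.mem_closedBall_self hρ.le))
  obtain ⟨C₂, hC₂, htrace⟩ := exists_halfSpace_trace (F := C3)
  set c₃ := ENNReal.ofReal (2 * (M * (1 + L)) ^ 2)
  refine ⟨ρ / 2, half_pos hρ, ?_, (C₁ + C₁ * C₁) * (C₂ * (1 + c₃)), by finiteness, fun φ hφ => ?_⟩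
  · have := hsurf (fun _ => 1) measurable_const
    simp only [setLIntegral_one] at this
    exact (measure_mono hball).trans_lt (this.trans_lt
      (ENNReal.mul_lt_top hC₁.lt_top measure_closedBall_lt_top))
  set f : R3 → C3 := fun x => θ x • φ x with hf
  have hfc : ContDiff ℝ 1 f := hθ.smul hφ
  have hfφ : ∀ x ∈ Metric.ball x₀ (ρ / 2), φ x = f x := fun x hx => by
    rw [hf]; simp only
    rw [θ.one_of_mem_closedBall (Metric.ball_subset_closedBall hx), one_smul]
  have hts : tsupport f ⊆ Metric.closedBall x₀ ρ :=
    (tsupport_smul_subset_left _ _).trans θ.tsupport_eq.le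
  have hfle : ∀ x, ‖f x‖ ≤ ‖φ x‖ := fun x => by
    rw [hf]; simp only
    rw [norm_smul, Real.norm_of_nonneg θ.nonneg]
    exact mul_le_of_le_one_left (norm_nonneg _) θ.le_one
  have hdle : ∀ x, ‖fderiv ℝ f x‖ ≤ (1 + L) * (‖grad φ x‖ + ‖φ x‖) := fun x => by
    have h1 : HasFDerivAt f (θ x • fderiv ℝ φ x + (fderiv ℝ θ x).smulRight (φ x)) x :=
      (hθ.differentiable (by simp) x).hasFDerivAt.smul (hφ.differentiable (by simp) x).hasFDerivAt
    rw [h1.fderiv]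
    refine (norm_add_le _ _).trans ?_
    rw [norm_smul, Real.norm_of_nonneg θ.nonneg, ContinuousLinearMap.norm_smulRight_apply]
    have h2 : θ x * ‖fderiv ℝ φ x‖ ≤ ‖grad φ x‖ :=
      (mul_le_of_le_one_left (norm_nonneg _) θ.le_one).trans (norm_fderiv_le_norm_grad φ x)
    have h3 : ‖fderiv ℝ θ x‖ * ‖φ x‖ ≤ L * ‖φ x‖ := by gcongr; exact hL x
    nlinarith [norm_nonneg (grad φ x), norm_nonneg (φ x), mul_nonneg hL0 (norm_nonneg (grad φ x))]
  set w : R2 × ℝ → C3 := fun p => f (Ψ p) with hw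
  have hwc : ContDiff ℝ 1 w := hfc.comp hΨ
  have hT := htrace w hwc
  -- the right-hand side
  set T : Set R3 := {x | δ x < 0} ∩ Metric.closedBall x₀ ρ with hTdef
  have hTm : MeasurableSet T :=
    (isOpen_lt hδc continuous_const).measurableSet.inter measurableSet_closedBall
  have hTs : T ⊆ stiff S := fun x hx =>
    ⟨interior_subset (hcell hx.2), fun h => lt_asymm ((hSδ x hx.2).1 h) hx.1⟩
  -- The half-space t > 0 is mapped below the graph, and there the support of the cut-off field lies
  -- in T, a subset of `stiff S`. As the flattening preserves measure, half-space integrals are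
  -- bounded by integrals over `stiff S`.
  have hrhs : ∀ (h : R3 → ℝ≥0∞) (k : R2 × ℝ → ℝ≥0∞), Measurable h →
      (∀ p, 0 < p.2 → k p ≤ T.indicator h (Ψ p)) →
      ∫⁻ t in Ioi (0 : ℝ), ∫⁻ z, k (z, t) ≤ ∫⁻ x in stiff S, h x := by
    intro h k hh hk
    have hm : Measurable (T.indicator h) := hh.indicator hTm
    calc ∫⁻ t in Ioi (0 : ℝ), ∫⁻ z, k (z, t)
        ≤ ∫⁻ t in Ioi (0 : ℝ), ∫⁻ z, T.indicator h (Ψ (z, t)) :=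
          setLIntegral_mono' measurableSet_Ioi fun t ht => lintegral_mono fun z => hk (z, t) ht
      _ ≤ ∫⁻ t, ∫⁻ z, T.indicator h (Ψ (z, t)) := setLIntegral_le_lintegral _ _
      _ = ∫⁻ p, T.indicator h (Ψ p) :=
          (lintegral_prod_symm' (fun p => T.indicator h (Ψ p)) (hm.comp hΨm.measurable)).symm
      _ = ∫⁻ x, T.indicator h x := hΨm.lintegral_comp hm
      _ = ∫⁻ x in T, h x := lintegral_indicator hTm _
      _ ≤ _ := lintegral_mono_set hTs
  have hφm : Measurable fun x => ‖φ x‖ₑ ^ 2 := hφ.continuous.enorm.measurable.pow_const 2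
  have hgm : Measurable fun x => ‖grad φ x‖ₑ ^ 2 := (measurable_grad φ).enorm.pow_const 2
  have hR1 := hrhs (fun x => ‖φ x‖ₑ ^ 2) (fun p => ‖w p‖ₑ ^ 2) hφm fun p hp => by
    by_cases hpB : Ψ p ∈ Metric.closedBall x₀ ρ
    · rw [indicator_of_mem]
      · simpa using enorm_sq_le_of_norm_le (c := 1) (by simpa using hfle (Ψ p))
      · refine ⟨?_, hpB⟩
        rw [Set.mem_ofPred_eq, hδdef, hΨdef, graphFun_flatMap]
        linarith
    · have : w p = 0 := by
        by_contra hne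
        exact hpB (hts (subset_tsupport f hne))
      simp [this]
  have hR2 := hrhs (fun x => c₃ * (‖grad φ x‖ₑ ^ 2 + ‖φ x‖ₑ ^ 2)) (fun p => ‖fderiv ℝ w p‖ₑ ^ 2)
    ((hgm.add hφm).const_mul c₃) fun p hp => by
    have hd : fderiv ℝ w p = (fderiv ℝ f (Ψ p)).comp (fderiv ℝ Ψ p) :=
      fderiv_comp p (hfc.differentiable (by simp) _) (hΨ.differentiable (by simp) _)
    by_cases hpB : Ψ p ∈ Metric.closedBall x₀ ρ
    · rw [indicator_of_mem]
      · refine enorm_sq_le_of_norm_le_add ?_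
        rw [hd]
        refine (ContinuousLinearMap.opNorm_comp_le _ _).trans ?_
        calc _ ≤ ((1 + L) * (‖grad φ (Ψ p)‖ + ‖φ (Ψ p)‖)) * M := by
              gcongr
              · exact hdle _
              · exact hM p hpB
          _ = _ := by ring
      · refine ⟨?_, hpB⟩
        rw [Set.mem_ofPred_eq, hδdef, hΨdef, graphFun_flatMap]
        linarith
    · have : fderiv ℝ f (Ψ p) = 0 := by
        by_contra hne
        exact hpB (hts (support_fderiv_subset ℝ hne))
      have h0' : fderiv ℝ w p = 0 := by rw [hd, this, ContinuousLinearMap.zero_comp]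
      have h1' : ‖fderiv ℝ w p‖ₑ ^ 2 = 0 := by rw [← ofReal_norm, h0', norm_zero]; simp
      rw [h1']
      exact zero_le
  rw [lintegral_const_mul' _ _ ENNReal.ofReal_ne_top, lintegral_add_left hgm] at hR2
  -- the left-hand side
  have hfcont : Continuous f := hfc.continuous
  have hL1 : ∫⁻ x in Metric.ball x₀ (ρ / 2), ‖φ x‖ₑ ^ 2 ∂(surf S) ≤
      C₁ * ∫⁻ z, ‖w (z, 0)‖ₑ ^ 2 := by
    calc _ = ∫⁻ x in Metric.ball x₀ (ρ / 2), ‖f x‖ₑ ^ 2 ∂(surf S) :=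
          setLIntegral_congr_fun measurableSet_ball fun x hx => by rw [hfφ x hx]
      _ ≤ ∫⁻ x in Metric.closedBall x₀ (ρ / 2), ‖f x‖ₑ ^ 2 ∂(surf S) := lintegral_mono_set hball
      _ ≤ C₁ * ∫⁻ z in D, ‖f (Ψ (z, 0))‖ₑ ^ 2 :=
          hsurf _ (hfcont.enorm.measurable.pow_const 2)
      _ ≤ _ := mul_le_mul' le_rfl (setLIntegral_le_lintegral _ _)
  have hG0 : Continuous fun z : R2 => Ψ (z, 0) := hΨ.continuous.comp (by fun_prop)
  have hL2 : ∫⁻ x in Metric.ball x₀ (ρ / 2), ∫⁻ y in Metric.ball x₀ (ρ / 2),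
      ‖φ x - φ y‖ₑ ^ 2 / edist x y ^ 3 ∂(surf S) ∂(surf S) ≤
      C₁ * (C₁ * ∫⁻ z, ∫⁻ z', ‖w (z, 0) - w (z', 0)‖ₑ ^ 2 / edist z z' ^ 3) := by
    have hinner : Measurable fun x => ∫⁻ z' in D,
        ‖f x - f (Ψ (z', 0))‖ₑ ^ 2 / edist x (Ψ (z', 0)) ^ 3 := by
      refine Measurable.lintegral_prod_right' (f := fun p : R3 × R2 =>
        ‖f p.1 - f (Ψ (p.2, 0))‖ₑ ^ 2 / edist p.1 (Ψ (p.2, 0)) ^ 3) ?_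
      exact measurable_kernel (α := R3 × R2) hfcont (a := fun p => p.1) (b := fun p => Ψ (p.2, 0))
        measurable_fst (hG0.measurable.comp measurable_snd)
    have hin : ∀ x ∈ Metric.ball x₀ (ρ / 2), ∫⁻ y in Metric.ball x₀ (ρ / 2),
        ‖φ x - φ y‖ₑ ^ 2 / edist x y ^ 3 ∂(surf S) = ∫⁻ y in Metric.ball x₀ (ρ / 2),
        ‖f x - f y‖ₑ ^ 2 / edist x y ^ 3 ∂(surf S) := fun x hx => by
      refine setLIntegral_congr_fun (f := fun y => ‖φ x - φ y‖ₑ ^ 2 / edist x y ^ 3)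
        (g := fun y => ‖f x - f y‖ₑ ^ 2 / edist x y ^ 3) measurableSet_ball fun y hy => ?_
      beta_reduce
      rw [hfφ x hx, hfφ y hy]
    calc ∫⁻ x in Metric.ball x₀ (ρ / 2), ∫⁻ y in Metric.ball x₀ (ρ / 2),
          ‖φ x - φ y‖ₑ ^ 2 / edist x y ^ 3 ∂(surf S) ∂(surf S)
        = ∫⁻ x in Metric.ball x₀ (ρ / 2), ∫⁻ y in Metric.ball x₀ (ρ / 2),
          ‖f x - f y‖ₑ ^ 2 / edist x y ^ 3 ∂(surf S) ∂(surf S) :=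
          setLIntegral_congr_fun measurableSet_ball hin
      _ ≤ ∫⁻ x in Metric.closedBall x₀ (ρ / 2), C₁ * (∫⁻ z' in D,
          ‖f x - f (Ψ (z', 0))‖ₑ ^ 2 / edist x (Ψ (z', 0)) ^ 3) ∂(surf S) := by
          refine (lintegral_mono_set hball).trans (lintegral_mono fun x => ?_)
          exact (lintegral_mono_set hball).trans (hsurf (fun y => ‖f x - f y‖ₑ ^ 2 / edist x y ^ 3)
            (measurable_kernel (α := R3) hfcont (a := fun _ => x) (b := fun y => y)
              measurable_const measurable_id))
      _ ≤ C₁ * ∫⁻ z in D, C₁ * ∫⁻ z' in D, ‖f (Ψ (z, 0)) - f (Ψ (z', 0))‖ₑ ^ 2 /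
            edist (Ψ (z, 0)) (Ψ (z', 0)) ^ 3 := hsurf _ (hinner.const_mul C₁)
      _ ≤ C₁ * ∫⁻ z, C₁ * ∫⁻ z', ‖w (z, 0) - w (z', 0)‖ₑ ^ 2 / edist z z' ^ 3 := by
          refine mul_le_mul' le_rfl ((setLIntegral_le_lintegral _ _).trans
            (lintegral_mono fun z => mul_le_mul' le_rfl ((setLIntegral_le_lintegral _ _).trans
              (lintegral_mono fun z' => ENNReal.div_le_div_left ?_ _))))
          gcongr
          -- The projection to the plane of the chart does not increase distances, so the kernel in
          -- chart coordinates dominates the kernel on the surface.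
          have h1 : edist (projL (Φ (Ψ (z, 0)))) (projL (Φ (Ψ (z', 0)))) ≤
              edist (Ψ (z, 0)) (Ψ (z', 0)) := by
            rw [edist_dist, edist_dist]
            refine ENNReal.ofReal_le_ofReal ?_
            rw [dist_eq_norm, ← map_sub]
            refine (norm_projL_le _).trans ?_
            rw [← dist_eq_norm, Φ.dist_map]
          rwa [hΨdef, projL_flatMap, projL_flatMap] at h1
      _ = _ := by rw [lintegral_const_mul' _ _ hC₁]
  set a := ∫⁻ x in stiff S, ‖φ x‖ₑ ^ 2
  set b := ∫⁻ x in stiff S, ‖grad φ x‖ₑ ^ 2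
  set I := ∫⁻ z, ‖w (z, 0)‖ₑ ^ 2
  set J := ∫⁻ z, ∫⁻ z', ‖w (z, 0) - w (z', 0)‖ₑ ^ 2 / edist z z' ^ 3
  have hIJ : I + J ≤ C₂ * (1 + c₃) * (a + b) := by
    refine hT.trans ?_
    rw [mul_assoc]
    refine mul_le_mul' le_rfl ((add_le_add hR1 hR2).trans ?_)
    rw [add_mul, one_mul, add_comm b a]
    gcongr
    exact le_self_add
  calc _ ≤ C₁ * I + C₁ * (C₁ * J) := add_le_add hL1 hL2
    _ ≤ C₁ * (I + J) + C₁ * (C₁ * (I + J)) := by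
        gcongr
        · exact le_self_add
        · exact le_add_self
    _ = (C₁ + C₁ * C₁) * (I + J) := by ring
    _ ≤ (C₁ + C₁ * C₁) * (C₂ * (1 + c₃) * (a + b)) := by gcongr
    _ = _ := by ring

end IsInclusion

/-! ### The interface -/

/-- The square of the `H^{1/2}(Γ)` norm. -/
def h12Sq (S : Set R3) (g : R3 → C3) : ℝ≥0∞ :=
  (∫⁻ x, ‖g x‖ₑ ^ 2 ∂(surf S)) +
    ∫⁻ x, ∫⁻ y, ‖g x - g y‖ₑ ^ 2 / edist x y ^ 3 ∂(surf S) ∂(surf S)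

theorem h12Norm_eq (S : Set R3) (g : R3 → C3) : h12Norm S g = h12Sq S g ^ (1 / 2 : ℝ) := rfl

theorem ae_mem_frontier (S : Set R3) : ∀ᵐ x ∂(surf S), x ∈ frontier S :=
  ae_restrict_mem isClosed_frontier.measurableSet

theorem lintegral_surf_le_sum {S : Set R3} {t : Finset R3} {s : R3 → Set R3}
    (hs : frontier S ⊆ ⋃ p ∈ t, s p) (f : R3 → ℝ≥0∞) :
    ∫⁻ x, f x ∂(surf S) ≤ ∑ p ∈ t, ∫⁻ x in s p, f x ∂(surf S) := by
  have h1 : ∫⁻ x, f x ∂(surf S) ≤ ∫⁻ x in ⋃ p : t, s p, f x ∂(surf S) := by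
    have : (surf S).restrict (⋃ p : t, s p) = surf S := by
      refine Measure.restrict_eq_self_of_ae_mem ?_
      filter_upwards [ae_mem_frontier S] with x hx
      simpa [iUnion_subtype] using hs hx
    rw [this]
  refine h1.trans ((lintegral_iUnion_le _ _).trans ?_)
  rw [tsum_fintype]
  exact le_of_eq (Finset.sum_coe_sort t fun p => ∫⁻ x in s p, f x ∂(surf S))

namespace IsInclusion

variable {S : Set R3}

theorem isCompact_frontier (hS : IsInclusion S) : IsCompact (frontier S) :=
  isCompact_closure_cell.of_isClosed_subset isClosed_frontier
    (frontier_subset_closure.trans (closure_mono hS.subset_cell))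

/-- The trace inequality. -/
theorem exists_trace (hS : IsInclusion S) :
    surf S univ < ⊤ ∧ ∃ C : ℝ≥0∞, C ≠ ⊤ ∧ ∀ φ : R3 → C3, ContDiff ℝ 1 φ →
      h12Sq S φ ≤ C * ((∫⁻ x in stiff S, ‖φ x‖ₑ ^ 2) + ∫⁻ x in stiff S, ‖grad φ x‖ₑ ^ 2) := by
  have hloc : ∀ p : R3, ∃ r > 0, p ∈ frontier S →
      (surf S (Metric.ball p r) < ⊤ ∧ ∃ C : ℝ≥0∞, C ≠ ⊤ ∧ ∀ φ : R3 → C3, ContDiff ℝ 1 φ →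
        (∫⁻ x in Metric.ball p r, ‖φ x‖ₑ ^ 2 ∂(surf S)) +
          ∫⁻ x in Metric.ball p r, ∫⁻ y in Metric.ball p r,
            ‖φ x - φ y‖ₑ ^ 2 / edist x y ^ 3 ∂(surf S) ∂(surf S) ≤
          C * ((∫⁻ x in stiff S, ‖φ x‖ₑ ^ 2) + ∫⁻ x in stiff S, ‖grad φ x‖ₑ ^ 2)) := by
    intro p
    by_cases hp : p ∈ frontier S
    · obtain ⟨r, hr, h⟩ := hS.exists_local_trace hp
      exact ⟨r, hr, fun _ => h⟩
    · exact ⟨1, one_pos, fun h => absurd h hp⟩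
  choose r hr hloc using hloc
  -- Balls of half the radius are used for the covering. For x in such a half ball, either y lies in
  -- the full ball and the local estimate applies, or |x - y| ≥ r/2 and the kernel is bounded by `D
  -- p`.
  obtain ⟨t, htS, ht⟩ := hS.isCompact_frontier.elim_nhds_subcover
    (fun p => Metric.ball p (r p / 2)) fun p _ => Metric.ball_mem_nhds p (half_pos (hr p))
  have ht' : frontier S ⊆ ⋃ p ∈ t, Metric.ball p (r p) :=
    ht.trans (iUnion₂_mono fun p _ => Metric.ball_subset_ball (half_le_self (hr p).le))
  have hfin : surf S univ < ⊤ := by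
    have := lintegral_surf_le_sum ht' (fun _ => 1)
    simp only [lintegral_one, Measure.restrict_apply_univ] at this
    exact this.trans_lt (ENNReal.sum_lt_top.2 fun p hp => (hloc p (htS p hp)).1)
  have hC : ∀ p : R3, ∃ C : ℝ≥0∞, C ≠ ⊤ ∧ (p ∈ t → ∀ φ : R3 → C3, ContDiff ℝ 1 φ →
        (∫⁻ x in Metric.ball p (r p), ‖φ x‖ₑ ^ 2 ∂(surf S)) +
          ∫⁻ x in Metric.ball p (r p), ∫⁻ y in Metric.ball p (r p),
            ‖φ x - φ y‖ₑ ^ 2 / edist x y ^ 3 ∂(surf S) ∂(surf S) ≤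
          C * ((∫⁻ x in stiff S, ‖φ x‖ₑ ^ 2) + ∫⁻ x in stiff S, ‖grad φ x‖ₑ ^ 2)) := by
    intro p
    by_cases hp : p ∈ t
    · obtain ⟨C, hC, h⟩ := (hloc p (htS p hp)).2
      exact ⟨C, hC, fun _ => h⟩
    · exact ⟨0, by simp, fun h => absurd h hp⟩
  choose C hC hCt using hC
  set m := surf S univ with hm
  set D : R3 → ℝ≥0∞ := fun p => (ENNReal.ofReal (r p / 2) ^ 3)⁻¹
  have hD : ∀ p, D p ≠ ⊤ := fun p =>
    ENNReal.inv_ne_top.2 (pow_ne_zero _ (ENNReal.ofReal_pos.2 (half_pos (hr p))).ne')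
  set A := ∑ p ∈ t, C p
  set B := ∑ p ∈ t, D p
  have hA : A ≠ ⊤ := ENNReal.sum_ne_top.2 fun p _ => hC p
  have hB : B ≠ ⊤ := ENNReal.sum_ne_top.2 fun p _ => hD p
  have hm' : m ≠ ⊤ := hfin.ne
  refine ⟨hfin, A + (A + B * (4 * m) * A), by finiteness, fun φ hφ => ?_⟩
  set E := (∫⁻ x in stiff S, ‖φ x‖ₑ ^ 2) + ∫⁻ x in stiff S, ‖grad φ x‖ₑ ^ 2
  set I := ∫⁻ x, ‖φ x‖ₑ ^ 2 ∂(surf S)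
  have hI : I ≤ A * E := by
    refine (lintegral_surf_le_sum ht' _).trans ?_
    rw [Finset.sum_mul]
    exact Finset.sum_le_sum fun p hp => le_self_add.trans (hCt p hp φ hφ)
  have hφm : Measurable fun x => ‖φ x‖ₑ ^ 2 := hφ.continuous.enorm.measurable.pow_const 2
  have hk : ∀ x, Measurable fun y => ‖φ x - φ y‖ₑ ^ 2 / edist x y ^ 3 := fun x =>
    measurable_kernel (α := R3) hφ.continuous (a := fun _ => x) (b := fun y => y)
      measurable_const measurable_id
  have hfar : ∀ p, ∀ x ∈ Metric.ball p (r p / 2),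
      ∫⁻ y in (Metric.ball p (r p))ᶜ, ‖φ x - φ y‖ₑ ^ 2 / edist x y ^ 3 ∂(surf S) ≤
        D p * (2 * (‖φ x‖ₑ ^ 2 * m + I)) := by
    intro p x hx
    have hpt : ∀ y ∈ (Metric.ball p (r p))ᶜ, ‖φ x - φ y‖ₑ ^ 2 / edist x y ^ 3 ≤
        D p * (2 * (‖φ x‖ₑ ^ 2 + ‖φ y‖ₑ ^ 2)) := by
      intro y hy
      have h1 : ENNReal.ofReal (r p / 2) ≤ edist x y := by
        rw [edist_dist]
        refine ENNReal.ofReal_le_ofReal ?_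
        have h2 : dist x p < r p / 2 := hx
        have h3 : r p ≤ dist y p := not_lt.1 hy
        linarith [dist_triangle y x p, dist_comm x y]
      rw [ENNReal.div_eq_inv_mul]
      refine mul_le_mul' (ENNReal.inv_le_inv.2 (by gcongr)) ?_
      have := enorm_add_sq_le (φ x) (-φ y)
      rw [enorm_neg, ← sub_eq_add_neg] at this
      rw [mul_add]
      exact this
    calc _ ≤ ∫⁻ y in (Metric.ball p (r p))ᶜ, D p * (2 * (‖φ x‖ₑ ^ 2 + ‖φ y‖ₑ ^ 2)) ∂(surf S) :=
          setLIntegral_mono' measurableSet_ball.compl hpt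
      _ ≤ ∫⁻ y, D p * (2 * (‖φ x‖ₑ ^ 2 + ‖φ y‖ₑ ^ 2)) ∂(surf S) := setLIntegral_le_lintegral _ _
      _ = _ := by
          rw [lintegral_const_mul' _ _ (hD p), lintegral_const_mul' _ _ (by simp),
            lintegral_add_left measurable_const, lintegral_const]
  have hJ : ∫⁻ x, ∫⁻ y, ‖φ x - φ y‖ₑ ^ 2 / edist x y ^ 3 ∂(surf S) ∂(surf S) ≤
      A * E + B * (4 * m) * I := by
    refine (lintegral_surf_le_sum ht _).trans ?_
    rw [Finset.sum_mul, Finset.sum_mul, Finset.sum_mul, ← Finset.sum_add_distrib]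
    refine Finset.sum_le_sum fun p hp => ?_
    have hmeas : Measurable fun x => D p * (2 * (‖φ x‖ₑ ^ 2 * m + I)) :=
      (((hφm.mul_const m).add_const I).const_mul 2).const_mul (D p)
    calc ∫⁻ x in Metric.ball p (r p / 2), ∫⁻ y, ‖φ x - φ y‖ₑ ^ 2 / edist x y ^ 3 ∂(surf S) ∂(surf S)
        ≤ ∫⁻ x in Metric.ball p (r p / 2), ((∫⁻ y in Metric.ball p (r p),
            ‖φ x - φ y‖ₑ ^ 2 / edist x y ^ 3 ∂(surf S)) + D p * (2 * (‖φ x‖ₑ ^ 2 * m + I)))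
            ∂(surf S) := by
          refine setLIntegral_mono' measurableSet_ball fun x hx => ?_
          rw [← lintegral_add_compl _ (measurableSet_ball (x := p) (ε := r p))]
          exact add_le_add le_rfl (hfar p x hx)
      _ = (∫⁻ x in Metric.ball p (r p / 2), ∫⁻ y in Metric.ball p (r p),
            ‖φ x - φ y‖ₑ ^ 2 / edist x y ^ 3 ∂(surf S) ∂(surf S)) +
          ∫⁻ x in Metric.ball p (r p / 2), D p * (2 * (‖φ x‖ₑ ^ 2 * m + I)) ∂(surf S) :=
          lintegral_add_right _ hmeas
      _ ≤ C p * E + ∫⁻ x, D p * (2 * (‖φ x‖ₑ ^ 2 * m + I)) ∂(surf S) := by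
          refine add_le_add ?_ (setLIntegral_le_lintegral _ _)
          refine (lintegral_mono_set (Metric.ball_subset_ball (half_le_self (hr p).le))).trans ?_
          exact le_add_self.trans (hCt p hp φ hφ)
      _ = C p * E + D p * (4 * m) * I := by
          rw [lintegral_const_mul' _ _ (hD p), lintegral_const_mul' _ _ (by simp),
            lintegral_add_right _ measurable_const, lintegral_mul_const' _ _ hm', lintegral_const,
            ← hm]
          ring
  calc I + _ ≤ A * E + (A * E + B * (4 * m) * (A * E)) :=
        add_le_add hI (hJ.trans (add_le_add le_rfl (mul_le_mul' le_rfl hI)))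
    _ = _ := by ring

theorem isFiniteMeasure_surf (hS : IsInclusion S) : IsFiniteMeasure (surf S) :=
  ⟨hS.exists_trace.1⟩

theorem nonempty_frontier (hS : IsInclusion S) : (frontier S).Nonempty := by
  refine nonempty_frontier_iff.2 ⟨hS.isConnected.nonempty, fun h => ?_⟩
  have := hS.subset_cell (h ▸ mem_univ (EuclideanSpace.single 0 2))
  have := (this 0).2
  simp at this

/-- In a chart the projection to the plane is 1-Lipschitz and maps the frontier onto a set
containing a disc; it does not increase Hausdorff measure. -/
theorem surf_univ_pos (hS : IsInclusion S) : 0 < surf S univ := by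
  obtain ⟨x₀, hx₀⟩ := hS.nonempty_frontier
  obtain ⟨Φ, γ, K, ρ, hγ, hδ, hρ, hcell, hSδ⟩ := hS.exists_chart hx₀
  have hδx : graphFun Φ γ x₀ = 0 :=
    graphFun_eq_zero hx₀ hS.isOpen hδ.contDiff.continuous hρ hSδ
  have hΨ : Continuous (flatMap Φ γ) := (contDiff_flatMap Φ hγ).continuous
  have hΨ0 : flatMap Φ γ (projL (Φ x₀), 0) = x₀ := by
    have := flatMap_inverse Φ (γ := γ) x₀
    rwa [hδx, neg_zero] at this
  have hev : ∀ᶠ z in 𝓝 (projL (Φ x₀)), flatMap Φ γ (z, 0) ∈ Metric.ball x₀ ρ := by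
    have hc : Continuous fun z : R2 => flatMap Φ γ (z, 0) := hΨ.comp (by fun_prop)
    refine hc.continuousAt.eventually_mem ?_
    rw [hΨ0]
    exact Metric.ball_mem_nhds _ hρ
  obtain ⟨s, hs, hball⟩ := Metric.eventually_nhds_iff_ball.1 hev
  have hsub : Metric.ball (projL (Φ x₀)) s ⊆ (fun x => projL (Φ x)) '' frontier S := by
    intro z hz
    refine ⟨flatMap Φ γ (z, 0), ?_, projL_flatMap Φ _⟩
    have hb := hball z hz
    rw [frontier, hS.isOpen.interior_eq]
    refine ⟨?_, fun h => ?_⟩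
    · have hc : Continuous fun t : ℝ => flatMap Φ γ (z, -t) := hΨ.comp (by fun_prop)
      have h1 : Tendsto (fun t : ℝ => flatMap Φ γ (z, -t)) (𝓝[>] 0) (𝓝 (flatMap Φ γ (z, 0))) := by
        have := hc.tendsto 0
        rw [neg_zero] at this
        exact this.mono_left nhdsWithin_le_nhds
      refine mem_closure_of_tendsto h1 ?_
      filter_upwards [h1.eventually_mem (Metric.isOpen_ball.mem_nhds hb), self_mem_nhdsWithin]
        with t ht ht0
      refine (hSδ _ (Metric.ball_subset_closedBall ht)).2 ?_
      rw [graphFun_flatMap, neg_neg]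
      exact ht0
    · have := (hSδ _ (Metric.ball_subset_closedBall hb)).1 h
      rw [graphFun_flatMap] at this
      simp at this
  have hLip : LipschitzWith 1 fun x => projL (Φ x) := LipschitzWith.of_dist_le_mul fun x y => by
    rw [dist_eq_norm, ← map_sub]
    refine (norm_projL_le _).trans ?_
    rw [← dist_eq_norm, Φ.dist_map]
    simp
  have h1 : (μHE[2] : Measure R2) (Metric.ball (projL (Φ x₀)) s) ≤ surf S univ := by
    rw [surf, Measure.restrict_apply_univ, Measure.euclideanHausdorffMeasure_def,
      Measure.euclideanHausdorffMeasure_def, Measure.smul_apply, Measure.smul_apply]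
    have := hLip.hausdorffMeasure_image_le (d := (2 : ℕ)) (by norm_num) (frontier S)
    simp only [ENNReal.smul_def, smul_eq_mul]
    refine mul_le_mul' le_rfl ((measure_mono hsub).trans (this.trans ?_))
    simp
  rw [EuclideanSpace.euclideanHausdorffMeasure_eq_volume 2] at h1
  exact (Metric.measure_ball_pos _ _ hs).trans_le h1

end IsInclusion

/-- The support keeps the distance ε from the faces of the cell, so the continuation vanishes near
them and the pieces fit together smoothly. -/
theorem isSmoothPeriodic_periodize {f : R3 → C3} (hf : ContDiff ℝ ∞ f) {ε : ℝ} (hε : 0 < ε)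
    (hsupp : ∀ x, f x ≠ 0 → ∀ i, x i ∈ Ioo ε (1 - ε)) : IsSmoothPeriodic (periodize f) := by
  have hcell : ∀ x ∈ cell, ContDiffAt ℝ ∞ (periodize f) x := by
    intro x hx
    by_cases hx0 : ∀ i, 0 < x i
    · refine hf.contDiffAt.congr_of_eventuallyEq ?_
      have : ∀ᶠ y : R3 in 𝓝 x, ∀ i, y i ∈ Ioo (0 : ℝ) 1 := by
        refine eventually_all.2 fun i => ?_
        have hc : Continuous fun y : R3 => y i := by fun_prop
        exact hc.continuousAt.eventually_mem (isOpen_Ioo.mem_nhds ⟨hx0 i, (hx i).2⟩)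
      filter_upwards [this] with y hy
      exact periodize_of_mem_cell f fun i => Ioo_subset_Ico_self (hy i)
    · push Not at hx0
      obtain ⟨i, hi⟩ := hx0
      have hi0 : x i = 0 := le_antisymm hi (hx i).1
      refine (contDiffAt_const (c := (0 : C3))).congr_of_eventuallyEq ?_
      have hc : Continuous fun y : R3 => y i := by fun_prop
      filter_upwards [hc.continuousAt.eventually_mem (isOpen_Ioo.mem_nhds
        (show x i ∈ Ioo (-ε) ε by rw [hi0]; exact ⟨by linarith, hε⟩))] with y hy
      by_contra hne
      have h := hsupp _ hne i
      have h' : Int.fract (y i) ∈ Ioo ε (1 - ε) := h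
      have hfl : (⌊y i⌋ : ℝ) + Int.fract (y i) = y i := Int.floor_add_fract _
      have hneg : ⌊y i⌋ < 0 := by
        have : (⌊y i⌋ : ℝ) < 0 := by linarith [hy.2, h'.1]
        exact_mod_cast this
      have hle : (⌊y i⌋ : ℝ) ≤ -1 := by exact_mod_cast (by lia : ⌊y i⌋ ≤ -1)
      linarith [hy.1, h'.2]
  refine ⟨contDiff_iff_contDiffAt.2 fun x => ?_, fun y i =>
    periodize_add f (single_mem_lattice i) y⟩
  obtain ⟨k, hk, hxk⟩ := exists_add_lattice_mem_cell x
  have h1 : periodize f = fun y => periodize f (y + k) :=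
    funext fun y => (periodize_add f hk y).symm
  rw [h1]
  exact ContDiffAt.comp (f := fun y => y + k) x (hcell _ hxk) (contDiffAt_id.add contDiffAt_const)

/-- The traces of smooth periodic fields are dense in `L²(Γ)`. -/
theorem IsInclusion.eq_zero_of_forall_integral {S : Set R3} (hS : IsInclusion S) (f : L2Bdry S)
    (h : ∀ φ, IsSmoothPeriodic φ → ∫ x, inner ℂ (φ x) (f x) ∂(surf S) = 0) : f = 0 := by
  have := hS.isFiniteMeasure_surf
  obtain ⟨ε, hε, hmargin⟩ := hS.exists_margin
  set U : Set R3 := {x | ∀ i, x i ∈ Ioo (ε / 2) (1 - ε / 2)} with hU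
  have hUo : IsOpen U := by
    have : U = ⋂ i, (fun x : R3 => x i) ⁻¹' Ioo (ε / 2) (1 - ε / 2) := by ext; simp [hU]
    rw [this]
    exact isOpen_iInter_of_finite fun i => isOpen_Ioo.preimage (by fun_prop)
  have hint : Integrable f (surf S) := (Lp.memLp f).integrable (by norm_num)
  have hcoord : ∀ i : Fin 3, ∀ᵐ x ∂(surf S), f x i = 0 := by
    intro i
    have hfi : Integrable (fun x => f x i) (surf S) :=
      (EuclideanSpace.proj (𝕜 := ℂ) i).integrable_comp hint
    -- Test functions supported in U, which contains the interface and stays away from the faces of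
    -- the cell, can be made periodic without changing their values on the interface.
    have := hUo.ae_eq_zero_of_integral_contDiff_smul_eq_zero
      (hfi.locallyIntegrable.locallyIntegrableOn U) (fun g hg _ hgU => by
        set w : R3 → C3 := fun x => g x • EuclideanSpace.single i (1 : ℂ) with hw
        have hws : ContDiff ℝ ∞ w := hg.smul contDiff_const
        have hsupp : ∀ x, w x ≠ 0 → ∀ i, x i ∈ Ioo (ε / 2) (1 - ε / 2) := by
          intro x hx
          refine hgU (subset_tsupport g fun h0 => hx ?_)
          simp [hw, h0]
        rw [← h _ (isSmoothPeriodic_periodize hws (half_pos hε) hsupp)]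
        refine integral_congr_ae ?_
        filter_upwards [ae_mem_frontier S] with x hx
        have hxc : x ∈ cell := (hS.closure_subset.trans interior_subset)
          (frontier_subset_closure hx)
        simp only [periodize_of_mem_cell _ hxc, hw]
        have hsm : g x • EuclideanSpace.single i (1 : ℂ) =
            (g x : ℂ) • EuclideanSpace.single i (1 : ℂ) := (Complex.coe_smul _ _).symm
        rw [hsm, inner_smul_left, EuclideanSpace.inner_single_left]
        simp)
    filter_upwards [this, ae_mem_frontier S] with x hx hxS
    refine hx fun j => ?_
    have := hmargin x (frontier_subset_closure hxS) j
    exact ⟨by linarith [this.1], by linarith [this.2]⟩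
  refine (Lp.eq_zero_iff_ae_eq_zero).2 ?_
  filter_upwards [ae_all_iff.2 hcoord] with x hx
  ext i
  exact hx i

/-! ### Coercivity, uniformly in the quasimomentum -/

/-- The completeness of L², stated for functions so that the limit has a strongly measurable
representative. -/
theorem exists_tendsto_of_cauchy {α E : Type*} [MeasurableSpace α] {ν : Measure α}
    [NormedAddCommGroup E] [CompleteSpace E] {f : ℕ → α → E} (hf : ∀ n, MemLp (f n) 2 ν)
    (h : Tendsto (fun p : ℕ × ℕ => ∫⁻ x, ‖f p.1 x - f p.2 x‖ₑ ^ 2 ∂ν) atTop (𝓝 0)) :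
    ∃ u : α → E, StronglyMeasurable u ∧
      Tendsto (fun n => ∫⁻ x, ‖f n x - u x‖ₑ ^ 2 ∂ν) atTop (𝓝 0) := by
  have hc : CauchySeq fun n => (hf n).toLp (f n) := by
    rw [cauchySeq_iff_tendsto_dist_atTop_0]
    have h1 : Tendsto (fun p : ℕ × ℕ => edist ((hf p.1).toLp (f p.1)) ((hf p.2).toLp (f p.2)))
        atTop (𝓝 0) := by
      refine tendsto_zero_of_sq (h.congr fun p => ?_)
      rw [Lp.edist_toLp_toLp, eLpNorm_two_sq]
      rfl
    have h2 := (ENNReal.tendsto_toReal ENNReal.zero_ne_top).comp h1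
    rw [ENNReal.toReal_zero] at h2
    exact h2.congr fun p => (dist_edist _ _).symm
  obtain ⟨u, hu⟩ := cauchySeq_tendsto_of_complete hc
  refine ⟨u, Lp.stronglyMeasurable u, ?_⟩
  have h1 := tendsto_iff_edist_tendsto_0.1 hu
  have h2 := ENNReal.Tendsto.pow (n := 2) h1
  rw [zero_pow two_ne_zero] at h2
  refine h2.congr fun n => ?_
  conv_lhs => rw [← Lp.toLp_coeFn u (Lp.memLp u)]
  rw [Lp.edist_toLp_toLp, eLpNorm_two_sq]
  rfl

/-- The square of the `H¹` norm on the stiff component. -/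
def h1Sq (S : Set R3) (φ : R3 → C3) : ℝ≥0∞ :=
  (∫⁻ x in stiff S, ‖φ x‖ₑ ^ 2) + ∫⁻ x in stiff S, ‖grad φ x‖ₑ ^ 2

section fstrain

variable {φ ψ : R3 → C3}

theorem continuous_fstrain (hφ : IsSmoothPeriodic φ) (χ : R3) : Continuous (fstrain χ φ) :=
  symL.continuous.comp (hφ.continuous_grad.add
    (((outerL χ).continuous.comp hφ.1.continuous).const_smul Complex.I))

theorem fstrain_sub (hφ : IsSmoothPeriodic φ) (hψ : IsSmoothPeriodic ψ) (χ x : R3) :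
    fstrain χ (fun y => φ y - ψ y) x = fstrain χ φ x - fstrain χ ψ x := by
  rw [fstrain, fstrain, fstrain, hφ.grad_sub hψ, ← map_sub, map_sub (outerL χ), smul_sub]
  congr 1
  abel

theorem fstrain_const_smul (hφ : IsSmoothPeriodic φ) (c : ℂ) (χ x : R3) :
    fstrain χ (fun y => c • φ y) x = c • fstrain χ φ x := by
  rw [fstrain, fstrain, hφ.grad_const_smul, map_smul (outerL χ), smul_comm, ← smul_add, map_smul]

theorem norm_fstrain_sub_le (χ χ' : R3) (φ : R3 → C3) (x : R3) :
    ‖fstrain χ φ x - fstrain χ' φ x‖ ≤ ‖χ - χ'‖ * ‖φ x‖ := by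
  have h : fstrain χ φ x - fstrain χ' φ x = symL (Complex.I • outerL (χ - χ') (φ x)) := by
    rw [fstrain, fstrain, ← map_sub]
    congr 1
    ext ⟨i, j⟩
    simp only [PiLp.sub_apply, PiLp.add_apply, PiLp.smul_apply, outerL_apply, smul_eq_mul]
    push_cast
    ring
  rw [h]
  refine (norm_symL_le _).trans ?_
  rw [norm_smul, Complex.norm_I, one_mul, norm_outerL, mul_comm]

end fstrain

theorem norm_le_of_forall_abs_le {χ : R3} (hχ : ∀ i, |χ i| ≤ Real.pi) : ‖χ‖ ≤ 2 * Real.pi := by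
  rw [EuclideanSpace.norm_eq, Real.sqrt_le_left (by positivity), Fin.sum_univ_three]
  have h : ∀ i, ‖χ i‖ ^ 2 ≤ Real.pi ^ 2 := fun i => by
    rw [Real.norm_eq_abs]
    exact pow_le_pow_left₀ (abs_nonneg _) (hχ i) 2
  nlinarith [h 0, h 1, h 2, sq_nonneg Real.pi]

theorem isCompact_closedDualCell : IsCompact {χ : R3 | ∀ i, |χ i| ≤ Real.pi} := by
  refine (isCompact_closedBall (0 : R3) (2 * Real.pi)).of_isClosed_subset ?_ fun χ hχ => ?_
  · have : {χ : R3 | ∀ i, |χ i| ≤ Real.pi} = ⋂ i, {χ : R3 | |χ i| ≤ Real.pi} := by ext; simp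
    rw [this]
    exact isClosed_iInter fun i => isClosed_le (by fun_prop) continuous_const
  · rw [mem_closedBall_zero_iff]
    exact norm_le_of_forall_abs_le hχ

namespace IsInclusion

variable {S : Set R3}

theorem memLp_stiff (hS : IsInclusion S) {G : Type*} [NormedAddCommGroup G]
    [SecondCountableTopologyEither R3 G] {f : R3 → G} (hf : Continuous f) :
    MemLp f 2 (volume.restrict (stiff S)) := by
  refine ⟨hf.aestronglyMeasurable, ?_⟩
  have h := hS.lintegral_enorm_sq_lt_top hf
  rw [← eLpNorm_two_sq] at h
  refine lt_top_iff_ne_top.2 fun h' => ?_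
  rw [h'] at h
  simp at h

theorem memLp_surf (hS : IsInclusion S) {G : Type*} [NormedAddCommGroup G]
    [SecondCountableTopologyEither R3 G] {f : R3 → G} (hf : Continuous f) :
    MemLp f 2 (surf S) := by
  have := hS.isFiniteMeasure_surf
  obtain ⟨M, hM⟩ := hS.isCompact_frontier.exists_bound_of_continuousOn hf.continuousOn
  refine MemLp.of_bound hf.aestronglyMeasurable M ?_
  filter_upwards [ae_mem_frontier S] with x hx using hM x hx

theorem h1Sq_lt_top (hS : IsInclusion S) {φ : R3 → C3} (hφ : IsSmoothPeriodic φ) :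
    h1Sq S φ < ⊤ :=
  ENNReal.add_lt_top.2 ⟨hS.lintegral_enorm_sq_lt_top hφ.1.continuous,
    hS.lintegral_enorm_sq_lt_top hφ.continuous_grad⟩

theorem tendsto_integral_surf (hS : IsInclusion S) {φ : ℕ → R3 → C3}
    (hφ : ∀ n, IsSmoothPeriodic (φ n)) (h : Tendsto (fun n => h1Sq S (φ n)) atTop (𝓝 0)) :
    Tendsto (fun n => ∫ x, φ n x ∂(surf S)) atTop (𝓝 0) := by
  obtain ⟨hfin, C, hC, htr⟩ := hS.exists_trace
  rw [tendsto_zero_iff_enorm_tendsto_zero]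
  refine tendsto_zero_of_sq (tendsto_of_tendsto_of_tendsto_of_le_of_le tendsto_const_nhds
    (tendsto_zero_const_mul (c := surf S univ * C) (ENNReal.mul_ne_top hfin.ne hC) h)
    (fun n => zero_le) fun n => ?_)
  calc ‖∫ x, φ n x ∂(surf S)‖ₑ ^ 2 ≤ (∫⁻ x, ‖φ n x‖ₑ ∂(surf S)) ^ 2 := by
        gcongr
        exact enorm_integral_le_lintegral_enorm _
    _ ≤ surf S univ * ∫⁻ x, ‖φ n x‖ₑ ^ 2 ∂(surf S) :=
        sq_lintegral_le (hφ n).1.continuous.enorm.aemeasurable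
    _ ≤ surf S univ * (C * h1Sq S (φ n)) :=
        mul_le_mul' le_rfl (le_self_add.trans (htr _ (hφ n).contDiff_one))
    _ = _ := (mul_assoc _ _ _).symm

theorem h1Sq_const_smul {φ : R3 → C3} (hφ : IsSmoothPeriodic φ) (c : ℂ) :
    h1Sq S (fun x => c • φ x) = ‖c‖ₑ ^ 2 * h1Sq S φ := by
  simp only [h1Sq, hφ.grad_const_smul, enorm_smul, mul_pow]
  rw [lintegral_const_mul' _ _ (by finiteness), lintegral_const_mul' _ _ (by finiteness), mul_add]

/-- A normalised sequence of smooth periodic fields cannot have strains and averages over the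
interface which tend to zero. -/
theorem false_of_tendsto (hS : IsInclusion S) {χ : R3} (hχ : ∀ i, |χ i| ≤ Real.pi)
    {ξ : ℕ → R3} (hξ : Tendsto ξ atTop (𝓝 χ)) {φ : ℕ → R3 → C3}
    (hφ : ∀ n, IsSmoothPeriodic (φ n)) (h1 : ∀ n, h1Sq S (φ n) = 1)
    (hs : Tendsto (fun n => ∫⁻ x in stiff S, ‖fstrain (ξ n) (φ n) x‖ₑ ^ 2) atTop (𝓝 0))
    (hm : Tendsto (fun n => ∫ x, φ n x ∂(surf S)) atTop (𝓝 0)) : False := by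
  obtain ⟨ι, _, P, C, hC, hPsub, hPle, hkorn⟩ := hS.exists_korn (2 * Real.pi)
  have hχB := norm_le_of_forall_abs_le hχ
  have hle1 : ∀ n, ∫⁻ x in stiff S, ‖φ n x‖ₑ ^ 2 ≤ 1 := fun n => le_self_add.trans (h1 n).le
  -- a subsequence along which the finitely many functionals converge
  set v : ℕ → ι → C3 := fun n i => P i (φ n) with hv
  have hbd : ∀ n, v n ∈ Metric.closedBall (0 : ι → C3) (C.toReal + 1) := by
    intro n
    rw [mem_closedBall_zero_iff, pi_norm_le_iff_of_nonneg (by positivity)]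
    intro i
    have h2 : ‖v n i‖ₑ ^ 2 ≤ C :=
      (hPle i _ (hφ n)).trans ((mul_le_mul' le_rfl (hle1 n)).trans (mul_one C).le)
    have h3 : ‖v n i‖ ^ 2 ≤ C.toReal := by
      have := ENNReal.toReal_mono hC h2
      rwa [ENNReal.toReal_pow, toReal_enorm] at this
    nlinarith [norm_nonneg (v n i), ENNReal.toReal_nonneg (a := C)]
  obtain ⟨p, -, k, hk, hkp⟩ := (isCompact_closedBall (0 : ι → C3) _).tendsto_subseq hbd
  -- the strains with the limit quasimomentum
  have hs' : Tendsto (fun n => ∫⁻ x in stiff S, ‖fstrain χ (φ n) x‖ₑ ^ 2) atTop (𝓝 0) := by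
    have hd : Tendsto (fun n => ‖χ - ξ n‖ₑ ^ 2) atTop (𝓝 0) := by
      have h2 : Tendsto (fun n => χ - ξ n) atTop (𝓝 0) := by
        simpa using (tendsto_const_nhds (x := χ)).sub hξ
      have h3 := ENNReal.Tendsto.pow (n := 2) (tendsto_zero_iff_enorm_tendsto_zero.1 h2)
      rwa [zero_pow two_ne_zero] at h3
    have hsum := (tendsto_zero_const_mul (c := 2) (by simp) hd).add
      (tendsto_zero_const_mul (c := 2) (by simp) hs)
    rw [add_zero] at hsum
    refine tendsto_of_tendsto_of_tendsto_of_le_of_le tendsto_const_nhds hsum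
      (fun n => zero_le) fun n => ?_
    have hpt : ∀ x, ‖fstrain χ (φ n) x‖ₑ ^ 2 ≤
        2 * (‖χ - ξ n‖ₑ ^ 2 * ‖φ n x‖ₑ ^ 2) + 2 * ‖fstrain (ξ n) (φ n) x‖ₑ ^ 2 := by
      intro x
      have h2 := enorm_add_sq_le (fstrain χ (φ n) x - fstrain (ξ n) (φ n) x)
        (fstrain (ξ n) (φ n) x)
      rw [sub_add_cancel] at h2
      refine h2.trans (add_le_add (mul_le_mul' le_rfl ?_) le_rfl)
      rw [← mul_pow]
      gcongr
      rw [← ofReal_norm, ← ofReal_norm, ← ofReal_norm, ← ENNReal.ofReal_mul (norm_nonneg _)]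
      exact ENNReal.ofReal_le_ofReal (norm_fstrain_sub_le _ _ _ _)
    have hm1 : Measurable fun x => 2 * ‖fstrain (ξ n) (φ n) x‖ₑ ^ 2 :=
      ((continuous_fstrain (hφ n) (ξ n)).enorm.measurable.pow_const 2).const_mul 2
    calc _ ≤ ∫⁻ x in stiff S, (2 * (‖χ - ξ n‖ₑ ^ 2 * ‖φ n x‖ₑ ^ 2) +
            2 * ‖fstrain (ξ n) (φ n) x‖ₑ ^ 2) := lintegral_mono hpt
      _ = 2 * (‖χ - ξ n‖ₑ ^ 2 * ∫⁻ x in stiff S, ‖φ n x‖ₑ ^ 2) +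
            2 * ∫⁻ x in stiff S, ‖fstrain (ξ n) (φ n) x‖ₑ ^ 2 := by
          rw [lintegral_add_right _ hm1, lintegral_const_mul' _ _ (by simp),
            lintegral_const_mul' _ _ (by finiteness), lintegral_const_mul' _ _ (by simp)]
      _ ≤ _ := by
          gcongr
          exact (mul_le_mul' le_rfl (hle1 n)).trans (mul_one _).le
  -- the subsequence is Cauchy
  set ψ : ℕ → R3 → C3 := fun n => φ (k n) with hψdef
  have hψ : ∀ n, IsSmoothPeriodic (ψ n) := fun n => hφ _
  have hsψ := hs'.comp hk.tendsto_atTop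
  -- Korn's inequality for the differences: their strains tend to zero, and along the subsequence
  -- the finitely many functionals form Cauchy sequences. This replaces a compact embedding.
  have hcau : Tendsto (fun q : ℕ × ℕ => h1Sq S fun x => ψ q.1 x - ψ q.2 x) atTop (𝓝 0) := by
    have hP : ∀ i, Tendsto (fun q : ℕ × ℕ => ‖P i (ψ q.1) - P i (ψ q.2)‖ₑ ^ 2) atTop (𝓝 0) := by
      intro i
      have h2 : Tendsto (fun n => P i (ψ n)) atTop (𝓝 (p i)) := (tendsto_pi_nhds.1 hkp) i
      rw [← prod_atTop_atTop_eq]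
      have h3 := (h2.comp (tendsto_fst (f := atTop) (g := atTop))).sub
        (h2.comp (tendsto_snd (f := atTop) (g := atTop)))
      rw [sub_self] at h3
      have h4 := ENNReal.Tendsto.pow (n := 2) (tendsto_zero_iff_enorm_tendsto_zero.1 h3)
      rwa [zero_pow two_ne_zero] at h4
    have hbound : Tendsto (fun q : ℕ × ℕ => C * ((2 * (∫⁻ x in stiff S, ‖fstrain χ (ψ q.1) x‖ₑ ^ 2)
        + 2 * ∫⁻ x in stiff S, ‖fstrain χ (ψ q.2) x‖ₑ ^ 2) +
        ∑ i, ‖P i (ψ q.1) - P i (ψ q.2)‖ₑ ^ 2)) atTop (𝓝 0) := by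
      refine tendsto_zero_const_mul hC ?_
      have h2 : Tendsto (fun q : ℕ × ℕ => ∑ i, ‖P i (ψ q.1) - P i (ψ q.2)‖ₑ ^ 2) atTop
          (𝓝 (∑ _i : ι, 0)) := tendsto_finsetSum _ fun i _ => hP i
      rw [Finset.sum_const_zero] at h2
      have h3 : Tendsto (fun q : ℕ × ℕ => ∫⁻ x in stiff S, ‖fstrain χ (ψ q.1) x‖ₑ ^ 2) atTop
          (𝓝 0) := by
        rw [← prod_atTop_atTop_eq]; exact hsψ.comp tendsto_fst
      have h4 : Tendsto (fun q : ℕ × ℕ => ∫⁻ x in stiff S, ‖fstrain χ (ψ q.2) x‖ₑ ^ 2) atTop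
          (𝓝 0) := by
        rw [← prod_atTop_atTop_eq]; exact hsψ.comp tendsto_snd
      have h5 := ((tendsto_zero_const_mul (c := 2) (by simp) h3).add
        (tendsto_zero_const_mul (c := 2) (by simp) h4)).add h2
      simpa using h5
    refine tendsto_of_tendsto_of_tendsto_of_le_of_le tendsto_const_nhds hbound
      (fun n => zero_le) fun q => ?_
    refine (hkorn χ hχB _ ((hψ q.1).sub (hψ q.2))).trans (mul_le_mul' le_rfl ?_)
    simp only [hPsub _ _ _ (hψ q.1) (hψ q.2), fstrain_sub (hψ q.1) (hψ q.2)]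
    refine add_le_add ?_ le_rfl
    have hm1 : Measurable fun x => 2 * ‖fstrain χ (ψ q.1) x‖ₑ ^ 2 :=
      ((continuous_fstrain (hψ q.1) χ).enorm.measurable.pow_const 2).const_mul 2
    calc _ ≤ ∫⁻ x in stiff S, (2 * ‖fstrain χ (ψ q.1) x‖ₑ ^ 2 +
          2 * ‖fstrain χ (ψ q.2) x‖ₑ ^ 2) := by
          refine lintegral_mono fun x => ?_
          have h2 := enorm_add_sq_le (fstrain χ (ψ q.1) x) (-fstrain χ (ψ q.2) x)
          rwa [enorm_neg, ← sub_eq_add_neg] at h2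
      _ = _ := by
          rw [lintegral_add_left hm1, lintegral_const_mul' _ _ (by simp),
            lintegral_const_mul' _ _ (by simp)]
  obtain ⟨u, hu, hψu⟩ := exists_tendsto_of_cauchy
    (fun n => hS.memLp_stiff (hψ n).1.continuous)
    (tendsto_of_tendsto_of_tendsto_of_le_of_le tendsto_const_nhds hcau (fun _ => zero_le)
      fun q => le_self_add)
  obtain ⟨g, hg, hψg⟩ := exists_tendsto_of_cauchy (f := fun n => grad (ψ n))
    (fun n => hS.memLp_stiff (hψ n).continuous_grad)
    (tendsto_of_tendsto_of_tendsto_of_le_of_le tendsto_const_nhds hcau (fun _ => zero_le)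
      fun q => by
        simp only [h1Sq, (hψ q.1).grad_sub (hψ q.2)]
        exact le_add_self)
  obtain ⟨a, -, ha⟩ := hS.exists_const_of_fstrain_tendsto hχ hψ hu hg hψu hψg hsψ
  -- convergence to the constant
  have hconv : Tendsto (fun n => h1Sq S fun x => ψ n x - a) atTop (𝓝 0) := by
    have h2 := hψu.add hψg
    rw [add_zero] at h2
    refine h2.congr fun n => ?_
    rw [h1Sq]
    congr 1
    · refine lintegral_congr_ae ?_
      filter_upwards [ha] with y hy
      rw [hy.1]
    · refine lintegral_congr_ae ?_
      filter_upwards [ha] with y hy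
      rw [hy.2, (hψ n).grad_sub (isSmoothPeriodic_const a), grad_const]
  have := hS.isFiniteMeasure_surf
  have hmean := hS.tendsto_integral_surf (fun n => (hψ n).sub (isSmoothPeriodic_const a)) hconv
  have hmean' : Tendsto (fun n => ∫ x, ψ n x - a ∂(surf S)) atTop
      (𝓝 (0 - ∫ _x, a ∂(surf S))) := by
    refine ((hm.comp hk.tendsto_atTop).sub_const (∫ _x, a ∂(surf S))).congr fun n => ?_
    rw [integral_sub ((hS.memLp_surf (hψ n).1.continuous).integrable (by norm_num))
      (integrable_const a)]
    rfl
  -- The integrals over the interface of `ψ n` and of `ψ n - a` both tend to zero, so a times the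
  -- area of the interface is zero. Then the H¹ norms tend to zero, although they all equal 1.
  have ha0 : a = 0 := by
    have h2 := tendsto_nhds_unique hmean hmean'
    rw [zero_sub, eq_comm, neg_eq_zero, integral_const, smul_eq_zero] at h2
    refine h2.resolve_left ?_
    exact (ENNReal.toReal_pos hS.surf_univ_pos.ne' hS.exists_trace.1.ne).ne'
  simp only [ha0, sub_zero] at hconv
  have h2 : Tendsto (fun _ : ℕ => (1 : ℝ≥0∞)) atTop (𝓝 0) := hconv.congr fun n => h1 (k n)
  exact one_ne_zero (tendsto_nhds_unique tendsto_const_nhds h2)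

/-- The `H¹` norm is controlled by the strain and the average over the interface, uniformly in
the quasimomentum. -/
theorem exists_coercive (hS : IsInclusion S) :
    ∃ C : ℝ≥0∞, C ≠ ⊤ ∧ ∀ χ : R3, (∀ i, |χ i| ≤ Real.pi) → ∀ φ, IsSmoothPeriodic φ →
      h1Sq S φ ≤ C * ((∫⁻ x in stiff S, ‖fstrain χ φ x‖ₑ ^ 2) + ‖∫ x, φ x ∂(surf S)‖ₑ ^ 2) := by
  by_contra! hcon
  -- A counterexample for every constant n + 1, each with its own quasimomentum. The closed dual
  -- cell is compact, so the quasimomenta converge along a subsequence. The limit may be 0, where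
  -- the strain alone does not control constants; this is why the average over the interface is
  -- needed.
  have hn := fun n : ℕ => hcon (n + 1) (by finiteness)
  choose χ hχ φ hφ hlt using hn
  set N : ℕ → ℝ≥0∞ := fun n => h1Sq S (φ n) with hN
  have hNt : ∀ n, N n ≠ ⊤ := fun n => (hS.h1Sq_lt_top (hφ n)).ne
  have hN0 : ∀ n, N n ≠ 0 := fun n => ((zero_le).trans_lt (hlt n)).ne'
  set c : ℕ → ℂ := fun n => ((Real.sqrt (N n).toReal)⁻¹ : ℝ) with hc
  have hcN : ∀ n, ‖c n‖ₑ ^ 2 = (N n)⁻¹ := fun n => by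
    have hpos := ENNReal.toReal_pos (hN0 n) (hNt n)
    rw [← ofReal_norm, ← ENNReal.ofReal_pow (norm_nonneg _), hc]
    simp only [Complex.norm_real, norm_inv, inv_pow, Real.norm_eq_abs, sq_abs]
    rw [Real.sq_sqrt hpos.le, ENNReal.ofReal_inv_of_pos hpos, ENNReal.ofReal_toReal (hNt n)]
  have hψ : ∀ n, IsSmoothPeriodic fun x => c n • φ n x := fun n => (hφ n).const_smul (c n)
  have h1 : ∀ n, h1Sq S (fun x => c n • φ n x) = 1 := fun n => by
    rw [h1Sq_const_smul (hφ n), hcN, ENNReal.inv_mul_cancel (hN0 n) (hNt n)]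
  have hsmall : ∀ n, (∫⁻ x in stiff S, ‖fstrain (χ n) (fun x => c n • φ n x) x‖ₑ ^ 2) +
      ‖∫ x, c n • φ n x ∂(surf S)‖ₑ ^ 2 ≤ ((n : ℝ≥0∞) + 1)⁻¹ := fun n => by
    rw [integral_smul, enorm_smul, mul_pow]
    simp only [fstrain_const_smul (hφ n), enorm_smul, mul_pow]
    rw [lintegral_const_mul' _ _ (by finiteness), ← mul_add, hcN, ← ENNReal.div_eq_inv_mul]
    refine ENNReal.div_le_of_le_mul ?_
    exact (ENNReal.mul_le_iff_le_inv (by simp) (by finiteness)).1 (hlt n).le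
  have hlim : Tendsto (fun n : ℕ => ((n : ℝ≥0∞) + 1)⁻¹) atTop (𝓝 0) := by
    have := (tendsto_add_atTop_iff_nat 1).2 ENNReal.tendsto_inv_nat_nhds_zero
    simpa using this
  obtain ⟨χ₀, hχ₀, k, hk, hkχ⟩ := isCompact_closedDualCell.tendsto_subseq hχ
  refine hS.false_of_tendsto hχ₀ hkχ (fun n => hψ (k n)) (fun n => h1 (k n)) ?_ ?_
  · exact tendsto_of_tendsto_of_tendsto_of_le_of_le tendsto_const_nhds
      (hlim.comp hk.tendsto_atTop) (fun _ => zero_le) fun n => le_self_add.trans (hsmall (k n))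
  · rw [tendsto_zero_iff_enorm_tendsto_zero]
    exact tendsto_zero_of_sq (tendsto_of_tendsto_of_tendsto_of_le_of_le tendsto_const_nhds
      (hlim.comp hk.tendsto_atTop) (fun _ => zero_le) fun n => le_add_self.trans (hsmall (k n)))

end IsInclusion

/-! ### The resolvent estimate in Hilbert spaces -/

theorem re_inner_self {W : Type*} [NormedAddCommGroup W] [InnerProductSpace ℂ W] (u : W) :
    (inner ℂ u u).re = ‖u‖ ^ 2 := inner_self_eq_norm_sq (𝕜 := ℂ) u

/-- The Lax-Milgram theorem. -/
theorem exists_rightInverse_of_coercive {W : Type*} [NormedAddCommGroup W] [InnerProductSpace ℂ W]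
    [CompleteSpace W] (b : W →L[ℂ] W) {c : ℝ} (hc : 0 < c)
    (h : ∀ u, c * ‖u‖ ^ 2 ≤ (inner ℂ u (b u)).re) : ∃ R : W →L[ℂ] W, ∀ l, b (R l) = l := by
  have hu : IsUnit b := by
    refine ContinuousLinearMap.isUnit_of_forall_le_norm_inner_map b (c := c.toNNReal)
      (by simpa using hc) fun u => ?_
    rw [Real.coe_toNNReal _ hc.le, norm_inner_symm]
    rw [mul_comm]
    exact (h u).trans (Complex.re_le_norm _)
  obtain ⟨e, he⟩ := hu
  refine ⟨↑e⁻¹, fun l => ?_⟩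
  have := congrArg (fun f : W →L[ℂ] W => f l) e.mul_inv
  rwa [he] at this

/-- The data of the periodic cell problem: the tensor `A`, the symmetrised gradient `D`, the trace
`tr`, the constant fields `cst`, the average `avg` over the interface of measure `m`, and the space
`Gs` of symmetric fields. -/
structure CellData (H G B : Type*) [NormedAddCommGroup H] [InnerProductSpace ℂ H]
    [NormedAddCommGroup G] [InnerProductSpace ℂ G] [NormedAddCommGroup B]
    [InnerProductSpace ℂ B] where
  A : G →L[ℂ] G
  D : H →L[ℂ] G
  tr : H →L[ℂ] B
  cst : C3 →L[ℂ] H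
  avg : B →L[ℂ] C3
  Gs : Submodule ℂ G
  m : ℝ
  ν : ℝ
  K : ℝ
  m_pos : 0 < m
  ν_pos : 0 < ν
  K_pos : 0 < K
  coercive : ∀ E ∈ Gs, ν * ‖E‖ ^ 2 ≤ (inner ℂ E (A E)).re
  D_mem : ∀ u, D u ∈ Gs
  D_cst : ∀ c, D (cst c) = 0
  inner_tr_cst : ∀ c g, inner ℂ (tr (cst c)) g = (m : ℂ) * inner ℂ c (avg g)
  avg_tr_cst : ∀ c, avg (tr (cst c)) = c
  korn : ∀ u, ‖u‖ ^ 2 ≤ K * (‖D u‖ ^ 2 + ‖avg (tr u)‖ ^ 2)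

namespace CellData

variable {H G B : Type*} [NormedAddCommGroup H] [InnerProductSpace ℂ H] [CompleteSpace H]
  [NormedAddCommGroup G] [InnerProductSpace ℂ G] [CompleteSpace G] [NormedAddCommGroup B]
  [InnerProductSpace ℂ B] [CompleteSpace B] (P : CellData H G B)

/-- The operator `X = i X_χ`, where `s = |χ|`. -/
structure IsShift (s : ℝ) (X : H →L[ℂ] G) : Prop where
  mem : ∀ u, X u ∈ P.Gs
  norm_le : ∀ u, ‖X u‖ ≤ s * ‖u‖
  korn : ∀ u, ‖u‖ ^ 2 ≤ P.K * (‖P.D u + X u‖ ^ 2 + ‖P.avg (P.tr u)‖ ^ 2)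

/-- Solvability of the problem without shift on a subspace without constants. -/
theorem exists_solution (W : Submodule ℂ H) (hW : IsClosed (W : Set H))
    (h0 : ∀ u ∈ W, P.avg (P.tr u) = 0) : ∃ R : G →L[ℂ] H, ∀ F, R F ∈ W ∧
      ∀ v ∈ W, inner ℂ (P.D v) (P.A (P.D (R F))) = inner ℂ (P.D v) F := by
  have : CompleteSpace W := hW.completeSpace_coe
  set DW : W →L[ℂ] G := P.D.comp W.subtypeL with hDW
  obtain ⟨R, hR⟩ := exists_rightInverse_of_coercive
    ((ContinuousLinearMap.adjoint DW).comp (P.A.comp DW)) (c := P.ν / P.K)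
    (div_pos P.ν_pos P.K_pos) fun u => by
      rw [ContinuousLinearMap.comp_apply, ContinuousLinearMap.adjoint_inner_right]
      refine le_trans ?_ (P.coercive _ (P.D_mem u))
      have := P.korn u
      rw [h0 u u.2, norm_zero, zero_pow two_ne_zero, add_zero] at this
      rw [div_mul_eq_mul_div, div_le_iff₀ P.K_pos]
      calc P.ν * ‖u‖ ^ 2 ≤ P.ν * (P.K * ‖P.D u‖ ^ 2) := mul_le_mul_of_nonneg_left this P.ν_pos.le
        _ = P.ν * ‖P.D u‖ ^ 2 * P.K := by ring
  refine ⟨W.subtypeL.comp (R.comp (ContinuousLinearMap.adjoint DW)), fun F => ⟨Subtype.prop _, ?_⟩⟩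
  intro v hv
  have := congrArg (fun z => inner ℂ (⟨v, hv⟩ : W) z) (hR (ContinuousLinearMap.adjoint DW F))
  simp only [ContinuousLinearMap.comp_apply, ContinuousLinearMap.adjoint_inner_right] at this
  exact this

theorem eq_zero_of_inner_eq_zero {E : G} (hE : E ∈ P.Gs) (h : inner ℂ E (P.A E) = 0) : E = 0 := by
  have := P.coercive E hE
  rw [h, Complex.zero_re] at this
  have h2 : ‖E‖ ^ 2 ≤ 0 := by
    by_contra hlt
    exact absurd this (not_le.2 (mul_pos P.ν_pos (not_le.1 hlt)))
  exact norm_eq_zero.1 (pow_eq_zero_iff two_ne_zero |>.1 (le_antisymm h2 (sq_nonneg _)))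

/-- Fields with the given trace which are orthogonal to the fields with zero trace. -/
theorem exists_lift (u : H) : ∃ z, P.tr z = 0 ∧
    ∀ v, P.tr v = 0 → inner ℂ (P.D v) (P.A (P.D (u - z))) = 0 := by
  obtain ⟨R, hR⟩ := P.exists_solution P.tr.ker P.tr.isClosed_ker fun u hu => by
    have : P.tr u = 0 := hu
    rw [this, map_zero]
  refine ⟨R (P.A (P.D u)), (hR _).1, fun v hv => ?_⟩
  rw [map_sub, map_sub, inner_sub_right, (hR _).2 v hv, sub_self]

/-- The correctors. -/
theorem exists_corrector (X : H →L[ℂ] G) : ∃ N : C3 →L[ℂ] H, ∀ c, P.avg (P.tr (N c)) = 0 ∧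
    ∀ v, inner ℂ (P.D v) (P.A (P.D (N c) + X (P.cst c))) = 0 := by
  obtain ⟨R, hR⟩ := P.exists_solution (P.avg.comp P.tr).ker (P.avg.comp P.tr).isClosed_ker
    fun u hu => hu
  refine ⟨-(R.comp (P.A.comp (X.comp P.cst))), fun c => ⟨?_, fun v => ?_⟩⟩
  · have : P.avg (P.tr (R (P.A (X (P.cst c))))) = 0 := (hR _).1
    simp [this]
  -- The equation has been solved against test fields of zero average. D annihilates constants, so
  -- it holds against all test fields.
  · have h1 : P.D v = P.D (v - P.cst (P.avg (P.tr v))) := by rw [map_sub, P.D_cst, sub_zero]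
    have h2 : v - P.cst (P.avg (P.tr v)) ∈ (P.avg.comp P.tr).ker := by
      change P.avg (P.tr (v - P.cst (P.avg (P.tr v)))) = 0
      rw [map_sub, map_sub, P.avg_tr_cst, sub_self]
    have h3 := (hR (P.A (X (P.cst c)))).2 _ h2
    rw [← h1] at h3
    simp [h3]

variable {P} {s : ℝ} {X : H →L[ℂ] G}

/-- The problem with the boundary condition of the resolvent. -/
theorem IsShift.exists_resolvent (hX : P.IsShift s X) {t : ℝ} (ht : 0 < t) :
    ∃ U : B →L[ℂ] H, ∀ h v, (t : ℂ) * inner ℂ (P.D v + X v) (P.A (P.D (U h) + X (U h))) +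
      inner ℂ (P.tr v) (P.tr (U h)) = -inner ℂ (P.tr v) h := by
  set T : H →L[ℂ] G := P.D + X with hT
  set a : ℝ := ‖P.avg‖ ^ 2 + 1
  have ha : 0 < a := by positivity
  obtain ⟨R, hR⟩ := exists_rightInverse_of_coercive ((t : ℂ) • (ContinuousLinearMap.adjoint T).comp
    (P.A.comp T) + (ContinuousLinearMap.adjoint P.tr).comp P.tr)
    -- The average is bounded by the trace with the constant a, so the strain and trace terms of the
    -- form together dominate both terms of the Korn inequality `hX.korn`.
    (c := min (t * P.ν) a⁻¹ / P.K)
    (div_pos (lt_min (mul_pos ht P.ν_pos) (inv_pos.2 ha)) P.K_pos) fun u => by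
      have e1 : (inner ℂ u (((t : ℂ) • (ContinuousLinearMap.adjoint T).comp (P.A.comp T) +
          (ContinuousLinearMap.adjoint P.tr).comp P.tr) u)).re =
          t * (inner ℂ (T u) (P.A (T u))).re + ‖P.tr u‖ ^ 2 := by
        simp only [add_apply, smul_apply, ContinuousLinearMap.comp_apply,
          inner_add_right, inner_smul_right, ContinuousLinearMap.adjoint_inner_right,
          Complex.add_re, Complex.re_ofReal_mul, re_inner_self]
      rw [e1]
      have hTm : T u ∈ P.Gs := P.Gs.add_mem (P.D_mem u) (hX.mem u)
      have h1 := P.coercive _ hTm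
      have h2 : ‖u‖ ^ 2 ≤ P.K * (‖T u‖ ^ 2 + ‖P.avg (P.tr u)‖ ^ 2) := hX.korn u
      have h3 : ‖P.avg (P.tr u)‖ ^ 2 ≤ a * ‖P.tr u‖ ^ 2 := by
        have := pow_le_pow_left₀ (norm_nonneg _) (P.avg.le_opNorm (P.tr u)) 2
        rw [mul_pow] at this
        nlinarith [sq_nonneg ‖P.tr u‖]
      set q := min (t * P.ν) a⁻¹
      have hq1 : q ≤ t * P.ν := min_le_left _ _
      have hq2 : q * a ≤ 1 := by
        have : q ≤ a⁻¹ := min_le_right _ _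
        calc q * a ≤ a⁻¹ * a := mul_le_mul_of_nonneg_right this ha.le
          _ = 1 := inv_mul_cancel₀ ha.ne'
      have hq : 0 ≤ q := (lt_min (mul_pos ht P.ν_pos) (inv_pos.2 ha)).le
      rw [div_mul_eq_mul_div, div_le_iff₀ P.K_pos]
      calc q * ‖u‖ ^ 2 ≤ q * (P.K * (‖T u‖ ^ 2 + a * ‖P.tr u‖ ^ 2)) :=
            mul_le_mul_of_nonneg_left (h2.trans (mul_le_mul_of_nonneg_left
              (add_le_add le_rfl h3) P.K_pos.le)) hq
        _ = (q * ‖T u‖ ^ 2 + (q * a) * ‖P.tr u‖ ^ 2) * P.K := by ring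
        _ ≤ (t * P.ν * ‖T u‖ ^ 2 + 1 * ‖P.tr u‖ ^ 2) * P.K := by
            have := P.K_pos.le
            gcongr
        _ ≤ _ := by
            rw [one_mul, mul_assoc]
            have := P.K_pos.le
            gcongr
  refine ⟨-(R.comp (ContinuousLinearMap.adjoint P.tr)), fun h v => ?_⟩
  have := congrArg (fun z => inner ℂ v z) (hR (ContinuousLinearMap.adjoint P.tr h))
  simp only [add_apply, smul_apply, ContinuousLinearMap.comp_apply,
    inner_add_right, inner_smul_right, ContinuousLinearMap.adjoint_inner_right, hT] at this
  simp only [neg_apply, ContinuousLinearMap.comp_apply, map_neg, ← neg_add, inner_neg_right,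
    mul_neg, this]

/-- Uniqueness for the problem with the boundary condition of the resolvent. -/
theorem IsShift.eq_zero (hX : P.IsShift s X) {t : ℝ} (ht : 0 < t) {u : H}
    (h : ∀ v, (t : ℂ) * inner ℂ (P.D v + X v) (P.A (P.D u + X u)) +
      inner ℂ (P.tr v) (P.tr u) = 0) : u = 0 := by
  have h1 := congrArg Complex.re (h u)
  rw [Complex.add_re, Complex.re_ofReal_mul, re_inner_self, Complex.zero_re] at h1
  have h2 := P.coercive _ (P.Gs.add_mem (P.D_mem u) (hX.mem u))
  have h3 : 0 ≤ P.ν * ‖P.D u + X u‖ ^ 2 := mul_nonneg P.ν_pos.le (sq_nonneg _)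
  have h4 : 0 ≤ t * (inner ℂ (P.D u + X u) (P.A (P.D u + X u))).re :=
    mul_nonneg ht.le (h3.trans h2)
  have h5 : ‖P.tr u‖ ^ 2 = 0 := le_antisymm (by linarith) (sq_nonneg _)
  have h6 : P.tr u = 0 := norm_eq_zero.1 (pow_eq_zero_iff two_ne_zero |>.1 h5)
  have h7 : (inner ℂ (P.D u + X u) (P.A (P.D u + X u))).re = 0 := by
    rw [h5, add_zero] at h1
    exact (mul_eq_zero.1 h1).resolve_left ht.ne'
  have h8 : ‖P.D u + X u‖ ^ 2 = 0 := by
    rw [h7] at h2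
    exact le_antisymm (by nlinarith [P.ν_pos, sq_nonneg ‖P.D u + X u‖]) (sq_nonneg _)
  have h9 := hX.korn u
  rw [h8, h6, map_zero, norm_zero, zero_pow two_ne_zero, add_zero, mul_zero] at h9
  exact norm_eq_zero.1 (pow_eq_zero_iff two_ne_zero |>.1 (le_antisymm h9 (sq_nonneg _)))

variable (P) in
/-- The homogenised operator. -/
def hom (X : H →L[ℂ] G) (N : C3 →L[ℂ] H) : C3 →L[ℂ] C3 :=
  -((P.m⁻¹ : ℝ) : ℂ) • (ContinuousLinearMap.adjoint (X.comp P.cst)).comp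
    (P.A.comp (P.D.comp N + X.comp P.cst))

theorem inner_hom (N : C3 →L[ℂ] H) (c d : C3) : inner ℂ d (P.hom X N c) =
    -((P.m : ℂ)⁻¹ * inner ℂ (X (P.cst d)) (P.A (P.D (N c) + X (P.cst c)))) := by
  simp only [hom, smul_apply, ContinuousLinearMap.comp_apply, inner_smul_right,
    ContinuousLinearMap.adjoint_inner_right, add_apply, neg_mul, Complex.ofReal_inv]

variable {N : C3 →L[ℂ] H}

/-- Testing the corrector equation with N c itself replaces X c by the full cell field E = D(N c) +
X c. Hence -m ⟨c, Λ_hom c⟩ = ⟨E, A E⟩, which is non-negative in real part. -/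
theorem IsShift.re_inner_hom_le (hX : P.IsShift s X)
    (hN : ∀ c, P.avg (P.tr (N c)) = 0 ∧
      ∀ v, inner ℂ (P.D v) (P.A (P.D (N c) + X (P.cst c))) = 0) (c : C3) :
    (inner ℂ c (P.hom X N c)).re ≤ 0 := by
  rw [inner_hom]
  have h1 : inner ℂ (X (P.cst c)) (P.A (P.D (N c) + X (P.cst c))) =
      inner ℂ (P.D (N c) + X (P.cst c)) (P.A (P.D (N c) + X (P.cst c))) := by
    conv_rhs => rw [inner_add_left, (hN c).2 (N c), zero_add]
  rw [h1, ← Complex.ofReal_inv, Complex.neg_re, Complex.re_ofReal_mul, neg_nonpos]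
  refine mul_nonneg (inv_nonneg.2 P.m_pos.le) (le_trans ?_
    (P.coercive _ (P.Gs.add_mem (P.D_mem _) (hX.mem _))))
  exact mul_nonneg P.ν_pos.le (sq_nonneg _)

/-- The operator `t Λ^hom - 1` is bounded below by `1`. -/
theorem IsShift.norm_le_hom (hX : P.IsShift s X)
    (hN : ∀ c, P.avg (P.tr (N c)) = 0 ∧
      ∀ v, inner ℂ (P.D v) (P.A (P.D (N c) + X (P.cst c))) = 0) {t : ℝ} (ht : 0 < t) (c : C3) :
    ‖c‖ ≤ ‖(t : ℂ) • P.hom X N c - c‖ := by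
  have h1 := hX.re_inner_hom_le hN c
  have h2 : (inner ℂ c ((t : ℂ) • P.hom X N c - c)).re ≤ -‖c‖ ^ 2 := by
    rw [inner_sub_right, inner_smul_right, Complex.sub_re, Complex.re_ofReal_mul, re_inner_self]
    have h3 : t * (inner ℂ c (P.hom X N c)).re ≤ 0 := mul_nonpos_of_nonneg_of_nonpos ht.le h1
    linarith
  have h3 : ‖c‖ ^ 2 ≤ ‖c‖ * ‖(t : ℂ) • P.hom X N c - c‖ := by
    refine le_trans ?_ (norm_inner_le_norm (𝕜 := ℂ) c _)
    have := Complex.abs_re_le_norm (inner ℂ c ((t : ℂ) • P.hom X N c - c))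
    have h4 := neg_abs_le (inner ℂ c ((t : ℂ) • P.hom X N c - c)).re
    linarith
  rcases (norm_nonneg c).eq_or_lt with h0 | h0
  · rw [← h0]; exact norm_nonneg _
  · rw [sq] at h3
    exact le_of_mul_le_mul_left h3 h0

set_option maxHeartbeats 1000000 in
/-- The comparison of the solution of the problem with the boundary condition of the resolvent and
the solution of the homogenised problem. -/
theorem IsShift.norm_sub_cst_le (hX : P.IsShift s X)
    (hN : ∀ c, P.avg (P.tr (N c)) = 0 ∧
      ∀ v, inner ℂ (P.D v) (P.A (P.D (N c) + X (P.cst c))) = 0)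
    {L : ℝ} (hL : 1 ≤ L) (hA : ‖P.A‖ ≤ L) (htr : ‖P.tr‖ ≤ L) (hcst : ‖P.cst‖ ≤ L)
    (havg : ‖P.avg‖ ≤ L) (hν : P.ν⁻¹ ≤ L) (hK : P.K ≤ L) (hs : 0 < s) (hsL : s ≤ L)
    {u : H} {h : B} {c : C3}
    (hu : ∀ v, (((s ^ 2)⁻¹ : ℝ) : ℂ) * inner ℂ (P.D v + X v) (P.A (P.D u + X u)) +
      inner ℂ (P.tr v) (P.tr u) = -inner ℂ (P.tr v) h)
    (hc : (((s ^ 2)⁻¹ : ℝ) : ℂ) • P.hom X N c - c = P.avg h) :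
    ‖u - P.cst c‖ ≤ 21 * L ^ 12 * s * ‖h‖ := by
  have hL0 : 0 < L := one_pos.trans_le hL
  set t : ℝ := (s ^ 2)⁻¹ with ht
  have ht0 : 0 < t := by positivity
  have hts : t * s ^ 2 = 1 := inv_mul_cancel₀ (by positivity)
  set η := ‖h‖
  have hη : 0 ≤ η := norm_nonneg _
  -- L ≥ 1 bounds all the data, so lower powers of L may always be raised; the exponents are not
  -- optimised.
  have hpow : ∀ {i j : ℕ}, i ≤ j → L ^ i ≤ L ^ j := fun hij => pow_le_pow_right₀ hL hij
  -- operator bounds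
  have bA : ∀ E, ‖P.A E‖ ≤ L * ‖E‖ := fun E =>
    (P.A.le_opNorm E).trans (mul_le_mul_of_nonneg_right hA (norm_nonneg _))
  have btr : ∀ v, ‖P.tr v‖ ≤ L * ‖v‖ := fun v =>
    (P.tr.le_opNorm v).trans (mul_le_mul_of_nonneg_right htr (norm_nonneg _))
  have bcst : ∀ d, ‖P.cst d‖ ≤ L * ‖d‖ := fun d =>
    (P.cst.le_opNorm d).trans (mul_le_mul_of_nonneg_right hcst (norm_nonneg _))
  have bavg : ∀ g, ‖P.avg g‖ ≤ L * ‖g‖ := fun g =>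
    (P.avg.le_opNorm g).trans (mul_le_mul_of_nonneg_right havg (norm_nonneg _))
  have bco : ∀ E ∈ P.Gs, ‖E‖ ^ 2 ≤ L * (inner ℂ E (P.A E)).re := fun E hE => by
    have h1 := P.coercive E hE
    have h2 : 1 ≤ L * P.ν := by
      rw [← inv_le_iff_one_le_mul₀ P.ν_pos]; exact hν
    calc ‖E‖ ^ 2 = 1 * ‖E‖ ^ 2 := (one_mul _).symm
      _ ≤ L * P.ν * ‖E‖ ^ 2 := mul_le_mul_of_nonneg_right h2 (sq_nonneg _)
      _ = L * (P.ν * ‖E‖ ^ 2) := mul_assoc _ _ _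
      _ ≤ _ := mul_le_mul_of_nonneg_left h1 hL0.le
  -- From K ≤ L ≤ L² the square root of K is at most L.
  have hsqrt : ∀ {a x y : ℝ}, 0 ≤ x → 0 ≤ y → a ^ 2 ≤ P.K * (x ^ 2 + y ^ 2) →
      a ≤ L * (x + y) := fun {a x y} hx hy h1 => by
    refine le_of_sq_le_sq (h1.trans ?_) (by positivity)
    have h2 : P.K ≤ L ^ 2 := hK.trans (by nlinarith)
    calc P.K * (x ^ 2 + y ^ 2) ≤ L ^ 2 * (x ^ 2 + y ^ 2) :=
          mul_le_mul_of_nonneg_right h2 (by positivity)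
      _ ≤ L ^ 2 * (x + y) ^ 2 := mul_le_mul_of_nonneg_left (by nlinarith [mul_nonneg hx hy])
          (by positivity)
      _ = _ := by ring
  have bD : ∀ v, P.avg (P.tr v) = 0 → ‖v‖ ≤ L * ‖P.D v‖ := fun v hv => by
    have h1 := P.korn v
    rw [hv, norm_zero] at h1
    simpa using hsqrt (norm_nonneg _) le_rfl h1
  have bT : ∀ v, ‖v‖ ≤ L * (‖P.D v + X v‖ + ‖P.avg (P.tr v)‖) := fun v =>
    hsqrt (norm_nonneg _) (norm_nonneg _) (hX.korn v)
  have binner : ∀ E F, ‖(inner ℂ E (P.A F) : ℂ)‖ ≤ ‖E‖ * (L * ‖F‖) := fun E F =>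
    (norm_inner_le_norm _ _).trans (mul_le_mul_of_nonneg_left (bA F) (norm_nonneg _))
  -- the homogenised solution and its corrector
  set E := P.D (N c) + X (P.cst c) with hE
  have hcη : ‖c‖ ≤ L * η := (hX.norm_le_hom hN ht0 c).trans (by rw [hc]; exact bavg h)
  have hXc : ‖X (P.cst c)‖ ≤ L * s * ‖c‖ := by
    refine (hX.norm_le _).trans ?_
    calc s * ‖P.cst c‖ ≤ s * (L * ‖c‖) := mul_le_mul_of_nonneg_left (bcst c) hs.le
      _ = _ := by ring
  have hDN : ‖P.D (N c)‖ ≤ L ^ 3 * s * ‖c‖ := by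
    have h1 := bco _ (P.D_mem (N c))
    have h2 : inner ℂ (P.D (N c)) (P.A (P.D (N c))) =
        -inner ℂ (P.D (N c)) (P.A (X (P.cst c))) := by
      have := (hN c).2 (N c)
      rw [map_add, inner_add_right] at this
      exact eq_neg_of_add_eq_zero_left this
    have h3 : (inner ℂ (P.D (N c)) (P.A (P.D (N c)))).re ≤
        ‖P.D (N c)‖ * (L * (L * s * ‖c‖)) := by
      refine (Complex.re_le_norm _).trans ?_
      rw [h2, norm_neg]
      refine (binner _ _).trans ?_
      gcongr
    have h4 : ‖P.D (N c)‖ * ‖P.D (N c)‖ ≤ ‖P.D (N c)‖ * (L ^ 3 * s * ‖c‖) := by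
      calc _ = ‖P.D (N c)‖ ^ 2 := (sq _).symm
        _ ≤ L * (‖P.D (N c)‖ * (L * (L * s * ‖c‖))) :=
            h1.trans (mul_le_mul_of_nonneg_left h3 hL0.le)
        _ = _ := by ring
    rcases (norm_nonneg (P.D (N c))).eq_or_lt with h0 | h0
    · rw [← h0]; positivity
    · exact le_of_mul_le_mul_left h4 h0
  have hNc : ‖N c‖ ≤ L ^ 5 * s * η := by
    calc ‖N c‖ ≤ L * ‖P.D (N c)‖ := bD _ (hN c).1
      _ ≤ L * (L ^ 3 * s * (L * η)) := by
          refine mul_le_mul_of_nonneg_left (hDN.trans ?_) hL0.le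
          gcongr
      _ = _ := by ring
  have hEη : ‖E‖ ≤ 2 * L ^ 4 * s * η := by
    have h1 : L * s * ‖c‖ ≤ L ^ 3 * s * ‖c‖ := by
      have := hpow (show 1 ≤ 3 by norm_num)
      rw [pow_one] at this
      gcongr
    calc ‖E‖ ≤ L ^ 3 * s * ‖c‖ + L ^ 3 * s * ‖c‖ :=
          (norm_add_le _ _).trans (add_le_add hDN (hXc.trans h1))
      _ = 2 * L ^ 3 * s * ‖c‖ := by ring
      _ ≤ 2 * L ^ 3 * s * (L * η) := by gcongr
      _ = _ := by ring
  -- the residual functional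
  set Br : H → ℂ := fun v => inner ℂ (P.tr v) h + (t : ℂ) * inner ℂ (X v) (P.A E) +
    inner ℂ (P.tr v) (P.tr (P.cst c)) with hBr
  -- Tested with constants, the residual is m times the equation satisfied by c. The homogenised
  -- equation is thus exactly the solvability condition of the expansion.
  have hBr_cst : ∀ d, Br (P.cst d) = 0 := fun d => by
    have h1 : inner ℂ (X (P.cst d)) (P.A E) = -((P.m : ℂ) * inner ℂ d (P.hom X N c)) := by
      rw [inner_hom, ← hE]
      have : (P.m : ℂ) ≠ 0 := by exact_mod_cast P.m_pos.ne'
      field_simp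
    have h2 : P.avg h = (t : ℂ) • P.hom X N c - c := hc.symm
    rw [hBr]
    simp only
    rw [P.inner_tr_cst, P.inner_tr_cst, P.avg_tr_cst, h1, h2, inner_sub_right, inner_smul_right]
    ring
  have hBr_sub : ∀ v w, Br (v - w) = Br v - Br w := fun v w => by
    simp only [hBr, map_sub, inner_sub_left]
    ring
  -- Subtracting from v its average changes neither `Br v` nor D v, and Korn then bounds the
  -- remaining field by D v. The term with the large factor t is harmless because X and E are both
  -- of order s and t s² = 1.
  have hBr_le : ∀ v, ‖Br v‖ ≤ 4 * L ^ 6 * η * ‖P.D v‖ := fun v => by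
    set z := v - P.cst (P.avg (P.tr v)) with hz
    have h1 : Br v = Br z := by rw [hz, hBr_sub, hBr_cst, sub_zero]
    have h2 : P.avg (P.tr z) = 0 := by rw [hz, map_sub, map_sub, P.avg_tr_cst, sub_self]
    have h3 : ‖z‖ ≤ L * ‖P.D v‖ := by
      have := bD z h2
      rwa [hz, map_sub P.D, P.D_cst, sub_zero] at this
    have i1 : ‖(inner ℂ (P.tr z) h : ℂ)‖ ≤ L ^ 5 * (‖z‖ * η) := by
      calc _ ≤ (L * ‖z‖) * η :=
            (norm_inner_le_norm _ _).trans (mul_le_mul_of_nonneg_right (btr z) hη)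
        _ = L ^ 1 * (‖z‖ * η) := by ring
        _ ≤ _ := mul_le_mul_of_nonneg_right (hpow (by norm_num)) (by positivity)
    have i2 : ‖(t : ℂ) * (inner ℂ (X z) (P.A E) : ℂ)‖ ≤ 2 * L ^ 5 * (‖z‖ * η) := by
      rw [norm_mul, Complex.norm_real, Real.norm_of_nonneg ht0.le]
      calc _ ≤ t * ((s * ‖z‖) * (L * (2 * L ^ 4 * s * η))) := by
            refine mul_le_mul_of_nonneg_left ((binner _ _).trans ?_) ht0.le
            have := hX.norm_le z
            gcongr
        _ = (t * s ^ 2) * (2 * L ^ 5 * (‖z‖ * η)) := by ring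
        _ = _ := by rw [hts, one_mul]
    have i3 : ‖(inner ℂ (P.tr z) (P.tr (P.cst c)) : ℂ)‖ ≤ L ^ 5 * (‖z‖ * η) := by
      calc _ ≤ (L * ‖z‖) * (L * (L * (L * η))) := by
            refine (norm_inner_le_norm _ _).trans (mul_le_mul (btr z) ?_ (norm_nonneg _)
              (by positivity))
            refine (btr _).trans (mul_le_mul_of_nonneg_left ((bcst c).trans ?_) hL0.le)
            gcongr
        _ = L ^ 4 * (‖z‖ * η) := by ring
        _ ≤ _ := mul_le_mul_of_nonneg_right (hpow (by norm_num)) (by positivity)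
    rw [h1]
    calc ‖Br z‖ ≤ L ^ 5 * (‖z‖ * η) + 2 * L ^ 5 * (‖z‖ * η) + L ^ 5 * (‖z‖ * η) :=
          (norm_add_le _ _).trans (add_le_add ((norm_add_le _ _).trans (add_le_add i1 i2)) i3)
      _ = 4 * L ^ 5 * η * ‖z‖ := by ring
      _ ≤ 4 * L ^ 5 * η * (L * ‖P.D v‖) := by gcongr
      _ = _ := by ring
  -- the remainder
  set r := u - P.cst c - N c with hr
  set T := P.D r + X r with hT
  -- The equation for u is tested with r. By the corrector equation only the X r part of T is seen
  -- by A E; it goes into `Br r`, and the other terms on the right contain N c.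
  have hident : (t : ℂ) * inner ℂ T (P.A T) + inner ℂ (P.tr r) (P.tr r) =
      -(Br r + (t : ℂ) * inner ℂ T (P.A (X (N c))) + inner ℂ (P.tr r) (P.tr (N c))) := by
    have h1 : T = P.D u + X u - E - X (N c) := by
      rw [hT, hr, hE]
      simp only [map_sub, P.D_cst]
      abel
    have h2 : inner ℂ T (P.A E) = inner ℂ (X r) (P.A E) := by
      rw [hT, inner_add_left, (hN c).2 r, zero_add]
    have h3 : inner ℂ T (P.A T) = inner ℂ T (P.A (P.D u + X u)) - inner ℂ (X r) (P.A E) -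
        inner ℂ T (P.A (X (N c))) := by
      conv_lhs => rw [h1, map_sub, map_sub, inner_sub_right, inner_sub_right, ← h1]
      rw [h2]
    have h4 : inner ℂ (P.tr r) (P.tr r) = inner ℂ (P.tr r) (P.tr u) -
        inner ℂ (P.tr r) (P.tr (P.cst c)) - inner ℂ (P.tr r) (P.tr (N c)) := by
      conv_lhs => enter [3]; rw [hr, map_sub, map_sub]
      rw [inner_sub_right, inner_sub_right]
    have h5 := hu r
    rw [h3, h4, hBr]
    simp only
    linear_combination h5
  -- The strain of the remainder is measured in units of s, so that t ‖T‖² = x² has the same size as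
  -- the trace term y².
  obtain ⟨x, hx⟩ : ∃ x, x = ‖T‖ / s := ⟨_, rfl⟩
  have hx0 : 0 ≤ x := hx ▸ by positivity
  have hTx : ‖T‖ = s * x := by rw [hx]; field_simp
  set y := ‖P.tr r‖ with hy
  have hy0 : 0 ≤ y := norm_nonneg _
  have hrxy : ‖r‖ ≤ L ^ 2 * (x + y) := by
    calc ‖r‖ ≤ L * (L * x + L * y) := by
          refine (bT r).trans (mul_le_mul_of_nonneg_left (add_le_add ?_ (bavg _)) hL0.le)
          rw [← hT, hTx]
          gcongr
      _ = _ := by ring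
  have hTle : t * ‖T‖ ^ 2 = x ^ 2 := by
    rw [hTx, mul_pow, ← mul_assoc, hts, one_mul]
  have hrhs : t * (inner ℂ T (P.A T)).re + y ^ 2 ≤ 10 * L ^ 9 * η * s * (x + y) := by
    have h1 := congrArg Complex.re hident
    rw [Complex.add_re, Complex.re_ofReal_mul, re_inner_self] at h1
    rw [h1]
    refine (Complex.re_le_norm _).trans ?_
    rw [norm_neg]
    -- The decisive gain: D r = T - X r carries a factor s, and the residual is bounded by D r.
    have hDr : ‖P.D r‖ ≤ s * x + s * ‖r‖ := by
      have : P.D r = T - X r := by rw [hT, add_sub_cancel_right]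
      rw [this]
      exact (norm_sub_le _ _).trans (add_le_add hTx.le (hX.norm_le r))
    have i1 : ‖Br r‖ ≤ 4 * L ^ 7 * η * s * (x + ‖r‖) := by
      calc ‖Br r‖ ≤ 4 * L ^ 6 * η * (s * x + s * ‖r‖) :=
            (hBr_le r).trans (mul_le_mul_of_nonneg_left hDr (by positivity))
        _ = 4 * L ^ 6 * η * s * (x + ‖r‖) := by ring
        _ ≤ _ := by
            have := hpow (show 6 ≤ 7 by norm_num)
            gcongr
    have i2 : ‖(t : ℂ) * (inner ℂ T (P.A (X (N c))) : ℂ)‖ ≤ L ^ 7 * η * s * x := by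
      rw [norm_mul, Complex.norm_real, Real.norm_of_nonneg ht0.le]
      calc _ ≤ t * ((s * x) * (L * (s * (L ^ 5 * s * η)))) := by
            refine mul_le_mul_of_nonneg_left ((binner _ _).trans ?_) ht0.le
            have := (hX.norm_le (N c)).trans (mul_le_mul_of_nonneg_left hNc hs.le)
            rw [hTx]
            gcongr
        _ = (t * s ^ 2) * (L ^ 6 * η * s * x) := by ring
        _ = L ^ 6 * η * s * x := by rw [hts, one_mul]
        _ ≤ _ := by
            have := hpow (show 6 ≤ 7 by norm_num)
            gcongr
    have i3 : ‖(inner ℂ (P.tr r) (P.tr (N c)) : ℂ)‖ ≤ L ^ 7 * η * s * ‖r‖ := by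
      calc _ ≤ (L * ‖r‖) * (L * (L ^ 5 * s * η)) := by
            refine (norm_inner_le_norm _ _).trans (mul_le_mul (btr r) ?_ (norm_nonneg _)
              (by positivity))
            exact (btr _).trans (mul_le_mul_of_nonneg_left hNc hL0.le)
        _ = _ := by ring
    have h2 : x + ‖r‖ ≤ 2 * L ^ 2 * (x + y) := by
      have : 1 ≤ L ^ 2 := one_le_pow₀ hL
      nlinarith
    calc _ ≤ 4 * L ^ 7 * η * s * (x + ‖r‖) + L ^ 7 * η * s * x + L ^ 7 * η * s * ‖r‖ :=
          (norm_add_le _ _).trans (add_le_add ((norm_add_le _ _).trans (add_le_add i1 i2)) i3)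
      _ = 5 * L ^ 7 * η * s * (x + ‖r‖) := by ring
      _ ≤ 5 * L ^ 7 * η * s * (2 * L ^ 2 * (x + y)) := by gcongr
      _ = _ := by ring
  have hxy : x + y ≤ 20 * L ^ 10 * η * s := by
    have h1 : x ^ 2 ≤ L * (t * (inner ℂ T (P.A T)).re) := by
      rw [← hTle]
      have := bco T (P.Gs.add_mem (P.D_mem r) (hX.mem r))
      calc t * ‖T‖ ^ 2 ≤ t * (L * (inner ℂ T (P.A T)).re) :=
            mul_le_mul_of_nonneg_left this ht0.le
        _ = _ := by ring
    have h2 : x ^ 2 + y ^ 2 ≤ L * (10 * L ^ 9 * η * s * (x + y)) := by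
      refine le_trans ?_ (mul_le_mul_of_nonneg_left hrhs hL0.le)
      rw [mul_add]
      have : y ^ 2 ≤ L * y ^ 2 := le_mul_of_one_le_left (sq_nonneg _) hL
      linarith
    -- The energy is quadratic in x + y and the right-hand side is linear in it, so one factor x + y
    -- cancels.
    have h3 : (x + y) * (x + y) ≤ (20 * L ^ 10 * η * s) * (x + y) := by
      calc (x + y) * (x + y) ≤ 2 * (x ^ 2 + y ^ 2) := by nlinarith [sq_nonneg (x - y)]
        _ ≤ 2 * (L * (10 * L ^ 9 * η * s * (x + y))) := by linarith
        _ = _ := by ring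
    rcases (add_nonneg hx0 hy0).eq_or_lt with h0 | h0
    · rw [← h0]; positivity
    · exact le_of_mul_le_mul_right h3 h0
  have hsplit : u - P.cst c = r + N c := by rw [hr]; abel
  rw [hsplit]
  calc ‖r + N c‖ ≤ L ^ 2 * (20 * L ^ 10 * η * s) + L ^ 5 * s * η :=
        (norm_add_le _ _).trans (add_le_add (hrxy.trans
          (mul_le_mul_of_nonneg_left hxy (by positivity))) hNc)
    _ ≤ L ^ 2 * (20 * L ^ 10 * η * s) + L ^ 12 * s * η := by
        have := hpow (show 5 ≤ 12 by norm_num)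
        gcongr
    _ = _ := by ring

end CellData

/-! ### The elasticity tensor as an operator -/

/-- A fourth-order tensor as an operator on matrices. -/
def tensorL (a : Fin 3 → Fin 3 → Fin 3 → Fin 3 → ℝ) : C33 →L[ℂ] C33 :=
  ∑ p : Fin 3 × Fin 3, ∑ q : Fin 3 × Fin 3, (a p.1 p.2 q.1 q.2 : ℂ) •
    (EuclideanSpace.proj (𝕜 := ℂ) q : C33 →L[ℂ] ℂ).smulRight (EuclideanSpace.single p (1 : ℂ))

theorem tensorL_apply (a : Fin 3 → Fin 3 → Fin 3 → Fin 3 → ℝ) (ξ : C33) (i j : Fin 3) :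
    tensorL a ξ (i, j) = ∑ k, ∑ l, (a i j k l : ℂ) * ξ (k, l) := by
  have h : tensorL a ξ (i, j) = ∑ q : Fin 3 × Fin 3, (a i j q.1 q.2 : ℂ) * ξ q := by
    simp only [tensorL, sum_apply, smul_apply, ContinuousLinearMap.smulRight_apply,
      WithLp.ofLp_sum, Finset.sum_apply, PiLp.smul_apply, PiLp.single_apply, smul_eq_mul,
      PiLp.proj_apply]
    rw [Finset.sum_eq_single (i, j)]
    · simp
    · intro p _ hp
      simp [hp.symm]
    · simp
  rw [h, Fintype.sum_prod_type]

theorem inner_tensorL (a : Fin 3 → Fin 3 → Fin 3 → Fin 3 → ℝ) (ξ ζ : C33) :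
    inner ℂ ζ (tensorL a ξ) =
      ∑ i, ∑ j, ∑ k, ∑ l, (a i j k l : ℂ) * ξ (k, l) * star (ζ (i, j)) := by
  rw [PiLp.inner_apply, Fintype.sum_prod_type]
  refine Finset.sum_congr rfl fun i _ => Finset.sum_congr rfl fun j _ => ?_
  rw [tensorL_apply, RCLike.inner_apply, Finset.sum_mul]
  refine Finset.sum_congr rfl fun k _ => ?_
  rw [Finset.sum_mul]
  rfl

/-- The coefficients are real, so ellipticity for complex matrices follows from that for the real
and imaginary parts separately. -/
theorem re_inner_tensorL (a : Fin 3 → Fin 3 → Fin 3 → Fin 3 → ℝ) (ξ : C33) :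
    (inner ℂ ξ (tensorL a ξ)).re =
      (∑ i, ∑ j, ∑ k, ∑ l, a i j k l * (ξ (k, l)).re * (ξ (i, j)).re) +
      ∑ i, ∑ j, ∑ k, ∑ l, a i j k l * (ξ (k, l)).im * (ξ (i, j)).im := by
  rw [inner_tensorL]
  simp only [Complex.re_sum, ← Finset.sum_add_distrib]
  refine Finset.sum_congr rfl fun i _ => Finset.sum_congr rfl fun j _ =>
    Finset.sum_congr rfl fun k _ => Finset.sum_congr rfl fun l _ => ?_
  simp [Complex.mul_re]

theorem exists_norm_tensorL_le : ∃ c : ℝ, 0 ≤ c ∧ ∀ (a : Fin 3 → Fin 3 → Fin 3 → Fin 3 → ℝ) (M : ℝ),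
    (∀ i j k l, |a i j k l| ≤ M) → ‖tensorL a‖ ≤ M * c := by
  refine ⟨∑ p : Fin 3 × Fin 3, ∑ q : Fin 3 × Fin 3, ‖(EuclideanSpace.proj (𝕜 := ℂ) q :
    C33 →L[ℂ] ℂ).smulRight (EuclideanSpace.single p (1 : ℂ) : C33)‖, by positivity,
    fun a M h => ?_⟩
  rw [tensorL, Finset.mul_sum]
  refine (norm_sum_le _ _).trans (Finset.sum_le_sum fun p _ => ?_)
  rw [Finset.mul_sum]
  refine (norm_sum_le _ _).trans (Finset.sum_le_sum fun q _ => ?_)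
  rw [norm_smul, Complex.norm_real, Real.norm_eq_abs]
  exact mul_le_mul_of_nonneg_right (h _ _ _ _) (norm_nonneg _)

/-- The symmetrisation of a square-integrable matrix field. -/
def symLp (S : Set R3) : L2Grad S →L[ℂ] L2Grad S := symL.compLpL 2 _

theorem coeFn_symLp {S : Set R3} (E : L2Grad S) :
    ∀ᵐ y ∂(volume.restrict (stiff S)), symLp S E y = symL (E y) :=
  ContinuousLinearMap.coeFn_compLpL symL E

/-- The square-integrable fields of symmetric matrices. -/
def symmetricFields (S : Set R3) : Submodule ℂ (L2Grad S) := (symLp S - .id ℂ _).ker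

theorem symL_symL (ξ : C33) : symL (symL ξ) = symL ξ := by
  ext ⟨i, j⟩
  simp only [symL_apply]
  ring

theorem symLp_mem {S : Set R3} (E : L2Grad S) : symLp S E ∈ symmetricFields S := by
  change symLp S (symLp S E) - symLp S E = 0
  rw [sub_eq_zero]
  refine Lp.ext ?_
  filter_upwards [coeFn_symLp E, coeFn_symLp (symLp S E)] with y h1 h2
  rw [h2, h1, symL_symL]

theorem ae_symm_of_mem {S : Set R3} {E : L2Grad S} (hE : E ∈ symmetricFields S) :
    ∀ᵐ y ∂(volume.restrict (stiff S)), ∀ i j, E y (i, j) = E y (j, i) := by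
  have h : symLp S E = E := sub_eq_zero.1 hE
  filter_upwards [coeFn_symLp E] with y hy i j
  rw [h] at hy
  rw [hy, symL_apply, symL_apply, add_comm]

theorem isCompact_closure_stiff (S : Set R3) : IsCompact (closure (stiff S)) :=
  isCompact_closure_cell.of_isClosed_subset isClosed_closure (closure_mono sdiff_subset)

/-- Lipschitz entries are bounded on the compact closure of the stiff component, so pointwise
application of the tensor is a bounded operator on L². Ellipticity is assumed for symmetric matrices
only, hence the restriction to `symmetricFields S`. -/
theorem IsElasticityTensor.exists_operator {S : Set R3} {A : TensorField} (hS : IsInclusion S)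
    (hA : IsElasticityTensor S A) :
    ∃ (T : L2Grad S →L[ℂ] L2Grad S) (ν : ℝ), 0 < ν ∧
      (∀ (E F : R3 → Matrix (Fin 3) (Fin 3) ℂ) (e f : L2Grad S),
        (∀ᵐ y ∂(volume.restrict (stiff S)), ∀ i j, E y i j = e y (i, j)) →
        (∀ᵐ y ∂(volume.restrict (stiff S)), ∀ i j, F y i j = f y (i, j)) →
        energy S A E F = inner ℂ f (T e)) ∧
      ∀ e ∈ symmetricFields S, ν * ‖e‖ ^ 2 ≤ (inner ℂ e (T e)).re := by
  obtain ⟨K, hK⟩ := hA.lipschitz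
  obtain ⟨ν, hν, hell⟩ := hA.elliptic
  have hbd : ∀ i j k l, ∃ M, ∀ y ∈ stiff S, |A y i j k l| ≤ M := fun i j k l => by
    obtain ⟨M, hM⟩ := (isCompact_closure_stiff S).exists_bound_of_continuousOn
      (hK i j k l).continuousOn
    exact ⟨M, fun y hy => hM y (subset_closure hy)⟩
  choose M hM using hbd
  set M' := ∑ i, ∑ j, ∑ k, ∑ l, |M i j k l| with hM'
  have hM'le : ∀ y ∈ stiff S, ∀ i j k l, |A y i j k l| ≤ M' := fun y hy i j k l => by
    refine (hM i j k l y hy).trans ((le_abs_self _).trans ?_)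
    refine le_trans ?_ (Finset.single_le_sum (f := fun i => ∑ j, ∑ k, ∑ l, |M i j k l|)
      (fun _ _ => by positivity) (Finset.mem_univ i))
    refine le_trans ?_ (Finset.single_le_sum (f := fun j => ∑ k, ∑ l, |M i j k l|)
      (fun _ _ => by positivity) (Finset.mem_univ j))
    refine le_trans ?_ (Finset.single_le_sum (f := fun k => ∑ l, |M i j k l|)
      (fun _ _ => by positivity) (Finset.mem_univ k))
    exact Finset.single_le_sum (f := fun l => |M i j k l|)
      (fun _ _ => by positivity) (Finset.mem_univ l)
  obtain ⟨c, hc, hcle⟩ := exists_norm_tensorL_le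
  have hmem : MemLp (fun y => tensorL (A y)) ⊤ (volume.restrict (stiff S)) := by
    refine memLp_top_of_bound (C := M' * c) ?_ ?_
    · simp only [tensorL]
      refine Finset.aestronglyMeasurable_fun_sum _ fun p _ =>
        Finset.aestronglyMeasurable_fun_sum _ fun q _ => AEStronglyMeasurable.smul_const ?_ _
      refine Complex.continuous_ofReal.comp_aestronglyMeasurable ?_
      exact ((hK _ _ _ _).continuousOn.mono subset_closure).aestronglyMeasurable
        hS.measurableSet_stiff
    · filter_upwards [ae_restrict_mem hS.measurableSet_stiff] with y hy
      exact hcle _ _ (hM'le y hy)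
  set T : L2Grad S →L[ℂ] L2Grad S :=
    (ContinuousLinearMap.id ℂ (C33 →L[ℂ] C33)).holderL (volume.restrict (stiff S)) ⊤ 2 2
      (hmem.toLp _) with hT
  have hTe : ∀ e : L2Grad S, ∀ᵐ y ∂(volume.restrict (stiff S)), T e y = tensorL (A y) (e y) := by
    intro e
    filter_upwards [(ContinuousLinearMap.id ℂ (C33 →L[ℂ] C33)).coeFn_holder (r := 2)
      (hmem.toLp _) e, hmem.coeFn_toLp] with y h1 h2
    rw [h2] at h1
    exact h1
  refine ⟨T, ν, hν, fun E F e f hE hF => ?_, fun e he => ?_⟩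
  · rw [energy, L2.inner_def]
    refine integral_congr_ae ?_
    filter_upwards [hE, hF, hTe e] with y h1 h2 h3
    rw [h3, inner_tensorL]
    simp only [h1, h2]
  · have h1 : (inner ℂ e (T e)).re = ∫ y in stiff S, (inner ℂ (e y) (T e y)).re :=
      (integral_re (𝕜 := ℂ) (L2.integrable_inner (𝕜 := ℂ) e (T e))).symm
    have h2 : ‖e‖ ^ 2 = ∫ y in stiff S, ‖e y‖ ^ 2 := by
      rw [← re_inner_self, L2.inner_def]
      rw [← RCLike.re_eq_complex_re, ← integral_re (L2.integrable_inner (𝕜 := ℂ) e e)]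
      simp only [RCLike.re_eq_complex_re, re_inner_self]
    rw [h1, h2, ← integral_const_mul]
    refine integral_mono_ae ?_ (L2.integrable_inner (𝕜 := ℂ) e (T e)).re ?_
    · refine Integrable.const_mul ?_ ν
      refine (L2.integrable_inner (𝕜 := ℂ) e e).re.congr ?_
      filter_upwards with y using re_inner_self _
    · filter_upwards [hTe e, ae_symm_of_mem he, ae_restrict_mem hS.measurableSet_stiff]
        with y h3 h4 hy
      rw [h3, re_inner_tensorL, norm_sq_C33]
      have hre := (hell y hy (Matrix.of fun i j => (e y (i, j)).re)
        (Matrix.IsSymm.ext fun i j => by simp [h4 j i])).1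
      have him := (hell y hy (Matrix.of fun i j => (e y (i, j)).im)
        (Matrix.IsSymm.ext fun i j => by simp [h4 j i])).1
      simp only [Matrix.of_apply] at hre him
      have hn : ∑ i, ∑ j, ‖e y (i, j)‖ ^ 2 = (∑ i, ∑ j, (e y (i, j)).re ^ 2) +
          ∑ i, ∑ j, (e y (i, j)).im ^ 2 := by
        simp only [Complex.sq_norm, Complex.normSq_apply, ← Finset.sum_add_distrib, ← sq]
      rw [hn, mul_add]
      exact add_le_add hre him

/-! ### The space of periodic fields as a Hilbert space -/

/-- Triples of a field, its gradient and its trace. -/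
abbrev Triple (S : Set R3) : Type := L2Stiff S × L2Grad S × L2Bdry S

theorem enorm_sq_Lp_eq {α E : Type*} [MeasurableSpace α] {μ : Measure α} [NormedAddCommGroup E]
    (f : Lp E 2 μ) {g : α → E} (h : f =ᵐ[μ] g) : ‖f‖ₑ ^ 2 = ∫⁻ x, ‖g x‖ₑ ^ 2 ∂μ := by
  rw [Lp.enorm_def, eLpNorm_congr_ae h, eLpNorm_two_sq]

/-- The triples of smooth periodic fields. -/
def smoothTriples (S : Set R3) : Submodule ℂ (Triple S) where
  carrier := {p | ∃ φ : R3 → C3, IsSmoothPeriodic φ ∧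
    p.1 =ᵐ[volume.restrict (stiff S)] φ ∧
    p.2.1 =ᵐ[volume.restrict (stiff S)] grad φ ∧
    p.2.2 =ᵐ[surf S] φ}
  add_mem' := by
    rintro p q ⟨φ, hφ, h1, h2, h3⟩ ⟨ψ, hψ, k1, k2, k3⟩
    refine ⟨_, hφ.add hψ, ?_, ?_, ?_⟩
    · filter_upwards [Lp.coeFn_add p.1 q.1, h1, k1] with x e1 e2 e3
      rw [Prod.fst_add, e1, Pi.add_apply, e2, e3]
    · filter_upwards [Lp.coeFn_add p.2.1 q.2.1, h2, k2] with x e1 e2 e3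
      rw [Prod.snd_add, Prod.fst_add, e1, Pi.add_apply, e2, e3, hφ.grad_add hψ]
    · filter_upwards [Lp.coeFn_add p.2.2 q.2.2, h3, k3] with x e1 e2 e3
      rw [Prod.snd_add, Prod.snd_add, e1, Pi.add_apply, e2, e3]
  zero_mem' := by
    refine ⟨_, isSmoothPeriodic_const 0, Lp.coeFn_zero _ _ _, ?_, Lp.coeFn_zero _ _ _⟩
    filter_upwards [Lp.coeFn_zero C33 2 (volume.restrict (stiff S))] with x hx
    rw [grad_const]
    exact hx
  smul_mem' := by
    rintro c p ⟨φ, hφ, h1, h2, h3⟩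
    refine ⟨_, hφ.const_smul c, ?_, ?_, ?_⟩
    · filter_upwards [Lp.coeFn_smul c p.1, h1] with x e1 e2
      rw [Prod.smul_fst, e1, Pi.smul_apply, e2]
    · filter_upwards [Lp.coeFn_smul c p.2.1, h2] with x e1 e2
      rw [Prod.smul_snd, Prod.smul_fst, e1, Pi.smul_apply, e2, hφ.grad_const_smul]
    · filter_upwards [Lp.coeFn_smul c p.2.2, h3] with x e1 e2
      rw [Prod.smul_snd, Prod.smul_snd, e1, Pi.smul_apply, e2]

/-- Used to carry inequalities between continuous expressions over from smooth periodic fields to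
all of H¹_#. -/
theorem H1per_induction {S : Set R3} {Q : Triple S → Prop} (hQ : IsClosed {p | Q p})
    (h : ∀ p ∈ smoothTriples S, Q p) : ∀ p ∈ H1per S, Q p :=
  closure_minimal (s := (smoothTriples S : Set (Triple S))) h hQ

/-- Triples with a Hilbert space norm. -/
abbrev HTriple (S : Set R3) : Type := WithLp 2 (L2Stiff S × WithLp 2 (L2Grad S × L2Bdry S))

/-- The change of norms. -/
def tripleEquiv (S : Set R3) : HTriple S ≃L[ℂ] Triple S :=
  (WithLp.prodContinuousLinearEquiv 2 ℂ (L2Stiff S) (WithLp 2 (L2Grad S × L2Bdry S))).trans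
    ((ContinuousLinearEquiv.refl ℂ (L2Stiff S)).prodCongr
      (WithLp.prodContinuousLinearEquiv 2 ℂ (L2Grad S) (L2Bdry S)))

theorem norm_sq_HTriple {S : Set R3} (u : HTriple S) : ‖u‖ ^ 2 =
    ‖(tripleEquiv S u).1‖ ^ 2 + (‖(tripleEquiv S u).2.1‖ ^ 2 + ‖(tripleEquiv S u).2.2‖ ^ 2) := by
  rw [WithLp.prod_norm_sq_eq_of_L2, WithLp.prod_norm_sq_eq_of_L2]
  rfl

/-- The space `H¹_#` as a subspace of a Hilbert space. -/
def H1Hilbert (S : Set R3) : Submodule ℂ (HTriple S) :=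
  (smoothTriples S).topologicalClosure.comap (tripleEquiv S : HTriple S →L[ℂ] Triple S).toLinearMap

theorem isClosed_H1Hilbert (S : Set R3) : IsClosed (H1Hilbert S : Set (HTriple S)) :=
  (smoothTriples S).isClosed_topologicalClosure.preimage (tripleEquiv S).continuous

instance (S : Set R3) : CompleteSpace (H1Hilbert S) := (isClosed_H1Hilbert S).completeSpace_coe

/-- The triple of an element of the Hilbert space. -/
def toTriple (S : Set R3) : H1Hilbert S →L[ℂ] Triple S :=
  (tripleEquiv S : HTriple S →L[ℂ] Triple S).comp (H1Hilbert S).subtypeL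

theorem toTriple_mem {S : Set R3} (u : H1Hilbert S) : toTriple S u ∈ H1per S := u.2

theorem exists_toTriple_eq {S : Set R3} {p : Triple S} (hp : p ∈ H1per S) :
    ∃ u : H1Hilbert S, toTriple S u = p := by
  have h : tripleEquiv S ((tripleEquiv S).symm p) = p := (tripleEquiv S).apply_symm_apply p
  refine ⟨⟨(tripleEquiv S).symm p, ?_⟩, h⟩
  change tripleEquiv S ((tripleEquiv S).symm p) ∈ (smoothTriples S).topologicalClosure
  rw [h]
  exact hp

theorem norm_sq_H1Hilbert {S : Set R3} (u : H1Hilbert S) : ‖u‖ ^ 2 =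
    ‖(toTriple S u).1‖ ^ 2 + (‖(toTriple S u).2.1‖ ^ 2 + ‖(toTriple S u).2.2‖ ^ 2) :=
  norm_sq_HTriple (u : HTriple S)

/-! ### Strains of triples -/

/-- The symmetrised gradient as an operator. -/
def symGradL (S : Set R3) : Triple S →L[ℂ] L2Grad S :=
  (symLp S).comp ((ContinuousLinearMap.fst ℂ (L2Grad S) (L2Bdry S)).comp
    (ContinuousLinearMap.snd ℂ (L2Stiff S) (L2Grad S × L2Bdry S)))

/-- `i X_χ` as an operator. -/
def symShiftL (S : Set R3) (χ : R3) : Triple S →L[ℂ] L2Grad S :=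
  (symLp S).comp (((Complex.I • outerL χ).compLpL 2 (volume.restrict (stiff S))).comp
    (ContinuousLinearMap.fst ℂ (L2Stiff S) (L2Grad S × L2Bdry S)))

theorem ae_symGradL {S : Set R3} (p : Triple S) :
    ∀ᵐ y ∂(volume.restrict (stiff S)), symGradL S p y = symL (p.2.1 y) :=
  coeFn_symLp p.2.1

theorem ae_symShiftL {S : Set R3} (χ : R3) (p : Triple S) :
    ∀ᵐ y ∂(volume.restrict (stiff S)), symShiftL S χ p y = symL (Complex.I • outerL χ (p.1 y)) := by
  filter_upwards [coeFn_symLp ((Complex.I • outerL χ).compLp p.1),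
    (Complex.I • outerL χ).coeFn_compLp p.1] with y h1 h2
  rw [h2] at h1
  exact h1

theorem ae_symGrad_eq {S : Set R3} (p : Triple S) :
    ∀ᵐ y ∂(volume.restrict (stiff S)), ∀ i j, symGrad p y i j = symGradL S p y (i, j) := by
  filter_upwards [ae_symGradL p] with y hy i j
  rw [hy]
  rfl

theorem ae_symShift_eq {S : Set R3} (χ : R3) (p : Triple S) :
    ∀ᵐ y ∂(volume.restrict (stiff S)), ∀ i j,
      (Complex.I • symShift χ p y) i j = symShiftL S χ p y (i, j) := by
  filter_upwards [ae_symShiftL χ p] with y hy i j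
  rw [hy, symL_apply]
  simp only [symShift, Matrix.smul_apply, Matrix.of_apply, PiLp.smul_apply, outerL_apply,
    smul_eq_mul]
  ring

theorem ae_strain_eq {S : Set R3} (χ : R3) (p : Triple S) :
    ∀ᵐ y ∂(volume.restrict (stiff S)), ∀ i j,
      strain χ p y i j = (symGradL S p + symShiftL S χ p) y (i, j) := by
  filter_upwards [ae_symGrad_eq p, ae_symShift_eq χ p,
    Lp.coeFn_add (symGradL S p) (symShiftL S χ p)] with y h1 h2 h3 i j
  rw [h3, strain, Matrix.add_apply, h1, h2]
  rfl

theorem norm_symShiftL_le {S : Set R3} (χ : R3) (p : Triple S) :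
    ‖symShiftL S χ p‖ ≤ ‖χ‖ * ‖p.1‖ := by
  refine Lp.norm_le_mul_norm_of_ae_le_mul ?_
  filter_upwards [ae_symShiftL χ p] with y hy
  rw [hy]
  refine (norm_symL_le _).trans ?_
  rw [norm_smul, Complex.norm_I, one_mul, norm_outerL, mul_comm]

theorem symShiftL_zero (S : Set R3) : symShiftL S 0 = 0 := by
  refine ContinuousLinearMap.ext fun p => ?_
  have := norm_symShiftL_le 0 p
  rw [norm_zero, zero_mul] at this
  exact norm_le_zero_iff.1 this

/-- The constant fields as elements of `L²(Γ)`. -/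
def constBdry (S : Set R3) [IsFiniteMeasure (surf S)] : C3 →L[ℂ] L2Bdry S :=
  Lp.constL 2 (surf S) ℂ

theorem coeFn_constBdry {S : Set R3} [IsFiniteMeasure (surf S)] (c : C3) :
    ∀ᵐ x ∂(surf S), constBdry S c x = c := Lp.coeFn_const 2 (surf S) c

theorem adjoint_constBdry {S : Set R3} [IsFiniteMeasure (surf S)] (g : L2Bdry S) :
    ContinuousLinearMap.adjoint (constBdry S) g = ∫ x, g x ∂(surf S) := by
  refine ext_inner_left ℂ fun c => ?_
  rw [ContinuousLinearMap.adjoint_inner_right, L2.inner_def,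
    ← integral_inner ((Lp.memLp g).integrable (by norm_num)) c]
  refine integral_congr_ae ?_
  filter_upwards [coeFn_constBdry c] with x hx
  rw [hx]

/-! ### Inequalities in `H¹_#` -/

theorem continuous_const_mul_of_ne_top {α : Type*} [TopologicalSpace α] {c : ℝ≥0∞} (hc : c ≠ ⊤)
    {f : α → ℝ≥0∞} (hf : Continuous f) : Continuous fun x => c * f x :=
  (ENNReal.continuous_const_mul hc).comp hf

namespace IsInclusion

variable {S : Set R3}

/-- Both sides depend continuously on the triple, so the inequality for smooth fields extends to the
closure. -/
theorem exists_coercive_H1per (hS : IsInclusion S) :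
    ∃ C : ℝ≥0∞, C ≠ ⊤ ∧ ∀ χ : R3, (∀ i, |χ i| ≤ Real.pi) → ∀ p ∈ H1per S,
      ‖p.1‖ₑ ^ 2 + ‖p.2.1‖ₑ ^ 2 ≤
        C * (‖symGradL S p + symShiftL S χ p‖ₑ ^ 2 + ‖∫ x, p.2.2 x ∂(surf S)‖ₑ ^ 2) := by
  have := hS.isFiniteMeasure_surf
  obtain ⟨C, hC, h⟩ := hS.exists_coercive
  refine ⟨C, hC, fun χ hχ => H1per_induction ?_ ?_⟩
  · have hint : Continuous fun p : Triple S => ∫ x, p.2.2 x ∂(surf S) := by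
      have h1 : Continuous fun g : L2Bdry S => ∫ x, g x ∂(surf S) := by
        simp only [← adjoint_constBdry]
        exact ContinuousLinearMap.continuous _
      exact h1.comp (continuous_snd.comp continuous_snd)
    refine isClosed_le (by fun_prop) (continuous_const_mul_of_ne_top hC ?_)
    have h2 : Continuous fun p : Triple S => symGradL S p + symShiftL S χ p :=
      (symGradL S).continuous.add (symShiftL S χ).continuous
    exact ((ENNReal.continuous_pow 2).comp h2.enorm).add
      ((ENNReal.continuous_pow 2).comp hint.enorm)
  · rintro p ⟨φ, hφ, h1, h2, h3⟩
    have h4 : symGradL S p + symShiftL S χ p =ᵐ[volume.restrict (stiff S)] fstrain χ φ := by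
      filter_upwards [Lp.coeFn_add (symGradL S p) (symShiftL S χ p), ae_symGradL p,
        ae_symShiftL χ p, h1, h2] with y e1 e2 e3 e4 e5
      rw [e1, Pi.add_apply, e2, e3, e4, e5, fstrain, map_add]
    rw [enorm_sq_Lp_eq _ h1, enorm_sq_Lp_eq _ h2, enorm_sq_Lp_eq _ h4, integral_congr_ae h3]
    exact h χ hχ φ hφ

/-- The trace inequality in `H¹_#`. -/
theorem exists_trace_H1per (hS : IsInclusion S) :
    ∃ C : ℝ≥0∞, C ≠ ⊤ ∧ ∀ p ∈ H1per S, h12Sq S p.2.2 ≤ C * (‖p.1‖ₑ ^ 2 + ‖p.2.1‖ₑ ^ 2) := by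
  obtain ⟨-, C, hC, htr⟩ := hS.exists_trace
  refine ⟨2 * C, by finiteness, fun p hp => ?_⟩
  obtain ⟨q, hq, hqp⟩ := mem_closure_iff_seq_limit.1 hp
  have hq2 : Tendsto (fun n => (q n).2.2) atTop (𝓝 p.2.2) :=
    ((continuous_snd.comp continuous_snd).tendsto p).comp hqp
  -- Convergence of the traces in L²(Γ) does not control the double integral. Along an almost
  -- everywhere convergent subsequence Fatou's lemma gives the lower semicontinuity that is needed.
  obtain ⟨k, hk, hae⟩ := (tendstoInMeasure_of_tendsto_Lp hq2).exists_seq_tendsto_ae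
  choose φ hφ h1 h2 h3 using fun n => hq (k n)
  set N : ℕ → ℝ≥0∞ := fun n => C * h1Sq S (φ n)
  set B : ℝ≥0∞ := C * (‖p.1‖ₑ ^ 2 + ‖p.2.1‖ₑ ^ 2)
  have hN : Tendsto N atTop (𝓝 B) := by
    have hc : Continuous fun p : Triple S => C * (‖p.1‖ₑ ^ 2 + ‖p.2.1‖ₑ ^ 2) :=
      continuous_const_mul_of_ne_top hC (by fun_prop)
    refine ((hc.tendsto p).comp (hqp.comp hk.tendsto_atTop)).congr fun n => ?_
    simp only [N, h1Sq, Function.comp_apply]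
    rw [enorm_sq_Lp_eq _ (h1 n), enorm_sq_Lp_eq _ (h2 n)]
  have hle := fun n => htr (φ n) (hφ n).contDiff_one
  have hconv : ∀ᵐ x ∂(surf S), Tendsto (fun n => φ n x) atTop (𝓝 (p.2.2 x)) := by
    filter_upwards [hae, ae_all_iff.2 h3] with x hx hx3
    exact hx.congr fun n => hx3 n
  have hfatou : ∀ {a : ℕ → ℝ≥0∞}, (∀ n, a n ≤ N n) → liminf a atTop ≤ B := fun {a} ha =>
    (liminf_le_liminf (Eventually.of_forall ha)).trans_eq hN.liminf_eq
  have hI : ∫⁻ x, ‖p.2.2 x‖ₑ ^ 2 ∂(surf S) ≤ B := by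
    calc ∫⁻ x, ‖p.2.2 x‖ₑ ^ 2 ∂(surf S)
        = ∫⁻ x, liminf (fun n => ‖φ n x‖ₑ ^ 2) atTop ∂(surf S) := by
          refine lintegral_congr_ae ?_
          filter_upwards [hconv] with x hx
          exact (ENNReal.Tendsto.pow (n := 2) hx.enorm).liminf_eq.symm
      _ ≤ liminf (fun n => ∫⁻ x, ‖φ n x‖ₑ ^ 2 ∂(surf S)) atTop :=
          lintegral_liminf_le fun n => (hφ n).1.continuous.enorm.measurable.pow_const 2
      _ ≤ B := hfatou fun n => le_self_add.trans (hle n)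
  have hJ : ∫⁻ x, ∫⁻ y, ‖p.2.2 x - p.2.2 y‖ₑ ^ 2 / edist x y ^ 3 ∂(surf S) ∂(surf S) ≤ B := by
    calc _ ≤ ∫⁻ x, liminf (fun n => ∫⁻ y, ‖φ n x - φ n y‖ₑ ^ 2 / edist x y ^ 3 ∂(surf S)) atTop
            ∂(surf S) := by
          refine lintegral_mono_ae ?_
          filter_upwards [hconv] with x hx
          calc ∫⁻ y, ‖p.2.2 x - p.2.2 y‖ₑ ^ 2 / edist x y ^ 3 ∂(surf S)
              = ∫⁻ y, liminf (fun n => ‖φ n x - φ n y‖ₑ ^ 2 / edist x y ^ 3) atTop ∂(surf S) := by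
                refine lintegral_congr_ae ?_
                filter_upwards [hconv] with y hy
                refine (Tendsto.liminf_eq ?_).symm
                -- On the diagonal all the quotients are 0 / 0 = 0.
                rcases eq_or_ne x y with rfl | hxy
                · simp
                · exact ENNReal.Tendsto.div_const (ENNReal.Tendsto.pow (hx.sub hy).enorm)
                    (Or.inr (pow_ne_zero _ (edist_pos.2 hxy).ne'))
            _ ≤ _ := lintegral_liminf_le fun n =>
                measurable_kernel (α := R3) (hφ n).1.continuous (a := fun _ => x) (b := fun y => y)
                  measurable_const measurable_id
      _ ≤ liminf (fun n => ∫⁻ x, ∫⁻ y, ‖φ n x - φ n y‖ₑ ^ 2 / edist x y ^ 3 ∂(surf S) ∂(surf S))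
            atTop := by
          have := hS.isFiniteMeasure_surf
          refine lintegral_liminf_le fun n => ?_
          refine Measurable.lintegral_prod_right' (f := fun q : R3 × R3 =>
            ‖φ n q.1 - φ n q.2‖ₑ ^ 2 / edist q.1 q.2 ^ 3) ?_
          exact measurable_kernel (α := R3 × R3) (hφ n).1.continuous measurable_fst measurable_snd
      _ ≤ B := hfatou fun n => le_add_self.trans (hle n)
  calc h12Sq S p.2.2 ≤ B + B := add_le_add hI hJ
    _ = _ := by simp only [B]; ring

end IsInclusion

/-! ### The data of the elastic problem -/

theorem norm_sq_add_le_of_enorm {E F G I : Type*} [NormedAddCommGroup E] [NormedAddCommGroup F]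
    [NormedAddCommGroup G] [NormedAddCommGroup I] {x : E} {y : F} {z : G} {w : I} {C : ℝ≥0∞}
    (hC : C ≠ ⊤) (h : ‖x‖ₑ ^ 2 + ‖y‖ₑ ^ 2 ≤ C * (‖z‖ₑ ^ 2 + ‖w‖ₑ ^ 2)) :
    ‖x‖ ^ 2 + ‖y‖ ^ 2 ≤ C.toReal * (‖z‖ ^ 2 + ‖w‖ ^ 2) := by
  have h1 := ENNReal.toReal_mono (by finiteness) h
  rwa [ENNReal.toReal_mul, ENNReal.toReal_add (by finiteness) (by finiteness),
    ENNReal.toReal_add (by finiteness) (by finiteness), ENNReal.toReal_pow, ENNReal.toReal_pow,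
    ENNReal.toReal_pow, ENNReal.toReal_pow, toReal_enorm, toReal_enorm, toReal_enorm,
    toReal_enorm] at h1

theorem IsInclusion.isFiniteMeasure_stiff {S : Set R3} (hS : IsInclusion S) :
    IsFiniteMeasure (volume.restrict (stiff S)) :=
  ⟨by rw [Measure.restrict_apply_univ]; exact hS.volume_stiff_lt_top⟩

/-- A small cube at a corner of the cell misses the inclusion because of the margin. The positive
volume is needed to normalise the cell corrector. -/
theorem IsInclusion.volume_stiff_pos {S : Set R3} (hS : IsInclusion S) :
    0 < (volume.restrict (stiff S)).real univ := by
  have := hS.isFiniteMeasure_stiff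
  rw [measureReal_restrict_apply_univ]
  refine ENNReal.toReal_pos (ne_of_gt ?_) hS.volume_stiff_lt_top.ne
  obtain ⟨ε, hε, hmargin⟩ := hS.exists_margin
  set U : Set R3 := {x | ∀ i, x i ∈ Ioo 0 (min ε 1)} with hU
  have hUo : IsOpen U := by
    have : U = ⋂ i, (fun x : R3 => x i) ⁻¹' Ioo 0 (min ε 1) := by ext; simp [hU]
    rw [this]
    exact isOpen_iInter_of_finite fun i => isOpen_Ioo.preimage (by fun_prop)
  have hne : U.Nonempty := by
    have hm : 0 < min ε 1 := lt_min hε one_pos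
    exact ⟨WithLp.toLp 2 fun _ => min ε 1 / 2, fun i => ⟨half_pos hm, half_lt_self hm⟩⟩
  refine (hUo.measure_pos volume hne).trans_le (measure_mono fun x hx => ⟨fun i => ?_, fun hxS => ?_⟩)
  · exact ⟨(hx i).1.le, (hx i).2.trans_le (min_le_right _ _)⟩
  · exact absurd (hmargin x (subset_closure hxS) 0).1
      (not_le.2 ((hx 0).2.trans_le (min_le_left _ _)))

/-- The triples of the constant fields. -/
def constTriple (S : Set R3) [IsFiniteMeasure (surf S)]
    [IsFiniteMeasure (volume.restrict (stiff S))] : C3 →L[ℂ] Triple S :=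
  (Lp.constL 2 (volume.restrict (stiff S)) ℂ : C3 →L[ℂ] L2Stiff S).prod
    ((0 : C3 →L[ℂ] L2Grad S).prod (constBdry S))

theorem constTriple_mem {S : Set R3} [IsFiniteMeasure (surf S)]
    [IsFiniteMeasure (volume.restrict (stiff S))] (c : C3) : constTriple S c ∈ H1per S := by
  refine subset_closure ⟨_, isSmoothPeriodic_const c, Lp.coeFn_const 2 _ c, ?_, coeFn_constBdry c⟩
  filter_upwards [Lp.coeFn_zero C33 2 (volume.restrict (stiff S))] with x hx
  rw [grad_const]
  exact hx

/-- The constant fields. -/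
def constH1 (S : Set R3) [IsFiniteMeasure (surf S)]
    [IsFiniteMeasure (volume.restrict (stiff S))] : C3 →L[ℂ] H1Hilbert S :=
  (((tripleEquiv S).symm : Triple S →L[ℂ] HTriple S).comp (constTriple S)).codRestrict
    (H1Hilbert S) fun c => by
      change tripleEquiv S ((tripleEquiv S).symm (constTriple S c)) ∈
        (smoothTriples S).topologicalClosure
      rw [ContinuousLinearEquiv.apply_symm_apply]
      exact constTriple_mem c

theorem toTriple_constH1 {S : Set R3} [IsFiniteMeasure (surf S)]
    [IsFiniteMeasure (volume.restrict (stiff S))] (c : C3) :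
    toTriple S (constH1 S c) = constTriple S c :=
  (tripleEquiv S).apply_symm_apply (constTriple S c)

/-- `i X_χ` on `H¹_#`. -/
def shiftH1 (S : Set R3) (χ : R3) : H1Hilbert S →L[ℂ] L2Grad S := (symShiftL S χ).comp (toTriple S)

/-- The Hilbert space data `P` describes the elastic problem. -/
structure Describes (S : Set R3) [IsFiniteMeasure (surf S)]
    [IsFiniteMeasure (volume.restrict (stiff S))] (A : TensorField)
    (P : CellData (H1Hilbert S) (L2Grad S) (L2Bdry S)) : Prop where
  D_eq : ∀ u, P.D u = symGradL S (toTriple S u)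
  tr_eq : ∀ u, P.tr u = (toTriple S u).2.2
  cst_eq : P.cst = constH1 S
  avg_eq : ∀ g, P.avg g = bdryAverage S g
  m_eq : P.m = (surf S).real univ
  energy_eq : ∀ (E F : R3 → Matrix (Fin 3) (Fin 3) ℂ) (e f : L2Grad S),
    (∀ᵐ y ∂(volume.restrict (stiff S)), ∀ i j, E y i j = e y (i, j)) →
    (∀ᵐ y ∂(volume.restrict (stiff S)), ∀ i j, F y i j = f y (i, j)) →
    energy S A E F = inner ℂ f (P.A e)
  isShift : ∀ χ : R3, (∀ i, |χ i| ≤ Real.pi) → P.IsShift ‖χ‖ (shiftH1 S χ)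

theorem norm_sq_trace_le {S : Set R3} {C : ℝ≥0∞} (hC : C ≠ ⊤) {p : Triple S}
    (h : h12Sq S p.2.2 ≤ C * (‖p.1‖ₑ ^ 2 + ‖p.2.1‖ₑ ^ 2)) :
    ‖p.2.2‖ ^ 2 ≤ C.toReal * (‖p.1‖ ^ 2 + ‖p.2.1‖ ^ 2) := by
  have h1 : ‖p.2.2‖ₑ ^ 2 + ‖(0 : ℝ)‖ₑ ^ 2 ≤ C * (‖p.1‖ₑ ^ 2 + ‖p.2.1‖ₑ ^ 2) := by
    rw [enorm_zero, zero_pow two_ne_zero, add_zero, enorm_sq_Lp_eq p.2.2 (EventuallyEq.refl _ _)]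
    exact le_self_add.trans h
  simpa using norm_sq_add_le_of_enorm hC h1

/-- Collects the analytic input of the abstract resolvent estimate. The constants ν and K do not
depend on χ, which makes the final estimate uniform. -/
theorem exists_describes {S : Set R3} [IsFiniteMeasure (surf S)]
    [IsFiniteMeasure (volume.restrict (stiff S))] {A : TensorField} (hS : IsInclusion S)
    (hA : IsElasticityTensor S A) :
    ∃ P : CellData (H1Hilbert S) (L2Grad S) (L2Bdry S), Describes S A P := by
  obtain ⟨T, ν, hν, henergy, hco⟩ := hA.exists_operator hS
  obtain ⟨C₀, hC₀, hcoer⟩ := hS.exists_coercive_H1per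
  obtain ⟨C₁, hC₁, htr⟩ := hS.exists_trace_H1per
  set m := (surf S).real univ with hm
  have hm0 : 0 < m := ENNReal.toReal_pos hS.surf_univ_pos.ne' (measure_ne_top _ _)
  -- The norm of `H1Hilbert S` contains the trace, which costs the factor 1 + C₁. The factor 1 + m²
  -- converts integrals over the interface into averages, and the last summand only makes K
  -- positive.
  set K : ℝ := (1 + C₁.toReal) * (C₀.toReal * (1 + m ^ 2)) + 1 with hK
  have hK0 : 0 < K := by positivity
  have havg : ∀ g : L2Bdry S, bdryAverage S g = (m : ℂ)⁻¹ •
      ContinuousLinearMap.adjoint (constBdry S) g := fun g => by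
    rw [adjoint_constBdry, bdryAverage, ← Complex.ofReal_inv, Complex.coe_smul]
  have hkorn : ∀ χ : R3, (∀ i, |χ i| ≤ Real.pi) → ∀ u : H1Hilbert S, ‖u‖ ^ 2 ≤
      K * (‖symGradL S (toTriple S u) + shiftH1 S χ u‖ ^ 2 +
        ‖bdryAverage S (toTriple S u).2.2‖ ^ 2) := by
    intro χ hχ u
    have h1 := norm_sq_add_le_of_enorm hC₀ (hcoer χ hχ _ (toTriple_mem u))
    have h2 := norm_sq_trace_le hC₁ (htr _ (toTriple_mem u))
    have h3 : ‖∫ x, (toTriple S u).2.2 x ∂(surf S)‖ ^ 2 =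
        m ^ 2 * ‖bdryAverage S (toTriple S u).2.2‖ ^ 2 := by
      rw [bdryAverage, norm_smul, norm_inv, Real.norm_of_nonneg hm0.le, mul_pow]
      field_simp
    rw [h3] at h1
    rw [norm_sq_H1Hilbert]
    set a := ‖(toTriple S u).1‖ ^ 2
    set b := ‖(toTriple S u).2.1‖ ^ 2
    set z := ‖symGradL S (toTriple S u) + shiftH1 S χ u‖ ^ 2 with hz
    set w := ‖bdryAverage S (toTriple S u).2.2‖ ^ 2
    have h1' : a + b ≤ C₀.toReal * (z + m ^ 2 * w) := h1
    have hz0 : 0 ≤ z := sq_nonneg _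
    have hw0 : 0 ≤ w := sq_nonneg _
    calc a + (b + ‖(toTriple S u).2.2‖ ^ 2) ≤ (1 + C₁.toReal) * (a + b) := by linarith
      _ ≤ (1 + C₁.toReal) * (C₀.toReal * (z + m ^ 2 * w)) :=
          mul_le_mul_of_nonneg_left h1' (by positivity)
      _ ≤ (1 + C₁.toReal) * (C₀.toReal * ((1 + m ^ 2) * (z + w))) := by
          gcongr
          nlinarith [mul_nonneg (sq_nonneg m) hz0]
      _ = (K - 1) * (z + w) := by rw [hK]; ring
      _ ≤ K * (z + w) := by gcongr; linarith
  have hshift_mem : ∀ (χ : R3) (u : H1Hilbert S), shiftH1 S χ u ∈ symmetricFields S :=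
    fun χ u => symLp_mem _
  refine ⟨{
    A := T
    D := (symGradL S).comp (toTriple S)
    tr := (ContinuousLinearMap.snd ℂ (L2Grad S) (L2Bdry S)).comp
      ((ContinuousLinearMap.snd ℂ (L2Stiff S) (L2Grad S × L2Bdry S)).comp (toTriple S))
    cst := constH1 S
    avg := (m : ℂ)⁻¹ • ContinuousLinearMap.adjoint (constBdry S)
    Gs := symmetricFields S
    m := m
    ν := ν
    K := K
    m_pos := hm0
    ν_pos := hν
    K_pos := hK0
    coercive := hco
    D_mem := fun u => symLp_mem _
    D_cst := fun c => ?_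
    inner_tr_cst := fun c g => ?_
    avg_tr_cst := fun c => ?_
    korn := fun u => ?_ }, ?_⟩
  · rw [ContinuousLinearMap.comp_apply, toTriple_constH1]
    exact map_zero (symLp S)
  · rw [ContinuousLinearMap.comp_apply, ContinuousLinearMap.comp_apply, toTriple_constH1,
      smul_apply, inner_smul_right, ContinuousLinearMap.adjoint_inner_right, ← mul_assoc,
      mul_inv_cancel₀ (by exact_mod_cast hm0.ne'), one_mul]
    rfl
  · rw [ContinuousLinearMap.comp_apply, ContinuousLinearMap.comp_apply, toTriple_constH1,
      smul_apply]
    change (m : ℂ)⁻¹ • ContinuousLinearMap.adjoint (constBdry S) (constBdry S c) = c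
    rw [adjoint_constBdry, integral_congr_ae (coeFn_constBdry c), integral_const, ← hm,
      ← Complex.coe_smul, smul_smul, inv_mul_cancel₀ (by exact_mod_cast hm0.ne'), one_smul]
  -- The Korn inequality without shift is the case χ = 0 of the uniform one.
  · have h := hkorn 0 (fun i => by simpa using Real.pi_pos.le) u
    rw [shiftH1, symShiftL_zero, ContinuousLinearMap.zero_comp, zero_apply, add_zero, havg] at h
    exact h
  · exact {
      D_eq := fun u => rfl
      tr_eq := fun u => rfl
      cst_eq := rfl
      avg_eq := fun g => (havg g).symm
      m_eq := rfl
      energy_eq := henergy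
      isShift := fun χ hχ =>
        { mem := hshift_mem χ
          norm_le := fun u => by
            refine (norm_symShiftL_le χ _).trans (mul_le_mul_of_nonneg_left ?_ (norm_nonneg _))
            refine le_of_sq_le_sq ?_ (norm_nonneg _)
            rw [norm_sq_H1Hilbert]
            exact le_add_of_nonneg_right (by positivity)
          korn := fun u => by
            have h := hkorn χ hχ u
            rw [havg] at h
            exact h } }

theorem h12Sq_congr_ae {S : Set R3} {f g : R3 → C3} (h : f =ᵐ[surf S] g) :
    h12Sq S f = h12Sq S g := by
  rw [h12Sq, h12Sq]
  congr 1
  · refine lintegral_congr_ae ?_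
    filter_upwards [h] with x hx
    rw [hx]
  · refine lintegral_congr_ae ?_
    filter_upwards [h] with x hx
    refine lintegral_congr_ae ?_
    filter_upwards [h] with y hy
    rw [hx, hy]

/-! ### The homogenised matrix -/

namespace CellData

variable {H G B : Type*} [NormedAddCommGroup H] [InnerProductSpace ℂ H] [CompleteSpace H]
  [NormedAddCommGroup G] [InnerProductSpace ℂ G] [CompleteSpace G] [NormedAddCommGroup B]
  [InnerProductSpace ℂ B] [CompleteSpace B] {P : CellData H G B} {X : H →L[ℂ] G} {N : C3 →L[ℂ] H}

/-- Constants have no strain, so the last term of the defining equation of the first corrector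
vanishes. -/
theorem corrector_iff (c : C3) (v w : H) :
    inner ℂ (P.D v) (P.A (P.D w)) = -inner ℂ (P.D v) (P.A (X (P.cst c))) -
      inner ℂ (X v) (P.A (P.D (P.cst c))) ↔
      inner ℂ (P.D v) (P.A (X (P.cst c) + P.D w)) = 0 := by
  rw [P.D_cst, map_zero, inner_zero_right, sub_zero, map_add, inner_add_right,
    eq_neg_iff_add_eq_zero, add_comm]

/-- All solutions of the cell problem have the same energy. -/
theorem inner_eq_of_corrector (hN : ∀ c, P.avg (P.tr (N c)) = 0 ∧
      ∀ v, inner ℂ (P.D v) (P.A (P.D (N c) + X (P.cst c))) = 0) {c : C3} {w k : H}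
    (hw : ∀ v, P.tr v = 0 → inner ℂ (P.D v) (P.A (X (P.cst c) + P.D w)) = 0)
    (hk : ∀ v, P.tr v = 0 → inner ℂ (P.D v) (P.A (P.D k)) = 0)
    (hkv : ∀ v, (∀ v', P.tr v' = 0 → inner ℂ (P.D v') (P.A (P.D v)) = 0) →
      inner ℂ (P.D v) (P.A (P.D k + (X (P.cst c) + P.D w))) = 0) (d : C3) (w' : H) :
    inner ℂ (X (P.cst d) + P.D w') (P.A (P.D k + (X (P.cst c) + P.D w))) =
      inner ℂ (X (P.cst d)) (P.A (P.D (N c) + X (P.cst c))) := by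
  set E := P.D k + (X (P.cst c) + P.D w) with hE
  -- Every field is the sum of a field with zero trace and a lift. The first corrector equation and
  -- the lift property of k treat the former, the cell problem the latter. So E is orthogonal to all
  -- strains, a property that also characterises the field obtained from N c.
  have horth : ∀ v, inner ℂ (P.D v) (P.A E) = 0 := by
    intro v
    obtain ⟨z, hz0, hz⟩ := P.exists_lift v
    have h3 : inner ℂ (P.D z) (P.A E) = 0 := by
      rw [hE, map_add, inner_add_right, hw z hz0, hk z hz0, add_zero]
    have h4 : P.D v = P.D (v - z) + P.D z := by rw [← map_add, sub_add_cancel]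
    rw [h4, inner_add_left, hkv _ hz, h3, add_zero]
  have hEN : E = P.D (N c) + X (P.cst c) := by
    have h1 : P.D (k + w - N c) = E - (P.D (N c) + X (P.cst c)) := by
      rw [hE, map_sub, map_add]
      abel
    rw [← sub_eq_zero, ← h1]
    refine P.eq_zero_of_inner_eq_zero (P.D_mem _) ?_
    conv_lhs => rw [h1, map_sub, ← h1]
    rw [inner_sub_right, horth, (hN c).2, sub_zero]
  rw [inner_add_left, horth, add_zero, hEN]

/-- The solution of the cell problem is a sum of a field with zero trace and a lift. -/
theorem exists_split (hN : ∀ c, P.avg (P.tr (N c)) = 0 ∧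
      ∀ v, inner ℂ (P.D v) (P.A (P.D (N c) + X (P.cst c))) = 0) (c : C3) :
    ∃ z k, P.tr z = 0 ∧
      (∀ v, P.tr v = 0 → inner ℂ (P.D v) (P.A (X (P.cst c) + P.D z)) = 0) ∧
      ∀ a, (∀ v, P.tr v = 0 → inner ℂ (P.D v) (P.A (P.D (k - P.cst a))) = 0) ∧
        ∀ v, inner ℂ (P.D v) (P.A (P.D (k - P.cst a) + (X (P.cst c) + P.D z))) = 0 := by
  obtain ⟨z, hz0, hz⟩ := P.exists_lift (N c)
  refine ⟨z, N c - z, hz0, fun v hv => ?_, fun a => ?_⟩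
  · have h1 : X (P.cst c) + P.D z = P.D (N c) + X (P.cst c) - P.D (N c - z) := by
      rw [map_sub]; abel
    rw [h1, map_sub, inner_sub_right, (hN c).2 v, hz v hv, sub_zero]
  · have hDk : P.D (N c - z - P.cst a) = P.D (N c - z) := by rw [map_sub, P.D_cst, sub_zero]
    rw [hDk]
    refine ⟨hz, fun v => ?_⟩
    have h1 : P.D (N c - z) + (X (P.cst c) + P.D z) = P.D (N c) + X (P.cst c) := by
      rw [map_sub]; abel
    rw [h1]
    exact (hN c).2 v

theorem eq_zero_of_tr {z : H} (h : P.tr z = 0) (hD : inner ℂ (P.D z) (P.A (P.D z)) = 0) :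
    z = 0 := by
  have h1 := P.eq_zero_of_inner_eq_zero (P.D_mem z) hD
  have h2 := P.korn z
  rw [h1, h, map_zero, norm_zero, norm_zero, zero_pow two_ne_zero, add_zero, mul_zero] at h2
  exact norm_eq_zero.1 (pow_eq_zero_iff two_ne_zero |>.1 (le_antisymm h2 (sq_nonneg _)))

/-- A lift with constant trace is constant. -/
theorem eq_cst {u : H} {c : C3} (htr : P.tr u = P.tr (P.cst c))
    (h : ∀ v, P.tr v = 0 → inner ℂ (P.D v) (P.A (P.D u)) = 0) : u = P.cst c := by
  have htr' : P.tr (u - P.cst c) = 0 := by rw [map_sub, sub_eq_zero, htr]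
  have hD : P.D (u - P.cst c) = P.D u := by rw [map_sub, P.D_cst, sub_zero]
  refine sub_eq_zero.1 (eq_zero_of_tr htr' ?_)
  have := h _ htr'
  rwa [hD] at this ⊢

end CellData

section Describes

variable {S : Set R3} [IsFiniteMeasure (surf S)] [IsFiniteMeasure (volume.restrict (stiff S))]
  {A : TensorField} {P : CellData (H1Hilbert S) (L2Grad S) (L2Bdry S)}

namespace Describes

theorem energy_strain (hP : Describes S A P) (χ : R3) (u v : H1Hilbert S) :
    energy S A (strain χ (toTriple S u)) (strain χ (toTriple S v)) =
      inner ℂ (P.D v + shiftH1 S χ v) (P.A (P.D u + shiftH1 S χ u)) := by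
  rw [hP.D_eq, hP.D_eq]
  exact hP.energy_eq _ _ _ _ (ae_strain_eq χ _) (ae_strain_eq χ _)

theorem shiftH1_zero (u : H1Hilbert S) : shiftH1 S 0 u = 0 := by
  rw [shiftH1, symShiftL_zero, ContinuousLinearMap.zero_comp, zero_apply]

theorem isLift_zero_iff (hP : Describes S A P) (u : H1Hilbert S) :
    IsLift S A 0 (toTriple S u) ↔ ∀ v, P.tr v = 0 → inner ℂ (P.D v) (P.A (P.D u)) = 0 := by
  constructor
  · intro h v hv
    have := h.2 (toTriple S v) (toTriple_mem v) (by rw [← hP.tr_eq]; exact hv)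
    rwa [hP.energy_strain, shiftH1_zero, shiftH1_zero, add_zero, add_zero] at this
  · refine fun h => ⟨toTriple_mem u, fun q hq hq0 => ?_⟩
    obtain ⟨v, rfl⟩ := exists_toTriple_eq hq
    rw [hP.energy_strain, shiftH1_zero, shiftH1_zero, add_zero, add_zero]
    exact h v (by rw [hP.tr_eq]; exact hq0)

theorem energy_symGrad (hP : Describes S A P) (u v : H1Hilbert S) :
    energy S A (symGrad (toTriple S u)) (symGrad (toTriple S v)) = inner ℂ (P.D v) (P.A (P.D u)) := by
  rw [hP.D_eq, hP.D_eq]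
  exact hP.energy_eq _ _ _ _ (ae_symGrad_eq _) (ae_symGrad_eq _)

theorem isFirstCorrector_iff (hP : Describes S A P) (χ : R3) (c : C3) (w : H1Hilbert S) :
    IsFirstCorrector S A χ (toTriple S (P.cst c)) (toTriple S w) ↔
      P.tr w = 0 ∧ ∀ v, P.tr v = 0 →
        inner ℂ (P.D v) (P.A (shiftH1 S χ (P.cst c) + P.D w)) = 0 := by
  have h1 : ∀ v, energy S A (symGrad (toTriple S w)) (symGrad (toTriple S v)) =
      -energy S A (fun y => Complex.I • symShift χ (toTriple S (P.cst c)) y)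
        (symGrad (toTriple S v)) - energy S A (symGrad (toTriple S (P.cst c)))
        (fun y => Complex.I • symShift χ (toTriple S v) y) ↔
      inner ℂ (P.D v) (P.A (shiftH1 S χ (P.cst c) + P.D w)) = 0 := by
    intro v
    have e1 : energy S A (fun y => Complex.I • symShift χ (toTriple S (P.cst c)) y)
        (symGrad (toTriple S v)) = inner ℂ (P.D v) (P.A (shiftH1 S χ (P.cst c))) := by
      rw [hP.D_eq]
      exact hP.energy_eq _ _ _ _ (ae_symShift_eq χ _) (ae_symGrad_eq _)
    have e2 : energy S A (symGrad (toTriple S (P.cst c)))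
        (fun y => Complex.I • symShift χ (toTriple S v) y) =
        inner ℂ (shiftH1 S χ v) (P.A (P.D (P.cst c))) := by
      rw [hP.D_eq]
      exact hP.energy_eq _ _ _ _ (ae_symGrad_eq _) (ae_symShift_eq χ _)
    rw [hP.energy_symGrad, e1, e2]
    exact CellData.corrector_iff c v w
  constructor
  · rintro ⟨-, h2, h3⟩
    refine ⟨by rw [hP.tr_eq]; exact h2, fun v hv => (h1 v).1 ?_⟩
    exact h3 _ (toTriple_mem v) (by rw [← hP.tr_eq]; exact hv)
  · rintro ⟨h2, h3⟩
    refine ⟨toTriple_mem w, by rw [← hP.tr_eq]; exact h2, fun q hq hq0 => ?_⟩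
    obtain ⟨v, rfl⟩ := exists_toTriple_eq hq
    exact (h1 v).2 (h3 v (by rw [hP.tr_eq]; exact hq0))

theorem trace_cst (hP : Describes S A P) (c : C3) :
    ∀ᵐ y ∂(surf S), (toTriple S (P.cst c)).2.2 y = c := by
  rw [hP.cst_eq, toTriple_constH1]
  exact coeFn_constBdry c

/-- By uniqueness the lift of a constant boundary field is the constant field itself, so only the
first corrector remains to be chosen. -/
theorem isPsi_iff (hP : Describes S A P) (χ : R3) (c : C3)
    (ψ : R3 → Matrix (Fin 3) (Fin 3) ℂ) : IsPsi S A χ c ψ ↔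
      ∃ w, P.tr w = 0 ∧ (∀ v, P.tr v = 0 →
        inner ℂ (P.D v) (P.A (shiftH1 S χ (P.cst c) + P.D w)) = 0) ∧
        ψ = fun y => Complex.I • symShift χ (toTriple S (P.cst c)) y +
          symGrad (toTriple S w) y := by
  constructor
  · rintro ⟨p, q, hp, hpc, hq, rfl⟩
    obtain ⟨u, rfl⟩ := exists_toTriple_eq hp.1
    obtain ⟨w, rfl⟩ := exists_toTriple_eq hq.1
    have hu : u = P.cst c := by
      refine CellData.eq_cst ?_ ((hP.isLift_zero_iff u).1 hp)
      rw [hP.tr_eq, hP.tr_eq]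
      refine Lp.ext ?_
      filter_upwards [hpc, hP.trace_cst c] with y h1 h2
      rw [h1, h2]
    subst hu
    obtain ⟨h1, h2⟩ := (hP.isFirstCorrector_iff χ c w).1 hq
    exact ⟨w, h1, h2, rfl⟩
  · rintro ⟨w, h1, h2, rfl⟩
    refine ⟨_, _, (hP.isLift_zero_iff (P.cst c)).2 fun v _ => ?_, hP.trace_cst c,
      (hP.isFirstCorrector_iff χ c w).2 ⟨h1, h2⟩, rfl⟩
    rw [P.D_cst, map_zero, inner_zero_right]

theorem ae_psi_eq (hP : Describes S A P) (χ : R3) (c : C3) (w : H1Hilbert S) :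
    ∀ᵐ y ∂(volume.restrict (stiff S)), ∀ i j,
      (Complex.I • symShift χ (toTriple S (P.cst c)) y + symGrad (toTriple S w) y) i j =
        (shiftH1 S χ (P.cst c) + P.D w) y (i, j) := by
  rw [hP.D_eq]
  filter_upwards [ae_symGrad_eq (toTriple S w), ae_symShift_eq χ (toTriple S (P.cst c)),
    Lp.coeFn_add (shiftH1 S χ (P.cst c)) (symGradL S (toTriple S w))] with y h1 h2 h3 i j
  rw [h3, Matrix.add_apply, h1, h2]
  rfl

theorem ae_cell_eq (hP : Describes S A P) (χ : R3) (c : C3) (w k : H1Hilbert S) :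
    ∀ᵐ y ∂(volume.restrict (stiff S)), ∀ i j,
      (symGrad (toTriple S k) y +
        (Complex.I • symShift χ (toTriple S (P.cst c)) y + symGrad (toTriple S w) y)) i j =
        (P.D k + (shiftH1 S χ (P.cst c) + P.D w)) y (i, j) := by
  have h0 := ae_symGrad_eq (toTriple S k)
  rw [← hP.D_eq] at h0
  filter_upwards [h0, hP.ae_psi_eq χ c w,
    Lp.coeFn_add (P.D k) (shiftH1 S χ (P.cst c) + P.D w)] with y h1 h2 h3 i j
  rw [h3, Matrix.add_apply, h1, h2]
  rfl

variable {χ : R3} {N : C3 →L[ℂ] H1Hilbert S}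

/-- The value of the form which defines the homogenised matrix. -/
theorem energy_hom (hP : Describes S A P)
    (hN : ∀ c, P.avg (P.tr (N c)) = 0 ∧
      ∀ v, inner ℂ (P.D v) (P.A (P.D (N c) + shiftH1 S χ (P.cst c))) = 0)
    {c d : C3} {ψc ψd : R3 → Matrix (Fin 3) (Fin 3) ℂ} {κ : Triple S} (hc : IsPsi S A χ c ψc)
    (hd : IsPsi S A χ d ψd) (hκ : IsCellCorrector S A ψc κ) :
    energy S A (fun y => symGrad κ y + ψc y) ψd =
      inner ℂ (shiftH1 S χ (P.cst d)) (P.A (P.D (N c) + shiftH1 S χ (P.cst c))) := by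
  obtain ⟨w, hw0, hw, rfl⟩ := (hP.isPsi_iff χ c ψc).1 hc
  obtain ⟨w', -, -, rfl⟩ := (hP.isPsi_iff χ d ψd).1 hd
  obtain ⟨k, rfl⟩ := exists_toTriple_eq hκ.1.1
  rw [hP.energy_eq _ _ _ _ (hP.ae_cell_eq χ c w k) (hP.ae_psi_eq χ d w')]
  refine CellData.inner_eq_of_corrector hN hw ((hP.isLift_zero_iff k).1 hκ.1) (fun v hv => ?_) d w'
  have h2 := hκ.2.2 _ ((hP.isLift_zero_iff v).2 hv)
  rw [hP.energy_eq _ _ _ _ (hP.ae_cell_eq χ c w k) (ae_symGrad_eq _), ← hP.D_eq] at h2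
  exact h2

theorem integral_constTriple (c : C3) : ∫ y in stiff S, (constTriple S c).1 y =
    (volume.restrict (stiff S)).real univ • c := by
  rw [← integral_const]
  exact integral_congr_ae (Lp.coeFn_const 2 _ c)

set_option maxHeartbeats 1000000 in
/-- Solvability of the cell problem. -/
theorem exists_isCellCorrector (hS : IsInclusion S) (hP : Describes S A P)
    (hN : ∀ c, P.avg (P.tr (N c)) = 0 ∧
      ∀ v, inner ℂ (P.D v) (P.A (P.D (N c) + shiftH1 S χ (P.cst c))) = 0) (c : C3) :
    ∃ ψ κ, IsPsi S A χ c ψ ∧ IsCellCorrector S A ψ κ := by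
  obtain ⟨z, k₀, hz0, hpsi, hk₀⟩ := CellData.exists_split hN c
  set V := (volume.restrict (stiff S)).real univ
  have hV : V ≠ 0 := hS.volume_stiff_pos.ne'
  -- Subtracting this constant gives the corrector mean zero over the stiff component; no strain
  -- notices it.
  set a : C3 := V⁻¹ • ∫ y in stiff S, (toTriple S k₀).1 y with ha
  set k := k₀ - P.cst a with hk
  refine ⟨_, toTriple S k, (hP.isPsi_iff χ c _).2 ⟨z, hz0, hpsi, rfl⟩,
    (hP.isLift_zero_iff k).2 (hk₀ a).1, ?_, fun q hq => ?_⟩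
  · have h1 : (toTriple S k).1 = (toTriple S k₀).1 - (constTriple S a).1 := by
      rw [hk, map_sub, hP.cst_eq, toTriple_constH1, Prod.fst_sub]
    have hi : ∀ f : L2Stiff S, Integrable f (volume.restrict (stiff S)) := fun f =>
      (Lp.memLp f).integrable (by norm_num)
    rw [h1, integral_congr_ae (Lp.coeFn_sub _ _)]
    simp only [Pi.sub_apply]
    rw [integral_sub (hi _) (hi _), integral_constTriple, ha, smul_smul, mul_inv_cancel₀ hV,
      one_smul, sub_self]
  · obtain ⟨v, rfl⟩ := exists_toTriple_eq hq.1
    rw [hP.energy_eq _ _ _ _ (hP.ae_cell_eq χ c z k) (ae_symGrad_eq _), ← hP.D_eq]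
    exact (hk₀ a).2 v

variable (P χ N) in
/-- The homogenised matrix. -/
def homMatrix : Matrix (Fin 3) (Fin 3) ℂ :=
  Matrix.toEuclideanLin.symm (P.hom (shiftH1 S χ) N : C3 →ₗ[ℂ] C3)

theorem homMatrix_mulVec (c : C3) :
    homMatrix P χ N *ᵥ c.ofLp = (P.hom (shiftH1 S χ) N c).ofLp := by
  have h : Matrix.toEuclideanLin (homMatrix P χ N) c = P.hom (shiftH1 S χ) N c := by
    rw [homMatrix, LinearEquiv.apply_symm_apply]
    rfl
  rw [← h]
  rfl

theorem sum_neg_mulVec (M : Matrix (Fin 3) (Fin 3) ℂ) (c d : C3) :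
    ∑ i, -(M *ᵥ c.ofLp) i * star (d i) = -inner ℂ d (WithLp.toLp 2 (M *ᵥ c.ofLp)) := by
  rw [PiLp.inner_apply, ← Finset.sum_neg_distrib]
  refine Finset.sum_congr rfl fun i _ => ?_
  rw [RCLike.inner_apply, neg_mul]
  rfl

/-- The definition leaves a choice of Ψ and of the corrector for each pair c, d. By `energy_hom` the
value of the form does not depend on it, so the form determines the matrix, and solvability of the
cell problem shows that such choices exist. -/
theorem isHomMatrix_iff (hS : IsInclusion S) (hP : Describes S A P)
    (hN : ∀ c, P.avg (P.tr (N c)) = 0 ∧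
      ∀ v, inner ℂ (P.D v) (P.A (P.D (N c) + shiftH1 S χ (P.cst c))) = 0)
    (M : Matrix (Fin 3) (Fin 3) ℂ) : IsHomMatrix S A χ M ↔ M = homMatrix P χ N := by
  have hval : ∀ c d, -inner ℂ d (WithLp.toLp 2 (homMatrix P χ N *ᵥ c.ofLp)) =
      (((surf S).real univ)⁻¹ : ℂ) *
        inner ℂ (shiftH1 S χ (P.cst d)) (P.A (P.D (N c) + shiftH1 S χ (P.cst c))) := by
    intro c d
    rw [homMatrix_mulVec, WithLp.toLp_ofLp, CellData.inner_hom, neg_neg, hP.m_eq]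
  constructor
  · intro hM
    have h1 : ∀ c : C3, WithLp.toLp 2 (M *ᵥ c.ofLp) =
        (WithLp.toLp 2 (homMatrix P χ N *ᵥ c.ofLp) : C3) := by
      intro c
      refine ext_inner_left ℂ fun d => ?_
      obtain ⟨ψc, ψd, κ, hc, hd, hκ, h⟩ := hM c d
      rw [hP.energy_hom hN hc hd hκ, ← hval, sum_neg_mulVec, neg_inj] at h
      exact h
    refine Matrix.ext_of_mulVec_single fun i => ?_
    have := congrArg WithLp.ofLp (h1 (WithLp.toLp 2 (Pi.single i 1)))
    exact this
  · rintro rfl c d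
    obtain ⟨ψc, κ, hc, hκ⟩ := exists_isCellCorrector hS hP hN c
    obtain ⟨ψd, -, hd, -⟩ := exists_isCellCorrector hS hP hN d
    refine ⟨ψc, ψd, κ, hc, hd, hκ, ?_⟩
    rw [hP.energy_hom hN hc hd hκ, ← hval, sum_neg_mulVec]

end Describes

end Describes

/-! ### The resolvent of the Dirichlet-to-Neumann operator -/

namespace CellData

variable {H G B : Type*} [NormedAddCommGroup H] [InnerProductSpace ℂ H] [CompleteSpace H]
  [NormedAddCommGroup G] [InnerProductSpace ℂ G] [CompleteSpace G] [NormedAddCommGroup B]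
  [InnerProductSpace ℂ B] [CompleteSpace B] {P : CellData H G B} {s : ℝ} {X : H →L[ℂ] G}

/-- A lift is determined by its trace. -/
theorem IsShift.eq_of_tr_eq (hX : P.IsShift s X) {u u' : H} (htr : P.tr u = P.tr u')
    (h : ∀ v, P.tr v = 0 → inner ℂ (P.D v + X v) (P.A (P.D u + X u)) = 0)
    (h' : ∀ v, P.tr v = 0 → inner ℂ (P.D v + X v) (P.A (P.D u' + X u')) = 0) : u = u' := by
  refine sub_eq_zero.1 (hX.eq_zero one_pos fun v => ?_)
  have h0 : P.tr (u - u') = 0 := by rw [map_sub, htr, sub_self]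
  have h1 : P.D (u - u') + X (u - u') = P.D u + X u - (P.D u' + X u') := by
    rw [map_sub, map_sub]; abel
  have h2 : P.D (u - u') + X (u - u') = 0 := by
    refine P.eq_zero_of_inner_eq_zero (P.Gs.add_mem (P.D_mem _) (hX.mem _)) ?_
    conv_lhs => enter [3]; rw [h1, map_sub]
    rw [inner_sub_right, h _ h0, h' _ h0, sub_zero]
  rw [h2, h0, map_zero, inner_zero_right, inner_zero_right, mul_zero, add_zero]

/-- Uniqueness for the resolvent problem. -/
theorem IsShift.eq_of_resolvent (hX : P.IsShift s X) {t : ℝ} (ht : 0 < t) {u u' : H} {h : B}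
    (hu : ∀ v, (t : ℂ) * inner ℂ (P.D v + X v) (P.A (P.D u + X u)) +
      inner ℂ (P.tr v) (P.tr u) = -inner ℂ (P.tr v) h)
    (hu' : ∀ v, (t : ℂ) * inner ℂ (P.D v + X v) (P.A (P.D u' + X u')) +
      inner ℂ (P.tr v) (P.tr u') = -inner ℂ (P.tr v) h) : u = u' := by
  refine sub_eq_zero.1 (hX.eq_zero ht fun v => ?_)
  have h1 : P.D (u - u') + X (u - u') = P.D u + X u - (P.D u' + X u') := by
    rw [map_sub, map_sub]; abel
  rw [h1, map_sub, map_sub, inner_sub_right, inner_sub_right]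
  linear_combination hu v - hu' v

end CellData

variable {S : Set R3} {A : TensorField}

namespace Describes

variable [IsFiniteMeasure (surf S)] [IsFiniteMeasure (volume.restrict (stiff S))]
  {P : CellData (H1Hilbert S) (L2Grad S) (L2Bdry S)} {χ : R3}

/-- The lift condition is Green's formula for test fields with zero trace, so it is contained in the
condition for all test fields. -/
theorem isDtN_iff (hP : Describes S A P) (g f : L2Bdry S) : IsDtN S A χ g f ↔
    ∃ u, P.tr u = g ∧ ∀ v, inner ℂ (P.D v + shiftH1 S χ v) (P.A (P.D u + shiftH1 S χ u)) =
      -inner ℂ (P.tr v) f := by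
  constructor
  · rintro ⟨p, hp, hpg, h⟩
    obtain ⟨u, rfl⟩ := exists_toTriple_eq hp.1
    refine ⟨u, by rw [hP.tr_eq, hpg], fun v => ?_⟩
    rw [← hP.energy_strain, hP.tr_eq]
    exact h _ (toTriple_mem v)
  · rintro ⟨u, hug, h⟩
    have h1 : ∀ v ∈ H1per S, energy S A (strain χ (toTriple S u)) (strain χ v) =
        -(inner ℂ v.2.2 f) := by
      intro q hq
      obtain ⟨v, rfl⟩ := exists_toTriple_eq hq
      rw [hP.energy_strain, h v, hP.tr_eq]
    refine ⟨_, ⟨toTriple_mem u, fun q hq hq0 => ?_⟩, by rw [← hP.tr_eq, hug], h1⟩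
    rw [h1 q hq, hq0, inner_zero_left, neg_zero]

/-- The lift is determined by g, so f and f' define the same functional on the traces of smooth
periodic fields; these traces are dense in L²(Γ). -/
theorem isDtN_unique (hS : IsInclusion S) (hP : Describes S A P) (hχ : ∀ i, |χ i| ≤ Real.pi)
    {g f f' : L2Bdry S} (h : IsDtN S A χ g f) (h' : IsDtN S A χ g f') : f = f' := by
  obtain ⟨u, hu, h⟩ := hP.isDtN_iff g f |>.1 h
  obtain ⟨u', hu', h'⟩ := hP.isDtN_iff g f' |>.1 h'
  have huu : u = u' := (hP.isShift χ hχ).eq_of_tr_eq (hu.trans hu'.symm)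
    (fun v hv => by rw [h, hv, inner_zero_left, neg_zero])
    (fun v hv => by rw [h', hv, inner_zero_left, neg_zero])
  subst huu
  have h1 : ∀ v, inner ℂ (P.tr v) (f - f') = 0 := fun v => by
    rw [inner_sub_right, ← neg_inj.1 ((h v).symm.trans (h' v)), sub_self]
  refine sub_eq_zero.1 (hS.eq_zero_of_forall_integral _ fun φ hφ => ?_)
  set p : Triple S := ((hS.memLp_stiff hφ.1.continuous).toLp φ,
    (hS.memLp_stiff hφ.continuous_grad).toLp (grad φ), (hS.memLp_surf hφ.1.continuous).toLp φ)
  have hp : p ∈ H1per S := subset_closure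
    ⟨φ, hφ, (hS.memLp_stiff hφ.1.continuous).coeFn_toLp,
      (hS.memLp_stiff hφ.continuous_grad).coeFn_toLp, (hS.memLp_surf hφ.1.continuous).coeFn_toLp⟩
  obtain ⟨v, hv⟩ := exists_toTriple_eq hp
  have h2 := h1 v
  rw [hP.tr_eq, hv, L2.inner_def] at h2
  rw [← h2]
  refine integral_congr_ae ?_
  filter_upwards [(hS.memLp_surf hφ.1.continuous).coeFn_toLp] with x hx
  rw [hx]

/-- For g = tr(U h) the choice f = t⁻¹(h + g) turns the resolvent problem into Green's formula.
Conversely, the lift of any g in the domain solves the problem with datum tf - g, whose solution is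
unique. -/
theorem isDtNResolvent (hP : Describes S A P) (hX : P.IsShift ‖χ‖ (shiftH1 S χ)) {t : ℝ}
    (ht : 0 < t) {U : L2Bdry S →L[ℂ] H1Hilbert S}
    (hU : ∀ h v, (t : ℂ) * inner ℂ (P.D v + shiftH1 S χ v) (P.A (P.D (U h) + shiftH1 S χ (U h))) +
      inner ℂ (P.tr v) (P.tr (U h)) = -inner ℂ (P.tr v) h) :
    IsDtNResolvent S A χ t (P.tr.comp U) := by
  have ht' : (t : ℂ) ≠ 0 := by exact_mod_cast ht.ne'
  constructor
  · intro h
    refine ⟨(t : ℂ)⁻¹ • (h + P.tr (U h)), (hP.isDtN_iff _ _).2 ⟨U h, rfl, fun v => ?_⟩, ?_⟩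
    · have h1 := hU h v
      rw [inner_smul_right, inner_add_right]
      field_simp
      linear_combination h1
    · rw [smul_smul, mul_inv_cancel₀ ht', one_smul, ContinuousLinearMap.comp_apply,
        add_sub_cancel_right]
  · intro g f hgf
    obtain ⟨u, rfl, hu⟩ := (hP.isDtN_iff g f).1 hgf
    have h1 : U ((t : ℂ) • f - P.tr u) = u := hX.eq_of_resolvent ht (hU _) fun v => by
      rw [hu v, inner_sub_right, inner_smul_right]
      ring
    rw [ContinuousLinearMap.comp_apply, h1]

/-- The lower bound `IsShift.norm_le_hom` makes the matrix injective, which suffices in finite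
dimensions. -/
theorem isUnit_homMatrix {N : C3 →L[ℂ] H1Hilbert S} (hX : P.IsShift ‖χ‖ (shiftH1 S χ))
    (hN : ∀ c, P.avg (P.tr (N c)) = 0 ∧
      ∀ v, inner ℂ (P.D v) (P.A (P.D (N c) + shiftH1 S χ (P.cst c))) = 0) {t : ℝ} (ht : 0 < t) :
    IsUnit ((t : ℂ) • homMatrix P χ N - 1) := by
  rw [← Matrix.mulVec_injective_iff_isUnit]
  intro x y hxy
  have h1 : ((t : ℂ) • homMatrix P χ N - 1) *ᵥ (x - y) = 0 := by
    rw [Matrix.mulVec_sub, hxy, sub_self]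
  set c : C3 := WithLp.toLp 2 (x - y) with hc
  have h2 : (t : ℂ) • P.hom (shiftH1 S χ) N c - c = 0 := by
    have h3 : homMatrix P χ N *ᵥ (x - y) = (P.hom (shiftH1 S χ) N c).ofLp := homMatrix_mulVec c
    rw [Matrix.sub_mulVec, Matrix.smul_mulVec, Matrix.one_mulVec, h3] at h1
    exact congrArg (WithLp.toLp 2) h1
  have h3 := hX.norm_le_hom hN ht c
  rw [h2, norm_zero] at h3
  have h4 : c = 0 := norm_le_zero_iff.1 h3
  exact sub_eq_zero.1 (congrArg WithLp.ofLp h4)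

theorem hom_inv_mulVec {N : C3 →L[ℂ] H1Hilbert S} {t : ℝ}
    (hM : IsUnit ((t : ℂ) • homMatrix P χ N - 1)) (b : C3) :
    (t : ℂ) • P.hom (shiftH1 S χ) N
        (WithLp.toLp 2 (((t : ℂ) • homMatrix P χ N - 1)⁻¹ *ᵥ b.ofLp)) -
      WithLp.toLp 2 (((t : ℂ) • homMatrix P χ N - 1)⁻¹ *ᵥ b.ofLp) = b := by
  set y := ((t : ℂ) • homMatrix P χ N - 1)⁻¹ *ᵥ b.ofLp with hy
  have h1 : ((t : ℂ) • homMatrix P χ N - 1) *ᵥ y = b.ofLp := by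
    rw [hy, Matrix.mulVec_mulVec, Matrix.mul_nonsing_inv _
      ((Matrix.isUnit_iff_isUnit_det _).1 hM), Matrix.one_mulVec]
  have h3 : homMatrix P χ N *ᵥ y = (P.hom (shiftH1 S χ) N (WithLp.toLp 2 y)).ofLp :=
    homMatrix_mulVec (WithLp.toLp 2 y)
  rw [Matrix.sub_mulVec, Matrix.smul_mulVec, Matrix.one_mulVec, h3] at h1
  exact congrArg (WithLp.toLp 2) h1

end Describes

/-- The square root of C is replaced by the larger number C + 1. -/
theorem rpow_half_le_ofReal {a C : ℝ≥0∞} (hC : C ≠ ⊤) {q : ℝ} (hq : 0 ≤ q)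
    (h : a ≤ C * ENNReal.ofReal (q ^ 2)) :
    a ^ (1 / 2 : ℝ) ≤ ENNReal.ofReal ((C.toReal + 1) * q) := by
  have h1 : a ≤ ENNReal.ofReal ((C.toReal + 1) * q) ^ (2 : ℝ) := by
    refine h.trans ?_
    rw [ENNReal.rpow_two, ← ENNReal.ofReal_pow (by positivity)]
    conv_lhs => rw [← ENNReal.ofReal_toReal hC, ← ENNReal.ofReal_mul ENNReal.toReal_nonneg]
    refine ENNReal.ofReal_le_ofReal ?_
    rw [mul_pow]
    gcongr
    nlinarith [ENNReal.toReal_nonneg (a := C)]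
  calc a ^ (1 / 2 : ℝ) ≤ (ENNReal.ofReal ((C.toReal + 1) * q) ^ (2 : ℝ)) ^ (1 / 2 : ℝ) := by
        gcongr
    _ = _ := by rw [← ENNReal.rpow_mul]; norm_num

theorem Describes.h12Norm_sub_le [IsFiniteMeasure (surf S)]
    [IsFiniteMeasure (volume.restrict (stiff S))]
    {P : CellData (H1Hilbert S) (L2Grad S) (L2Bdry S)} (hP : Describes S A P) {C : ℝ≥0∞}
    (hC : C ≠ ⊤)
    (htr : ∀ p ∈ H1per S, h12Sq S p.2.2 ≤ C * (‖p.1‖ₑ ^ 2 + ‖p.2.1‖ₑ ^ 2)) (u : H1Hilbert S)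
    (c : C3) {q : ℝ} (hq : ‖u - P.cst c‖ ≤ q) :
    h12Norm S (fun y => P.tr u y - c) ≤ ENNReal.ofReal ((C.toReal + 1) * q) := by
  rw [h12Norm_eq]
  refine rpow_half_le_ofReal hC ((norm_nonneg _).trans hq) ?_
  have h1 : (fun y => P.tr u y - c) =ᵐ[surf S] (toTriple S (u - P.cst c)).2.2 := by
    have h2 : (toTriple S (u - P.cst c)).2.2 = P.tr u - (toTriple S (P.cst c)).2.2 := by
      rw [← hP.tr_eq, map_sub, ← hP.tr_eq]
    rw [h2]
    filter_upwards [Lp.coeFn_sub (P.tr u) (toTriple S (P.cst c)).2.2, hP.trace_cst c]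
      with y e1 e2
    rw [e1, Pi.sub_apply, e2]
  rw [h12Sq_congr_ae h1]
  refine (htr _ (toTriple_mem _)).trans (mul_le_mul' le_rfl ?_)
  rw [← ofReal_norm, ← ofReal_norm, ← ENNReal.ofReal_pow (norm_nonneg _),
    ← ENNReal.ofReal_pow (norm_nonneg _), ← ENNReal.ofReal_add (sq_nonneg _) (sq_nonneg _)]
  refine ENNReal.ofReal_le_ofReal (le_trans ?_ (pow_le_pow_left₀ (norm_nonneg _) hq 2))
  rw [norm_sq_H1Hilbert]
  linarith [sq_nonneg ‖(toTriple S (u - P.cst c)).2.2‖]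

end StiffDtN

/-! ### The resolvent estimate for the Dirichlet-to-Neumann map -/

theorem theorem4p6 (S : Set StiffDtN.R3) (A : StiffDtN.TensorField)
    (hS : StiffDtN.IsInclusion S) (hA : StiffDtN.IsElasticityTensor S A) :
    ∃ C : ℝ, 0 < C ∧ ∀ χ ∈ StiffDtN.dualCell, χ ≠ 0 →
      -- `Λ_χ^stiff` is a single-valued operator
      (∀ g f f' : StiffDtN.L2Bdry S,
        StiffDtN.IsDtN S A χ g f → StiffDtN.IsDtN S A χ g f' → f = f') ∧
      -- `M = Λ_χ^hom` is well defined and `R = (|χ|⁻² Λ_χ^stiff - I)⁻¹` exists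
      ∃ (M : Matrix (Fin 3) (Fin 3) ℂ) (R : StiffDtN.L2Bdry S →L[ℂ] StiffDtN.L2Bdry S),
        (∀ M', StiffDtN.IsHomMatrix S A χ M' ↔ M' = M) ∧
        StiffDtN.IsDtNResolvent S A χ ((‖χ‖ ^ 2)⁻¹) R ∧
        IsUnit (((‖χ‖ ^ 2)⁻¹ : ℂ) • M - 1) ∧
        ∀ h : StiffDtN.L2Bdry S,
          StiffDtN.h12Norm S (fun y => R h y -
              WithLp.toLp 2 ((((‖χ‖ ^ 2)⁻¹ : ℂ) • M - 1)⁻¹ *ᵥ (StiffDtN.bdryAverage S h).ofLp))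
            ≤ ENNReal.ofReal (C * ‖χ‖ * ‖h‖) := by
  have := hS.isFiniteMeasure_surf
  have := hS.isFiniteMeasure_stiff
  obtain ⟨P, hP⟩ := StiffDtN.exists_describes hS hA
  obtain ⟨C₁, hC₁, htr⟩ := hS.exists_trace_H1per
  have hνi : 0 ≤ P.ν⁻¹ := inv_nonneg.2 P.ν_pos.le
  have hK := P.K_pos.le
  have hpi := Real.pi_pos.le
  -- One number, independent of χ, which dominates all the data of `IsShift.norm_sub_cst_le`; the
  -- summand 2π bounds |χ| on the dual cell.
  obtain ⟨L, hL⟩ : ∃ L : ℝ, L = 1 + ‖P.A‖ + ‖P.tr‖ + ‖P.cst‖ + ‖P.avg‖ + P.ν⁻¹ + P.K +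
    2 * Real.pi := ⟨_, rfl⟩
  have n1 := norm_nonneg P.A
  have n2 := norm_nonneg P.tr
  have n3 := norm_nonneg P.cst
  have n4 := norm_nonneg P.avg
  have hL1 : 1 ≤ L := by linarith
  refine ⟨(C₁.toReal + 1) * (21 * L ^ 12), by positivity, fun χ hχ hχ0 => ?_⟩
  have hχ' : ∀ i, |χ i| ≤ Real.pi := fun i => abs_le.2 ⟨(hχ i).1, (hχ i).2.le⟩
  have hs : 0 < ‖χ‖ := norm_pos_iff.2 hχ0
  have hX := hP.isShift χ hχ'
  set t : ℝ := (‖χ‖ ^ 2)⁻¹ with ht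
  have ht0 : 0 < t := by positivity
  have htc : ((‖χ‖ ^ 2)⁻¹ : ℂ) = (t : ℂ) := by rw [ht]; push_cast; rfl
  obtain ⟨N, hN⟩ := P.exists_corrector (StiffDtN.shiftH1 S χ)
  obtain ⟨U, hU⟩ := hX.exists_resolvent ht0
  have hunit := StiffDtN.Describes.isUnit_homMatrix hX hN ht0
  rw [htc]
  refine ⟨fun g f f' => hP.isDtN_unique hS hχ', StiffDtN.Describes.homMatrix P χ N, P.tr.comp U,
    fun M' => StiffDtN.Describes.isHomMatrix_iff hS hP hN M', hP.isDtNResolvent hX ht0 hU, hunit,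
    fun h => ?_⟩
  -- This is an H¹ estimate for `U h` minus the homogenised constant, with the factor |χ|; the trace
  -- inequality turns it into the bound in H^{1/2}(Γ).
  have hbd := hX.norm_sub_cst_le hN hL1 (by linarith) (by linarith) (by linarith) (by linarith)
    (by linarith) (by linarith) hs
    (by linarith [StiffDtN.norm_le_of_forall_abs_le hχ']) (hU h)
    ((StiffDtN.Describes.hom_inv_mulVec hunit (StiffDtN.bdryAverage S h)).trans (hP.avg_eq h).symm)
  refine (hP.h12Norm_sub_le hC₁ htr (U h) _ hbd).trans (ENNReal.ofReal_le_ofReal (le_of_eq ?_))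
  ring

end
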